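/- Let $K$ be an algebraically closed field of characteristic $2$. Let $\mathcal O(n;\infty)$ be the commutative algebra of divided powers with basis $x^{(r)}$, $r\in\mathbb Z_{\ge0}^n$, with distinguished derivatives $\partial_i x^{(r)}=x^{(r-\varepsilon_i)}$. For a shearing vector $N\in\{1,2,\dots,\infty\}^n$ let $\mathcal O(n;N)$ be spanned by the $x^{(r)}$ with $r_i<2^{N_i}$, and let $\mathfrak{vect}(n;N)=\{\sum f_j\partial_j\mid f_j\in\mathcal O(n;N)\}$. If $\deg x_i=w_i>0$ and $\mathfrak g_-,\mathfrak g_0$ (and possibly $\mathfrak g_1$) are given graded components, their complete (partial, if $\mathfrak g_1$ is prescribed) prolong in $\mathfrak{vect}(n;N)$ is obtained by adding, degree by degree, $\mathfrak g_{k}=\{D\in\mathfrak{vect}(n;N)_k\mid[D,\mathfrak g_{-1}]\subset\mathfrak g_{k-1}\}$. In $\mathcal O(7;\infty)$ with indeterminates $t,\xi_1,\xi_2,\xi_3,\eta_1,\eta_2,\eta_3$ set $E'=\sum\xi_i\partial_{\xi_i}$, $\Phi=\sum\xi_i\eta_i$, $$\{f,g\}=\partial_tf\,(1+E')g+(1+E')f\,\partial_tg+\sum_i(\partial_{\xi_i}f\,\partial_{\eta_i}g+\partial_{\eta_i}f\,\partial_{\xi_i}g),$$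 $$K_f=((1+E')f)\,\partial_t+\partial_tf\,E'+\sum_i(\partial_{\xi_i}f\,\partial_{\eta_i}+\partial_{\eta_i}f\,\partial_{\xi_i}).$$ The following algebras are the analogs of the exceptional Lie superalgebra $\mathfrak{kas}$, with all indeterminates commuting. * $\mathfrak{kas}(7;L)$: with $\deg t=2$ and the other indeterminates of degree $1$, the partial prolong of $\mathfrak g_{-2},\mathfrak g_{-1},\mathfrak g_0,\mathfrak g_1$ spanned by the fields $K_f$ with $f$, respectively, $1$; the $\xi_i$ and $\eta_i$; $t$ and the products of two distinct indeterminates among the $\xi_i,\eta_i$; and $\xi_1\xi_2\xi_3$, $\eta_i\Phi$, $\xi_i\Phi$, $\xi_i\eta_j\eta_k$ ($i,j,k$ distinct), $\eta_i(t+\xi_j\eta_j)$ ($i\ne j$), $t\xi_i$. * $\mathfrak{kas}(8;M)$: the algebra $\mathfrak{kas}$ of all $f$ with $K_f\in\mathfrak{kas}(7;\infty)$, regraded by $\deg t=\deg\eta_i=1$, $\deg\xi_i=0$ (minus $1$), so that $\mathfrak g_{-1}$ has the commuting basis $e=(1,\xi_1\xi_2,\xi_1\xi_3,\xi_2\xi_3,\xi_1,\xi_2,\xi_3,\xi_1\xi_2\xi_3)$,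 and realized by the fields $\sum_{r,j}c_{r,j}x^{(r)}\partial_j$, where $c_{r,j}$ is the coefficient of $e_j$ in $\prod_i(\mathrm{ad}\,e_i)^{r_i}f$; intersected with $\mathfrak{vect}(8;M)$. * $\mathfrak{kas}(10;N)$: with $\deg x_1=\deg x_2=2$ and the other indeterminates of degree $1$, the complete prolong of the nonpositive part of $\mathfrak{kas}$ regraded by $\deg t=\deg\eta_1=2$, $\deg\xi_1=0$, $\deg\xi_i=\deg\eta_i=1$ for $i=2,3$ (minus $2$): $\mathfrak g_{-2}=\langle\partial_1,\partial_2\rangle$; $\mathfrak g_{-1}$ is spanned by $\partial_3$, $\partial_4$, $\partial_5$, $\partial_6$, $x_5\partial_1+\partial_7$, $x_6\partial_1+\partial_8$, $x_3\partial_1+x_7\partial_2+\partial_9$, $x_4\partial_1+x_8\partial_2+\partial_{10}$ (representing $\xi_1\xi_2,\xi_1\xi_3,\xi_1\eta_2,\xi_1\eta_3,\xi_2,\xi_3,\eta_2,\eta_3$, while $\partial_1,\partial_2$ represent $\xi_1,1$); and $\mathfrak g_0$ is the $13$-dimensional space of degree-$0$ fields that represents $\xi_1\Phi$, $t\xi_1$,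 $\xi_1\eta_2\eta_3$, $\xi_1\xi_2\xi_3$, $\xi_2\xi_3$, $\xi_3\eta_2$, $\eta_2\eta_3$, $\xi_2\eta_3$, $\xi_1\eta_1$, $\xi_2\eta_2$, $\xi_3\eta_3$, $t$, $\eta_1$. * $\widetilde{\mathfrak{kas}}(7;N)$: with all $\deg x_i=1$, the complete prolong of $\mathfrak g_{-1}=\langle\partial_1,\dots,\partial_7\rangle$, identified with the space of polynomials of degree $\le2$ in three Grassmann indeterminates $\eta_i$ by $\partial_1,\dots,\partial_7\leftrightarrow1,\eta_1\eta_2,\eta_1\eta_3,\eta_2\eta_3,\eta_1,\eta_2,\eta_3$, and the $25$-dimensional algebra $\mathfrak g_0$ of the operators $D+\mathrm{Div}\,D+c$ on it, where $D$ is a vector field in the $\eta$'s and $c\in K$. Call $N$ *attained* by $\mathfrak g(\cdot)$ if for every $i$ and every finite $m<N_i$ some field in $\mathfrak g(N)$ contains a monomial with $r_i\ge2^m$. Call the $i$-th coordinate *noncritical* if it takes arbitrarily large values on attained vectors. The *unconstrained* shearing vector is infinite at the noncritical coordinates and equal to $1$ at the others; $\mathfrak g$ without argument denotes the algebra with this shearing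 vector. Then: 1. The attained vectors (all coordinates $\ge1$) are exactly those with $N_i=1$ for $i\notin S$, where $S=\{1\}$ for $\mathfrak{kas}(7;L)$ (the coordinate of $t$) and for $\mathfrak{kas}(8;M)$, $S=\{1,2\}$ for $\mathfrak{kas}(10;N)$, and $S=\{1,5,6,7\}$ for $\widetilde{\mathfrak{kas}}(7;N)$. So the numbers of parameters (noncritical coordinates) are $1$, $1$, $2$, $4$, respectively. 2. None of these four algebras is simple, whatever the shearing vector. For the unconstrained shearing vector, the derived algebra of each of them has codimension $1$ and is a simple Lie algebra. 3. $\mathfrak{kas}(7;L)\simeq\mathfrak{kas}(8;M)$ for the unconstrained $L$ and $M$, and also for $L=(m,1,\dots,1)$, $M=(m,1,\dots,1)$ with any $1\le m\le\infty$. 4. The simple derived algebras of $\mathfrak{kas}(7)$ (isomorphic to that of $\mathfrak{kas}(8)$), $\mathfrak{kas}(10)$ and $\widetilde{\mathfrak{kas}}(7)$ are pairwise non-isomorphic. 5. Let $P(M)$ be the complete prolong in $\mathfrak{vect}(8;M)$ of the nonpositive part of $\mathfrak{kas}(8;M)$. It also has exactly one noncritical coordinate. For the unconstrained shearing vector, $P$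 contains $\mathfrak{kas}(8)$ as a subspace of codimension $1$, the derived algebra of $P$ has codimension $1$ in $P$, and the second derived algebra of $P$ is the simple derived algebra of $\mathfrak{kas}(8)$. -/

import Mathlib

open scoped BigOperators

noncomputable section

namespace Kas

/-! ### Divided powers -/

/-- The algebra `O(n; ∞)` of divided powers in `n` indeterminates over `K`: finite linear
combinations of the monomials `x ^ (r)`, where `r : Fin n → ℕ`. -/
def DP (K : Type*) [Field K] (n : ℕ) : Type _ := (Fin n → ℕ) →₀ K

variable {K : Type*} [Field K] {n : ℕ}

instance : AddCommGroup (DP K n) := inferInstanceAs (AddCommGroup ((Fin n → ℕ) →₀ K))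

instance : Module K (DP K n) := inferInstanceAs (Module K ((Fin n → ℕ) →₀ K))

/-- The monomial `x ^ (r)`. -/
def mono (r : Fin n → ℕ) : DP K n := Finsupp.single r (1 : K)

/-- The coefficient of `x ^ (r)` in `f`. -/
def coef (f : DP K n) (r : Fin n → ℕ) : K := (show (Fin n → ℕ) →₀ K from f) r

/-- The multi-binomial coefficient `binom (r + s) r`. -/
def binom (r s : Fin n → ℕ) : ℕ := ∏ i, (r i + s i).choose (r i)

/-- Extension by linearity from monomials. -/
def lift {M : Type*} [AddCommGroup M] [Module K M] (v : (Fin n → ℕ) → M) : DP K n →ₗ[K] M :=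
  Finsupp.linearCombination K v

theorem lift_mono {M : Type*} [AddCommGroup M] [Module K M] (v : (Fin n → ℕ) → M)
    (r : Fin n → ℕ) : lift v (mono r : DP K n) = v r := by
  unfold lift mono
  exact (Finsupp.linearCombination_single K 1 r).trans (one_smul K _)

theorem hom_ext {M : Type*} [AddCommGroup M] [Module K M] {f g : DP K n →ₗ[K] M}
    (h : ∀ r, f (mono r) = g (mono r)) : f = g := by
  refine Finsupp.lhom_ext' (M := K) (α := Fin n → ℕ) (N := M) (R := K) (φ := f) (ψ := g) ?_
  intro r
  ext
  exact h r

/-- The product `x ^ (r) * x ^ (s) = binom (r + s) r • x ^ (r + s)`. -/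
def mulL : DP K n →ₗ[K] DP K n →ₗ[K] DP K n :=
  lift fun r => lift fun s => (binom r s : K) • mono (r + s)

instance : Mul (DP K n) := ⟨fun f g => mulL f g⟩

instance : One (DP K n) := ⟨mono 0⟩

theorem mul_def (f g : DP K n) : f * g = mulL f g := rfl

theorem one_def : (1 : DP K n) = mono 0 := rfl

theorem mono_mul_mono (r s : Fin n → ℕ) :
    (mono r : DP K n) * mono s = (binom r s : K) • mono (r + s) := by
  rw [mul_def, mulL, lift_mono, lift_mono]

theorem binom_assoc (r s t : Fin n → ℕ) :
    binom r s * binom (r + s) t = binom s t * binom r (s + t) := by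
  unfold binom
  rw [← Finset.prod_mul_distrib, ← Finset.prod_mul_distrib]
  refine Finset.prod_congr rfl fun i _ => ?_
  simp only [Pi.add_apply]
  have h := Nat.choose_mul (n := r i + s i + t i) (k := r i + s i) (s := r i) (by omega)
  have e1 : r i + s i + t i - r i = s i + t i := by omega
  have e2 : r i + s i - r i = s i := by omega
  rw [e1, e2] at h
  rw [mul_comm, h, mul_comm, ← add_assoc]

theorem binom_comm (r s : Fin n → ℕ) : binom r s = binom s r := by
  unfold binom
  refine Finset.prod_congr rfl fun i _ => ?_
  rw [add_comm (s i) (r i)]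
  exact Nat.choose_symm_add

theorem mul_comm' (f g : DP K n) : f * g = g * f := by
  have : (mulL : DP K n →ₗ[K] DP K n →ₗ[K] DP K n) = mulL.flip := by
    refine hom_ext fun r => hom_ext fun s => ?_
    rw [LinearMap.flip_apply, ← mul_def, ← mul_def, mono_mul_mono, mono_mul_mono, binom_comm,
      add_comm]
  exact congrArg (fun m : DP K n →ₗ[K] DP K n →ₗ[K] DP K n => m f g) this

theorem one_mul' (f : DP K n) : 1 * f = f := by
  have : (mulL (1 : DP K n)) = LinearMap.id := by
    refine hom_ext fun r => ?_
    rw [← mul_def, one_def, mono_mul_mono]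
    simp [binom]
  exact congrArg (fun m : DP K n →ₗ[K] DP K n => m f) this

theorem dp_induction {P : DP K n → Prop} (f : DP K n) (h0 : P 0)
    (ha : ∀ f g, P f → P g → P (f + g)) (hm : ∀ (c : K) r, P (c • mono r)) : P f := by
  refine Finsupp.induction_linear (motive := P) f h0 ha fun r c => ?_
  have h := hm c r
  have e : (c • mono r : DP K n) = Finsupp.single r c := by
    unfold mono
    exact (Finsupp.smul_single' c r 1).trans (by rw [mul_one])
  rw [e] at h
  exact h

theorem mul_add' (f g h : DP K n) : f * (g + h) = f * g + f * h := map_add (mulL f) g h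

theorem add_mul' (f g h : DP K n) : (f + g) * h = f * h + g * h := by
  rw [mul_comm', mul_add', mul_comm' h f, mul_comm' h g]

theorem mul_smul' (c : K) (f g : DP K n) : f * (c • g) = c • (f * g) := map_smul (mulL f) c g

theorem smul_mul' (c : K) (f g : DP K n) : (c • f) * g = c • (f * g) := by
  rw [mul_comm', mul_smul', mul_comm' g f]

theorem zero_mul' (f : DP K n) : 0 * f = 0 := by rw [mul_comm']; exact map_zero (mulL f)

theorem mul_zero' (f : DP K n) : f * 0 = 0 := map_zero (mulL f)

theorem mul_assoc' (f g h : DP K n) : f * g * h = f * (g * h) := by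
  induction f using dp_induction with
  | h0 => simp only [zero_mul']
  | ha f₁ f₂ h₁ h₂ => simp only [add_mul', h₁, h₂]
  | hm a r =>
    induction g using dp_induction with
    | h0 => simp only [zero_mul', mul_zero']
    | ha f₁ f₂ h₁ h₂ => simp only [add_mul', mul_add', h₁, h₂]
    | hm b s =>
      induction h using dp_induction with
      | h0 => simp only [mul_zero']
      | ha f₁ f₂ h₁ h₂ => simp only [mul_add', h₁, h₂]
      | hm c t =>
        simp only [smul_mul', mul_smul', mono_mul_mono, smul_smul, add_assoc]
        congr 1
        have h := congrArg (Nat.cast (R := K)) (binom_assoc r s t)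
        push_cast at h
        linear_combination (c * (b * a)) * h

instance : CommRing (DP K n) :=
  { (inferInstance : AddCommGroup (DP K n)) with
    mul := (· * ·)
    one := 1
    mul_assoc := mul_assoc'
    one_mul := one_mul'
    mul_one := fun f => (mul_comm' f 1).trans (one_mul' f)
    left_distrib := mul_add'
    right_distrib := add_mul'
    zero_mul := zero_mul'
    mul_zero := mul_zero'
    mul_comm := mul_comm' }

instance : Algebra K (DP K n) := Algebra.ofModule smul_mul' mul_smul'

/-- The indeterminate `x_i`. -/
def X (i : Fin n) : DP K n := mono (Pi.single i 1)

/-! ### Distinguished partial derivatives and vector fields -/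

/-- The distinguished partial derivative on monomials, `x ^ (r) ↦ x ^ (r - ε_i)`. -/
def pdL (i : Fin n) : DP K n →ₗ[K] DP K n :=
  lift fun r => if r i = 0 then 0 else mono (Function.update r i (r i - 1))

theorem binom_split (i : Fin n) (r s : Fin n → ℕ) : binom r s = (r i + s i).choose (r i) *
    ∏ j ∈ Finset.univ.erase i, (r j + s j).choose (r j) := by
  unfold binom
  rw [← Finset.mul_prod_erase _ _ (Finset.mem_univ i)]

theorem binom_update_left (i : Fin n) (r s : Fin n → ℕ) (a : ℕ) :
    binom (Function.update r i a) s =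
      (a + s i).choose a * ∏ j ∈ Finset.univ.erase i, (r j + s j).choose (r j) := by
  rw [binom_split i]
  congr 1
  · simp
  · refine Finset.prod_congr rfl fun j hj => ?_
    rw [Function.update_of_ne (Finset.ne_of_mem_erase hj)]

theorem binom_update_right (i : Fin n) (r s : Fin n → ℕ) (a : ℕ) :
    binom r (Function.update s i a) =
      (r i + a).choose (r i) * ∏ j ∈ Finset.univ.erase i, (r j + s j).choose (r j) := by
  rw [binom_split i]
  congr 1
  · simp
  · refine Finset.prod_congr rfl fun j hj => ?_
    rw [Function.update_of_ne (Finset.ne_of_mem_erase hj)]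

theorem update_add_left (i : Fin n) (r s : Fin n → ℕ) (a : ℕ) :
    Function.update r i a + s = Function.update (r + s) i (a + s i) := by
  funext j
  by_cases h : j = i
  · subst h; simp
  · simp [Function.update_of_ne h]

theorem update_add_right (i : Fin n) (r s : Fin n → ℕ) (a : ℕ) :
    r + Function.update s i a = Function.update (r + s) i (r i + a) := by
  funext j
  by_cases h : j = i
  · subst h; simp
  · simp [Function.update_of_ne h]

theorem pdL_mono (i : Fin n) (r : Fin n → ℕ) :
    pdL i (mono r : DP K n) = if r i = 0 then 0 else mono (Function.update r i (r i - 1)) := by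
  rw [pdL, lift_mono]

theorem pdL_leibniz (i : Fin n) (f g : DP K n) :
    pdL i (f * g) = f • pdL i g + g • pdL i f := by
  simp only [smul_eq_mul]
  induction f using dp_induction with
  | h0 => simp
  | ha f₁ f₂ h₁ h₂ => rw [add_mul, map_add, h₁, h₂, map_add]; ring
  | hm a r =>
    induction g using dp_induction with
    | h0 => simp
    | ha f₁ f₂ h₁ h₂ => rw [mul_add, map_add, h₁, h₂, map_add]; ring
    | hm b s =>
      simp only [smul_mul', mul_smul', map_smul, mono_mul_mono, pdL_mono]
      by_cases hr : r i = 0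
      · by_cases hs : s i = 0
        · simp [hr, hs]
        · have e : r i + (s i - 1) = r i + s i - 1 := by omega
          have hrs : (r + s) i ≠ 0 := by simp [hs]
          rw [if_neg hrs, if_pos hr, if_neg hs, mono_mul_mono, binom_split i r s,
            binom_update_right, update_add_right, e]
          simp [hr, smul_smul]
      · have hrs : (r + s) i ≠ 0 := by simp [hr]
        obtain ⟨p, hp⟩ : ∃ p, r i = p + 1 := ⟨r i - 1, by omega⟩
        by_cases hs : s i = 0
        · rw [if_neg hrs, if_neg hr, if_pos hs, mono_mul_mono, binom_split i r s,
            binom_comm, binom_update_left, update_add_right]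
          have e : s i + (r i - 1) = r i + s i - 1 := by omega
          rw [e]
          simp only [hp, hs, smul_smul, add_zero, Nat.choose_self, one_mul, smul_zero, zero_add,
            mul_zero]
          have h5 : (r + s) i - 1 = p + 1 - 1 := by simp [hp, hs]
          rw [h5, add_comm s r, mul_left_comm]
        · obtain ⟨q, hq⟩ : ∃ q, s i = q + 1 := ⟨s i - 1, by omega⟩
          rw [if_neg hrs, if_neg hr, if_neg hs, mul_comm (mono s), mono_mul_mono, mono_mul_mono,
            binom_split i r s, binom_update_left, binom_update_right, update_add_left,
            update_add_right]
          have e1 : r i - 1 + s i = (r + s) i - 1 := by simp only [Pi.add_apply]; omega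
          have e2 : r i + (s i - 1) = (r + s) i - 1 := by simp only [Pi.add_apply]; omega
          rw [e1, e2]
          simp only [smul_smul]
          rw [← add_smul]
          congr 1
          have h3 : (r + s) i - 1 = p + q + 1 := by simp only [Pi.add_apply]; omega
          have h4 : r i + s i = p + q + 1 + 1 := by omega
          rw [h3, h4, hp, Nat.choose_succ_succ]
          have h6 : p + 1 - 1 = p := rfl
          rw [h6]
          push_cast
          ring

/-- The Lie algebra of all derivations of `O(n; ∞)`. -/
abbrev Der (K : Type*) [Field K] (n : ℕ) : Type _ := Derivation K (DP K n) (DP K n)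

/-- The distinguished partial derivative `∂_i`. -/
def pd (i : Fin n) : Der K n := Derivation.mk' (pdL i) (pdL_leibniz i)

theorem pd_mono (i : Fin n) (r : Fin n → ℕ) :
    pd i (mono r : DP K n) = if r i = 0 then 0 else mono (Function.update r i (r i - 1)) :=
  pdL_mono i r

theorem pd_comm (i j : Fin n) (f : DP K n) : pd i (pd j f) = pd j (pd i f) := by
  have : (pdL i : DP K n →ₗ[K] DP K n) ∘ₗ pdL j = pdL j ∘ₗ pdL i := by
    refine hom_ext fun r => ?_
    simp only [LinearMap.comp_apply, pdL_mono]
    by_cases hij : i = j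
    · subst hij; rfl
    · have hji : j ≠ i := fun h => hij h.symm
      by_cases hi : r i = 0 <;> by_cases hj : r j = 0 <;>
        simp [hi, hj, pdL_mono, Function.update_of_ne hij, Function.update_of_ne hji,
          Function.update_comm hij]
  exact congrArg (fun m : DP K n →ₗ[K] DP K n => m f) this

/-- The exponents allowed by the shearing vector `N`: `r i < 2 ^ (N i)` for all `i`, where
`2 ^ ∞ = ∞`. -/
def Allowed (N : Fin n → ℕ∞) (r : Fin n → ℕ) : Prop := ∀ (i : Fin n) (m : ℕ), N i = m → r i < 2 ^ m

variable (K) in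
/-- The algebra of divided powers `O(n; N)` over a field of characteristic 2. -/
def trunc (N : Fin n → ℕ∞) : Submodule K (DP K n) :=
  Submodule.span K (mono '' {r | Allowed N r})

theorem even_choose {m a b : ℕ} (ha : a < 2 ^ m) (hb : b < 2 ^ m) (h : 2 ^ m ≤ a + b) :
    2 ∣ (a + b).choose a := by
  have hm : 1 ≤ m := by
    rcases Nat.eq_zero_or_pos m with h0 | h0
    · subst h0; simp at ha hb; omega
    · exact h0
  have hne : (b + a).choose a ≠ 0 := (Nat.choose_pos (Nat.le_add_left a b)).ne'
  rw [add_comm]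
  refine (Nat.prime_two.dvd_iff_one_le_factorization hne).2 ?_
  rw [Nat.factorization_choose' Nat.prime_two (Nat.lt_succ_self _)]
  refine Finset.card_pos.2 ⟨m, ?_⟩
  rw [Finset.mem_filter, Finset.mem_Ico]
  refine ⟨⟨hm, ?_⟩, ?_⟩
  · refine Nat.lt_succ_of_le (Nat.le_log_of_pow_le one_lt_two ?_)
    omega
  · rw [Nat.mod_eq_of_lt ha, Nat.mod_eq_of_lt hb]; omega

theorem trunc_mul [CharP K 2] {N : Fin n → ℕ∞} {f g : DP K n} (hf : f ∈ trunc K N)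
    (hg : g ∈ trunc K N) : f * g ∈ trunc K N := by
  induction hf using Submodule.span_induction with
  | zero => rw [zero_mul]; exact Submodule.zero_mem _
  | add x y _ _ hx hy => rw [add_mul]; exact Submodule.add_mem _ hx hy
  | smul c x _ hx => rw [smul_mul']; exact Submodule.smul_mem _ c hx
  | mem x hx =>
    induction hg using Submodule.span_induction with
    | zero => rw [mul_zero]; exact Submodule.zero_mem _
    | add x y _ _ hx hy => rw [mul_add]; exact Submodule.add_mem _ hx hy
    | smul c x _ hx => rw [mul_smul']; exact Submodule.smul_mem _ c hx
    | mem y hy =>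
      obtain ⟨r, hr, rfl⟩ := hx
      obtain ⟨s, hs, rfl⟩ := hy
      rw [mono_mul_mono]
      by_cases hrs : Allowed N (r + s)
      · exact Submodule.smul_mem _ _ (Submodule.subset_span ⟨_, hrs, rfl⟩)
      · unfold Allowed at hrs
        push Not at hrs
        obtain ⟨i, m, hm, hle⟩ := hrs
        have h2 : 2 ∣ binom r s := by
          rw [binom_split i]
          exact Dvd.dvd.mul_right (even_choose (hr i m hm) (hs i m hm) hle) _
        rw [(CharP.cast_eq_zero_iff K 2 _).2 h2, zero_smul]
        exact Submodule.zero_mem _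

theorem trunc_pd {N : Fin n → ℕ∞} (i : Fin n) {f : DP K n} (hf : f ∈ trunc K N) :
    pd i f ∈ trunc K N := by
  induction hf using Submodule.span_induction with
  | zero => rw [map_zero]; exact Submodule.zero_mem _
  | add x y _ _ hx hy => rw [map_add]; exact Submodule.add_mem _ hx hy
  | smul c x _ hx => rw [Derivation.map_smul]; exact Submodule.smul_mem _ c hx
  | mem x hx =>
    obtain ⟨r, hr, rfl⟩ := hx
    rw [pd_mono]
    split_ifs
    · exact Submodule.zero_mem _
    · refine Submodule.subset_span ⟨_, ?_, rfl⟩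
      intro j m hm
      have := hr j m hm
      by_cases hji : j = i
      · subst hji; rw [Function.update_self]; omega
      · rwa [Function.update_of_ne hji]

theorem field_apply (f : Fin n → DP K n) (g : DP K n) :
    (∑ j, f j • pd j : Der K n) g = ∑ j, f j * pd j g := by
  have h : ∀ s : Finset (Fin n), (∑ j ∈ s, f j • pd j : Der K n) g = ∑ j ∈ s, f j * pd j g := by
    intro s
    induction s using Finset.induction_on with
    | empty => simp
    | insert a s ha ih =>
      rw [Finset.sum_insert ha, Finset.sum_insert ha, Derivation.add_apply, ih,
        Derivation.smul_apply, smul_eq_mul]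
  exact h Finset.univ

theorem trunc_field [CharP K 2] {N : Fin n → ℕ∞} {f : Fin n → DP K n}
    (hf : ∀ j, f j ∈ trunc K N) {g : DP K n} (hg : g ∈ trunc K N) :
    (∑ j, f j • pd j : Der K n) g ∈ trunc K N := by
  rw [field_apply]
  exact Submodule.sum_mem _ fun j _ => trunc_mul (hf j) (trunc_pd j hg)

variable (K) in
/-- The vectorial Lie algebra `vect(n; N)` of the fields `∑ f_j ∂_j` with `f_j ∈ O(n; N)`. -/
def vect [CharP K 2] (N : Fin n → ℕ∞) : LieSubalgebra K (Der K n) where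
  carrier := {D | ∃ f : Fin n → DP K n, (∀ j, f j ∈ trunc K N) ∧ D = ∑ j, f j • pd j}
  zero_mem' := ⟨0, fun _ => Submodule.zero_mem _, by simp⟩
  add_mem' := by
    rintro _ _ ⟨f, hf, rfl⟩ ⟨g, hg, rfl⟩
    refine ⟨f + g, fun j => Submodule.add_mem _ (hf j) (hg j), ?_⟩
    simp only [Pi.add_apply, add_smul, Finset.sum_add_distrib]
  smul_mem' := by
    rintro c _ ⟨f, hf, rfl⟩
    refine ⟨c • f, fun j => Submodule.smul_mem _ c (hf j), ?_⟩
    simp only [Pi.smul_apply, Finset.smul_sum, smul_assoc]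
  lie_mem' := by
    rintro _ _ ⟨f, hf, rfl⟩ ⟨g, hg, rfl⟩
    refine ⟨fun j => (∑ i, f i • pd i : Der K n) (g j) - (∑ i, g i • pd i : Der K n) (f j),
      fun j => Submodule.sub_mem _ (trunc_field hf (hg j)) (trunc_field hg (hf j)), ?_⟩
    ext a
    rw [Derivation.commutator_apply, field_apply, field_apply g a, field_apply f a]
    simp only [field_apply, map_sum, Derivation.leibniz, smul_eq_mul, mul_add, sub_mul,
      Finset.sum_add_distrib, Finset.sum_sub_distrib, Finset.mul_sum, Finset.sum_mul]
    have h1 : ∑ j, ∑ i, f j * (g i * pd j (pd i a)) = ∑ j, ∑ i, f j * (g i * pd i (pd j a)) :=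
      Finset.sum_congr rfl fun j _ => Finset.sum_congr rfl fun i _ => by rw [pd_comm]
    have h2 : ∑ j, ∑ i, pd j a * (g i * pd i (f j)) = ∑ j, ∑ i, g i * pd i (f j) * pd j a :=
      Finset.sum_congr rfl fun i _ => Finset.sum_congr rfl fun j _ => by ring
    have h3 : ∑ j, ∑ i, f j * (pd i a * pd j (g i)) = ∑ j, ∑ i, f i * pd i (g j) * pd j a := by
      rw [Finset.sum_comm]
      exact Finset.sum_congr rfl fun i _ => Finset.sum_congr rfl fun j _ => by ring
    rw [h1, h2, h3]
    ring

/-! ### Prolongs -/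

/-- The field `D` is homogeneous of degree `k` when `x_i` has degree `w i` and `∂_i` has
degree `- w i`. -/
def IsHomog (w : Fin n → ℕ) (k : ℤ) (D : Der K n) : Prop :=
  ∀ j r, coef (D (X j)) r ≠ 0 → ∑ i, (w i : ℤ) * (r i : ℤ) = k + w j

theorem coef_add (f g : DP K n) (r : Fin n → ℕ) : coef (f + g) r = coef f r + coef g r := rfl

theorem coef_smul (c : K) (f : DP K n) (r : Fin n → ℕ) : coef (c • f) r = c * coef f r := rfl

/-- One step of the Cartan prolongation inside `vect(n; N)`: the fields of degree `k` whose
brackets with `neg` (the component of degree `-1`) belong to `P` (the component of degree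
`k - 1`). -/
def prolongStep [CharP K 2] (w : Fin n → ℕ) (N : Fin n → ℕ∞) (neg P : Submodule K (Der K n))
    (k : ℤ) : Submodule K (Der K n) where
  carrier := {D | D ∈ vect K N ∧ IsHomog w k D ∧ ∀ y ∈ neg, ⁅D, y⁆ ∈ P}
  zero_mem' := ⟨zero_mem _, fun j r h => absurd rfl h, fun y _ => by
    rw [zero_lie]; exact P.zero_mem⟩
  add_mem' := by
    rintro D E ⟨h1, h2, h3⟩ ⟨h4, h5, h6⟩
    refine ⟨add_mem h1 h4, fun j r h => ?_, fun y hy => ?_⟩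
    · by_cases hD : coef (D (X j)) r = 0
      · refine h5 j r fun hE => h ?_
        rw [Derivation.add_apply, coef_add, hD, hE, add_zero]
      · exact h2 j r hD
    · rw [add_lie]; exact P.add_mem (h3 y hy) (h6 y hy)
  smul_mem' := by
    rintro c D ⟨h1, h2, h3⟩
    refine ⟨(vect K N).smul_mem c h1, fun j r h => h2 j r fun hD => h ?_, fun y hy => ?_⟩
    · rw [Derivation.smul_apply, coef_smul, hD, mul_zero]
    · rw [smul_lie]; exact P.smul_mem c (h3 y hy)

/-- The component of degree `k₀ + m` of the prolong whose component of degree `k₀` is `top` and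
whose component of degree `-1` is `neg`. -/
def prolongComp [CharP K 2] (w : Fin n → ℕ) (N : Fin n → ℕ∞) (k₀ : ℤ)
    (neg top : Submodule K (Der K n)) : ℕ → Submodule K (Der K n)
  | 0 => top
  | m + 1 => prolongStep w N neg (prolongComp w N k₀ neg top m) (k₀ + m + 1)

/-- The Cartan prolong inside `vect(n; N)` of the graded part `low ⊕ neg ⊕ mid ⊕ top`, where `low`
is the sum of the components of degree less than `-1`, `neg` is the component of degree `-1`,
`mid` is the sum of the components of degrees `0, …, k₀ - 1`, and `top` is the component of degree
`k₀`: it is the complete prolong of the nonpositive part if `k₀ = 0` and a partial prolong if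
`k₀ = 1`. For a graded part as below the sum of the components is closed under the bracket, so
it coincides with its Lie span. -/
def prolong [CharP K 2] (w : Fin n → ℕ) (N : Fin n → ℕ∞) (k₀ : ℤ)
    (low neg mid top : Submodule K (Der K n)) : LieSubalgebra K (Der K n) :=
  LieSubalgebra.lieSpan K (Der K n)
    {D | D ∈ low ∨ D ∈ neg ∨ D ∈ mid ∨ ∃ m, D ∈ prolongComp w N k₀ neg top m}

/-! ### The desuperized contact algebra `k(1|6)` and `kas(7; N)`

The indeterminates of `O(7)` are `t, ξ₁, ξ₂, ξ₃, η₁, η₂, η₃`. -/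

/-- The position of `ξ_{i+1}`. -/
def ixi (i : Fin 3) : Fin 7 := ![1, 2, 3] i

/-- The position of `η_{i+1}`. -/
def ieta (i : Fin 3) : Fin 7 := ![4, 5, 6] i

variable (K) in
/-- The generating function `t`. -/
def tt : DP K 7 := X 0

variable (K) in
/-- The generating function `ξ_{i+1}`. -/
def xi (i : Fin 3) : DP K 7 := X (ixi i)

variable (K) in
/-- The generating function `η_{i+1}`. -/
def eta (i : Fin 3) : DP K 7 := X (ieta i)

variable (K) in
/-- `Φ = ξ₁ η₁ + ξ₂ η₂ + ξ₃ η₃`. -/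
def phi : DP K 7 := ∑ i, xi K i * eta K i

variable (K) in
/-- The operator `E' = ∑ ξ_i ∂_{ξ_i}`. -/
def eulerXi : Der K 7 := ∑ i, xi K i • pd (ixi i)

/-- The contact bracket of generating functions. -/
def contactBracket (f g : DP K 7) : DP K 7 :=
  pd 0 f * (g + eulerXi K g) + (f + eulerXi K f) * pd 0 g +
    ∑ i, (pd (ixi i) f * pd (ieta i) g + pd (ieta i) f * pd (ixi i) g)

/-- The contact vector field `K_f` with generating function `f`. -/
def contact (f : DP K 7) : Der K 7 :=
  (f + eulerXi K f) • pd 0 + pd 0 f • eulerXi K +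
    ∑ i, (pd (ixi i) f • pd (ieta i) + pd (ieta i) f • pd (ixi i))

/-- The span of the contact fields whose generating functions belong to `s`. -/
def contactSpan (s : Set (DP K 7)) : Submodule K (Der K 7) := Submodule.span K (contact '' s)

variable (K) in
/-- The generating functions of the component of degree 1 of `kas(7; N)`. -/
def kasOne : Set (DP K 7) :=
  {f | f = xi K 0 * xi K 1 * xi K 2 ∨
    (∃ i, f = eta K i * phi K) ∨
    (∃ i, f = xi K i * phi K) ∨
    (∃ i j k, i ≠ j ∧ i ≠ k ∧ j ≠ k ∧ f = xi K i * eta K j * eta K k) ∨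
    (∃ i j, i ≠ j ∧ f = eta K i * (tt K + xi K j * eta K j)) ∨
    (∃ i, f = tt K * xi K i)}

variable (K) in
/-- `kas(7; N)`: the partial prolong of the nonpositive part of the contact algebra (in its
standard grading `deg t = 2`, `deg ξ_i = deg η_i = 1`) and of the component of degree 1 spanned by
the fields with generating functions in `kasOne`. -/
def kas7 [CharP K 2] (N : Fin 7 → ℕ∞) : LieSubalgebra K (Der K 7) :=
  prolong ![2, 1, 1, 1, 1, 1, 1] N 1 (contactSpan {1})
    (contactSpan {f | ∃ i : Fin 7, i ≠ 0 ∧ f = X i})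
    (contactSpan {f | f = tt K ∨ ∃ i j : Fin 7, i ≠ 0 ∧ j ≠ 0 ∧ i ≠ j ∧ f = X i * X j})
    (contactSpan (kasOne K))

/-! ### Fields given by lists -/

/-- The exponent of a monomial given by the list of its indeterminates, numbered from 1. -/
def expo (n : ℕ) (l : List ℕ) : Fin n → ℕ := fun i => l.count (i.val + 1)

variable (K) in
/-- The field `∑ x_{a_1} ⋯ x_{a_k} ∂_b` over the pairs `([a_1, …, a_k], b)` in the list (with
`a_1, …, a_k` distinct; indeterminates are numbered from 1). -/
def vf (n : ℕ) [NeZero n] (l : List (List ℕ × ℕ)) : Der K n :=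
  (l.map fun p => (mono (expo n p.1) : DP K n) • (pd (Fin.ofNat n (p.2 - 1)) : Der K n)).sum

variable (K) in
/-- The span of the fields given by the members of the list. -/
def vfSpan (n : ℕ) [NeZero n] (l : List (List (List ℕ × ℕ))) : Submodule K (Der K n) :=
  Submodule.span K {D | ∃ p ∈ l, D = vf K n p}

/-! ### `kas(8; M)`: the regrading `deg t = deg η_i = 1`, `deg ξ_i = 0` of `kas` -/

/-- The exponents of the basis `1, ξ₁ξ₂, ξ₁ξ₃, ξ₂ξ₃, ξ₁, ξ₂, ξ₃, ξ₁ξ₂ξ₃` of the component of degree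
`-1` of the regraded algebra. -/
def negExp (j : Fin 8) : Fin 7 → ℕ :=
  expo 7 (![[], [2, 3], [2, 4], [3, 4], [2], [3], [4], [2, 3, 4]] j)

/-- The operator `(ad e_1)^{r_1} ⋯ (ad e_8)^{r_8}` applied to the generating function `f`, where
`e_1, …, e_8` is the (commutative) basis of the component of degree `-1`. -/
def adNeg (r : Fin 8 → ℕ) (f : DP K 7) : DP K 7 :=
  (List.finRange 8).foldr (fun i g => (contactBracket (mono (negExp i)))^[r i] g) f

/-- The field `D` in 8 indeterminates represents the generating function `f` in the regraded
algebra: the realization that sends `e_j` to `∂_j` sends `f` to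
`∑_{r, j} c_{r, j} x^(r) ∂_j`, where `c_{r, j}` is the coefficient of `e_j` in
`(ad e_1)^{r_1} ⋯ (ad e_8)^{r_8} f`. -/
def Represents (D : Der K 8) (f : DP K 7) : Prop :=
  ∀ r j, coef (D (X j)) r = coef (adNeg r f) (negExp j)

variable (K) in
/-- `kas(8; M)`: the algebra `kas`, regraded by `deg t = deg η_i = 1`, `deg ξ_i = 0`
(minus 1), realized by vector fields on the component of degree `-1`, and intersected
with `vect(8; M)`. The set of fields below is already closed under the bracket. -/
def kas8 [CharP K 2] (M : Fin 8 → ℕ∞) : LieSubalgebra K (Der K 8) :=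
  LieSubalgebra.lieSpan K (Der K 8)
    {D | D ∈ vect K (⊤ : Fin 8 → ℕ∞) ∧ ∃ f, contact f ∈ kas7 K ⊤ ∧ Represents D f} ⊓ vect K M

variable (K) in
/-- The component of degree 0 of `kas(8; M)`. -/
def kas8Zero : Submodule K (Der K 8) := vfSpan K 8
  [[([1], 5), ([4], 8), ([6], 2), ([7], 3)], [([1], 6), ([3], 8), ([5], 2), ([7], 4)],
   [([1], 7), ([2], 8), ([5], 3), ([6], 4)], [([1], 2), ([7], 8)], [([1], 3), ([6], 8)],
   [([1], 4), ([5], 8)], [([1], 8)], [([2], 6), ([3], 7), ([5], 1), ([8], 4)],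
   [([2], 5), ([4], 7), ([6], 1), ([8], 3)], [([3], 5), ([4], 6), ([7], 1), ([8], 2)],
   [([6], 2), ([7], 3)], [([5], 2), ([7], 4)], [([5], 3), ([6], 4)], [([3], 4), ([5], 6)],
   [([2], 4), ([5], 7)], [([4], 3), ([6], 5)], [([2], 3), ([6], 7)], [([4], 2), ([7], 5)],
   [([3], 2), ([7], 6)], [([2], 2), ([3], 3), ([5], 5), ([8], 8)],
   [([2], 2), ([4], 4), ([6], 6), ([8], 8)], [([3], 3), ([4], 4), ([7], 7), ([8], 8)],
   [([1], 1), ([2], 2), ([3], 3), ([4], 4), ([5], 5), ([6], 6), ([7], 7), ([8], 8)]]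

variable (K) in
/-- The complete prolong in `vect(8; M)` of the nonpositive part of `kas(8; M)`. -/
def prolong8 [CharP K 2] (M : Fin 8 → ℕ∞) : LieSubalgebra K (Der K 8) :=
  prolong (fun _ => 1) M 0 ⊥ (Submodule.span K (Set.range pd)) ⊥ (kas8Zero K)

/-! ### `kas(10; N)` -/

variable (K) in
/-- The component of degree `-2`, spanned by the images of `ξ₁` and `1`. -/
def kas10NegTwo : Submodule K (Der K 10) := vfSpan K 10
  [[([], 1)], [([], 2)]]

variable (K) in
/-- The component of degree `-1`, spanned by the images of `ξ₁ξ₂`, `ξ₁ξ₃`, `ξ₁η₂`, `ξ₁η₃`, `ξ₂`,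
`ξ₃`, `η₂`, `η₃`. -/
def kas10NegOne : Submodule K (Der K 10) := vfSpan K 10
  [[([], 3)], [([], 4)], [([], 5)], [([], 6)], [([5], 1), ([], 7)], [([6], 1), ([], 8)],
   [([3], 1), ([7], 2), ([], 9)], [([4], 1), ([8], 2), ([], 10)]]

variable (K) in
/-- The component of degree 0, spanned by the images of `ξ₁Φ`, `tξ₁`, `ξ₁η₂η₃`, `ξ₁ξ₂ξ₃`, `ξ₂ξ₃`,
`ξ₃η₂`, `η₂η₃`, `ξ₂η₃`, `ξ₂η₂`, `ξ₃η₃`, `ξ₁η₁`, `t`, `η₁` (up to linear combinations). -/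
def kas10Zero : Submodule K (Der K 10) := vfSpan K 10
  [[([7], 3), ([9], 5), ([8], 4), ([10], 6), ([7, 9], 1), ([8, 10], 1)],
   [([2], 1), ([9], 5), ([10], 6), ([7, 9], 1), ([8, 10], 1)], [([7], 6), ([8], 5), ([7, 8], 1)],
   [([9], 4), ([10], 3), ([9, 10], 1)], [([5], 4), ([6], 3), ([9], 8), ([10], 7), ([9, 10], 2)],
   [([3], 4), ([6], 5), ([7], 8), ([10], 9)],
   [([3], 6), ([4], 5), ([7], 10), ([8], 9), ([7, 8], 2)],
   [([4], 3), ([5], 6), ([8], 7), ([9], 10)], [([3], 3), ([5], 5), ([7], 7), ([9], 9)],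
   [([4], 4), ([6], 6), ([8], 8), ([10], 10)],
   [([1], 1), ([3], 3), ([4], 4), ([5], 5), ([6], 6)],
   [([2], 2), ([3], 3), ([4], 4), ([9], 9), ([10], 10)],
   [([3, 5], 1), ([4, 6], 1), ([5, 7], 2), ([6, 8], 2), ([1], 2), ([3], 7), ([4], 8), ([5], 9), ([6], 10)]]

variable (K) in
/-- `kas(10; N)`: the complete prolong of the nonpositive part of `kas` regraded by
`deg t = deg η₁ = 2`, `deg ξ₁ = 0`, `deg ξ_i = deg η_i = 1` for `i = 2, 3` (minus 2). -/
def kas10 [CharP K 2] (N : Fin 10 → ℕ∞) : LieSubalgebra K (Der K 10) :=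
  prolong ![2, 2, 1, 1, 1, 1, 1, 1, 1, 1] N 0 (kas10NegTwo K) (kas10NegOne K) ⊥ (kas10Zero K)

/-! ### The algebra `kas~(7; N)` -/

variable (K) in
/-- The component of degree 0 of `kas~(7; N)`: the algebra of operators `D + Div D + c`,
where `D` is a vector field in the Grassmann indeterminates `η₁, η₂, η₃` and `c` is a scalar,
acting on the functions of `η` without top term; the indeterminates
`x_1, …, x_7` are dual to `1, η₁η₂, η₁η₃, η₂η₃, η₁, η₂, η₃`. -/
def kas7tZero : Submodule K (Der K 7) := vfSpan K 7
  [[([5], 1), ([2], 6), ([3], 7)], [([6], 1), ([2], 5), ([4], 7)],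
   [([7], 1), ([3], 5), ([4], 6)],
   [([1], 1), ([2], 2), ([3], 3), ([4], 4), ([5], 5), ([6], 6), ([7], 7)],
   [([5], 5), ([2], 2), ([3], 3)], [([6], 6), ([2], 2), ([4], 4)],
   [([7], 7), ([3], 3), ([4], 4)], [([5], 6), ([3], 4)], [([5], 7), ([2], 4)],
   [([6], 5), ([4], 3)], [([6], 7), ([2], 3)], [([7], 5), ([4], 2)], [([7], 6), ([3], 2)],
   [([5], 4)], [([6], 3)], [([7], 2)], [([6], 2), ([7], 3)], [([5], 2), ([7], 4)],
   [([5], 3), ([6], 4)], [([1], 5), ([7], 3)], [([1], 6), ([5], 2)], [([1], 7), ([6], 4)],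
   [([1], 2)], [([1], 3)], [([1], 4)]]

variable (K) in
/-- `kas~(7; N)`: the complete prolong of the pair (`∂_1, …, ∂_7`; `kas7tZero`). -/
def kas7t [CharP K 2] (N : Fin 7 → ℕ∞) : LieSubalgebra K (Der K 7) :=
  prolong (fun _ => 1) N 0 ⊥ (Submodule.span K (Set.range pd)) ⊥ (kas7tZero K)

/-! ### Shearing vectors and the properties of the algebras -/

/-- The algebra `g(N)` indeed depends on every coordinate of `N`: for every `i` and every finite
`m < N i` there is a field in `g(N)` with a monomial whose exponent at `x_i` is at least `2 ^ m`
(so `N` cannot be lowered at `i`). -/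
def Attained (g : (Fin n → ℕ∞) → LieSubalgebra K (Der K n)) (N : Fin n → ℕ∞) : Prop :=
  ∀ (i : Fin n) (m : ℕ), (m : ℕ∞) < N i →
    ∃ D ∈ g N, ∃ (j : Fin n) (r : Fin n → ℕ), coef (D (X j)) r ≠ 0 ∧ 2 ^ m ≤ r i

/-- The `i`-th coordinate of the shearing vector is noncritical: it can take arbitrarily large
values. -/
def Noncritical (g : (Fin n → ℕ∞) → LieSubalgebra K (Der K n)) (i : Fin n) : Prop :=
  ∀ m : ℕ, ∃ N : Fin n → ℕ∞, (∀ j, 1 ≤ N j) ∧ Attained g N ∧ (m : ℕ∞) ≤ N i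

/-- The number of parameters on which the unconstrained shearing vector depends. -/
def numParams (g : (Fin n → ℕ∞) → LieSubalgebra K (Der K n)) : ℕ :=
  Set.ncard {i | Noncritical g i}

/-- The unconstrained shearing vector: infinite at the noncritical coordinates, and 1 at the
critical ones. -/
def unconstrained (g : (Fin n → ℕ∞) → LieSubalgebra K (Der K n)) : Fin n → ℕ∞ :=
  open Classical in fun i => if Noncritical g i then ⊤ else 1

/-- The Lie algebra `g(N)` for the unconstrained shearing vector `N`. -/
abbrev Unc (g : (Fin n → ℕ∞) → LieSubalgebra K (Der K n)) : LieSubalgebra K (Der K n) :=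
  g (unconstrained g)

/-- The shearing vector with value `m` at the first indeterminate and 1 at the others. -/
def shearFirst (n : ℕ) (m : ℕ∞) : Fin (n + 1) → ℕ∞ := Fin.cons m fun _ => 1

variable (K) in
/-- The derived algebra of `L` has codimension 1 in `L` and it is simple. -/
def DerivedIsSimpleOfCodimOne (L : Type*) [LieRing L] [LieAlgebra K L] : Prop :=
  Module.finrank K (L ⧸ LieAlgebra.derivedSeries K L 1) = 1 ∧
    LieAlgebra.IsSimple K (LieAlgebra.derivedSeries K L 1)

end Kas

end

noncomputable section
set_option linter.unusedSectionVars false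

/-- The degrees of the indeterminates. -/
notation "wt7" => ([2, 1, 1, 1, 1, 1, 1] : List ℕ)
notation "wt7t" => ([1, 1, 1, 1, 1, 1, 1] : List ℕ)
notation "wt8" => ([1, 1, 1, 1, 1, 1, 1, 1] : List ℕ)
notation "wt10" => ([2, 2, 1, 1, 1, 1, 1, 1, 1, 1] : List ℕ)

namespace Kas
variable {K : Type*} [Field K] {n : ℕ}

/-! ### Combinations of keys modulo 2 -/

section Lists

variable {M : Type*} [AddCommGroup M]

/-- The sum of the values of `φ` over a list of keys. -/
def lsum (φ : ℕ → M) (L : List ℕ) : M := (L.map φ).sum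

@[simp] theorem lsum_nil (φ : ℕ → M) : lsum φ [] = 0 := rfl

@[simp] theorem lsum_cons (φ : ℕ → M) (k : ℕ) (L : List ℕ) :
    lsum φ (k :: L) = φ k + lsum φ L := by simp [lsum]

@[simp] theorem lsum_append (φ : ℕ → M) (L L' : List ℕ) :
    lsum φ (L ++ L') = lsum φ L + lsum φ L' := by simp [lsum]

theorem lsum_flatMap {α : Type*} (φ : ℕ → M) (f : α → List ℕ) (L : List α) :
    lsum φ (L.flatMap f) = (L.map fun a => lsum φ (f a)).sum := by
  induction L with
  | nil => rfl
  | cons a l ih => simp [List.flatMap_cons, ih]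

/-- Insertion of a key with cancellation of repeated keys. -/
def toggle (k : ℕ) : List ℕ → List ℕ
  | [] => [k]
  | a :: l => bif Nat.beq a k then l else a :: toggle k l

/-- Cancellation of keys that are repeated an even number of times. -/
def cancel : List ℕ → List ℕ
  | [] => []
  | a :: l => toggle a (cancel l)

theorem lsum_toggle (h2 : ∀ x : M, x + x = 0) (φ : ℕ → M) (k : ℕ) (L : List ℕ) :
    lsum φ (toggle k L) = φ k + lsum φ L := by
  induction L with
  | nil => simp [toggle]
  | cons a l ih =>
    rw [toggle]
    cases h : Nat.beq a k with
    | true =>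
      rw [Nat.eq_of_beq_eq_true h, cond_true, lsum_cons, ← add_assoc, h2, zero_add]
    | false =>
      rw [cond_false, lsum_cons, lsum_cons, ih]; abel

theorem lsum_cancel (h2 : ∀ x : M, x + x = 0) (φ : ℕ → M) (L : List ℕ) :
    lsum φ (cancel L) = lsum φ L := by
  induction L with
  | nil => rfl
  | cons a l ih => rw [cancel, lsum_toggle h2, ih, lsum_cons]

/-- Equality of two combinations of keys modulo 2. -/
def eqv (L L' : List ℕ) : Bool := (cancel (L ++ L')).isEmpty

theorem lsum_eq_of_eqv (h2 : ∀ x : M, x + x = 0) (φ : ℕ → M) {L L' : List ℕ}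
    (h : eqv L L' = true) : lsum φ L = lsum φ L' := by
  rw [eqv, List.isEmpty_iff] at h
  have := lsum_cancel h2 φ (L ++ L')
  rw [h, lsum_nil, lsum_append] at this
  have h3 := h2 (lsum φ L')
  rw [this] at h3
  exact (add_right_cancel h3).symm

end Lists

/-! ### Digits of keys -/

/-- The digit number `i` in base 16. -/
def dig (e i : ℕ) : ℕ := e / 16 ^ i % 16

theorem dig_zero (e : ℕ) : dig e 0 = e % 16 := by simp [dig]

theorem dig_succ (e i : ℕ) : dig e (i + 1) = dig (e / 16) i := by
  rw [dig, dig, pow_succ', Nat.div_div_eq_div_mul]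

theorem dig_lt (e i : ℕ) : dig e i < 16 := Nat.mod_lt _ (by norm_num)

theorem dig_add (i a b : ℕ) (h : ∀ k, dig a k + dig b k < 16) :
    dig (a + b) i = dig a i + dig b i := by
  induction i generalizing a b with
  | zero =>
    have := h 0
    simp only [dig_zero] at this ⊢
    omega
  | succ i ih =>
    have h0 := h 0
    simp only [dig_zero] at h0
    have e : (a + b) / 16 = a / 16 + b / 16 := by omega
    rw [dig_succ, dig_succ, dig_succ, e]
    exact ih _ _ fun k => by have := h (k + 1); rwa [dig_succ, dig_succ] at this

theorem dig_sub_pow (i k a : ℕ) (h : dig a i ≠ 0) :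
    dig (a - 16 ^ i) k = if k = i then dig a k - 1 else dig a k := by
  induction i generalizing a k with
  | zero =>
    rw [dig_zero] at h
    cases k with
    | zero => simp only [dig_zero, pow_zero, if_true]; omega
    | succ k =>
      have e : (a - 1) / 16 = a / 16 := by omega
      simp [dig_succ, e]
  | succ i ih =>
    rw [dig_succ] at h
    have e : (a - 16 ^ (i + 1)) / 16 = a / 16 - 16 ^ i := by
      rw [pow_succ']; omega
    have hle : 16 ^ i ≤ a / 16 := by
      by_contra hlt
      exact h (by rw [dig, Nat.div_eq_of_lt (by omega)])
    cases k with
    | zero =>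
      rw [pow_succ']
      simp only [dig_zero]
      rw [if_neg (by omega)]
      omega
    | succ k =>
      rw [dig_succ, e, ih _ _ h, dig_succ]
      simp

theorem land_digits {a b : ℕ} (h : a &&& b = 0) (k : ℕ) : dig a k &&& dig b k = 0 := by
  have := congrArg (fun x => dig x k) h
  have e : ∀ x, dig x k = (x >>> (4 * k)) % 2 ^ 4 := fun x => by
    rw [dig, Nat.shiftRight_eq_div_pow, pow_mul]; norm_num
  rw [e a, e b, ← Nat.and_mod_two_pow, ← Nat.shiftRight_and_distrib, h]
  simp

theorem land_eq_zero_of_digits (a b : ℕ) (h : ∀ k, dig a k &&& dig b k = 0) : a &&& b = 0 := by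
  induction a using Nat.strong_induction_on generalizing b with
  | _ a ih =>
    rcases Nat.eq_zero_or_pos a with h0 | h0
    · simp [h0]
    · have h1 := ih (a / 16) (by omega) (b / 16) fun k => by
        have := h (k + 1); rwa [dig_succ, dig_succ] at this
      have h2 : (a &&& b) % 2 ^ 4 = 0 := by
        rw [Nat.and_mod_two_pow]
        have := h 0
        rwa [dig_zero, dig_zero] at this
      have h3 : (a &&& b) / 2 ^ 4 = 0 := by
        rw [← Nat.shiftRight_eq_div_pow, Nat.shiftRight_and_distrib, Nat.shiftRight_eq_div_pow,
          Nat.shiftRight_eq_div_pow]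
        exact h1
      omega

theorem add_lt_of_land {a b : ℕ} (ha : a < 16) (hb : b < 16) (h : a &&& b = 0) : a + b < 16 := by
  have : ∀ a < 16, ∀ b < 16, a &&& b = 0 → a + b < 16 := by decide
  exact this a ha b hb h

theorem choose_parity (a b : ℕ) : (a + b).choose a % 2 = if a &&& b = 0 then 1 else 0 := by
  induction a using Nat.strong_induction_on generalizing b with
  | _ a ih =>
    rcases Nat.eq_zero_or_pos a with h0 | h0
    · simp [h0]
    · have h := Choose.choose_modEq_choose_mod_mul_choose_div_nat (p := 2) (n := a + b) (k := a)
      rw [Nat.ModEq] at h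
      rw [h]
      have hmod : (a &&& b) % 2 = a % 2 &&& b % 2 := by
        have := Nat.and_mod_two_pow (a := a) (b := b) (n := 1)
        simpa using this
      have hdiv : (a &&& b) / 2 = a / 2 &&& b / 2 := by
        have := Nat.shiftRight_and_distrib (a := a) (b := b) (i := 1)
        simpa [Nat.shiftRight_eq_div_pow] using this
      have i1 := ih (a / 2) (by omega) (b / 2)
      rcases Nat.mod_two_eq_zero_or_one a with ha | ha <;>
        rcases Nat.mod_two_eq_zero_or_one b with hb | hb
      · have e1 : (a + b) % 2 = 0 := by omega
        have e2 : (a + b) / 2 = a / 2 + b / 2 := by omega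
        rw [ha, hb] at hmod
        have e3 : (a &&& b) = 0 ↔ (a / 2 &&& b / 2) = 0 := by
          rw [← hdiv]; simp at hmod; omega
        rw [e1, e2, ha]
        simp only [Nat.choose_self, one_mul, i1, e3]
      · have e1 : (a + b) % 2 = 1 := by omega
        have e2 : (a + b) / 2 = a / 2 + b / 2 := by omega
        rw [ha, hb] at hmod
        have e3 : (a &&& b) = 0 ↔ (a / 2 &&& b / 2) = 0 := by
          rw [← hdiv]; simp at hmod; omega
        rw [e1, e2, ha]
        simp only [Nat.choose_zero_right, one_mul, i1, e3]
      · have e1 : (a + b) % 2 = 1 := by omega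
        have e2 : (a + b) / 2 = a / 2 + b / 2 := by omega
        rw [ha, hb] at hmod
        have e3 : (a &&& b) = 0 ↔ (a / 2 &&& b / 2) = 0 := by
          rw [← hdiv]; simp at hmod; omega
        rw [e1, e2, ha]
        simp only [Nat.choose_self, one_mul, i1, e3]
      · have e1 : (a + b) % 2 = 0 := by omega
        rw [ha, hb] at hmod
        have e3 : ¬ (a &&& b) = 0 := fun h0 => by rw [h0] at hmod; simp at hmod
        rw [e1, ha, if_neg e3]
        simp

theorem binom_cast [CharP K 2] (u v : Fin n → ℕ) :
    (binom u v : K) = if ∀ i, u i &&& v i = 0 then 1 else 0 := by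
  have hc : ∀ m : ℕ, (m : K) = ((m % 2 : ℕ) : K) := fun m =>
    (CharP.cast_eq_iff_mod_eq K 2).2 (Nat.mod_mod _ _).symm
  unfold binom
  rw [Nat.cast_prod]
  have : ∀ i, (((u i + v i).choose (u i) : ℕ) : K) = if u i &&& v i = 0 then 1 else 0 := by
    intro i
    rw [hc, choose_parity]
    split_ifs <;> simp
  rw [Finset.prod_congr rfl fun i _ => this i]
  split_ifs with h
  · exact Finset.prod_eq_one fun i _ => if_pos (h i)
  · push Not at h
    obtain ⟨i, hi⟩ := h
    exact Finset.prod_eq_zero (Finset.mem_univ i) (if_neg hi)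

/-! ### Coefficients -/

theorem coef_mono (r s : Fin n → ℕ) : coef (mono r : DP K n) s = if r = s then 1 else 0 := by
  classical
  unfold coef mono
  exact Finsupp.single_apply

theorem coef_ext {f g : DP K n} (h : ∀ r, coef f r = coef g r) : f = g :=
  Finsupp.ext (M := K) (α := Fin n → ℕ) h

/-- The coefficient as a linear functional. -/
def coefL (r : Fin n → ℕ) : DP K n →ₗ[K] K where
  toFun f := coef f r
  map_add' _ _ := rfl
  map_smul' _ _ := rfl

theorem coefL_apply (r : Fin n → ℕ) (f : DP K n) : coefL r f = coef f r := rfl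

theorem coef_zero (r : Fin n → ℕ) : coef (0 : DP K n) r = 0 := rfl

theorem coef_sum {ι : Type*} (s : Finset ι) (f : ι → DP K n) (r : Fin n → ℕ) :
    coef (∑ i ∈ s, f i) r = ∑ i ∈ s, coef (f i) r := map_sum (coefL r) f s

theorem coef_sub (f g : DP K n) (r : Fin n → ℕ) : coef (f - g) r = coef f r - coef g r :=
  map_sub (coefL r) f g

theorem coef_pd (i : Fin n) (f : DP K n) (r : Fin n → ℕ) :
    coef (pd i f) r = coef f (Function.update r i (r i + 1)) := by
  classical
  have : (coefL r ∘ₗ (pdL i : DP K n →ₗ[K] DP K n)) =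
      coefL (Function.update r i (r i + 1)) := by
    refine hom_ext fun s => ?_
    rw [LinearMap.comp_apply, pdL_mono, coefL_apply, coefL_apply, coef_mono]
    by_cases hs : s i = 0
    · rw [if_pos hs, if_neg, coef_zero]
      intro h
      have := congrFun h i
      simp [hs] at this
    · rw [if_neg hs, coef_mono]
      congr 1
      refine propext ⟨fun h => ?_, fun h => ?_⟩
      · subst h
        funext j
        by_cases hj : j = i
        · subst hj; simp; omega
        · simp [Function.update_of_ne hj]
      · subst h
        funext j
        by_cases hj : j = i
        · subst hj; simp
        · simp [Function.update_of_ne hj]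
  exact congrArg (fun m : DP K n →ₗ[K] K => m f) this

theorem pd_X (i j : Fin n) : pd i (X j : DP K n) = if i = j then 1 else 0 := by
  unfold X
  rw [pd_mono]
  by_cases h : i = j
  · subst h
    rw [if_neg (by simp), if_pos rfl, one_def]
    congr 1
    funext k
    by_cases hk : k = i
    · subst hk; simp
    · simp [hk]
  · rw [if_pos (by simp [h]), if_neg h]

theorem field_X (f : Fin n → DP K n) (i : Fin n) : (∑ j, f j • pd j : Der K n) (X i) = f i := by
  rw [field_apply]
  simp [pd_X]

theorem add_self_der [CharP K 2] (D : Der K n) : D + D = 0 := by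
  rw [← two_smul K D, show (2 : K) = 0 from CharTwo.two_eq_zero, zero_smul]

theorem add_self_dp [CharP K 2] (f : DP K n) : f + f = 0 := by
  rw [← two_smul K f, show (2 : K) = 0 from CharTwo.two_eq_zero, zero_smul]

theorem neg_eq_der [CharP K 2] (D : Der K n) : -D = D :=
  neg_eq_of_add_eq_zero_left (add_self_der D)

theorem sub_eq_add_der [CharP K 2] (D E : Der K n) : D - E = D + E := by
  rw [sub_eq_add_neg, neg_eq_der]

theorem lie_comm_der [CharP K 2] (D E : Der K n) : ⁅D, E⁆ = ⁅E, D⁆ := by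
  rw [← lie_skew, neg_eq_der]

theorem mem_trunc_top (f : DP K n) : f ∈ trunc K (⊤ : Fin n → ℕ∞) := by
  induction f using dp_induction with
  | h0 => exact Submodule.zero_mem _
  | ha f g hf hg => exact Submodule.add_mem _ hf hg
  | hm c r =>
    refine Submodule.smul_mem _ c (Submodule.subset_span ⟨r, ?_, rfl⟩)
    intro i m h
    simp at h

theorem mem_vect_top [CharP K 2] {D : Der K n} :
    D ∈ vect K (⊤ : Fin n → ℕ∞) ↔ D = ∑ j, D (X j) • pd j := by
  constructor
  · rintro ⟨f, -, rfl⟩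
    exact Finset.sum_congr rfl fun j _ => by rw [field_X]
  · intro h
    exact ⟨_, fun j => mem_trunc_top _, h⟩

theorem vect_ext [CharP K 2] {D E : Der K n} (hD : D ∈ vect K (⊤ : Fin n → ℕ∞))
    (hE : E ∈ vect K (⊤ : Fin n → ℕ∞)) (h : ∀ j, D (X j) = E (X j)) : D = E := by
  rw [mem_vect_top.1 hD, mem_vect_top.1 hE]
  exact Finset.sum_congr rfl fun j _ => by rw [h j]

theorem mem_trunc_iff {N : Fin n → ℕ∞} {f : DP K n} :
    f ∈ trunc K N ↔ ∀ r, coef f r ≠ 0 → Allowed N r := by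
  classical
  constructor
  · intro hf
    induction hf using Submodule.span_induction with
    | zero => exact fun r h => absurd rfl h
    | add x y _ _ hx hy =>
      intro r h
      by_cases h0 : coef x r = 0
      · exact hy r fun h1 => h (by rw [coef_add, h0, h1, add_zero])
      · exact hx r h0
    | smul c x _ hx => exact fun r h => hx r fun h0 => h (by rw [coef_smul, h0, mul_zero])
    | mem x hx =>
      obtain ⟨s, hs, rfl⟩ := hx
      intro r h
      rw [coef_mono] at h
      by_cases e : s = r
      · rwa [← e]
      · rw [if_neg e] at h; exact absurd rfl h
  · intro h
    have e : f = ∑ r ∈ Finsupp.support (M := K) f, coef f r • mono r := by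
      refine coef_ext fun s => ?_
      rw [coef_sum]
      simp only [coef_smul, coef_mono, mul_ite, mul_one, mul_zero]
      rw [Finset.sum_ite_eq']
      split_ifs with hs
      · rfl
      · exact Finsupp.notMem_support_iff.1 hs
    rw [e]
    refine Submodule.sum_mem _ fun r hr => Submodule.smul_mem _ _ (Submodule.subset_span ?_)
    exact ⟨r, h r (Finsupp.mem_support_iff.1 hr), rfl⟩

theorem mem_vect_iff [CharP K 2] {N : Fin n → ℕ∞} {D : Der K n} :
    D ∈ vect K N ↔ D ∈ vect K (⊤ : Fin n → ℕ∞) ∧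
      ∀ j r, coef (D (X j)) r ≠ 0 → Allowed N r := by
  constructor
  · rintro ⟨f, hf, rfl⟩
    refine ⟨⟨f, fun j => mem_trunc_top _, rfl⟩, fun j r h => ?_⟩
    rw [field_X] at h
    exact mem_trunc_iff.1 (hf j) r h
  · rintro ⟨h1, h2⟩
    exact ⟨_, fun j => mem_trunc_iff.2 (h2 j), mem_vect_top.1 h1⟩

theorem vect_le_top [CharP K 2] {N : Fin n → ℕ∞} {D : Der K n} (h : D ∈ vect K N) :
    D ∈ vect K (⊤ : Fin n → ℕ∞) := (mem_vect_iff.1 h).1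

/-! ### Fields given by keys -/

/-- The exponent given by a key: the digits of the key are shifted by `r - base`. -/
def kexp (base r : Fin n → ℕ) (k : ℕ) : Fin n → ℕ := fun i => r i + dig k (i + 1) - base i

open Classical in
/-- The monomial given by a key, relative to `base` and `r`. -/
def kmono (K : Type*) [Field K] (base r : Fin n → ℕ) (k : ℕ) : DP K n :=
  if ∀ i, base i ≤ r i + dig k (i + 1) then mono (kexp base r k) else 0

variable (K) in
/-- The field given by a key. -/
def kfield [NeZero n] (base r : Fin n → ℕ) (k : ℕ) : Der K n :=
  kmono K base r k • pd (Fin.ofNat n (k % 16))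

variable (K) in
/-- The field given by a list of keys. -/
abbrev kf [NeZero n] (base r : Fin n → ℕ) (L : List ℕ) : Der K n := lsum (kfield K base r) L

variable (K n) in
/-- The field given by a list of keys, without a shift. -/
abbrev kz [NeZero n] (L : List ℕ) : Der K n := kf K (0 : Fin n → ℕ) 0 L

/-- Half of the bracket of two fields given by keys. -/
def brHalf (a b : ℕ) : List ℕ :=
  bif Nat.beq (dig b (a % 16 + 1)) 0 then [] else
    bif Nat.beq ((a / 16) &&& ((b - 16 ^ (a % 16 + 1)) / 16)) 0 then
      [(a / 16) * 16 + (b - 16 ^ (a % 16 + 1))] else []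

/-- The bracket of two fields given by lists of keys. -/
def brL (L L' : List ℕ) : List ℕ :=
  L.flatMap fun a => L'.flatMap fun b => brHalf a b ++ brHalf b a

/-- The key is valid for `n` indeterminates. -/
def validKey (n k : ℕ) : Bool := Nat.blt (k % 16) n && Nat.blt k (16 ^ (n + 1))

theorem validKey_iff {k : ℕ} : validKey n k = true ↔ k % 16 < n ∧ k < 16 ^ (n + 1) := by
  simp [validKey, Nat.blt_eq]

theorem dig_eq_zero_of_valid {k : ℕ} (h : validKey n k = true) {i : ℕ} (hi : n < i) :
    dig k i = 0 := by
  rw [dig, Nat.div_eq_of_lt]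
  exact ((validKey_iff.1 h).2).trans_le (Nat.pow_le_pow_right (by norm_num) hi)

theorem mono_mul_mono_char [CharP K 2] (u v : Fin n → ℕ) :
    (mono u : DP K n) * mono v = if ∀ i, u i &&& v i = 0 then mono (u + v) else 0 := by
  rw [mono_mul_mono, binom_cast]
  split_ifs <;> simp

/-- `a` has no digits where `base` does not vanish, and the digits of `b` are positive there. -/
def Compat (base r : Fin n → ℕ) (a b : ℕ) : Prop :=
  ∀ i, (base i = 0 ∧ r i = 0) ∨ (dig a (i + 1) = 0 ∧ dig b (i + 1) ≠ 0)

theorem Compat.base_zero (a b : ℕ) : Compat (n := n) 0 0 a b := fun _ => Or.inl ⟨rfl, rfl⟩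

theorem dig_key_add {a c : ℕ} (h : (a / 16) &&& (c / 16) = 0) (i : ℕ) :
    dig ((a / 16) * 16 + c) (i + 1) = dig a (i + 1) + dig c (i + 1) := by
  have e : ((a / 16) * 16 + c) / 16 = a / 16 + c / 16 := by omega
  rw [dig_succ, e, dig_add, ← dig_succ, ← dig_succ]
  intro k
  exact add_lt_of_land (dig_lt _ _) (dig_lt _ _) (land_digits h k)

theorem key_add_mod (a c : ℕ) : ((a / 16) * 16 + c) % 16 = c % 16 := by omega

theorem brHalf_left [CharP K 2] [NeZero n] {base r : Fin n → ℕ} {a b : ℕ} (ha : validKey n a = true)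
    (hc : Compat base r a b) :
    (kmono K 0 0 a * pd (Fin.ofNat n (a % 16)) (kmono K base r b)) • pd (Fin.ofNat n (b % 16)) =
      kf K base r (brHalf a b) := by
  classical
  obtain ⟨ha1, -⟩ := validKey_iff.1 ha
  set i : Fin n := Fin.ofNat n (a % 16) with hi
  have hiv : (i : ℕ) = a % 16 := by rw [hi]; exact Nat.mod_eq_of_lt ha1
  have ek : kmono K 0 0 a = (mono (fun j => dig a (j + 1)) : DP K n) := by
    rw [kmono, if_pos (show ∀ i : Fin n, (0 : Fin n → ℕ) i ≤ _ from fun _ => Nat.zero_le _)]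
    congr 1
    funext j
    simp [kexp]
  rw [ek, brHalf]
  by_cases h0 : dig b (a % 16 + 1) = 0
  · rw [h0]
    rw [show Nat.beq 0 0 = true from rfl, cond_true, kf, lsum_nil]
    have hb0 : base i = 0 ∧ r i = 0 := (hc i).resolve_right fun h => h.2 (by rw [hiv]; exact h0)
    have : pd i (kmono K base r b) = 0 := by
      rw [kmono]
      split_ifs
      · rw [pd_mono, if_pos]
        rw [kexp, hb0.1, hb0.2, hiv, h0]
      · exact map_zero _
    rw [this, mul_zero, zero_smul]
  · have hne : Nat.beq (dig b (a % 16 + 1)) 0 = false := by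
      rw [← Bool.not_eq_true, Nat.beq_eq]; exact h0
    rw [hne, cond_false]
    have hdc : ∀ j, dig (b - 16 ^ (a % 16 + 1)) j =
        if j = a % 16 + 1 then dig b j - 1 else dig b j := fun j => dig_sub_pow _ _ _ h0
    have hc16 : (b - 16 ^ (a % 16 + 1)) % 16 = b % 16 := by
      have := hdc 0
      rw [if_neg (by omega)] at this
      rwa [dig_zero, dig_zero] at this
    have hdcj : ∀ j : Fin n, dig (b - 16 ^ (a % 16 + 1)) (j + 1) =
        if j = i then dig b (j + 1) - 1 else dig b (j + 1) := by
      intro j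
      rw [hdc]
      congr 1
      rw [Fin.ext_iff, hiv]
      simp
    -- the product
    have hprod : (mono (fun j => dig a (j + 1)) : DP K n) * pd i (kmono K base r b) =
        if (∀ j : Fin n, dig a (j + 1) &&& dig (b - 16 ^ (a % 16 + 1)) (j + 1) = 0) ∧
          ∀ j, base j ≤ r j + (dig a (j + 1) + dig (b - 16 ^ (a % 16 + 1)) (j + 1)) then
        mono (fun j => r j + (dig a (j + 1) + dig (b - 16 ^ (a % 16 + 1)) (j + 1)) - base j)
        else 0 := by
      rw [kmono]
      by_cases hok : ∀ j, base j ≤ r j + dig b (j + 1)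
      · rw [if_pos hok, pd_mono]
        by_cases hz : kexp base r b i = 0
        · rw [if_pos hz, mul_zero, if_neg]
          rintro ⟨-, h2⟩
          have := h2 i
          rw [hdcj, if_pos rfl] at this
          have h4 : dig b (i + 1) ≠ 0 := by rw [hiv]; exact h0
          rw [kexp] at hz
          rcases hc i with h | h
          · rw [h.1, h.2] at hz; omega
          · rw [h.1] at this; omega
        · rw [if_neg hz, mono_mul_mono_char]
          have h4 : dig b (i + 1) ≠ 0 := by rw [hiv]; exact h0
          have e2 : ∀ j, base j ≤ r j + (dig a (j + 1) + dig (b - 16 ^ (a % 16 + 1)) (j + 1)) := by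
            intro j
            rw [hdcj]
            rw [kexp] at hz
            have := hok j
            rcases hc j with h | h
            · omega
            · split_ifs with e
              · subst e; omega
              · omega
          have e1 : ∀ j, Function.update (kexp base r b) i (kexp base r b i - 1) j =
              r j + dig (b - 16 ^ (a % 16 + 1)) (j + 1) - base j := by
            intro j
            rw [hdcj]
            by_cases e : j = i
            · subst e
              rw [Function.update_self, if_pos rfl, kexp]
              omega
            · rw [Function.update_of_ne e, if_neg e, kexp]
          have e3 : (∀ j : Fin n, dig a (j + 1) &&& Function.update (kexp base r b) i
              (kexp base r b i - 1) j = 0) ↔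
              ∀ j : Fin n, dig a (j + 1) &&& dig (b - 16 ^ (a % 16 + 1)) (j + 1) = 0 := by
            refine forall_congr' fun j => ?_
            rw [e1]
            rcases hc j with h | h
            · rw [h.1, h.2, zero_add, Nat.sub_zero]
            · rw [h.1, Nat.zero_and, Nat.zero_and]
          rw [if_congr (e3.trans (and_iff_left e2).symm) _ rfl]
          congr 1
          funext j
          rw [Pi.add_apply, e1]
          have h5 := e2 j
          rcases hc j with h | h
          · omega
          · rw [h.1]; omega
      · rw [if_neg hok, map_zero, mul_zero, if_neg]
        rintro ⟨-, h2⟩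
        apply hok
        intro j
        have := h2 j
        rw [hdcj] at this
        rcases hc j with h | h
        · rw [h.1]; omega
        · rw [h.1] at this
          split_ifs at this <;> omega
    rw [hprod]
    by_cases hland : (a / 16) &&& ((b - 16 ^ (a % 16 + 1)) / 16) = 0
    · rw [hland]
      rw [show Nat.beq 0 0 = true from rfl, cond_true, kf, lsum_cons, lsum_nil, add_zero]
      have hl : ∀ j : Fin n, dig a (j + 1) &&& dig (b - 16 ^ (a % 16 + 1)) (j + 1) = 0 := by
        intro j
        have := land_digits hland j
        rwa [← dig_succ, ← dig_succ] at this
      rw [kfield, key_add_mod, hc16, kmono]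
      congr 1
      have ed := fun j : ℕ => dig_key_add hland j
      have ek2 : kexp base r (a / 16 * 16 + (b - 16 ^ (a % 16 + 1))) = fun j : Fin n =>
          r j + (dig a (j + 1) + dig (b - 16 ^ (a % 16 + 1)) (j + 1)) - base j :=
        funext fun j => by rw [kexp, ed]
      simp only [hl, implies_true, true_and, ek2, ed]
    · have : Nat.beq ((a / 16) &&& ((b - 16 ^ (a % 16 + 1)) / 16)) 0 = false := by
        rw [← Bool.not_eq_true, Nat.beq_eq]; exact hland
      rw [this, cond_false, kf, lsum_nil, if_neg, zero_smul]
      rintro ⟨h1, -⟩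
      apply hland
      apply land_eq_zero_of_digits
      intro k
      rw [← dig_succ, ← dig_succ]
      by_cases hk : k < n
      · exact h1 ⟨k, hk⟩
      · rw [dig_eq_zero_of_valid ha (by omega), Nat.zero_and]

theorem brHalf_right [CharP K 2] [NeZero n] {base r : Fin n → ℕ} {a b : ℕ}
    (hb : validKey n b = true) (hc : Compat base r a b) :
    (kmono K base r b * pd (Fin.ofNat n (b % 16)) (kmono K 0 0 a)) • pd (Fin.ofNat n (a % 16)) =
      kf K base r (brHalf b a) := by
  classical
  obtain ⟨hb1, -⟩ := validKey_iff.1 hb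
  set i : Fin n := Fin.ofNat n (b % 16) with hi
  have hiv : (i : ℕ) = b % 16 := by rw [hi]; exact Nat.mod_eq_of_lt hb1
  have ek : kmono K 0 0 a = (mono (fun j => dig a (j + 1)) : DP K n) := by
    rw [kmono, if_pos (show ∀ i : Fin n, (0 : Fin n → ℕ) i ≤ _ from fun _ => Nat.zero_le _)]
    congr 1
    funext j
    simp [kexp]
  rw [ek, brHalf, pd_mono]
  by_cases h0 : dig a (b % 16 + 1) = 0
  · rw [h0, show Nat.beq 0 0 = true from rfl, cond_true, kf, lsum_nil, hiv, h0, if_pos rfl,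
      mul_zero, zero_smul]
  · have hne : Nat.beq (dig a (b % 16 + 1)) 0 = false := by
      rw [← Bool.not_eq_true, Nat.beq_eq]; exact h0
    rw [hne, cond_false, hiv, if_neg h0]
    have hdc : ∀ j, dig (a - 16 ^ (b % 16 + 1)) j =
        if j = b % 16 + 1 then dig a j - 1 else dig a j := fun j => dig_sub_pow _ _ _ h0
    have hc16 : (a - 16 ^ (b % 16 + 1)) % 16 = a % 16 := by
      have := hdc 0
      rw [if_neg (by omega)] at this
      rwa [dig_zero, dig_zero] at this
    have hdcj : Function.update (fun j : Fin n => dig a (j + 1)) i (dig a (b % 16 + 1) - 1) =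
        fun j : Fin n => dig (a - 16 ^ (b % 16 + 1)) (j + 1) := by
      funext j
      rw [hdc]
      by_cases e : j = i
      · subst e
        rw [Function.update_self, if_pos (by rw [hiv]), hiv]
      · rw [Function.update_of_ne e, if_neg]
        intro h
        exact e (Fin.ext (by rw [hiv]; omega))
    have hz : ∀ j : Fin n, dig a (j + 1) = 0 → dig (a - 16 ^ (b % 16 + 1)) (j + 1) = 0 := by
      intro j h
      rw [hdc, h]
      split_ifs <;> rfl
    rw [hdcj]
    by_cases hland : (b / 16) &&& ((a - 16 ^ (b % 16 + 1)) / 16) = 0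
    · rw [hland, show Nat.beq 0 0 = true from rfl, cond_true, kf, lsum_cons, lsum_nil, add_zero]
      have hl : ∀ j : Fin n, dig b (j + 1) &&& dig (a - 16 ^ (b % 16 + 1)) (j + 1) = 0 := by
        intro j
        have := land_digits hland j
        rwa [← dig_succ, ← dig_succ] at this
      have ed := fun j : ℕ => dig_key_add hland j
      have e5 : ∀ j : Fin n, base j ≤ r j + dig b (j + 1) ↔
          base j ≤ r j + (dig b (j + 1) + dig (a - 16 ^ (b % 16 + 1)) (j + 1)) := by
        intro j
        rcases hc j with h | h
        · omega
        · rw [hz j h.1, add_zero]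
      rw [kfield, key_add_mod, hc16, kmono, kmono]
      simp only [ed]
      rw [if_congr (forall_congr' e5) rfl rfl]
      congr 1
      split_ifs with hok
      · rw [mono_mul_mono_char, if_pos]
        · congr 1
          funext j
          rw [Pi.add_apply, kexp, kexp, ed]
          have := (e5 j).2 (hok j)
          omega
        · intro j
          rw [kexp]
          rcases hc j with h | h
          · rw [h.1, h.2, zero_add, Nat.sub_zero]; exact hl j
          · rw [hz j h.1, Nat.and_zero]
      · rw [zero_mul]
    · have : Nat.beq ((b / 16) &&& ((a - 16 ^ (b % 16 + 1)) / 16)) 0 = false := by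
        rw [← Bool.not_eq_true, Nat.beq_eq]; exact hland
      rw [this, cond_false, kf, lsum_nil, kmono]
      split_ifs with hok
      · rw [mono_mul_mono_char, if_neg, zero_smul]
        intro h1
        apply hland
        apply land_eq_zero_of_digits
        intro k
        rw [← dig_succ, ← dig_succ]
        by_cases hk : k < n
        · have := h1 ⟨k, hk⟩
          rw [kexp] at this
          rcases hc ⟨k, hk⟩ with h | h
          · rwa [h.1, h.2, zero_add, Nat.sub_zero] at this
          · rw [hz ⟨k, hk⟩ h.1, Nat.and_zero]
        · rw [dig_eq_zero_of_valid hb (by omega), Nat.zero_and]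
      · rw [zero_mul, zero_smul]

theorem lie_smul_pd [CharP K 2] (f g : DP K n) (i j : Fin n) :
    ⁅(f • pd i : Der K n), (g • pd j : Der K n)⁆ = (f * pd i g) • pd j + (g * pd j f) • pd i := by
  rw [← sub_eq_add_der]
  ext a
  simp only [Derivation.commutator_apply, Derivation.smul_apply, Derivation.sub_apply,
    Derivation.leibniz, smul_eq_mul]
  rw [pd_comm j i]
  ring

theorem lie_kfield [CharP K 2] [NeZero n] {base r : Fin n → ℕ} {a b : ℕ}
    (ha : validKey n a = true) (hb : validKey n b = true) (hc : Compat base r a b) :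
    ⁅kfield K (0 : Fin n → ℕ) 0 a, kfield K base r b⁆ = kf K base r (brHalf a b ++ brHalf b a) := by
  rw [kfield, kfield, lie_smul_pd, brHalf_left ha hc, brHalf_right hb hc, kf, kf, kf,
    lsum_append]

/-- Validity of all keys in a list. -/
def validL (n : ℕ) (L : List ℕ) : Bool := L.all (validKey n)

theorem lie_kf_of_compat [CharP K 2] [NeZero n] {base r : Fin n → ℕ} {L L' : List ℕ}
    (hL : validL n L = true) (hL' : validL n L' = true)
    (hc : ∀ a ∈ L, ∀ b ∈ L', Compat base r a b) :
    ⁅kf K (0 : Fin n → ℕ) 0 L, kf K base r L'⁆ = kf K base r (brL L L') := by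
  rw [validL, List.all_eq_true] at hL hL'
  have h1 : ∀ a, validKey n a = true → (∀ b ∈ L', Compat base r a b) →
      ⁅kfield K (0 : Fin n → ℕ) 0 a, kf K base r L'⁆ =
        kf K base r (L'.flatMap fun b => brHalf a b ++ brHalf b a) := by
    intro a ha
    clear hc
    induction L' with
    | nil => intro _; simp
    | cons b l ih =>
      intro hc
      rw [List.flatMap_cons, kf, kf, lsum_append, lsum_cons, lie_add,
        lie_kfield ha (hL' b (by simp)) (hc b (by simp))]
      congr 1
      exact ih (fun x hx => hL' x (by simp [hx])) fun x hx => hc x (by simp [hx])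
  induction L with
  | nil => simp [brL]
  | cons a l ih =>
    rw [brL, List.flatMap_cons, kf, kf, kf, lsum_append, lsum_cons, add_lie]
    exact congrArg₂ (· + ·) (h1 a (hL a (by simp)) (hc a (by simp)))
      (ih (fun x hx => hL x (by simp [hx])) fun x hx => hc x (by simp [hx]))

theorem lie_kf [CharP K 2] [NeZero n] {L L' : List ℕ}
    (hL : validL n L = true) (hL' : validL n L' = true) :
    ⁅kz K n L, kz K n L'⁆ = kz K n (brL L L') :=
  lie_kf_of_compat hL hL' fun a _ b _ => Compat.base_zero a b

theorem kf_eq_of_eqv [CharP K 2] [NeZero n] {base r : Fin n → ℕ} {L L' : List ℕ}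
    (h : eqv L L' = true) : kf K base r L = kf K base r L' :=
  lsum_eq_of_eqv add_self_der _ h

theorem kf_mem_vect [CharP K 2] [NeZero n] {base r : Fin n → ℕ} (L : List ℕ) :
    kf K base r L ∈ vect K (⊤ : Fin n → ℕ∞) := by
  induction L with
  | nil => exact zero_mem _
  | cons a l ih =>
    rw [kf, lsum_cons]
    refine add_mem ?_ ih
    rw [mem_vect_top]
    rw [kfield, Finset.sum_eq_single (Fin.ofNat n (a % 16))]
    · rw [Derivation.smul_apply, pd_X, if_pos rfl, smul_eq_mul, mul_one]
    · intro j _ hj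
      rw [Derivation.smul_apply, pd_X, if_neg (Ne.symm hj), smul_zero, zero_smul]
    · intro h; exact absurd (Finset.mem_univ _) h

theorem coef_kfield [NeZero n] {base r : Fin n → ℕ} (a : ℕ) (j : Fin n) (s : Fin n → ℕ) :
    coef (kfield K base r a (X j)) s =
      if Fin.ofNat n (a % 16) = j then coef (kmono K base r a) s else 0 := by
  rw [kfield, Derivation.smul_apply, pd_X]
  split_ifs <;> simp [coef_zero]

theorem eq_of_dig {a k : ℕ} (hd : ∀ i, dig a i = dig k i) : a = k := by
  induction a using Nat.strong_induction_on generalizing k with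
  | _ a ih =>
    have h0 := hd 0
    rw [dig_zero, dig_zero] at h0
    rcases Nat.eq_zero_or_pos a with ha | ha
    · subst ha
      induction k using Nat.strong_induction_on with
      | _ k ihk =>
        by_contra hk0
        have := ihk (k / 16) (by omega) (fun i => by
          have := hd (i + 1)
          rw [dig_succ, dig_succ] at this
          simpa using this) (by rw [← dig_zero, ← dig_zero, ← dig_succ, ← hd 1]; simp [dig])
        omega
    · have := ih (a / 16) (by omega) (k := k / 16) fun i => by
        have := hd (i + 1)
        rwa [dig_succ, dig_succ] at this
      omega

theorem coef_kfield_key [NeZero n] {base r : Fin n → ℕ} {a k : ℕ} (ha : validKey n a = true)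
    (hk : validKey n k = true) (hb : ∀ i : Fin n, base i ≤ r i + dig k (i.val + 1)) :
    coef (kfield K base r a (X (Fin.ofNat n (k % 16)))) (kexp base r k) = if a = k then 1 else 0 := by
  classical
  rw [coef_kfield]
  by_cases hak : a = k
  · subst hak
    rw [if_pos rfl, if_pos rfl, kmono, if_pos hb, coef_mono, if_pos rfl]
  · rw [if_neg hak]
    split_ifs with h1
    · rw [kmono]
      split_ifs with h3
      · rw [coef_mono, if_neg]
        intro h2
        refine hak (eq_of_dig fun i => ?_)
        cases i with
        | zero =>
          rw [dig_zero, dig_zero]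
          have := congrArg Fin.val h1
          simp only [Fin.ofNat] at this
          rwa [Nat.mod_eq_of_lt (validKey_iff.1 ha).1, Nat.mod_eq_of_lt (validKey_iff.1 hk).1]
            at this
        | succ i =>
          by_cases hi : i < n
          · have := congrFun h2 ⟨i, hi⟩
            have h4 := hb ⟨i, hi⟩
            have h5 := h3 ⟨i, hi⟩
            simp only [kexp] at this h4 h5
            omega
          · rw [dig_eq_zero_of_valid ha (by omega), dig_eq_zero_of_valid hk (by omega)]
      · rfl
    · rfl

theorem coef_kf_key [NeZero n] {base r : Fin n → ℕ} {L : List ℕ} {k : ℕ} (hL : validL n L = true)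
    (hk : validKey n k = true) (hb : ∀ i : Fin n, base i ≤ r i + dig k (i.val + 1)) :
    coef (kf K base r L (X (Fin.ofNat n (k % 16)))) (kexp base r k) = L.count k := by
  rw [validL, List.all_eq_true] at hL
  induction L with
  | nil => exact (Nat.cast_zero).symm
  | cons a L ih =>
    rw [kf, lsum_cons, Derivation.add_apply, coef_add, coef_kfield_key (hL a (by simp)) hk hb]
    have := ih fun x hx => hL x (by simp [hx])
    rw [kf] at this
    rw [this, List.count_cons, add_comm]
    by_cases h : a = k
    · simp [h]
    · simp [h]

theorem kfield_independent [NeZero n] {l : List ℕ} (hv : validL n l = true) (hn : l.Nodup)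
    (c : ℕ → K) (h : (l.map fun k => c k • kfield K (0 : Fin n → ℕ) 0 k).sum = 0) :
    ∀ k ∈ l, c k = 0 := by
  classical
  rw [validL, List.all_eq_true] at hv
  intro k hk
  set j : Fin n := Fin.ofNat n (k % 16) with hj
  have h1 := congrArg (fun D : Der K n => coef (D (X j)) (kexp 0 0 k)) h
  have e : ∀ m : List ℕ, coef ((m.map fun k => c k • kfield K (0 : Fin n → ℕ) 0 k).sum (X j))
      (kexp 0 0 k) = (m.map fun a => c a * coef (kfield K (0 : Fin n → ℕ) 0 a (X j))
        (kexp 0 0 k)).sum := by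
    intro m
    induction m with
    | nil => rfl
    | cons a m ih =>
      rw [List.map_cons, List.sum_cons, Derivation.add_apply, coef_add, ih, List.map_cons,
        List.sum_cons, Derivation.smul_apply, coef_smul]
  have e2 : ∀ a ∈ l, coef (kfield K (0 : Fin n → ℕ) 0 a (X j)) (kexp 0 0 k) =
      if a = k then 1 else 0 := fun a ha =>
    coef_kfield_key (hv a ha) (hv k hk) fun _ => Nat.zero_le _
  rw [e] at h1
  have e3 : (l.map fun a => c a * coef (kfield K (0 : Fin n → ℕ) 0 a (X j))
      (kexp 0 0 k)) = l.map fun a => if a = k then c k else 0 := by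
    refine List.map_congr_left fun a ha => ?_
    rw [e2 a ha]
    split_ifs with h
    · rw [h, mul_one]
    · rw [mul_zero]
  rw [e3] at h1
  have e4 : ∀ m : List ℕ, m.Nodup → (m.map fun a => if a = k then c k else 0).sum =
      if k ∈ m then c k else 0 := by
    intro m hm
    induction m with
    | nil => simp
    | cons a m ih =>
      rw [List.nodup_cons] at hm
      rw [List.map_cons, List.sum_cons, ih hm.2]
      by_cases h : a = k
      · subst h
        rw [if_pos rfl, if_neg hm.1, if_pos (by simp), add_zero]
      · rw [if_neg h, zero_add]
        simp only [List.mem_cons]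
        by_cases h2 : k ∈ m
        · simp [h2]
        · simp [h2, Ne.symm h]
  rw [e4 l hn, if_pos hk] at h1
  exact h1

/-! ### Linear functionals given by bit masks

The coordinate number `j` corresponds to the bit `64 + j` of a mask; the lower bits depend linearly
on the other ones and only serve to make the masks look different. -/

/-- The sum of the `c j`, `j < m`, over the bits of the mask. -/
def ev (c : ℕ → K) (m v : ℕ) : K := ∑ j ∈ Finset.range m, if v.testBit (64 + j) then c j else 0

theorem ev_zero (c : ℕ → K) (m : ℕ) : ev c m 0 = 0 := by simp [ev]

theorem ev_xor [CharP K 2] (c : ℕ → K) (m v w : ℕ) : ev c m (v ^^^ w) = ev c m v + ev c m w := by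
  unfold ev
  rw [← Finset.sum_add_distrib]
  refine Finset.sum_congr rfl fun j _ => ?_
  rw [Nat.testBit_xor]
  cases v.testBit (64 + j) <;> cases w.testBit (64 + j) <;> simp [CharTwo.add_self_eq_zero]

/-- The mask of a coordinate. -/
def bitM (j : ℕ) : ℕ :=
  Nat.add (Nat.pow 2 (Nat.add 64 j))
    (Nat.mod (Nat.mul (Nat.succ j) 0x9e3779b97f4a7c15) 0x10000000000000000)

theorem testBit_bitM (i j : ℕ) : (bitM j).testBit (64 + i) = decide (i = j) := by
  have h : bitM j = 2 ^ 64 * 2 ^ j + (j.succ * 0x9e3779b97f4a7c15) % 2 ^ 64 := by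
    unfold bitM
    rw [← pow_add]; rfl
  rw [h, Nat.testBit_two_pow_mul_add _ (Nat.mod_lt _ (by positivity)), if_neg (by omega),
    Nat.add_sub_cancel_left, Nat.testBit_two_pow]
  simp [eq_comm]

theorem ev_bitM (c : ℕ → K) {m j : ℕ} (h : j < m) : ev c m (bitM j) = c j := by
  unfold ev
  simp only [testBit_bitM, decide_eq_true_eq]
  rw [Finset.sum_ite_eq']
  exact if_pos (Finset.mem_range.2 h)

/-- Reduction of a mask by a list of masks with the positions of their leading bits. -/
def redM : List (ℕ × ℕ) → ℕ → ℕ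
  | [], v => v
  | (r, b) :: l, v =>
    match bif Nat.beq (Nat.land (Nat.shiftRight v b) 1) 0 then v else Nat.xor v r with
    | 0 => 0
    | w + 1 => redM l w.succ

theorem ev_redM [CharP K 2] (c : ℕ → K) (m : ℕ) (rows : List (ℕ × ℕ))
    (h : ∀ r ∈ rows, ev c m r.1 = 0) (v : ℕ) : ev c m (redM rows v) = ev c m v := by
  induction rows generalizing v with
  | nil => rfl
  | cons r l ih =>
    obtain ⟨r, b⟩ := r
    have e : ev c m (bif Nat.beq (Nat.land (Nat.shiftRight v b) 1) 0 then v else Nat.xor v r) =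
        ev c m v := by
      cases Nat.beq (Nat.land (Nat.shiftRight v b) 1) 0
      · exact (ev_xor c m v r).trans (by rw [h (r, b) (by simp), add_zero])
      · rfl
    rw [redM, ← e]
    cases (bif Nat.beq (Nat.land (Nat.shiftRight v b) 1) 0 then v else Nat.xor v r) with
    | zero => rfl
    | succ w => exact ih (fun x hx => h x (by simp [hx])) _

/-- The list `r :: l`, with `l` evaluated. -/
def consE (r : ℕ × ℕ) : List (ℕ × ℕ) → List (ℕ × ℕ)
  | [] => [r]
  | x :: l => r :: x :: l

theorem consE_eq (r : ℕ × ℕ) (l : List (ℕ × ℕ)) : consE r l = r :: l := by cases l <;> rfl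

/-- Insertion of a mask with the leading bit at the position `b > 0`. -/
def insE (w : ℕ) : ℕ → List (ℕ × ℕ) → List (ℕ × ℕ)
  | 0, l => l
  | b + 1, [] => [(w, b.succ)]
  | b + 1, r :: l => bif Nat.blt r.2 b.succ then (w, b.succ) :: r :: l
      else consE r (insE w b.succ l)

theorem mem_insE {w b : ℕ} {x : ℕ × ℕ} {l : List (ℕ × ℕ)} (h : x ∈ insE w b l) :
    x.1 = w ∨ x ∈ l := by
  cases b with
  | zero => cases l <;> exact Or.inr h
  | succ b =>
    induction l with
    | nil => rw [insE, List.mem_singleton] at h; exact Or.inl (by rw [h])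
    | cons r l ih =>
      rw [insE, consE_eq] at h
      cases hb : Nat.blt r.2 b.succ with
      | true =>
        rw [hb, cond_true, List.mem_cons] at h
        exact h.imp (fun h => by rw [h]) id
      | false =>
        rw [hb, cond_false, List.mem_cons] at h
        rcases h with h | h
        · exact Or.inr (by simp [h])
        · exact (ih h).imp id fun h => by simp [h]

/-- Gaussian elimination: extends the reduced list `rows` by the masks in a list. -/
def elim : List ℕ → List (ℕ × ℕ) → List (ℕ × ℕ)
  | [], rows => rows
  | v :: l, rows =>
    match redM rows v with
    | 0 => elim l rows
    | w + 1 =>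
      match insE w.succ w.succ.log2 rows with
      | [] => elim l []
      | x :: y => elim l (x :: y)

theorem ev_elim [CharP K 2] (c : ℕ → K) (m : ℕ) (L : List ℕ) (rows : List (ℕ × ℕ))
    (h : ∀ r ∈ rows, ev c m r.1 = 0) (hL : ∀ r ∈ L, ev c m r = 0) :
    ∀ r ∈ elim L rows, ev c m r.1 = 0 := by
  induction L generalizing rows with
  | nil => exact h
  | cons v l ih =>
    have hl : ∀ r ∈ l, ev c m r = 0 := fun r hr => hL r (by simp [hr])
    have hv := ev_redM c m rows h v
    rw [hL v (by simp)] at hv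
    rw [elim]
    cases e : redM rows v with
    | zero => exact ih rows h hl
    | succ w =>
      rw [e] at hv
      have h2 : ∀ r ∈ insE w.succ w.succ.log2 rows, ev c m r.1 = 0 := fun r hr =>
        (mem_insE hr).elim (fun e => e ▸ hv) (h r)
      cases e2 : insE w.succ w.succ.log2 rows with
      | nil => simp only [e2]; exact ih [] (by simp) hl
      | cons x y => simp only [e2]; exact ih _ (e2 ▸ h2) hl

/-! ### Collecting coefficients of keys -/

/-- Search trees of keys with masks. -/
inductive KeyTree
  | nil : KeyTree
  | node : KeyTree → ℕ → ℕ → KeyTree → KeyTree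

/-- The node with an evaluated left subtree. -/
def KeyTree.nodeL : KeyTree → ℕ → ℕ → KeyTree → KeyTree
  | .nil, k, v, r => .node .nil k v r
  | .node a b c d, k, v, r => .node (.node a b c d) k v r

/-- The node with an evaluated right subtree. -/
def KeyTree.nodeR (l : KeyTree) (k v : ℕ) : KeyTree → KeyTree
  | .nil => .node l k v .nil
  | .node a b c d => .node l k v (.node a b c d)

theorem KeyTree.nodeL_eq (l : KeyTree) (k v : ℕ) (r : KeyTree) : nodeL l k v r = node l k v r := by
  cases l <;> rfl

theorem KeyTree.nodeR_eq (l : KeyTree) (k v : ℕ) (r : KeyTree) : nodeR l k v r = node l k v r := by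
  cases r <;> rfl

/-- Adds the mask `b` at the key `k`. -/
def KeyTree.add (k b : ℕ) : KeyTree → KeyTree
  | .nil => .node .nil k b .nil
  | .node l k' v r =>
    bif Nat.beq k k' then .node l k' (v ^^^ b) r else
      bif Nat.blt k k' then .nodeL (l.add k b) k' v r else .nodeR l k' v (r.add k b)

/-- The list of pairs in a tree. -/
def KeyTree.toList : KeyTree → List (ℕ × ℕ) → List (ℕ × ℕ)
  | .nil, acc => acc
  | .node l k v r, acc => l.toList ((k, v) :: r.toList acc)

/-- The combination given by a list of keys with masks. -/
def pairSum {M : Type*} [AddCommGroup M] [Module K M] (φ : ℕ → M) (c : ℕ → K) (m : ℕ)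
    (l : List (ℕ × ℕ)) : M := (l.map fun p => ev c m p.2 • φ p.1).sum

/-- The combination given by a tree. -/
def KeyTree.sem {M : Type*} [AddCommGroup M] [Module K M] (φ : ℕ → M) (c : ℕ → K) (m : ℕ) :
    KeyTree → M
  | .nil => 0
  | .node l k v r => l.sem φ c m + ev c m v • φ k + r.sem φ c m

section Collect

variable {M : Type*} [AddCommGroup M] [Module K M] (φ : ℕ → M) (c : ℕ → K) (m : ℕ)

theorem KeyTree.sem_add [CharP K 2] (k b : ℕ) (t : KeyTree) :
    (t.add k b).sem φ c m = t.sem φ c m + ev c m b • φ k := by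
  induction t with
  | nil => simp [KeyTree.add, KeyTree.sem]
  | node l k' v r ihl ihr =>
    rw [KeyTree.add]
    cases h : Nat.beq k k' with
    | true =>
      rw [cond_true, KeyTree.sem, KeyTree.sem, ev_xor, Nat.eq_of_beq_eq_true h, add_smul]; abel
    | false =>
      rw [cond_false]
      cases Nat.blt k k' with
      | true => rw [cond_true, KeyTree.nodeL_eq, KeyTree.sem, KeyTree.sem, ihl]; abel
      | false => rw [cond_false, KeyTree.nodeR_eq, KeyTree.sem, KeyTree.sem, ihr]; abel

theorem KeyTree.pairSum_toList (t : KeyTree) (acc : List (ℕ × ℕ)) :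
    pairSum φ c m (t.toList acc) = t.sem φ c m + pairSum φ c m acc := by
  induction t generalizing acc with
  | nil => simp [KeyTree.toList, KeyTree.sem]
  | node l k v r ihl ihr =>
    rw [KeyTree.toList, ihl, pairSum, List.map_cons, List.sum_cons, ← pairSum, ihr, KeyTree.sem]
    abel

/-- Adds the mask `b` at all keys of a list. -/
def addKeys (b : ℕ) : List ℕ → KeyTree → KeyTree
  | [], t => t
  | k :: l, t =>
    match t.add k b with
    | .nil => addKeys b l .nil
    | .node x y z w => addKeys b l (.node x y z w)

theorem sem_addKeys [CharP K 2] (b : ℕ) (L : List ℕ) (t : KeyTree) :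
    (addKeys b L t).sem φ c m = t.sem φ c m + ev c m b • lsum φ L := by
  induction L generalizing t with
  | nil => simp [addKeys]
  | cons k l ih =>
    have e : addKeys b (k :: l) t = addKeys b l (t.add k b) := by
      rw [addKeys]; cases t.add k b <;> rfl
    rw [e, ih, KeyTree.sem_add, lsum_cons, smul_add]; abel

/-- Adds the list number `j` of `Ls` with the mask of the coordinate `i + j`. -/
def addLists (i : ℕ) : List (List ℕ) → KeyTree → KeyTree
  | [], t => t
  | L :: Ls, t => addLists (i + 1) Ls (addKeys (bitM i) L t)

/-- The combination `∑ c (i + j) • φ (Ls j)`. -/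
def listComb (i : ℕ) : List (List ℕ) → M
  | [] => 0
  | L :: Ls => c i • lsum φ L + listComb (i + 1) Ls

theorem sem_addLists [CharP K 2] (i : ℕ) (Ls : List (List ℕ)) (t : KeyTree)
    (hi : i + Ls.length ≤ m) :
    (addLists i Ls t).sem φ c m = t.sem φ c m + listComb φ c i Ls := by
  induction Ls generalizing i t with
  | nil => simp [addLists, listComb]
  | cons L Ls ih =>
    rw [List.length_cons] at hi
    rw [addLists, ih _ _ (by omega), sem_addKeys, ev_bitM c (by omega), listComb]; abel

end Collect

/-- The keys of a list of pairs are strictly increasing. -/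
def sortedKeys : List (ℕ × ℕ) → Bool
  | [] => true
  | [_] => true
  | p :: q :: l => Nat.blt p.1 q.1 && sortedKeys (q :: l)

theorem nodup_of_sortedKeys {l : List (ℕ × ℕ)} (h : sortedKeys l = true) :
    (l.map Prod.fst).Nodup := by
  have : (l.map Prod.fst).Pairwise (· < ·) := by
    induction l with
    | nil => simp
    | cons p l ih =>
      cases l with
      | nil => simp
      | cons q l =>
        rw [sortedKeys, Bool.and_eq_true, Nat.blt_eq] at h
        have h1 := ih h.2
        rw [List.map_cons, List.pairwise_cons]
        refine ⟨?_, h1⟩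
        intro x hx
        rw [List.map_cons, List.pairwise_cons] at h1
        rw [List.map_cons, List.mem_cons] at hx
        rcases hx with hx | hx
        · rw [hx]; exact h.1
        · exact h.1.trans (h1.1 x hx)
  exact this.imp fun h => h.ne

theorem ev_eq_zero_of_pairSum [NeZero n] {l : List (ℕ × ℕ)} (hs : sortedKeys l = true)
    (hv : validL n (l.map Prod.fst) = true) (c : ℕ → K) (m : ℕ)
    (h : pairSum (kfield K (0 : Fin n → ℕ) 0) c m l = 0) : ∀ p ∈ l, ev c m p.2 = 0 := by
  have hn := nodup_of_sortedKeys hs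
  -- a function on keys that returns the coefficient
  have key : ∀ l : List (ℕ × ℕ), (l.map Prod.fst).Nodup → ∃ d : ℕ → K, ∀ p ∈ l,
      d p.1 = ev c m p.2 := by
    intro l hl
    induction l with
    | nil => exact ⟨0, by simp⟩
    | cons p l ih =>
      rw [List.map_cons, List.nodup_cons] at hl
      obtain ⟨d, hd⟩ := ih hl.2
      refine ⟨Function.update d p.1 (ev c m p.2), ?_⟩
      intro q hq
      rcases List.mem_cons.1 hq with hq | hq
      · rw [hq, Function.update_self]
      · rw [Function.update_of_ne, hd q hq]
        intro h
        exact hl.1 (List.mem_map.2 ⟨q, hq, h⟩)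
  obtain ⟨d, hd⟩ := key l hn
  have h2 : ((l.map Prod.fst).map fun k => d k • kfield K (0 : Fin n → ℕ) 0 k).sum = 0 := by
    rw [← h, pairSum, List.map_map]
    congr 1
    refine List.map_congr_left fun p hp => ?_
    rw [Function.comp_apply, hd p hp]
  intro p hp
  rw [← hd p hp]
  exact kfield_independent hv hn d h2 p.1 (List.mem_map.2 ⟨p, hp, rfl⟩)

/-! ### Membership in a span over the field of two elements -/

/-- Concatenation of the lists whose positions are bits of the mask, starting from bit `i`. -/
def pick (v : ℕ) (i : ℕ) : List (List ℕ) → List ℕ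
  | [] => []
  | L :: Ls => bif v.testBit i then L ++ pick v (i + 1) Ls else pick v (i + 1) Ls

theorem lsum_pick_mem {M : Type*} [AddCommGroup M] [Module K M] (φ : ℕ → M) (v i : ℕ)
    (Ls : List (List ℕ)) :
    lsum φ (pick v i Ls) ∈ Submodule.span K {x | ∃ L ∈ Ls, x = lsum φ L} := by
  induction Ls generalizing i with
  | nil => exact zero_mem _
  | cons L Ls ih =>
    have hle : Submodule.span K {x | ∃ L ∈ Ls, x = lsum φ L} ≤
        Submodule.span K {x | ∃ L' ∈ L :: Ls, x = lsum φ L'} :=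
      Submodule.span_mono fun x ⟨L', h, e⟩ => ⟨L', by simp [h], e⟩
    rw [pick]
    cases v.testBit i with
    | true =>
      rw [cond_true, lsum_append]
      exact add_mem (Submodule.subset_span ⟨L, by simp, rfl⟩) (hle (ih _))
    | false => exact hle (ih _)

theorem listComb_add {M : Type*} [AddCommGroup M] [Module K M] (φ : ℕ → M) (c d : ℕ → K) (i : ℕ)
    (Ls : List (List ℕ)) :
    listComb φ (c + d) i Ls = listComb φ c i Ls + listComb φ d i Ls := by
  induction Ls generalizing i with
  | nil => simp [listComb]
  | cons L Ls ih => rw [listComb, listComb, listComb, ih, Pi.add_apply, add_smul]; abel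

theorem listComb_smul {M : Type*} [AddCommGroup M] [Module K M] (φ : ℕ → M) (a : K) (c : ℕ → K)
    (i : ℕ) (Ls : List (List ℕ)) : listComb φ (a • c) i Ls = a • listComb φ c i Ls := by
  induction Ls generalizing i with
  | nil => simp [listComb]
  | cons L Ls ih => rw [listComb, listComb, ih, Pi.smul_apply, smul_eq_mul, smul_add, mul_smul]

theorem listComb_zero {M : Type*} [AddCommGroup M] [Module K M] (φ : ℕ → M) (i : ℕ)
    (Ls : List (List ℕ)) : listComb φ (0 : ℕ → K) i Ls = 0 := by
  induction Ls generalizing i with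
  | nil => rfl
  | cons L Ls ih => rw [listComb, ih, Pi.zero_apply, zero_smul, add_zero]

theorem listComb_congr {M : Type*} [AddCommGroup M] [Module K M] (φ : ℕ → M) {c d : ℕ → K}
    (i j : ℕ) (Ls : List (List ℕ)) (h : ∀ k < Ls.length, c (i + k) = d (j + k)) :
    listComb φ c i Ls = listComb φ d j Ls := by
  induction Ls generalizing i j with
  | nil => rfl
  | cons L Ls ih =>
    have h0 := h 0 (by simp)
    rw [add_zero, add_zero] at h0
    rw [listComb, listComb, h0, ih (i + 1) (j + 1)]
    intro k hk
    have := h (k + 1) (by simpa using hk)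
    rwa [← add_assoc, ← add_assoc, add_right_comm, add_right_comm j] at this

theorem lsum_pick {M : Type*} [AddCommGroup M] [Module K M] (φ : ℕ → M) (v i : ℕ)
    (Ls : List (List ℕ)) :
    lsum φ (pick v i Ls) = listComb φ (fun j => if v.testBit j then (1 : K) else 0) i Ls := by
  induction Ls generalizing i with
  | nil => rfl
  | cons L Ls ih =>
    rw [pick, listComb, ← ih]
    cases v.testBit i <;> simp

theorem exists_listComb_of_mem_span {M : Type*} [AddCommGroup M] [Module K M] (φ : ℕ → M)
    (Ls : List (List ℕ)) (i : ℕ) {x : M} (h : x ∈ Submodule.span K {x | ∃ L ∈ Ls, x = lsum φ L}) :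
    ∃ c : ℕ → K, x = listComb φ c i Ls := by
  classical
  induction h using Submodule.span_induction with
  | zero => exact ⟨0, (listComb_zero φ i Ls).symm⟩
  | add x y _ _ hx hy =>
    obtain ⟨c, rfl⟩ := hx
    obtain ⟨d, rfl⟩ := hy
    exact ⟨c + d, (listComb_add φ c d i Ls).symm⟩
  | smul a x _ hx =>
    obtain ⟨c, rfl⟩ := hx
    exact ⟨a • c, (listComb_smul φ a c i Ls).symm⟩
  | mem x hx =>
    obtain ⟨L, hL, rfl⟩ := hx
    obtain ⟨k, hk, rfl⟩ := List.getElem_of_mem hL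
    clear hL
    refine ⟨Pi.single (i + k) 1, ?_⟩
    induction Ls generalizing i k with
    | nil => simp at hk
    | cons L Ls ih =>
      rw [listComb]
      cases k with
      | zero =>
        rw [add_zero, Pi.single_eq_same, one_smul]
        rw [listComb_congr φ (d := (0 : ℕ → K)) (i + 1) 0 Ls, listComb_zero, add_zero]
        · rfl
        · intro k _
          rw [Pi.single_eq_of_ne (by omega)]; rfl
      | succ k =>
        have := ih (i + 1) k (by simpa using hk)
        rw [Pi.single_eq_of_ne (by omega), zero_smul, zero_add]
        rw [show i + (k + 1) = i + 1 + k by omega]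
        exact this

/-- Reduction of a list of keys by rows (a nonempty reduced list with a mask). -/
def redK : List (List ℕ × ℕ) → List ℕ → ℕ → List ℕ × ℕ
  | [], L, v => (L, v)
  | (r, w) :: l, L, v => bif L.any (fun k => Nat.beq k (r.headD 0)) then
      redK l (cancel (r ++ L)) (v ^^^ w) else redK l L v

/-- Elimination for lists of keys, with masks that record the combination. -/
def elimK : List (List ℕ) → ℕ → List (List ℕ × ℕ) → List (List ℕ × ℕ)
  | [], _, rows => rows
  | L :: Ls, i, rows =>
    match redK rows (cancel L) (2 ^ i) with
    | ([], _) => elimK Ls (i + 1) rows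
    | (k :: r, w) => elimK Ls (i + 1) (rows ++ [(k :: r, w)])

/-- The mask of the coordinates of `L` (not verified). -/
def coordK (rows : List (List ℕ × ℕ)) (L : List ℕ) : ℕ := (redK rows (cancel L) 0).2

/-- Every list in `Ls` is a combination of lists in `Gs`. -/
def inSpan (Gs Ls : List (List ℕ)) : Bool :=
  let rows := elimK Gs 0 []
  Ls.all fun L => eqv L (pick (coordK rows L) 0 Gs)

variable (K n) in
/-- The span of the fields given by a list of lists of keys. -/
def kspan [NeZero n] (Ls : List (List ℕ)) : Submodule K (Der K n) :=
  Submodule.span K {x | ∃ L ∈ Ls, x = kz K n L}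

theorem inSpan_mem [CharP K 2] [NeZero n] {Gs Ls : List (List ℕ)} (h : inSpan Gs Ls = true)
    {L : List ℕ} (hL : L ∈ Ls) : kz K n L ∈ kspan K n Gs := by
  rw [inSpan, List.all_eq_true] at h
  rw [kz, kf_eq_of_eqv (h L hL)]
  exact lsum_pick_mem _ _ _ _

theorem kspan_le_of_inSpan [CharP K 2] [NeZero n] {Gs Ls : List (List ℕ)}
    (h : inSpan Gs Ls = true) : kspan K n Ls ≤ kspan K n Gs :=
  Submodule.span_le.2 fun _ ⟨_, hL, e⟩ => e ▸ inSpan_mem h hL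

/-! ### Fields with prescribed brackets with the negative part -/

/-- Collects the coefficients of `∑ ([y_p, h_q] + [y_q, h_p])` over the pairs in a list, where
`h_p = ∑ c (p * m + b) G_b`. -/
def relTree (ys Gs : List (List ℕ)) : List (ℕ × ℕ) → KeyTree → KeyTree
  | [], t => t
  | (p, q) :: l, t => relTree ys Gs l
      (addLists (q * Gs.length) (Gs.map (brL (ys.getD p [])))
        (addLists (p * Gs.length) (Gs.map (brL (ys.getD q []))) t))

/-- The linear equations given by a relation among brackets. -/
def relRows (ys Gs : List (List ℕ)) (E : List (ℕ × ℕ)) : List (ℕ × ℕ) :=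
  (relTree ys Gs E .nil).toList []

/-- The equation that expresses the coordinate `j` by the pivots of the items. -/
def pivotRow (j : ℕ) : List (List ℕ × ℕ × ℕ) → ℕ
  | [] => bitM j
  | (_, v, p) :: l => bif v.testBit (64 + j) then Nat.xor (pivotRow j l) (bitM p)
      else pivotRow j l

/-- The masks of the coordinates `p * m + b` for all `p` such that `y_p` is in the list `Ts`. -/
def killRows (m : ℕ) (Ts : List (List ℕ)) : ℕ → List (List ℕ) → List ℕ
  | _, [] => []
  | p, y :: ys => (bif Ts.any (fun T => eqv y T) then
      (List.range m).map (fun b => bitM (p * m + b)) else []) ++ killRows m Ts (p + 1) ys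

/-- Reduction of a field and its mask by a list of items. -/
def redItem : List (List ℕ × ℕ × ℕ) → List ℕ → ℕ → List ℕ × ℕ
  | [], D, v => (D, v)
  | i :: l, D, v => bif v.testBit (64 + i.2.2) then redItem l (cancel (D ++ i.1)) (v ^^^ i.2.1)
      else redItem l D v

/-- Adds a field to a reduced list of items. -/
def addItem (items : List (List ℕ × ℕ × ℕ)) : List ℕ × ℕ → List (List ℕ × ℕ × ℕ)
  | (_, 0) => items
  | (D, v + 1) => (D, v.succ, v.succ.log2 - 64) ::
    items.map fun i => bif i.2.1.testBit v.succ.log2 then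
      (cancel (D ++ i.1), v.succ ^^^ i.2.1, i.2.2) else i

/-- The mask whose bits from the coordinate `i` on are the bits of `w`. -/
def maskAt (i w : ℕ) : ℕ → ℕ
  | 0 => 0
  | b + 1 => bif w.testBit b then Nat.xor (maskAt i w b) (bitM (i + b)) else maskAt i w b

/-- The reduced list of items for a list of fields. -/
def mkItems (ys Gs Ds : List (List ℕ)) : List (List ℕ × ℕ × ℕ) :=
  let rows := elimK Gs 0 []
  Ds.foldl (fun items D => addItem items (redItem items D
    (ys.zipIdx.foldr (fun y v =>
      Nat.xor v (maskAt (y.2 * Gs.length) (coordK rows (brL y.1 D)) Gs.length)) 0))) []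

/-- The combination `T` of keys vanishes or belongs to the list. -/
def relOK (Ts : List (List ℕ)) (T : List ℕ) : Bool := eqv T [] || Ts.any (eqv T)

/-- All coordinates are expressed by the pivots, modulo the rows. -/
def pivotOK (m : ℕ) (items : List (List ℕ × ℕ × ℕ)) (rows : List (ℕ × ℕ)) : Bool :=
  (List.range m).all fun j => Nat.beq (redM rows (pivotRow j items)) 0

/-- The verification that the fields `D` whose brackets with the `ys` are in the span of the `Gs`
and that commute with the `Ts` are determined by the items. -/
def solveOK (n : ℕ) (ys Gs Ts : List (List ℕ)) (Es : List (List (ℕ × ℕ)))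
    (items : List (List ℕ × ℕ × ℕ)) : Bool :=
  ys.all (validL n) && Gs.all (validL n) &&
  Es.all (fun E =>
    (E.all fun x => Nat.blt x.1 ys.length && Nat.blt x.2 ys.length) &&
    relOK Ts (E.flatMap fun x => brL (ys.getD x.1 []) (ys.getD x.2 [])) &&
    sortedKeys (relRows ys Gs E) && validL n ((relRows ys Gs E).map Prod.fst)) &&
  items.all (fun i => validL n i.1 && Nat.blt i.2.2 (ys.length * Gs.length) &&
    (List.range ys.length).all fun p =>
    eqv (brL (ys.getD p []) i.1) (pick (i.2.1 >>> (64 + p * Gs.length)) 0 Gs)) &&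
  pivotOK (ys.length * Gs.length) items (elim (killRows Gs.length Ts 0 ys ++
    Es.flatMap fun E => (relRows ys Gs E).map Prod.snd) [])


theorem kf_append [NeZero n] (base r : Fin n → ℕ) (L L' : List ℕ) :
    kf K base r (L ++ L') = kf K base r L + kf K base r L' := lsum_append _ _ _

theorem kz_append [NeZero n] (L L' : List ℕ) : kz K n (L ++ L') = kz K n L + kz K n L' :=
  lsum_append _ _ _

theorem listComb_brL [CharP K 2] [NeZero n] {y : List ℕ} (hy : validL n y = true)
    (c : ℕ → K) (i : ℕ) {Gs : List (List ℕ)} (hG : Gs.all (validL n) = true) :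
    listComb (kfield K (0 : Fin n → ℕ) 0) c i (Gs.map (brL y)) =
      ⁅kz K n y, listComb (kfield K (0 : Fin n → ℕ) 0) c i Gs⁆ := by
  induction Gs generalizing i with
  | nil => simp [listComb]
  | cons G Gs ih =>
    rw [List.all_cons, Bool.and_eq_true] at hG
    rw [List.map_cons, listComb, listComb, ih _ hG.2, lie_add, lie_smul]
    congr 2
    exact (lie_kf hy hG.1).symm

theorem validL_getD {ys : List (List ℕ)} (h : ys.all (validL n) = true) (p : ℕ) :
    validL n (ys.getD p []) = true := by
  rw [List.getD_eq_getElem?_getD]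
  rcases hp : ys[p]? with _ | y
  · rfl
  · exact List.all_eq_true.1 h y (List.mem_of_getElem? hp)

theorem sem_relTree [CharP K 2] [NeZero n] {ys Gs : List (List ℕ)}
    (hy : ys.all (validL n) = true) (hG : Gs.all (validL n) = true) (c : ℕ → K)
    (E : List (ℕ × ℕ)) (hE : ∀ x ∈ E, x.1 < ys.length ∧ x.2 < ys.length) (t : KeyTree) :
    (relTree ys Gs E t).sem (kfield K (0 : Fin n → ℕ) 0) c (ys.length * Gs.length) =
      t.sem (kfield K (0 : Fin n → ℕ) 0) c (ys.length * Gs.length) +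
      (E.map fun x => ⁅kz K n (ys.getD x.1 []),
          listComb (kfield K (0 : Fin n → ℕ) 0) c (x.2 * Gs.length) Gs⁆ +
        ⁅kz K n (ys.getD x.2 []),
          listComb (kfield K (0 : Fin n → ℕ) 0) c (x.1 * Gs.length) Gs⁆).sum := by
  induction E generalizing t with
  | nil => simp [relTree]
  | cons x E ih =>
    have hx := hE x (by simp)
    have hle : ∀ p < ys.length, p * Gs.length + Gs.length ≤ ys.length * Gs.length := by
      intro p hp
      rw [← Nat.succ_mul]
      exact Nat.mul_le_mul_right _ hp
    rw [relTree, ih fun z hz => hE z (by simp [hz]), sem_addLists, sem_addLists,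
      listComb_brL (validL_getD hy _) c _ hG, listComb_brL (validL_getD hy _) c _ hG,
      List.map_cons, List.sum_cons]
    · abel
    · rw [List.length_map]; exact hle _ hx.1
    · rw [List.length_map]; exact hle _ hx.2

theorem ev_pivotRow [CharP K 2] (c : ℕ → K) {m j : ℕ} (hj : j < m)
    (items : List (List ℕ × ℕ × ℕ)) (hi : ∀ i ∈ items, i.2.2 < m) :
    ev c m (pivotRow j items) =
      c j + (items.map fun i => if i.2.1.testBit (64 + j) then c i.2.2 else 0).sum := by
  induction items with
  | nil => simp [pivotRow, ev_bitM c hj]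
  | cons i l ih =>
    have ih' := ih fun x hx => hi x (by simp [hx])
    obtain ⟨D, v, p⟩ := i
    rw [pivotRow, List.map_cons, List.sum_cons]
    have hp : p < m := hi (D, v, p) (by simp)
    cases hb : v.testBit (64 + j) with
    | true =>
      rw [cond_true, show ∀ a b, Nat.xor a b = a ^^^ b from fun _ _ => rfl, ev_xor, ih',
        ev_bitM c hp]
      simp only [if_true]; ring
    | false => rw [cond_false, ih']; simp

theorem killRows_spec [CharP K 2] (c : ℕ → K) (m M : ℕ) (Ts : List (List ℕ)) (ys : List (List ℕ))
    (p : ℕ) (hM : (p + ys.length) * m ≤ M)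
    (h : ∀ i < ys.length, (∃ T ∈ Ts, eqv (ys.getD i []) T = true) →
      ∀ b < m, c ((p + i) * m + b) = 0) :
    ∀ r ∈ killRows m Ts p ys, ev c M r = 0 := by
  induction ys generalizing p with
  | nil => simp [killRows]
  | cons y ys ih =>
    intro r hr
    rw [killRows, List.mem_append] at hr
    rw [List.length_cons] at hM
    rcases hr with hr | hr
    · cases hb : Ts.any (fun T => eqv y T) with
      | false => rw [hb] at hr; simp at hr
      | true =>
        rw [hb, cond_true, List.mem_map] at hr
        obtain ⟨b, hb2, rfl⟩ := hr
        rw [List.mem_range] at hb2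
        rw [List.any_eq_true] at hb
        rw [ev_bitM]
        · exact h 0 (by simp) hb b hb2
        · have : (p + 1) * m ≤ (p + (ys.length + 1)) * m := Nat.mul_le_mul_right _ (by omega)
          rw [Nat.succ_mul] at this
          omega
    · refine ih (p + 1) (by rw [show p + 1 + ys.length = p + (ys.length + 1) by omega]; exact hM)
        ?_ r hr
      intro i hi hT b hb
      have := h (i + 1) (by simpa using hi) hT b hb
      rwa [show p + 1 + i = p + (i + 1) by omega]

theorem listComb_sum {M : Type*} [AddCommGroup M] [Module K M] (φ : ℕ → M) (Gs : List (List ℕ))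
    {ι : Type*} (l : List ι) (f : ι → ℕ → K) (i : ℕ) :
    (l.map fun x => listComb φ (f x) i Gs).sum =
      listComb φ (fun b => (l.map fun x => f x b).sum) i Gs := by
  induction l with
  | nil => exact (listComb_zero φ i Gs).symm
  | cons x l ih =>
    rw [List.map_cons, List.sum_cons, ih, ← listComb_add]
    congr 1

theorem lie_list_sum {ι : Type*} (y : Der K n) (l : List ι) (f : ι → Der K n) :
    ⁅y, (l.map f).sum⁆ = (l.map fun x => ⁅y, f x⁆).sum := by
  induction l with
  | nil => simp
  | cons x l ih => rw [List.map_cons, List.sum_cons, lie_add, ih, List.map_cons, List.sum_cons]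

theorem exists_of_solveOK [CharP K 2] [NeZero n] {ys Gs Ts : List (List ℕ)}
    {Es : List (List (ℕ × ℕ))} {items : List (List ℕ × ℕ × ℕ)}
    (h : solveOK n ys Gs Ts Es items = true) {D : Der K n}
    (hD : ∀ y ∈ ys, ⁅kz K n y, D⁆ ∈ kspan K n Gs) (hT : ∀ T ∈ Ts, ⁅kz K n T, D⁆ = 0) :
    ∃ D' ∈ kspan K n (items.map Prod.fst), ∀ y ∈ ys, ⁅kz K n y, D⁆ = ⁅kz K n y, D'⁆ := by
  classical
  set φ := kfield K (0 : Fin n → ℕ) 0 with hφ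
  set m := Gs.length with hm
  rw [solveOK, Bool.and_eq_true, Bool.and_eq_true, Bool.and_eq_true, Bool.and_eq_true] at h
  obtain ⟨⟨⟨⟨hy, hG⟩, hE⟩, hI⟩, hP⟩ := h
  rw [List.all_eq_true] at hE hI
  have hc : ∀ p, ∃ c : ℕ → K, p < ys.length →
      ⁅kz K n (ys.getD p []), D⁆ = listComb φ c 0 Gs ∧
      (⁅kz K n (ys.getD p []), D⁆ = 0 → c = 0) := by
    intro p
    by_cases hp : p < ys.length
    · by_cases hz : ⁅kz K n (ys.getD p []), D⁆ = 0
      · exact ⟨0, fun _ => ⟨by rw [hz, listComb_zero], fun _ => rfl⟩⟩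
      have := hD (ys.getD p []) (by
        rw [List.getD_eq_getElem?_getD, List.getElem?_eq_getElem hp]; simp)
      obtain ⟨c, hc⟩ := exists_listComb_of_mem_span φ Gs 0 this
      exact ⟨c, fun _ => ⟨hc, fun h => absurd h hz⟩⟩
    · exact ⟨0, fun h => absurd h hp⟩
  choose c0 hc0 using hc
  set c : ℕ → K := fun j => c0 (j / m) (j % m) with hcdef
  have hcv : ∀ p, ∀ b < m, c (p * m + b) = c0 p b := by
    intro p b hb
    have h1 : (p * m + b) / m = p := by
      rw [mul_comm, Nat.mul_add_div (by omega), Nat.div_eq_of_lt hb, add_zero]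
    have h2 : (p * m + b) % m = b := by
      rw [mul_comm, Nat.mul_add_mod, Nat.mod_eq_of_lt hb]
    simp only [hcdef, h1, h2]
  have hh : ∀ p < ys.length, listComb φ c (p * m) Gs = ⁅kz K n (ys.getD p []), D⁆ := by
    intro p hp
    rw [(hc0 p hp).1]
    refine listComb_congr φ _ _ Gs fun k hk => ?_
    rw [hcv p k hk, zero_add]
  set M := ys.length * m with hM
  have hlt : ∀ p < ys.length, ∀ b < m, p * m + b < M := by
    intro p hp b hb
    have : (p + 1) * m ≤ M := Nat.mul_le_mul_right _ hp
    rw [Nat.succ_mul] at this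
    omega
  have hkill : ∀ T, (eqv T [] = true ∨ ∃ T' ∈ Ts, eqv T T' = true) → ⁅kz K n T, D⁆ = 0 := by
    rintro T (h | ⟨T', hT', h⟩)
    · rw [kz, kf_eq_of_eqv h, kf, lsum_nil, zero_lie]
    · rw [kz, kf_eq_of_eqv h]; exact hT T' hT'
  have hrows : ∀ r ∈ killRows m Ts 0 ys ++ Es.flatMap (fun E => (relRows ys Gs E).map Prod.snd),
      ev c M r = 0 := by
    intro r hr
    rw [List.mem_append] at hr
    rcases hr with hr | hr
    · refine killRows_spec c m M Ts ys 0 (by rw [zero_add]) ?_ r hr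
      intro i hi hex b hb
      rw [zero_add, hcv i b hb]
      rw [(hc0 i hi).2 (hkill _ (Or.inr hex)), Pi.zero_apply]
    · rw [List.mem_flatMap] at hr
      obtain ⟨E, hEm, hr⟩ := hr
      rw [List.mem_map] at hr
      obtain ⟨x, hx, rfl⟩ := hr
      have hE1 := hE E hEm
      rw [Bool.and_eq_true, Bool.and_eq_true, Bool.and_eq_true] at hE1
      obtain ⟨⟨⟨h1, h2⟩, h3⟩, h4⟩ := hE1
      have h1' : ∀ x ∈ E, x.1 < ys.length ∧ x.2 < ys.length := by
        intro x hx
        have := List.all_eq_true.1 h1 x hx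
        rwa [Bool.and_eq_true, Nat.blt_eq, Nat.blt_eq] at this
      refine ev_eq_zero_of_pairSum h3 h4 c M ?_ x hx
      rw [relRows, KeyTree.pairSum_toList, sem_relTree hy hG c E h1']
      rw [KeyTree.sem, pairSum, List.map_nil, List.sum_nil, add_zero, zero_add]
      rw [relOK, Bool.or_eq_true, List.any_eq_true] at h2
      rw [← hkill _ h2]
      clear h1 h2 h3 h4 hx hEm
      induction E with
      | nil => simp
      | cons x E ih =>
        rw [List.map_cons, List.sum_cons, ih fun z hz => h1' z (by simp [hz]), List.flatMap_cons,
          kz_append, add_lie]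
        congr 1
        have hx := h1' x (by simp)
        rw [hh _ hx.1, hh _ hx.2, ← lie_kf (validL_getD hy _) (validL_getD hy _),
          lie_lie, sub_eq_add_der]
  have hel := ev_elim c M _ [] (by simp) hrows
  rw [pivotOK, List.all_eq_true] at hP
  have hIv : ∀ i ∈ items, i.2.2 < M := by
    intro i hi
    have := hI i hi
    rw [Bool.and_eq_true, Bool.and_eq_true, Nat.blt_eq] at this
    exact this.1.2
  have hpiv : ∀ j < M, c j = (items.map fun i => if i.2.1.testBit (64 + j) then c i.2.2 else 0).sum := by
    intro j hj
    have h1 := hP j (List.mem_range.2 hj)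
    have h2 := ev_pivotRow c hj items hIv
    rw [← ev_redM c M _ hel, Nat.eq_of_beq_eq_true h1, ev_zero] at h2
    have h3 := CharTwo.add_self_eq_zero (c j)
    rw [h2] at h3
    exact add_left_cancel h3
  refine ⟨(items.map fun i => c i.2.2 • kz K n i.1).sum, ?_, ?_⟩
  · refine list_sum_mem ?_
    intro x hx
    rw [List.mem_map] at hx
    obtain ⟨i, hi, rfl⟩ := hx
    exact Submodule.smul_mem _ _ (Submodule.subset_span ⟨i.1, List.mem_map.2 ⟨i, hi, rfl⟩, rfl⟩)
  · intro y hyy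
    obtain ⟨p, hp, rfl⟩ := List.getElem_of_mem hyy
    have hg : ys.getD p [] = ys[p] := by
      rw [List.getD_eq_getElem?_getD, List.getElem?_eq_getElem hp]; rfl
    rw [← hg, ← hh p hp, lie_list_sum]
    have e : ∀ i ∈ items, ⁅kz K n (ys.getD p []), c i.2.2 • kz K n i.1⁆ =
        listComb φ (fun b => if i.2.1.testBit (64 + (p * m + b)) then c i.2.2 else 0) 0 Gs := by
      intro i hi
      have := hI i hi
      rw [Bool.and_eq_true, Bool.and_eq_true] at this
      obtain ⟨⟨hv, -⟩, hb⟩ := this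
      have hb := List.all_eq_true.1 hb p (List.mem_range.2 hp)
      rw [lie_smul, lie_kf (validL_getD hy _) hv, kz, kf_eq_of_eqv hb, kf, lsum_pick (K := K),
        ← listComb_smul]
      refine listComb_congr φ _ _ Gs fun k hk => ?_
      simp only [zero_add, Pi.smul_apply, smul_eq_mul, Nat.testBit_shiftRight, add_assoc, ← hm]
      split_ifs <;> simp
    rw [List.map_congr_left e, listComb_sum]
    refine listComb_congr φ _ _ Gs fun k hk => ?_
    rw [zero_add]
    exact hpiv _ (hlt p hp k hk)

/-! ### Homogeneous fields -/

/-- The weighted degree of an exponent. -/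
def wdeg (w r : Fin n → ℕ) : ℕ := ∑ i, w i * r i

theorem wdeg_cast (w r : Fin n → ℕ) : (wdeg w r : ℤ) = ∑ i, (w i : ℤ) * (r i : ℤ) := by
  simp [wdeg]

theorem wdeg_add (w r s : Fin n → ℕ) : wdeg w (r + s) = wdeg w r + wdeg w s := by
  simp [wdeg, mul_add, Finset.sum_add_distrib]

theorem wdeg_single (w : Fin n → ℕ) (i : Fin n) (a : ℕ) :
    wdeg w (Pi.single i a) = w i * a := by
  rw [wdeg, Finset.sum_eq_single i]
  · simp
  · intro j _ hj; simp [hj]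
  · simp

theorem update_add_single (r : Fin n → ℕ) (i : Fin n) (h : r i ≠ 0) :
    Function.update r i (r i - 1) + Pi.single i 1 = r := by
  funext j
  by_cases hj : j = i
  · subst hj; simp; omega
  · simp [hj]

theorem wdeg_update_pred (w r : Fin n → ℕ) (i : Fin n) (h : r i ≠ 0) :
    wdeg w (Function.update r i (r i - 1)) + w i = wdeg w r := by
  conv_rhs => rw [← update_add_single r i h, wdeg_add, wdeg_single, mul_one]

theorem dp_eq_sum (f : DP K n) :
    f = ∑ r ∈ Finsupp.support (M := K) f, coef f r • mono r := by
  classical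
  refine coef_ext fun s => ?_
  rw [coef_sum]
  simp only [coef_smul, coef_mono, mul_ite, mul_one, mul_zero]
  rw [Finset.sum_ite_eq']
  split_ifs with hs
  · rfl
  · exact Finsupp.notMem_support_iff.1 hs

theorem sum_smul_mem_vect [CharP K 2] (f : Fin n → DP K n) :
    (∑ j, f j • pd j : Der K n) ∈ vect K (⊤ : Fin n → ℕ∞) := ⟨f, fun _ => mem_trunc_top _, rfl⟩

theorem smul_pd_mem_vect [CharP K 2] (f : DP K n) (i : Fin n) :
    (f • pd i : Der K n) ∈ vect K (⊤ : Fin n → ℕ∞) := by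
  classical
  have h := sum_smul_mem_vect (Pi.single i f : Fin n → DP K n)
  rw [Finset.sum_eq_single i] at h
  · simpa using h
  · intro j _ hj; simp [hj]
  · simp

theorem pd_mem_vect [CharP K 2] (i : Fin n) : (pd i : Der K n) ∈ vect K (⊤ : Fin n → ℕ∞) := by
  simpa using smul_pd_mem_vect (1 : DP K n) i

theorem smul_pd_X (f : DP K n) (i j : Fin n) :
    (f • pd i : Der K n) (X j) = if i = j then f else 0 := by
  rw [Derivation.smul_apply, pd_X]
  split_ifs <;> simp

variable (K) in
/-- The fields that are homogeneous of degree `k`. -/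
def homS [CharP K 2] (w : Fin n → ℕ) (k : ℤ) : Submodule K (Der K n) := prolongStep w ⊤ ⊥ ⊥ k

section Homog

variable [CharP K 2] {w : Fin n → ℕ}

theorem mem_homS {k : ℤ} {D : Der K n} :
    D ∈ homS K w k ↔ D ∈ vect K (⊤ : Fin n → ℕ∞) ∧ IsHomog w k D := by
  refine ⟨fun h => ⟨h.1, h.2.1⟩, fun h => ⟨h.1, h.2, fun y hy => ?_⟩⟩
  rw [(Submodule.mem_bot K).1 hy, lie_zero]
  exact zero_mem _

theorem homS_le_vect {k : ℤ} {D : Der K n} (h : D ∈ homS K w k) :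
    D ∈ vect K (⊤ : Fin n → ℕ∞) := (mem_homS.1 h).1

theorem mono_pd_mem_homS {k : ℤ} {r : Fin n → ℕ} {j : Fin n}
    (h : (wdeg w r : ℤ) = k + w j) : ((mono r : DP K n) • pd j : Der K n) ∈ homS K w k := by
  refine mem_homS.2 ⟨smul_pd_mem_vect _ _, fun i s hs => ?_⟩
  rw [smul_pd_X] at hs
  split_ifs at hs with hij
  · rw [coef_mono] at hs
    split_ifs at hs with hrs
    · rw [← wdeg_cast, ← hrs, h, hij]
    · exact absurd rfl hs
  · exact absurd rfl hs

theorem vect_eq_sum {D : Der K n} (h : D ∈ vect K (⊤ : Fin n → ℕ∞)) :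
    D = ∑ j, ∑ r ∈ Finsupp.support (M := K) (D (X j)),
      coef (D (X j)) r • ((mono r : DP K n) • pd j : Der K n) := by
  conv_lhs => rw [mem_vect_top.1 h]
  refine Finset.sum_congr rfl fun j _ => ?_
  conv_lhs => rw [dp_eq_sum (D (X j))]
  rw [Finset.sum_smul]
  exact Finset.sum_congr rfl fun r _ => smul_assoc _ _ _

theorem homS_induction {k : ℤ} {P : Der K n → Prop} (h0 : P 0) (ha : ∀ D E, P D → P E → P (D + E))
    (hs : ∀ (c : K) D, P D → P (c • D))
    (hm : ∀ r j, (wdeg w r : ℤ) = k + w j → P ((mono r : DP K n) • pd j)) {D : Der K n}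
    (h : D ∈ homS K w k) : P D := by
  rw [vect_eq_sum (homS_le_vect h)]
  refine Finset.sum_induction _ P ha h0 fun j _ => Finset.sum_induction _ P ha h0 fun r hr => ?_
  refine hs _ _ (hm _ _ ?_)
  rw [wdeg_cast]
  exact (mem_homS.1 h).2 j r (Finsupp.mem_support_iff.1 hr)

theorem lie_mem_homS {k l m : ℤ} (hm : k + l = m) {D E : Der K n} (hD : D ∈ homS K w k)
    (hE : E ∈ homS K w l) : ⁅D, E⁆ ∈ homS K w m := by
  have key : ∀ (k l : ℤ) (r s : Fin n → ℕ) (i j : Fin n), (wdeg w r : ℤ) = k + w i →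
      (wdeg w s : ℤ) = l + w j →
      (((mono r : DP K n) * pd i (mono s)) • pd j : Der K n) ∈ homS K w (k + l) := by
    intro k l r s i j hr hs
    rw [pd_mono]
    split_ifs with h0
    · rw [mul_zero, zero_smul]; exact zero_mem _
    · rw [mono_mul_mono, smul_assoc]
      refine Submodule.smul_mem _ _ (mono_pd_mem_homS ?_)
      have := wdeg_update_pred w s i h0
      rw [wdeg_add]
      push_cast
      have h2 : (wdeg w (Function.update s i (s i - 1)) : ℤ) + w i = wdeg w s := by
        exact_mod_cast this
      linarith
  subst hm
  refine homS_induction (P := fun D => ⁅D, E⁆ ∈ homS K w (k + l)) (by rw [zero_lie]; exact zero_mem _)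
    (fun a b ha hb => by rw [add_lie]; exact add_mem ha hb)
    (fun c a ha => by rw [smul_lie]; exact Submodule.smul_mem _ _ ha) (fun r i hr => ?_) hD
  refine homS_induction (P := fun E => ⁅((mono r : DP K n) • pd i : Der K n), E⁆ ∈ homS K w (k + l))
    (by rw [lie_zero]; exact zero_mem _)
    (fun a b ha hb => by rw [lie_add]; exact add_mem ha hb)
    (fun c a ha => by rw [lie_smul]; exact Submodule.smul_mem _ _ ha) (fun s j hs => ?_) hE
  rw [lie_smul_pd]
  refine add_mem (key _ _ _ _ _ _ hr hs) ?_
  rw [add_comm k l]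
  exact key _ _ _ _ _ _ hs hr

/-- The part of weighted degree `m` of a function. -/
def hpart (w : Fin n → ℕ) (m : ℤ) : DP K n →ₗ[K] DP K n :=
  lift fun r => if (wdeg w r : ℤ) = m then mono r else 0

theorem coef_hpart (m : ℤ) (f : DP K n) (r : Fin n → ℕ) :
    coef (hpart w m f) r = if (wdeg w r : ℤ) = m then coef f r else 0 := by
  have : (coefL r ∘ₗ (hpart w m : DP K n →ₗ[K] DP K n)) =
      if (wdeg w r : ℤ) = m then coefL r else 0 := by
    refine hom_ext fun s => ?_
    rw [LinearMap.comp_apply, hpart, lift_mono]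
    by_cases hs : s = r
    · subst hs
      split_ifs <;> simp
    · split_ifs <;> simp [coefL_apply, coef_mono, hs, coef_zero]
  have := congrArg (fun m : DP K n →ₗ[K] K => m f) this
  simp only [LinearMap.comp_apply, coefL_apply] at this
  rw [this]
  split_ifs <;> simp [coefL_apply]

/-- The component of degree `k` of a field. -/
def hproj (w : Fin n → ℕ) (k : ℤ) : Der K n →ₗ[K] Der K n where
  toFun D := ∑ j, hpart w (k + w j) (D (X j)) • pd j
  map_add' D E := by
    simp only [Derivation.add_apply, map_add, add_smul, Finset.sum_add_distrib]
  map_smul' c D := by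
    simp only [Derivation.smul_apply, map_smul, RingHom.id_apply, Finset.smul_sum, smul_assoc]

theorem hproj_X (k : ℤ) (D : Der K n) (j : Fin n) :
    hproj w k D (X j) = hpart w (k + w j) (D (X j)) := field_X _ _

theorem coef_hproj (k : ℤ) (D : Der K n) (j : Fin n) (r : Fin n → ℕ) :
    coef (hproj w k D (X j)) r = if (wdeg w r : ℤ) = k + w j then coef (D (X j)) r else 0 := by
  rw [hproj_X, coef_hpart]

theorem hproj_mem_vect_top (k : ℤ) (D : Der K n) : hproj w k D ∈ vect K (⊤ : Fin n → ℕ∞) :=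
  sum_smul_mem_vect _

theorem hproj_mem (k : ℤ) (D : Der K n) : hproj w k D ∈ homS K w k := by
  refine mem_homS.2 ⟨hproj_mem_vect_top k D, fun j r h => ?_⟩
  rw [coef_hproj] at h
  rw [← wdeg_cast]
  by_contra hne
  rw [if_neg hne] at h
  exact h rfl

theorem hproj_mem_vect {N : Fin n → ℕ∞} (k : ℤ) {D : Der K n} (h : D ∈ vect K N) :
    hproj w k D ∈ vect K N := by
  refine mem_vect_iff.2 ⟨hproj_mem_vect_top k D, fun j r hr => (mem_vect_iff.1 h).2 j r ?_⟩
  rw [coef_hproj] at hr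
  intro h0
  rw [h0, ite_self] at hr
  exact hr rfl

theorem hproj_self {k : ℤ} {D : Der K n} (h : D ∈ homS K w k) : hproj w k D = D := by
  refine vect_ext (hproj_mem_vect_top k D) (homS_le_vect h) fun j => coef_ext fun r => ?_
  rw [coef_hproj]
  split_ifs with h1
  · rfl
  · by_contra hne
    exact h1 (by rw [wdeg_cast]; exact (mem_homS.1 h).2 j r (Ne.symm hne))

theorem hproj_other {k l : ℤ} (hkl : l ≠ k) {D : Der K n} (h : D ∈ homS K w l) :
    hproj w k D = 0 := by
  refine vect_ext (hproj_mem_vect_top k D) (zero_mem _) fun j => coef_ext fun r => ?_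
  rw [coef_hproj, Derivation.zero_apply, coef_zero]
  split_ifs with h1
  · by_contra hne
    have := (mem_homS.1 h).2 j r hne
    rw [← wdeg_cast] at this
    omega
  · rfl

theorem exists_sum_hproj (w : Fin n → ℕ) {D : Der K n} (h : D ∈ vect K (⊤ : Fin n → ℕ∞)) :
    ∃ F : Finset ℤ, D = ∑ k ∈ F, hproj w k D := by
  classical
  refine ⟨Finset.univ.biUnion fun j => (Finsupp.support (M := K) (D (X j))).image fun r =>
    (wdeg w r : ℤ) - w j, vect_ext h (sum_mem fun k _ => hproj_mem_vect_top k D) fun j =>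
    coef_ext fun r => ?_⟩
  set F := Finset.univ.biUnion fun j => (Finsupp.support (M := K) (D (X j))).image fun r =>
    (wdeg w r : ℤ) - w j with hF
  have e : (∑ k ∈ F, hproj w k D) (X j) = ∑ k ∈ F, hproj w k D (X j) := by
    induction F using Finset.induction_on with
    | empty => simp
    | insert a s ha ih => rw [Finset.sum_insert ha, Finset.sum_insert ha, Derivation.add_apply, ih]
  rw [e, coef_sum]
  simp only [coef_hproj]
  by_cases h0 : coef (D (X j)) r = 0
  · simp [h0]
  · rw [Finset.sum_eq_single ((wdeg w r : ℤ) - w j)]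
    · rw [if_pos (by ring)]
    · intro k _ hk
      rw [if_neg]
      intro h2
      exact hk (by rw [h2]; ring)
    · intro hn
      exact absurd (Finset.mem_biUnion.2 ⟨j, Finset.mem_univ _,
        Finset.mem_image.2 ⟨r, Finsupp.mem_support_iff.2 h0, rfl⟩⟩) hn

theorem hproj_ext (w : Fin n → ℕ) {D : Der K n} (h : D ∈ vect K (⊤ : Fin n → ℕ∞))
    (h0 : ∀ k, hproj w k D = 0) : D = 0 := by
  obtain ⟨F, hF⟩ := exists_sum_hproj w h
  rw [hF]
  exact Finset.sum_eq_zero fun k _ => h0 k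

theorem hproj_lie {k d m : ℤ} (hm : d + k = m) {y D : Der K n} (hy : y ∈ homS K w d)
    (hD : D ∈ vect K (⊤ : Fin n → ℕ∞)) : hproj w m ⁅y, D⁆ = ⁅y, hproj w k D⁆ := by
  obtain ⟨F, hF⟩ := exists_sum_hproj w hD
  subst hm
  have key : ∀ (l : ℤ) (E : Der K n), E ∈ homS K w l →
      hproj w (d + k) ⁅y, E⁆ = ⁅y, hproj w k E⁆ := by
    intro l E hE
    by_cases hl : l = k
    · subst hl
      rw [hproj_self hE, hproj_self (lie_mem_homS rfl hy hE)]
    · rw [hproj_other hl hE, hproj_other (l := d + l) (by omega) (lie_mem_homS rfl hy hE), lie_zero]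
  have : ∀ F : Finset ℤ, hproj w (d + k) ⁅y, ∑ k ∈ F, hproj w k D⁆ =
      ⁅y, hproj w k (∑ k ∈ F, hproj w k D)⁆ := by
    intro F
    induction F using Finset.induction_on with
    | empty => simp
    | insert a s ha ih =>
      rw [Finset.sum_insert ha, lie_add, map_add, map_add, lie_add, ih, key a _ (hproj_mem a D)]
  rw [hF]
  exact this F

/-! ### Graded sums -/

variable {G : ℕ → Submodule K (Der K n)}

theorem hproj_mem_of_iSup (hG : ∀ q, G q ≤ homS K w ((q : ℤ) - 2)) {D : Der K n}
    (h : D ∈ ⨆ q, G q) (q : ℕ) : hproj w ((q : ℤ) - 2) D ∈ G q := by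
  induction h using Submodule.iSup_induction' with
  | mem p x hx =>
    by_cases hp : p = q
    · subst hp; rwa [hproj_self (hG _ hx)]
    · rw [hproj_other (l := (p : ℤ) - 2) (by omega) (hG _ hx)]; exact zero_mem _
  | zero => rw [map_zero]; exact zero_mem _
  | add x y _ _ hx hy => rw [map_add]; exact add_mem hx hy

theorem hproj_eq_zero_of_iSup (hG : ∀ q, G q ≤ homS K w ((q : ℤ) - 2)) {D : Der K n}
    (h : D ∈ ⨆ q, G q) {k : ℤ} (hk : k < -2) : hproj w k D = 0 := by
  induction h using Submodule.iSup_induction' with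
  | mem p x hx => exact hproj_other (l := (p : ℤ) - 2) (by omega) (hG _ hx)
  | zero => rw [map_zero]
  | add x y _ _ hx hy => rw [map_add, hx, hy, add_zero]

theorem iSup_le_vect (hG : ∀ q, G q ≤ homS K w ((q : ℤ) - 2)) {D : Der K n}
    (h : D ∈ ⨆ q, G q) : D ∈ vect K (⊤ : Fin n → ℕ∞) := by
  have : (⨆ q, G q) ≤ (vect K (⊤ : Fin n → ℕ∞)).toSubmodule :=
    iSup_le fun q x hx => homS_le_vect (hG q hx)
  exact this h

theorem iSup_inf_vect (hG : ∀ q, G q ≤ homS K w ((q : ℤ) - 2)) {N : Fin n → ℕ∞} {D : Der K n}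
    (h : D ∈ ⨆ q, G q) (hN : D ∈ vect K N) : D ∈ ⨆ q, G q ⊓ (vect K N).toSubmodule := by
  obtain ⟨F, hF⟩ := exists_sum_hproj w (iSup_le_vect hG h)
  rw [hF]
  refine sum_mem fun k _ => ?_
  by_cases hk : k < -2
  · rw [hproj_eq_zero_of_iSup hG h hk]; exact zero_mem _
  · obtain ⟨q, rfl⟩ : ∃ q : ℕ, k = (q : ℤ) - 2 := ⟨(k + 2).toNat, by omega⟩
    exact Submodule.mem_iSup_of_mem q ⟨hproj_mem_of_iSup hG h q, hproj_mem_vect _ hN⟩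

/-! ### Prolongs as graded sums -/

/-- The components of degrees `q - 2` of a graded Lie algebra of fields of depth at most 2 that is
a prolong from the degree `c` on. -/
structure GradedProlong (w : Fin n → ℕ) (c : ℕ) (G : ℕ → Submodule K (Der K n)) : Prop where
  homog : ∀ q, G q ≤ homS K w ((q : ℤ) - 2)
  step : ∀ q, c + 2 ≤ q → ∀ D, D ∈ homS K w ((q : ℤ) - 1) → (∀ y ∈ G 1, ⁅D, y⁆ ∈ G q) → D ∈ G (q + 1)
  lie_one : ∀ q, ∀ D ∈ G (q + 1), ∀ y ∈ G 1, ⁅D, y⁆ ∈ G q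
  zero_one : ∀ D ∈ G 0, ∀ y ∈ G 1, ⁅D, y⁆ = 0
  gen : G 0 ≤ Submodule.span K {D | ∃ a ∈ G 1, ∃ b ∈ G 1, ⁅a, b⁆ = D}
  mid : ∀ p q, 2 ≤ p → 2 ≤ q → p + q ≤ c + 4 → ∀ D ∈ G p, ∀ E ∈ G q, ⁅D, E⁆ ∈ G (p + q - 2)

theorem GradedProlong.lie_zero_left {c : ℕ} (h : GradedProlong w c G) (q : ℕ) {D E : Der K n}
    (hD : D ∈ G 0) (hE : E ∈ G (q + 2)) : ⁅D, E⁆ ∈ G q := by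
  have hD' := h.gen hD
  clear hD
  induction hD' using Submodule.span_induction with
  | mem x hx =>
    obtain ⟨a, ha, b, hb, rfl⟩ := hx
    rw [lie_lie]
    refine sub_mem ?_ ?_
    · rw [← lie_skew]
      refine neg_mem (h.lie_one _ _ ?_ _ ha)
      rw [← lie_skew]
      exact neg_mem (h.lie_one _ _ hE _ hb)
    · rw [← lie_skew]
      refine neg_mem (h.lie_one _ _ ?_ _ hb)
      rw [← lie_skew]
      exact neg_mem (h.lie_one _ _ hE _ ha)
  | zero => rw [zero_lie]; exact zero_mem _
  | add x y _ _ hx hy => rw [add_lie]; exact add_mem hx hy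
  | smul a x _ hx => rw [smul_lie]; exact Submodule.smul_mem _ _ hx

theorem GradedProlong.lie_zero_zero {c : ℕ} (h : GradedProlong w c G) {D E : Der K n}
    (hD : D ∈ G 0) (hE : E ∈ G 0) : ⁅D, E⁆ = 0 := by
  have hD' := h.gen hD
  clear hD
  induction hD' using Submodule.span_induction with
  | mem x hx =>
    obtain ⟨a, ha, b, hb, rfl⟩ := hx
    rw [lie_lie, ← lie_skew b E, ← lie_skew a E, h.zero_one _ hE _ hb, h.zero_one _ hE _ ha]
    simp
  | zero => rw [zero_lie]
  | add x y _ _ hx hy => rw [add_lie, hx, hy, add_zero]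
  | smul a x _ hx => rw [smul_lie, hx, smul_zero]

theorem GradedProlong.lie_mem_of_two {c : ℕ} (h : GradedProlong w c G) (m : ℕ) :
    ∀ p q, 2 ≤ p → 2 ≤ q → p + q = m + 2 → ∀ D ∈ G p, ∀ E ∈ G q, ⁅D, E⁆ ∈ G m := by
  induction m with
  | zero => intro p q hp hq hm; omega
  | succ m ih =>
    intro p q hp hq hm D hD E hE
    have e : p + q - 2 = m + 1 := by omega
    by_cases hc : p + q ≤ c + 4
    · rw [← e]; exact h.mid p q hp hq hc D hD E hE
    · refine h.step m (by omega) _ ?_ fun y hy => ?_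
      · refine lie_mem_homS (k := (p : ℤ) - 2) (l := (q : ℤ) - 2) ?_ (h.homog _ hD) (h.homog _ hE)
        omega
      · obtain ⟨p, rfl⟩ : ∃ p', p = p' + 1 := ⟨p - 1, by omega⟩
        obtain ⟨q, rfl⟩ : ∃ q', q = q' + 1 := ⟨q - 1, by omega⟩
        have h1 := h.lie_one _ _ hE _ hy
        have h2 := h.lie_one _ _ hD _ hy
        have e2 : ⁅⁅D, E⁆, y⁆ = ⁅D, ⁅E, y⁆⁆ + ⁅⁅D, y⁆, E⁆ := by
          rw [lie_lie, sub_eq_add_neg, lie_skew]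
        rw [e2]
        refine add_mem ?_ ?_
        · rcases Nat.lt_or_ge q 2 with hq2 | hq2
          · obtain rfl : q = 1 := by omega
            obtain rfl : p = m := by omega
            exact h.lie_one _ _ hD _ h1
          · exact ih (p + 1) q hp hq2 (by omega) _ hD _ h1
        · rcases Nat.lt_or_ge p 2 with hp2 | hp2
          · obtain rfl : p = 1 := by omega
            obtain rfl : q = m := by omega
            rw [← lie_skew]
            exact neg_mem (h.lie_one _ _ hE _ h2)
          · exact ih p (q + 1) hp2 hq (by omega) _ h2 _ hE

theorem GradedProlong.lie_mem {c : ℕ} (h : GradedProlong w c G) {m p q : ℕ} (hm : p + q = m + 2)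
    {D E : Der K n} (hD : D ∈ G p) (hE : E ∈ G q) : ⁅D, E⁆ ∈ G m := by
  rcases p with _ | _ | p
  · obtain rfl : q = m + 2 := by omega
    exact h.lie_zero_left m hD hE
  · obtain rfl : q = m + 1 := by omega
    rw [← lie_skew]
    exact neg_mem (h.lie_one _ _ hE _ hD)
  · rcases q with _ | _ | q
    · obtain rfl : p = m := by omega
      rw [← lie_skew]
      exact neg_mem (h.lie_zero_left p hE hD)
    · obtain rfl : p + 1 = m := by omega
      exact h.lie_one _ _ hD _ hE
    · exact h.lie_mem_of_two m _ _ (by omega) (by omega) hm _ hD _ hE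

theorem GradedProlong.lie_eq_zero {c : ℕ} (h : GradedProlong w c G) {p q : ℕ} (hm : p + q < 2)
    {D E : Der K n} (hD : D ∈ G p) (hE : E ∈ G q) : ⁅D, E⁆ = 0 := by
  have : (p = 0 ∧ q = 0) ∨ (p = 0 ∧ q = 1) ∨ (p = 1 ∧ q = 0) := by omega
  rcases this with ⟨rfl, rfl⟩ | ⟨rfl, rfl⟩ | ⟨rfl, rfl⟩
  · exact h.lie_zero_zero hD hE
  · exact h.zero_one _ hD _ hE
  · rw [← lie_skew, h.zero_one _ hE _ hD, neg_zero]

/-- Brackets of elements of two sums of submodules. -/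
theorem lie_mem_of_iSup {A B : ℕ → Submodule K (Der K n)} {C : Submodule K (Der K n)}
    (h : ∀ p q, ∀ D ∈ A p, ∀ E ∈ B q, ⁅D, E⁆ ∈ C) {D E : Der K n} (hD : D ∈ ⨆ q, A q)
    (hE : E ∈ ⨆ q, B q) : ⁅D, E⁆ ∈ C := by
  induction hD using Submodule.iSup_induction' with
  | mem p x hx =>
    induction hE using Submodule.iSup_induction' with
    | mem q y hy => exact h p q x hx y hy
    | zero => rw [lie_zero]; exact zero_mem _
    | add a b _ _ ha hb => rw [lie_add]; exact add_mem ha hb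
  | zero => rw [zero_lie]; exact zero_mem _
  | add a b _ _ ha hb => rw [add_lie]; exact add_mem ha hb

/-- The components of a prolong. -/
def gcomp (w : Fin n → ℕ) (N : Fin n → ℕ∞) (c : ℕ) (low neg mid top : Submodule K (Der K n)) :
    ℕ → Submodule K (Der K n)
  | 0 => low
  | 1 => neg
  | q + 2 => if q < c then mid else prolongComp w N c neg top (q - c)

theorem prolongComp_eq_inf {N : Fin n → ℕ∞} {c : ℕ} {neg top : Submodule K (Der K n)}
    (hneg : neg ≤ (vect K N).toSubmodule) (htop : top ≤ (vect K N).toSubmodule) (m : ℕ) :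
    prolongComp w N c neg top m = prolongComp w ⊤ c neg top m ⊓ (vect K N).toSubmodule := by
  induction m with
  | zero => exact (inf_eq_left.2 htop).symm
  | succ m ih =>
    ext D
    constructor
    · rintro ⟨h1, h2, h3⟩
      refine ⟨⟨vect_le_top h1, h2, fun y hy => ?_⟩, h1⟩
      have := h3 y hy
      rw [ih] at this
      exact this.1
    · rintro ⟨⟨h1, h2, h3⟩, h4⟩
      refine ⟨h4, h2, fun y hy => ?_⟩
      rw [ih]
      exact ⟨h3 y hy, (vect K N).lie_mem h4 (hneg hy)⟩

theorem gcomp_eq_inf {N : Fin n → ℕ∞} {c : ℕ} {low neg mid top : Submodule K (Der K n)}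
    (hlow : low ≤ (vect K N).toSubmodule) (hneg : neg ≤ (vect K N).toSubmodule)
    (hmid : mid ≤ (vect K N).toSubmodule) (htop : top ≤ (vect K N).toSubmodule) (q : ℕ) :
    gcomp w N c low neg mid top q = gcomp w ⊤ c low neg mid top q ⊓ (vect K N).toSubmodule := by
  rcases q with _ | _ | q
  · exact (inf_eq_left.2 hlow).symm
  · exact (inf_eq_left.2 hneg).symm
  · rw [gcomp, gcomp]
    split_ifs
    · exact (inf_eq_left.2 hmid).symm
    · exact prolongComp_eq_inf hneg htop _

theorem gcomp_succ {c : ℕ} {low neg mid top : Submodule K (Der K n)} {q : ℕ} (hq : c + 2 ≤ q)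
    {D : Der K n} : D ∈ gcomp w ⊤ c low neg mid top (q + 1) ↔
      D ∈ homS K w ((q : ℤ) - 1) ∧ ∀ y ∈ neg, ⁅D, y⁆ ∈ gcomp w ⊤ c low neg mid top q := by
  obtain ⟨m, rfl⟩ : ∃ m, q = c + m + 2 := ⟨q - c - 2, by omega⟩
  have e1 : gcomp w ⊤ c low neg mid top (c + m + 2 + 1) = prolongComp w ⊤ c neg top (m + 1) := by
    rw [show c + m + 2 + 1 = (c + (m + 1)) + 2 by omega, gcomp, if_neg (by omega)]
    congr 1; omega
  have e2 : gcomp w ⊤ c low neg mid top (c + m + 2) = prolongComp w ⊤ c neg top m := by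
    rw [gcomp, if_neg (by omega)]
    congr 1; omega
  have e3 : ((c + m + 2 : ℕ) : ℤ) - 1 = (c : ℤ) + m + 1 := by push_cast; ring
  rw [e1, e2, e3, mem_homS, and_assoc]
  exact Iff.rfl

/-- The prolong is the sum of its components. -/
theorem prolong_toSubmodule {N : Fin n → ℕ∞} {c : ℕ}
    {low neg mid top : Submodule K (Der K n)} (hmid : c = 0 → mid = ⊥)
    (hcl : ∀ p q, ∀ D ∈ gcomp w N c low neg mid top p, ∀ E ∈ gcomp w N c low neg mid top q,
      ⁅D, E⁆ ∈ ⨆ q, gcomp w N c low neg mid top q) :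
    (prolong w N c low neg mid top).toSubmodule = ⨆ q, gcomp w N c low neg mid top q := by
  set A : LieSubalgebra K (Der K n) :=
    { (⨆ q, gcomp w N c low neg mid top q : Submodule K (Der K n)) with
      lie_mem' := fun hx hy => lie_mem_of_iSup hcl hx hy } with hA
  have hmem : ∀ D, D ∈ A ↔ D ∈ ⨆ q, gcomp w N c low neg mid top q := fun D => Iff.rfl
  apply le_antisymm
  · have : prolong w N c low neg mid top ≤ A := by
      refine LieSubalgebra.lieSpan_le.2 ?_
      rintro D (h | h | h | ⟨m, h⟩) <;> rw [SetLike.mem_coe, hmem]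
      · exact Submodule.mem_iSup_of_mem 0 h
      · exact Submodule.mem_iSup_of_mem 1 h
      · rcases Nat.eq_zero_or_pos c with h0 | h0
        · rw [hmid h0, Submodule.mem_bot] at h
          rw [h]; exact zero_mem _
        · refine Submodule.mem_iSup_of_mem 2 ?_
          rw [gcomp, if_pos h0]; exact h
      · refine Submodule.mem_iSup_of_mem (c + m + 2) ?_
        rw [gcomp, if_neg (by omega)]
        rwa [show c + m - c = m by omega]
    exact this
  · refine iSup_le fun q D hD => LieSubalgebra.subset_lieSpan ?_
    rcases q with _ | _ | q
    · exact Or.inl hD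
    · exact Or.inr (Or.inl hD)
    · rw [gcomp] at hD
      split_ifs at hD
      · exact Or.inr (Or.inr (Or.inl hD))
      · exact Or.inr (Or.inr (Or.inr ⟨_, hD⟩))

theorem GradedProlong.prolong_top {c : ℕ}
    {low neg mid top : Submodule K (Der K n)} (hmid : c = 0 → mid = ⊥)
    (h : GradedProlong w c (gcomp w ⊤ c low neg mid top)) :
    (prolong w ⊤ c low neg mid top).toSubmodule = ⨆ q, gcomp w ⊤ c low neg mid top q := by
  refine prolong_toSubmodule hmid fun p q D hD E hE => ?_
  rcases Nat.lt_or_ge (p + q) 2 with h2 | h2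
  · rw [h.lie_eq_zero h2 hD hE]; exact zero_mem _
  · exact Submodule.mem_iSup_of_mem (p + q - 2) (h.lie_mem (by omega) hD hE)

theorem GradedProlong.prolong_eq_inf {c : ℕ}
    {low neg mid top : Submodule K (Der K n)} (hmid : c = 0 → mid = ⊥)
    (h : GradedProlong w c (gcomp w ⊤ c low neg mid top)) {N : Fin n → ℕ∞}
    (h1 : low ≤ (vect K N).toSubmodule) (h2 : neg ≤ (vect K N).toSubmodule)
    (h3 : mid ≤ (vect K N).toSubmodule) (h4 : top ≤ (vect K N).toSubmodule) :
    prolong w N c low neg mid top = prolong w ⊤ c low neg mid top ⊓ vect K N := by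
  have e := gcomp_eq_inf (w := w) (c := c) h1 h2 h3 h4
  have hN : (prolong w N c low neg mid top).toSubmodule = ⨆ q, gcomp w N c low neg mid top q := by
    refine prolong_toSubmodule hmid fun p q D hD E hE => ?_
    rw [e] at hD hE
    rcases Nat.lt_or_ge (p + q) 2 with h2 | h2
    · rw [h.lie_eq_zero h2 hD.1 hE.1]; exact zero_mem _
    · refine Submodule.mem_iSup_of_mem (p + q - 2) ?_
      rw [e]
      exact ⟨h.lie_mem (by omega) hD.1 hE.1, (vect K N).lie_mem hD.2 hE.2⟩
  ext D
  rw [← LieSubalgebra.mem_toSubmodule, hN, LieSubalgebra.mem_inf,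
    ← LieSubalgebra.mem_toSubmodule (L' := prolong w ⊤ c low neg mid top), h.prolong_top hmid]
  constructor
  · intro hD
    have h6 : (⨆ q, gcomp w N c low neg mid top q) ≤
        (⨆ q, gcomp w ⊤ c low neg mid top q) ⊓ (vect K N).toSubmodule := by
      refine iSup_le fun q => ?_
      rw [e]
      exact inf_le_inf_right _ (le_iSup (gcomp w ⊤ c low neg mid top) q)
    exact h6 hD
  · rintro ⟨h5, h6⟩
    have := iSup_inf_vect h.homog h5 h6
    simp only [← e] at this
    exact this

end Homog

section

/-! ### Shifts of keys -/

theorem dig_sub_mul (i k m a : ℕ) (h : m ≤ dig a i) :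
    dig (a - m * 16 ^ i) k = if k = i then dig a k - m else dig a k := by
  induction m with
  | zero => simp
  | succ m ih =>
    have ih := ih (by omega)
    have e : a - (m + 1) * 16 ^ i = a - m * 16 ^ i - 16 ^ i := by
      rw [Nat.succ_mul, Nat.sub_add_eq]
    have hm : dig (a - m * 16 ^ i) i ≠ 0 := by
      have : dig (a - m * 16 ^ i) i = dig a i - m := by
        have h3 : ∀ p, p ≤ dig a i → dig (a - p * 16 ^ i) i = dig a i - p := by
          intro p
          induction p with
          | zero => simp
          | succ p ihp =>
            intro hp
            have h4 := ihp (by omega)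
            rw [Nat.succ_mul, Nat.sub_add_eq, dig_sub_pow _ _ _ (by omega), if_pos rfl, h4]
            omega
        exact h3 m (by omega)
      omega
    rw [e, dig_sub_pow i k _ hm, ih]
    split_ifs <;> omega

theorem ble_of_le {a b : ℕ} (h : a ≤ b) : Nat.ble a b = true := by rw [Nat.ble_eq]; exact h

/-- The keys of the `m`-th power of the bracket with `∂_s`. -/
def shiftK (s m : ℕ) (L : List ℕ) : List ℕ :=
  L.flatMap fun k => bif Nat.ble m (dig k (s + 1)) then [k - m * 16 ^ (s + 1)] else []

variable (K n) in
/-- The partial derivative with a numerical index. -/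
abbrev pn [NeZero n] (s : ℕ) : Der K n := pd (Fin.ofNat n s)

variable [NeZero n]

theorem val_ofNat {s : ℕ} (hs : s < n) : (Fin.ofNat n s).val = s := Nat.mod_eq_of_lt hs

theorem lie_pd_smul_pd [CharP K 2] (f : DP K n) (i j : Fin n) :
    ⁅(pd i : Der K n), (f • pd j : Der K n)⁆ = pd i f • pd j := by
  have h := lie_smul_pd (1 : DP K n) f i j
  simpa using h

theorem mod_sub_mul_pow (k m s : ℕ) (h : m ≤ dig k (s + 1)) :
    (k - m * 16 ^ (s + 1)) % 16 = k % 16 := by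
  have := dig_sub_mul (s + 1) 0 m k h
  rwa [if_neg (by omega), dig_zero, dig_zero] at this

theorem lie_pn_kfield [CharP K 2] {base r : Fin n → ℕ} {s k : ℕ} (hs : s < n)
    (hb : dig k (s + 1) ≤ base (Fin.ofNat n s)) :
    ⁅pn K n s, kfield K base r k⁆ = if r (Fin.ofNat n s) = 0 then 0 else
      kfield K base (Function.update r (Fin.ofNat n s) (r (Fin.ofNat n s) - 1)) k := by
  have hiv := val_ofNat (n := n) hs
  change ⁅(pd (Fin.ofNat n s) : Der K n), _⁆ = _
  generalize Fin.ofNat n s = i at *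
  have hd : dig k (i.val + 1) ≤ base i := by rw [hiv]; exact hb
  rw [kfield, kfield, lie_pd_smul_pd, kmono, kmono]
  by_cases hc : ∀ j, base j ≤ r j + dig k (j.val + 1)
  · rw [if_pos hc, pd_mono]
    have hci := hc i
    by_cases hr : r i = 0
    · rw [if_pos hr, if_pos (by rw [kexp]; omega), zero_smul]
    · rw [if_neg hr]
      by_cases he : kexp base r k i = 0
      · rw [if_pos he, if_neg]
        intro hall
        have := hall i
        rw [Function.update_self] at this
        rw [kexp] at he
        omega
      · rw [if_neg he, if_pos]
        · congr 2
          funext j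
          by_cases hj : j = i
          · subst hj; rw [Function.update_self, kexp, kexp, Function.update_self]
            rw [kexp] at he; omega
          · rw [Function.update_of_ne hj, kexp, kexp, Function.update_of_ne hj]
        · intro j
          by_cases hj : j = i
          · subst hj; rw [Function.update_self]; rw [kexp] at he; omega
          · rw [Function.update_of_ne hj]; exact hc j
  · rw [if_neg hc, map_zero, zero_smul]
    split_ifs with h1 h2
    · rfl
    · exfalso
      apply hc
      intro j
      have := h2 j
      by_cases hj : j = i
      · subst hj; rw [Function.update_self] at this; omega
      · rwa [Function.update_of_ne hj] at this
    · rw [zero_smul]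

theorem lie_pn_kf [CharP K 2] {base r : Fin n → ℕ} {s : ℕ} {L : List ℕ} (hs : s < n)
    (hb : ∀ k ∈ L, dig k (s + 1) ≤ base (Fin.ofNat n s)) :
    ⁅pn K n s, kf K base r L⁆ = if r (Fin.ofNat n s) = 0 then 0 else
      kf K base (Function.update r (Fin.ofNat n s) (r (Fin.ofNat n s) - 1)) L := by
  induction L with
  | nil => simp
  | cons k L ih =>
    rw [kf, kf, lsum_cons, lsum_cons, lie_add, lie_pn_kfield hs (hb k (by simp)),
      ih fun x hx => hb x (by simp [hx])]
    split_ifs <;> simp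

theorem lie_pn_kf_shift [CharP K 2] {base r : Fin n → ℕ} {s : ℕ} {L : List ℕ} (hs : s < n)
    (hb : (base (Fin.ofNat n s) = 0 ∧ r (Fin.ofNat n s) = 0) ∨ ∀ k ∈ L, 1 ≤ dig k (s + 1)) :
    ⁅pn K n s, kf K base r L⁆ = kf K base r (shiftK s 1 L) := by
  have hiv := val_ofNat (n := n) hs
  change ⁅(pd (Fin.ofNat n s) : Der K n), _⁆ = _
  generalize Fin.ofNat n s = i at *
  induction L with
  | nil => simp [shiftK]
  | cons k L ih =>
    have ih := ih (hb.imp id fun h x hx => h x (by simp [hx]))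
    have hk : (base i = 0 ∧ r i = 0) ∨ 1 ≤ dig k (s + 1) := hb.imp id fun h => h k (by simp)
    rw [shiftK, List.flatMap_cons, kf, kf, lsum_cons, lsum_append, lie_add]
    refine congrArg₂ (· + ·) ?_ ih
    rw [kfield, lie_pd_smul_pd]
    by_cases hd : dig k (s + 1) = 0
    · rw [show Nat.ble 1 (dig k (s + 1)) = false by rw [hd]; rfl, cond_false, lsum_nil, kmono]
      obtain ⟨h1, h2⟩ : base i = 0 ∧ r i = 0 := hk.resolve_right (by omega)
      split_ifs
      · rw [pd_mono, if_pos, zero_smul]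
        rw [kexp, h1, h2, hiv, hd]
      · rw [map_zero, zero_smul]
    · have h1 : 1 ≤ dig k (s + 1) := by omega
      rw [show Nat.ble 1 (dig k (s + 1)) = true from ble_of_le h1, cond_true, lsum_cons, lsum_nil,
        add_zero, kfield, mod_sub_mul_pow _ _ _ h1]
      congr 1
      have hdig : ∀ j : Fin n, dig (k - 1 * 16 ^ (s + 1)) (j.val + 1) =
          if j = i then dig k (j.val + 1) - 1 else dig k (j.val + 1) := by
        intro j
        rw [dig_sub_mul _ _ _ _ h1]
        have : (j.val + 1 = s + 1) ↔ j = i := by rw [← hiv, Fin.ext_iff]; omega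
        by_cases hj : j = i
        · rw [if_pos hj, if_pos (this.2 hj)]
        · rw [if_neg hj, if_neg (fun h => hj (this.1 h))]
      have hdi : dig k (i.val + 1) ≠ 0 := by rw [hiv]; exact hd
      rw [kmono, kmono]
      by_cases hc : ∀ j, base j ≤ r j + dig k (j.val + 1)
      · rw [if_pos hc, pd_mono]
        have hci := hc i
        by_cases he : kexp base r k i = 0
        · rw [if_pos he, if_neg]
          intro hall
          have := hall i
          rw [hdig, if_pos rfl] at this
          rw [kexp] at he
          omega
        · rw [if_neg he, if_pos]
          · congr 1
            funext j
            by_cases hj : j = i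
            · subst hj; rw [Function.update_self, kexp, kexp, hdig, if_pos rfl]
              omega
            · rw [Function.update_of_ne hj, kexp, kexp, hdig, if_neg hj]
          · intro j
            rw [hdig]
            by_cases hj : j = i
            · subst hj; rw [if_pos rfl]; rw [kexp] at he; omega
            · rw [if_neg hj]; exact hc j
      · rw [if_neg hc, map_zero, if_neg]
        intro hall
        apply hc
        intro j
        have := hall j
        rw [hdig] at this
        split_ifs at this with hj <;> omega

theorem kz_single [CharP K 2] {s : ℕ} (hs : s < 16) : kz K n [s] = pn K n s := by
  rw [kz, kf, lsum_cons, lsum_nil, add_zero, kfield, kmono,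
    if_pos (show ∀ i : Fin n, (0 : Fin n → ℕ) i ≤ _ from fun _ => Nat.zero_le _),
    Nat.mod_eq_of_lt hs]
  have : kexp (0 : Fin n → ℕ) 0 s = 0 := by
    funext i
    have h0 : s / 16 ^ (i.val + 1) = 0 := Nat.div_eq_of_lt (hs.trans_le (Nat.le_self_pow (by omega) 16))
    simp [kexp, dig, h0]
  rw [this, ← one_def, one_smul]

theorem shiftK_zero (s : ℕ) (L : List ℕ) : shiftK s 0 L = L := by
  induction L with
  | nil => rfl
  | cons a L ih =>
    have e : shiftK s 0 (a :: L) = a :: shiftK s 0 L := by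
      rw [shiftK, List.flatMap_cons, ble_of_le (Nat.zero_le _), cond_true, zero_mul, Nat.sub_zero, List.singleton_append,
        shiftK]
      simp only [zero_mul, Nat.sub_zero]
    rw [e, ih]

theorem shiftK_succ (s m : ℕ) (L : List ℕ) : shiftK s (m + 1) L = shiftK s 1 (shiftK s m L) := by
  induction L with
  | nil => rfl
  | cons a L ih =>
    have e : shiftK s 1 (shiftK s m (a :: L)) =
        shiftK s 1 (bif Nat.ble m (dig a (s + 1)) then [a - m * 16 ^ (s + 1)] else []) ++
          shiftK s 1 (shiftK s m L) := by
      rw [shiftK, shiftK, List.flatMap_cons, List.flatMap_append]; rfl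
    rw [e, ← ih, shiftK, List.flatMap_cons]
    refine congrArg₂ (· ++ ·) ?_ rfl
    by_cases h1 : m ≤ dig a (s + 1)
    · rw [show Nat.ble m (dig a (s + 1)) = true from ble_of_le h1, cond_true, shiftK,
        List.flatMap_cons, List.flatMap_nil, List.append_nil, dig_sub_mul _ _ _ _ h1, if_pos rfl]
      by_cases h2 : m + 1 ≤ dig a (s + 1)
      · rw [show Nat.ble (m + 1) (dig a (s + 1)) = true from ble_of_le h2,
          show Nat.ble 1 (dig a (s + 1) - m) = true from ble_of_le (by omega), cond_true, cond_true,
          one_mul, Nat.succ_mul, Nat.sub_add_eq]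
      · rw [show Nat.ble (m + 1) (dig a (s + 1)) = false by
            rw [← Bool.not_eq_true, Nat.ble_eq]; exact h2,
          show Nat.ble 1 (dig a (s + 1) - m) = false by
            rw [← Bool.not_eq_true, Nat.ble_eq]; omega]
        rfl
    · rw [show Nat.ble (m + 1) (dig a (s + 1)) = false by
            rw [← Bool.not_eq_true, Nat.ble_eq]; omega,
          show Nat.ble m (dig a (s + 1)) = false by
            rw [← Bool.not_eq_true, Nat.ble_eq]; omega]
      rfl

/-! ### Families of fields indexed by exponents -/

/-- The base exponent of a family of fields. -/
def sbase (S : List ℕ) : Fin n → ℕ := fun i => if i.val ∈ S then 8 else 0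

/-- The weights given by a list. -/
def wf (wl : List ℕ) : Fin n → ℕ := fun i => wl.getD i.val 0

/-- The weighted sum of the digits. -/
def wkey : List ℕ → ℕ → ℕ
  | [], _ => 0
  | a :: l, k => a * (k % 16) + wkey l (k / 16)

theorem wkey_eq (wl : List ℕ) (k : ℕ) (hl : wl.length = n) :
    wkey wl (k / 16) = wdeg (wf wl : Fin n → ℕ) fun i => dig k (i.val + 1) := by
  have h : ∀ (wl : List ℕ) (k : ℕ),
      wkey wl k = ∑ i ∈ Finset.range wl.length, wl.getD i 0 * dig k i := by
    intro wl
    induction wl with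
    | nil => intro k; rfl
    | cons a l ih =>
      intro k
      rw [wkey, ih, List.length_cons, Finset.sum_range_succ']
      simp only [List.getD_cons_succ, List.getD_cons_zero, dig_zero, dig_succ]
      rw [add_comm]
  rw [h, hl, wdeg, ← Fin.sum_univ_eq_sum_range (fun i => wl.getD i 0 * dig (k / 16) i)]
  exact Finset.sum_congr rfl fun i _ => by rw [wf, ← dig_succ]

/-- The keys `L` are valid, homogeneous of degree `g - 2` relative to the base, the digits on `S` are
between 1 and 8, and the other digits are at most 1. -/
def strOK (n : ℕ) (S wl : List ℕ) (x : ℕ × List ℕ) : Bool :=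
  x.2.all fun k => validKey n k &&
    Nat.beq (wkey wl (k / 16) + 2) (x.1 + wl.getD (k % 16) 0 + 8 * (S.map fun s => wl.getD s 0).sum) &&
    (List.range n).all fun i => bif S.contains i then
      Nat.ble 1 (dig k (i + 1)) && Nat.ble (dig k (i + 1)) 8 else Nat.ble (dig k (i + 1)) 1

/-- The indices are different and less than `n`. -/
def SOK (n : ℕ) (S wl : List ℕ) : Bool :=
  decide S.Nodup && decide (wl.length = n) && Nat.ble n 15 &&
    S.all fun s => Nat.blt s n && Nat.ble 1 (wl.getD s 0) && Nat.ble (wl.getD s 0) 2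

variable (K n) in
/-- The span of the fields of degree `q - 2` of the families given by `Str`, with zero exponents
on `Z`. -/
def sq (S wl : List ℕ) (Str : List (ℕ × List ℕ)) (Z : List ℕ) (q : ℕ) : Submodule K (Der K n) :=
  Submodule.span K {D | ∃ (g : ℕ) (L : List ℕ) (r : Fin n → ℕ), (g, L) ∈ Str ∧
    (∀ i : Fin n, i.val ∉ S → r i = 0) ∧ (∀ i : Fin n, i.val ∈ Z → r i = 0) ∧
    wdeg (wf wl) r + g = q ∧ D = kf K (sbase S) r L}

section Families

variable [CharP K 2] {S wl : List ℕ} {Str : List (ℕ × List ℕ)}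

theorem SOK_lt (h : SOK n S wl = true) {s : ℕ} (hs : s ∈ S) : s < n := by
  simp only [SOK, Bool.and_eq_true, List.all_eq_true, Nat.blt_eq] at h
  exact (h.2 s hs).1.1

theorem SOK_le (h : SOK n S wl = true) : n ≤ 15 := by
  simp only [SOK, Bool.and_eq_true, Nat.ble_eq] at h
  exact h.1.2

theorem SOK_length (h : SOK n S wl = true) : wl.length = n := by
  simp only [SOK, Bool.and_eq_true, decide_eq_true_eq] at h
  exact h.1.1.2

theorem SOK_nodup (h : SOK n S wl = true) : S.Nodup := by
  simp only [SOK, Bool.and_eq_true, decide_eq_true_eq] at h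
  exact h.1.1.1

theorem SOK_one_le (h : SOK n S wl = true) {s : ℕ} (hs : s ∈ S) : 1 ≤ wl.getD s 0 := by
  simp only [SOK, Bool.and_eq_true, List.all_eq_true, Nat.ble_eq] at h
  exact (h.2 s hs).1.2

theorem SOK_le_two (h : SOK n S wl = true) {s : ℕ} (hs : s ∈ S) : wl.getD s 0 ≤ 2 := by
  simp only [SOK, Bool.and_eq_true, List.all_eq_true, Nat.ble_eq] at h
  exact (h.2 s hs).2

theorem wf_ofNat {s : ℕ} (hs : s < n) : wf wl (Fin.ofNat n s) = wl.getD s 0 := by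
  rw [wf, val_ofNat hs]

theorem sbase_ofNat {s : ℕ} (hn : s < n) (hs : s ∈ S) : sbase S (Fin.ofNat n s) = 8 := by
  rw [sbase, val_ofNat hn, if_pos hs]

theorem strOK_valid {g : ℕ} {L : List ℕ} (h : strOK n S wl (g, L) = true) : validL n L = true := by
  rw [strOK, List.all_eq_true] at h
  rw [validL, List.all_eq_true]
  intro k hk
  have := h k hk
  simp only [Bool.and_eq_true] at this
  exact this.1.1

theorem strOK_dig {g : ℕ} {L : List ℕ} (h : strOK n S wl (g, L) = true) {k : ℕ} (hk : k ∈ L)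
    {i : ℕ} (hi : i < n) : if i ∈ S then 1 ≤ dig k (i + 1) ∧ dig k (i + 1) ≤ 8 else
      dig k (i + 1) ≤ 1 := by
  rw [strOK, List.all_eq_true] at h
  have := h k hk
  simp only [Bool.and_eq_true, List.all_eq_true] at this
  have := this.2 i (List.mem_range.2 hi)
  split_ifs with hS
  · rw [List.contains_iff_mem.2 hS, cond_true, Bool.and_eq_true, Nat.ble_eq, Nat.ble_eq] at this
    exact this
  · rw [show S.contains i = false by simpa using hS, cond_false, Nat.ble_eq] at this
    exact this

theorem strOK_le_eight {g : ℕ} {L : List ℕ} (h : strOK n S wl (g, L) = true) {s : ℕ} (hn : s < n)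
    (hs : s ∈ S) : ∀ k ∈ L, dig k (s + 1) ≤ sbase S (Fin.ofNat n s) := by
  intro k hk
  have := strOK_dig h hk hn
  rw [if_pos hs] at this
  rw [sbase_ofNat hn hs]
  exact this.2

theorem wdeg_sbase (h : SOK n S wl = true) :
    wdeg (wf wl) (sbase S : Fin n → ℕ) = 8 * (S.map fun s => wl.getD s 0).sum := by
  have hlt : ∀ s ∈ S, s < n := fun s hs => SOK_lt h hs
  have hnd := SOK_nodup h
  clear h
  induction S with
  | nil => simp [wdeg, sbase]
  | cons a l ih =>
    rw [List.nodup_cons] at hnd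
    have e : (sbase (a :: l) : Fin n → ℕ) = sbase l + Pi.single (Fin.ofNat n a) 8 := by
      funext i
      have ha : a < n := hlt a (by simp)
      by_cases hi : i = Fin.ofNat n a
      · subst hi
        simp [sbase, Nat.mod_eq_of_lt ha, hnd.1]
      · have : i.val ≠ a := fun h => hi (by ext; simp [Nat.mod_eq_of_lt ha, h])
        rw [Pi.add_apply, Pi.single_eq_of_ne hi]
        simp [sbase, this]
    rw [e, wdeg_add, ih (fun s hs => hlt s (by simp [hs])) hnd.2, wdeg_single,
      wf_ofNat (hlt a (by simp)), List.map_cons, List.sum_cons]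
    ring

theorem kfield_mem_homS {base r : Fin n → ℕ} {k : ℕ} {d : ℤ} (hk : validKey n k = true)
    (hl : wl.length = n)
    (h : (wkey wl (k / 16) : ℤ) + wdeg (wf wl) r = d + wl.getD (k % 16) 0 + wdeg (wf wl) base) :
    kfield K base r k ∈ homS K (wf wl) d := by
  rw [kfield, kmono]
  split_ifs with hc
  · refine mono_pd_mem_homS ?_
    rw [wf_ofNat (validKey_iff.1 hk).1]
    have e : (fun i => dig k (i.val + 1)) + r = kexp base r k + base := by
      funext i
      have := hc i
      simp only [Pi.add_apply, kexp]
      omega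
    have e2 := congrArg (wdeg (wf wl)) e
    rw [wdeg_add, wdeg_add, ← wkey_eq wl k hl] at e2
    have e3 : (wkey wl (k / 16) : ℤ) + wdeg (wf wl) r =
      wdeg (wf wl) (kexp base r k) + wdeg (wf wl) base := by exact_mod_cast e2
    linarith
  · rw [zero_smul]; exact zero_mem _

theorem kf_mem_homS (hS : SOK n S wl = true) {g : ℕ} {L : List ℕ}
    (h : strOK n S wl (g, L) = true) (r : Fin n → ℕ) :
    kf K (sbase S) r L ∈ homS K (wf wl) ((wdeg (wf wl) r : ℤ) + g - 2) := by
  rw [strOK, List.all_eq_true] at h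
  induction L with
  | nil => exact zero_mem _
  | cons k L ih =>
    rw [kf, lsum_cons]
    refine add_mem ?_ (ih fun x hx => h x (by simp [hx]))
    have := h k (by simp)
    simp only [Bool.and_eq_true] at this
    refine kfield_mem_homS this.1.1 (SOK_length hS) ?_
    rw [wdeg_sbase hS]
    have h2 := Nat.eq_of_beq_eq_true this.1.2
    have h3 : ((wkey wl (k / 16) : ℕ) : ℤ) + 2 = g + wl.getD (k % 16) 0 +
      (8 * (S.map fun s => wl.getD s 0).sum : ℕ) := by exact_mod_cast h2
    linarith

theorem sq_le_homS (hS : SOK n S wl = true) (h : Str.all (strOK n S wl) = true) (Z : List ℕ)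
    (q : ℕ) : sq K n S wl Str Z q ≤ homS K (wf wl) ((q : ℤ) - 2) := by
  rw [List.all_eq_true] at h
  refine Submodule.span_le.2 ?_
  rintro _ ⟨g, L, r, hL, -, -, rfl, rfl⟩
  have := kf_mem_homS (K := K) hS (h _ hL) r
  push_cast
  exact this

theorem sq_mono {Z Z' : List ℕ} (hZ : ∀ z ∈ Z', z ∈ Z) (q : ℕ) :
    sq K n S wl Str Z q ≤ sq K n S wl Str Z' q := by
  refine Submodule.span_mono ?_
  rintro _ ⟨g, L, r, h1, h2, h3, h4, h5⟩
  exact ⟨g, L, r, h1, h2, fun i hi => h3 i (hZ _ hi), h4, h5⟩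

theorem lie_pn_mem_sq (hS : SOK n S wl = true) (h : Str.all (strOK n S wl) = true) {Z : List ℕ}
    {q s p : ℕ} (hs : s ∈ S) (hp : p + wl.getD s 0 = q) {D : Der K n}
    (hD : D ∈ sq K n S wl Str Z q) : ⁅pn K n s, D⁆ ∈ sq K n S wl Str Z p := by
  rw [List.all_eq_true] at h
  induction hD using Submodule.span_induction with
  | mem x hx =>
    obtain ⟨g, L, r, hL, h1, h2, h3, rfl⟩ := hx
    rw [lie_pn_kf (SOK_lt hS hs) (strOK_le_eight (h _ hL) (SOK_lt hS hs) hs)]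
    split_ifs with h0
    · exact zero_mem _
    · refine Submodule.subset_span ⟨g, L, _, hL, fun i hi => ?_, fun i hi => ?_, ?_, rfl⟩
      · rw [Function.update_of_ne, h1 i hi]
        rintro rfl
        exact h0 (h1 _ hi)
      · rw [Function.update_of_ne, h2 i hi]
        rintro rfl
        exact h0 (h2 _ hi)
      · have := wdeg_update_pred (wf wl) r _ h0
        rw [wf_ofNat (SOK_lt hS hs)] at this
        omega
  | zero => rw [lie_zero]; exact zero_mem _
  | add x y _ _ hx hy => rw [lie_add]; exact add_mem hx hy
  | smul c x _ hx => rw [lie_smul]; exact Submodule.smul_mem _ _ hx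

theorem lie_pn_eq_zero (hS : SOK n S wl = true) (h : Str.all (strOK n S wl) = true)
    {Z : List ℕ} {q s : ℕ} (hs : s ∈ S) (hz : s ∈ Z) {D : Der K n}
    (hD : D ∈ sq K n S wl Str Z q) : ⁅pn K n s, D⁆ = 0 := by
  rw [List.all_eq_true] at h
  induction hD using Submodule.span_induction with
  | mem x hx =>
    obtain ⟨g, L, r, hL, h1, h2, h3, rfl⟩ := hx
    rw [lie_pn_kf (SOK_lt hS hs) (strOK_le_eight (h _ hL) (SOK_lt hS hs) hs), if_pos]
    refine h2 _ ?_
    rwa [val_ofNat (SOK_lt hS hs)]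
  | zero => rw [lie_zero]
  | add x y _ _ hx hy => rw [lie_add, hx, hy, add_zero]
  | smul c x _ hx => rw [lie_smul, hx, smul_zero]

theorem exists_lie_pn_eq (hS : SOK n S wl = true) (h : Str.all (strOK n S wl) = true)
    {Z : List ℕ} {q s : ℕ} (hs : s ∈ S) (hz : s ∉ Z) {D : Der K n}
    (hD : D ∈ sq K n S wl Str Z q) :
    ∃ D' ∈ sq K n S wl Str Z (q + wl.getD s 0), ⁅pn K n s, D'⁆ = D := by
  rw [List.all_eq_true] at h
  have hv : (Fin.ofNat n s).val = s := Nat.mod_eq_of_lt (SOK_lt hS hs)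
  induction hD using Submodule.span_induction with
  | mem x hx =>
    obtain ⟨g, L, r, hL, h1, h2, h3, rfl⟩ := hx
    refine ⟨kf K (sbase S) (r + Pi.single (Fin.ofNat n s) 1) L,
      Submodule.subset_span ⟨g, L, _, hL, fun i hi => ?_, fun i hi => ?_, ?_, rfl⟩, ?_⟩
    · have : i ≠ Fin.ofNat n s := by rintro rfl; exact hi (hv.symm ▸ hs)
      rw [Pi.add_apply, h1 i hi, Pi.single_eq_of_ne this, add_zero]
    · have : i ≠ Fin.ofNat n s := by rintro rfl; exact hz (hv ▸ hi)
      rw [Pi.add_apply, h2 i hi, Pi.single_eq_of_ne this, add_zero]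
    · rw [wdeg_add, wdeg_single, wf_ofNat (SOK_lt hS hs)]
      omega
    · rw [lie_pn_kf (SOK_lt hS hs) (strOK_le_eight (h _ hL) (SOK_lt hS hs) hs), if_neg (by simp)]
      congr 1
      funext i
      by_cases hi : i = Fin.ofNat n s
      · subst hi; simp
      · rw [Function.update_of_ne hi, Pi.add_apply, Pi.single_eq_of_ne hi, add_zero]
  | zero => exact ⟨0, zero_mem _, lie_zero _⟩
  | add x y _ _ hx hy =>
    obtain ⟨a, ha, ea⟩ := hx
    obtain ⟨b, hb, eb⟩ := hy
    exact ⟨a + b, add_mem ha hb, by rw [lie_add, ea, eb]⟩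
  | smul c x _ hx =>
    obtain ⟨a, ha, ea⟩ := hx
    exact ⟨c • a, Submodule.smul_mem _ _ ha, by rw [lie_smul, ea]⟩

/-- The shearing vector that is infinite on `S` and 1 elsewhere. -/
def shearS (S : List ℕ) : Fin n → ℕ∞ := fun i => if i.val ∈ S then ⊤ else 1

theorem kfield_mem_vect {N : Fin n → ℕ∞} {base r : Fin n → ℕ} {k : ℕ}
    (h : (∀ i, base i ≤ r i + dig k (i.val + 1)) → Allowed N (kexp base r k)) :
    kfield K base r k ∈ vect K N := by
  refine mem_vect_iff.2 ⟨by simpa [kf] using kf_mem_vect (base := base) (r := r) [k], fun j s hs => ?_⟩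
  rw [coef_kfield] at hs
  split_ifs at hs with hj
  · rw [kmono] at hs
    split_ifs at hs with hc
    · rw [coef_mono] at hs
      split_ifs at hs with he
      · rw [← he]; exact h hc
      · exact absurd rfl hs
    · exact absurd rfl hs
  · exact absurd rfl hs

theorem kf_mem_vect_of {N : Fin n → ℕ∞} {base r : Fin n → ℕ} {L : List ℕ}
    (h : ∀ k ∈ L, (∀ i, base i ≤ r i + dig k (i.val + 1)) → Allowed N (kexp base r k)) :
    kf K base r L ∈ vect K N := by
  induction L with
  | nil => exact zero_mem _
  | cons k L ih =>
    rw [kf, lsum_cons]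
    exact add_mem (kfield_mem_vect (h k (by simp))) (ih fun x hx => h x (by simp [hx]))

theorem sq_le_vect (h : Str.all (strOK n S wl) = true) (Z : List ℕ) (q : ℕ) :
    sq K n S wl Str Z q ≤ (vect K (shearS S : Fin n → ℕ∞)).toSubmodule := by
  rw [List.all_eq_true] at h
  refine Submodule.span_le.2 ?_
  rintro _ ⟨g, L, r, hL, h1, -, -, rfl⟩
  refine kf_mem_vect_of fun k hk _ i m hm => ?_
  by_cases hi : i.val ∈ S
  · rw [shearS, if_pos hi] at hm
    exact absurd hm (ENat.top_ne_natCast m)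
  · rw [shearS, if_neg hi] at hm
    have hm : m = 1 := by exact_mod_cast hm.symm
    have := strOK_dig (h _ hL) hk i.isLt
    rw [if_neg hi] at this
    rw [hm, kexp, h1 i hi, sbase, if_neg hi]
    omega

/-! ### Brackets with the component of degree -1 -/

/-- The combinations of keys that can occur in the brackets of degree `g - 3`. -/
def closeList (S wl : List ℕ) (Str : List (ℕ × List ℕ)) (g : ℕ) : List (List ℕ) :=
  (Str.filter fun x => Nat.beq (x.1 + 1) g).map Prod.snd ++
    S.flatMap fun s => (Str.filter fun x => Nat.beq (x.1 + 1) (g + wl.getD s 0)).map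
      fun x => shiftK s 1 x.2

/-- The families are closed under the brackets with the fields `ys`. -/
def closeOK (n : ℕ) (S wl : List ℕ) (Str : List (ℕ × List ℕ)) (ys : List (List ℕ)) : Bool :=
  (ys.all fun y => validL n y && y.all fun k => S.all fun s => Nat.beq (dig k (s + 1)) 0) &&
    (Str.all fun x => Nat.blt x.1 16) &&
    (List.range 16).all fun g => inSpan (closeList S wl Str g)
      ((Str.filter fun x => Nat.beq x.1 g).flatMap fun x => ys.map fun y => brL y x.2)

theorem lie_mem_sq (hS : SOK n S wl = true) (h : Str.all (strOK n S wl) = true)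
    {ys : List (List ℕ)} (hc : closeOK n S wl Str ys = true) {q : ℕ} {D : Der K n}
    (hD : D ∈ sq K n S wl Str [] (q + 1)) {y : List ℕ} (hy : y ∈ ys) :
    ⁅kz K n y, D⁆ ∈ sq K n S wl Str [] q := by
  have h' := h
  rw [List.all_eq_true] at h'
  rw [closeOK, Bool.and_eq_true, Bool.and_eq_true, List.all_eq_true, List.all_eq_true,
    List.all_eq_true] at hc
  have hyy := hc.1.1 y hy
  rw [Bool.and_eq_true, List.all_eq_true] at hyy
  induction hD using Submodule.span_induction with
  | mem x hx =>
    obtain ⟨g, L, r, hL, h1, -, h3, rfl⟩ := hx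
    have hL' := h' _ hL
    rw [kz, lie_kf_of_compat hyy.1 (strOK_valid hL')]
    · have hlt := hc.1.2 _ hL
      rw [Nat.blt_eq] at hlt
      have hin := hc.2 g (List.mem_range.2 hlt)
      rw [inSpan, List.all_eq_true] at hin
      have := hin (brL y L) (List.mem_flatMap.2 ⟨(g, L),
        List.mem_filter.2 ⟨hL, Nat.beq_refl g⟩, List.mem_map.2 ⟨y, hy, rfl⟩⟩)
      rw [kf_eq_of_eqv this]
      refine (Submodule.span_le.2 ?_) (lsum_pick_mem _ _ _ _)
      rintro _ ⟨T, hT, rfl⟩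
      rw [closeList, List.mem_append, List.mem_map, List.mem_flatMap] at hT
      rcases hT with ⟨⟨g', L'⟩, hx, rfl⟩ | ⟨s, hs, hT⟩
      · rw [List.mem_filter] at hx
        have := Nat.eq_of_beq_eq_true hx.2
        exact Submodule.subset_span ⟨g', L', r, hx.1, h1, by simp, by omega, rfl⟩
      · rw [List.mem_map] at hT
        obtain ⟨⟨g', L'⟩, hx, rfl⟩ := hT
        rw [List.mem_filter] at hx
        have := Nat.eq_of_beq_eq_true hx.2
        have e := lie_pn_kf_shift (K := K) (base := sbase S) (r := r) (L := L') (SOK_lt hS hs) (Or.inr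
          fun k hk => by
            have := strOK_dig (h' _ hx.1) hk (SOK_lt hS hs)
            rw [if_pos hs] at this
            exact this.1)
        change kf K (sbase S) r (shiftK s 1 L') ∈ _
        rw [← e]
        exact lie_pn_mem_sq hS h hs (q := q + wl.getD s 0) rfl
          (Submodule.subset_span ⟨g', L', r, hx.1, h1, by simp, by omega, rfl⟩)
    · intro a ha b hb i
      by_cases hi : i.val ∈ S
      · right
        have h5 := hyy.2 a ha
        rw [List.all_eq_true] at h5
        have h6 := strOK_dig hL' hb i.isLt
        rw [if_pos hi] at h6
        exact ⟨Nat.eq_of_beq_eq_true (h5 _ hi), by omega⟩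
      · left
        rw [sbase, if_neg hi]
        exact ⟨rfl, h1 i hi⟩
  | zero => rw [lie_zero]; exact zero_mem _
  | add x y _ _ hx hy => rw [lie_add]; exact add_mem hx hy
  | smul c x _ hx => rw [lie_smul]; exact Submodule.smul_mem _ _ hx

theorem lie_pn_of_closeOK (hS : SOK n S wl = true) {ys : List (List ℕ)}
    (hc : closeOK n S wl Str ys = true) {s : ℕ} (hs : s ∈ S) {y : List ℕ} (hy : y ∈ ys) :
    ⁅pn K n s, kz K n y⁆ = 0 := by
  rw [closeOK, Bool.and_eq_true, Bool.and_eq_true, List.all_eq_true, List.all_eq_true,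
    List.all_eq_true] at hc
  have hyy := hc.1.1 y hy
  rw [Bool.and_eq_true, List.all_eq_true] at hyy
  rw [lie_pn_kf_shift (SOK_lt hS hs) (Or.inl ⟨rfl, rfl⟩)]
  have : shiftK s 1 y = [] := by
    rw [shiftK, List.flatMap_eq_nil_iff]
    intro k hk
    have h5 := hyy.2 k hk
    rw [List.all_eq_true] at h5
    rw [Nat.eq_of_beq_eq_true (h5 s hs)]
    rfl
  rw [this]
  rfl

end Families

end

section

/-! ### Enumeration of the families in a given degree -/

/-- The lists of keys of the members of a family with exponents of weighted sum `b` on the indices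
in the list; the exponents at the indices in `Z` vanish. -/
def enumR (wl Z : List ℕ) : List ℕ → ℕ → List ℕ → List (List ℕ)
  | [], b, L => bif Nat.beq b 0 then [L] else []
  | s :: S, b, L => (List.range (bif Z.contains s then 1 else 9)).flatMap fun v =>
      bif Nat.ble (v * wl.getD s 0) b then
        enumR wl Z S (b - v * wl.getD s 0) (shiftK s (8 - v) L) else []

/-- The lists of keys of the members of degree `q - 2` of all families. -/
def enumS (S wl : List ℕ) (Str : List (ℕ × List ℕ)) (Z : List ℕ) (q : ℕ) : List (List ℕ) :=
  Str.flatMap fun x => bif Nat.ble x.1 q then enumR wl Z S (q - x.1) x.2 else []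

theorem wdeg_update (w r : Fin n → ℕ) (i : Fin n) (v : ℕ) :
    wdeg w (Function.update r i v) + w i * r i = wdeg w r + w i * v := by
  have e : Function.update r i v + Pi.single i (r i) = r + Pi.single i v := by
    funext j
    by_cases hj : j = i
    · subst hj; simp [add_comm]
    · simp [hj]
  have := congrArg (wdeg w) e
  rwa [wdeg_add, wdeg_add, wdeg_single, wdeg_single] at this

variable [NeZero n] [CharP K 2]

theorem kz_shiftK {base r : Fin n → ℕ} {L L₀ : List ℕ} {s m : ℕ} (hs : s < n)
    (h : kz K n L₀ = kf K base r L) (hm : m ≤ r (Fin.ofNat n s))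
    (hb : ∀ k ∈ L, dig k (s + 1) ≤ base (Fin.ofNat n s)) :
    kz K n (shiftK s m L₀) =
      kf K base (Function.update r (Fin.ofNat n s) (r (Fin.ofNat n s) - m)) L := by
  induction m with
  | zero => rw [shiftK_zero, h, Nat.sub_zero, Function.update_eq_self]
  | succ m ih =>
    rw [shiftK_succ, kz, ← lie_pn_kf_shift hs (Or.inl ⟨rfl, rfl⟩)]
    have ih := ih (by omega)
    rw [kz] at ih
    rw [ih, lie_pn_kf hs hb, Function.update_self, if_neg (by omega), Function.update_idem]
    congr 2

variable {S wl : List ℕ} {Str : List (ℕ × List ℕ)}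

theorem exists_of_mem_enumR {Z : List ℕ} {base : Fin n → ℕ} {L : List ℕ} {l : List ℕ}
    (hl : ∀ s ∈ l, s < n) (hb : ∀ s ∈ l, ∀ k ∈ L, dig k (s + 1) ≤ base (Fin.ofNat n s))
    (hnd : l.Nodup) {b : ℕ} {L₀ : List ℕ} {r₀ : Fin n → ℕ} (h8 : ∀ s ∈ l, r₀ (Fin.ofNat n s) = 8)
    (h : kz K n L₀ = kf K base r₀ L) {L' : List ℕ} (hL' : L' ∈ enumR wl Z l b L₀) :
    ∃ r : Fin n → ℕ, (∀ i : Fin n, i.val ∉ l → r i = r₀ i) ∧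
      (∀ i : Fin n, i.val ∈ l → i.val ∈ Z → r i = 0) ∧
      wdeg (wf wl) r + 8 * (l.map fun s => wl.getD s 0).sum = wdeg (wf wl) r₀ + b ∧
      kz K n L' = kf K base r L := by
  induction l generalizing b L₀ r₀ with
  | nil =>
    rw [enumR] at hL'
    cases hbz : Nat.beq b 0 with
    | false => rw [hbz] at hL'; exact absurd hL' (by simp)
    | true =>
      rw [hbz, cond_true, List.mem_singleton] at hL'
      have := Nat.eq_of_beq_eq_true hbz
      exact ⟨r₀, fun _ _ => rfl, by simp, by simp [this], by rw [hL', h]⟩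
  | cons s l ih =>
    rw [List.nodup_cons] at hnd
    have hsn := hl s (by simp)
    rw [enumR, List.mem_flatMap] at hL'
    obtain ⟨v, hv, hL'⟩ := hL'
    rw [List.mem_range] at hv
    have hv8 : v ≤ 8 := by
      cases hz : Z.contains s <;> rw [hz] at hv <;> simp at hv <;> omega
    cases hble : Nat.ble (v * wl.getD s 0) b with
    | false => rw [hble] at hL'; exact absurd hL' (by simp)
    | true =>
      rw [hble, cond_true] at hL'
      rw [Nat.ble_eq] at hble
      have h8s := h8 s (by simp)
      obtain ⟨r, h1, h2, h3, h4⟩ := ih (fun x hx => hl x (by simp [hx]))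
        (fun x hx => hb x (by simp [hx])) hnd.2
        (r₀ := Function.update r₀ (Fin.ofNat n s) (r₀ (Fin.ofNat n s) - (8 - v)))
        (fun x hx => by
          rw [Function.update_of_ne, h8 x (by simp [hx])]
          intro e
          have := congrArg Fin.val e
          rw [val_ofNat hsn, val_ofNat (hl x (by simp [hx]))] at this
          exact hnd.1 (this ▸ hx))
        (kz_shiftK hsn h (by omega) (hb s (by simp))) hL'
      refine ⟨r, fun i hi => ?_, fun i hi hz => ?_, ?_, h4⟩
      · rw [List.mem_cons, not_or] at hi
        rw [h1 i hi.2, Function.update_of_ne]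
        rintro rfl
        exact hi.1 (val_ofNat hsn)
      · by_cases hil : i.val ∈ l
        · exact h2 i hil hz
        · have his : i.val = s := by simpa [hil] using hi
          have hi2 : i = Fin.ofNat n s := by ext; rw [val_ofNat hsn, his]
          rw [h1 i hil, hi2, Function.update_self, h8s]
          rw [his] at hz
          rw [List.contains_iff_mem.2 hz] at hv
          simp at hv
          omega
      · have := wdeg_update (wf wl) r₀ (Fin.ofNat n s) (r₀ (Fin.ofNat n s) - (8 - v))
        rw [h8s, wf_ofNat hsn, show 8 - (8 - v) = v by omega] at this
        rw [h8s, show 8 - (8 - v) = v by omega] at h3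
        rw [List.map_cons, List.sum_cons]
        have e : wl.getD s 0 * v = v * wl.getD s 0 := mul_comm _ _
        omega

theorem exists_mem_enumR {Z : List ℕ} {base : Fin n → ℕ} {L : List ℕ} {l : List ℕ}
    (hl : ∀ s ∈ l, s < n) (hb : ∀ s ∈ l, ∀ k ∈ L, dig k (s + 1) ≤ base (Fin.ofNat n s))
    (hnd : l.Nodup) {b : ℕ} {L₀ : List ℕ} {r₀ r : Fin n → ℕ}
    (h8 : ∀ s ∈ l, r₀ (Fin.ofNat n s) = 8)
    (h : kz K n L₀ = kf K base r₀ L) (h1 : ∀ i : Fin n, i.val ∉ l → r i = r₀ i)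
    (h2 : ∀ i : Fin n, i.val ∈ l → i.val ∈ Z → r i = 0) (hr : ∀ s ∈ l, r (Fin.ofNat n s) ≤ 8)
    (h3 : wdeg (wf wl) r + 8 * (l.map fun s => wl.getD s 0).sum = wdeg (wf wl) r₀ + b) :
    ∃ L' ∈ enumR wl Z l b L₀, kz K n L' = kf K base r L := by
  induction l generalizing b L₀ r₀ with
  | nil =>
    have e : r = r₀ := funext fun i => h1 i (by simp)
    subst e
    have hb0 : b = 0 := by simpa using h3
    exact ⟨L₀, by rw [enumR, hb0]; simp, h⟩
  | cons s l ih =>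
    rw [List.nodup_cons] at hnd
    have hsn := hl s (by simp)
    have h8s := h8 s (by simp)
    set v := r (Fin.ofNat n s) with hv
    have hv8 : v ≤ 8 := hr s (by simp)
    have hr0 := kz_shiftK hsn h (m := 8 - v) (by omega) (hb s (by simp))
    rw [h8s, show 8 - (8 - v) = v by omega] at hr0
    have hup := wdeg_update (wf wl) r₀ (Fin.ofNat n s) v
    rw [h8s, wf_ofNat hsn] at hup
    have hrem : ∀ x ∈ l, Fin.ofNat n x ≠ Fin.ofNat n s := by
      intro x hx e
      have := congrArg Fin.val e
      rw [val_ofNat hsn, val_ofNat (hl x (by simp [hx]))] at this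
      exact hnd.1 (this ▸ hx)
    have h1' : ∀ i : Fin n, i.val ∉ l → r i = Function.update r₀ (Fin.ofNat n s) v i := by
      intro i hi
      by_cases his : i = Fin.ofNat n s
      · subst his; rw [Function.update_self]
      · rw [Function.update_of_ne his]
        refine h1 i ?_
        rw [List.mem_cons, not_or]
        refine ⟨fun e => his ?_, hi⟩
        ext; rw [val_ofNat hsn, e]
    rw [List.map_cons, List.sum_cons] at h3
    have hge : wdeg (wf wl) (Function.update r₀ (Fin.ofNat n s) v) ≤
        wdeg (wf wl) r + 8 * (l.map fun s => wl.getD s 0).sum := by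
      have hle : ∀ (l : List ℕ) (r r' : Fin n → ℕ), l.Nodup → (∀ s ∈ l, s < n) →
          (∀ i : Fin n, i.val ∉ l → r i = r' i) → (∀ x ∈ l, r' (Fin.ofNat n x) = 8) →
          wdeg (wf wl) r' ≤ wdeg (wf wl) r + 8 * (l.map fun s => wl.getD s 0).sum := by
        intro l
        induction l with
        | nil =>
          intro r r' _ _ h _
          rw [show r = r' from funext fun i => h i (by simp)]
          simp
        | cons a l ihl =>
          intro r r' hnd hlt h h8
          rw [List.nodup_cons] at hnd
          have han := hlt a (by simp)
          have hi := ihl (Function.update r (Fin.ofNat n a) 8) r' hnd.2 (fun s hs => hlt s (by simp [hs]))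
            (fun i hi => by
              by_cases hia : i = Fin.ofNat n a
              · subst hia; rw [Function.update_self, h8 a (by simp)]
              · rw [Function.update_of_ne hia]
                refine h i ?_
                rw [List.mem_cons, not_or]
                refine ⟨fun e => hia ?_, hi⟩
                ext; rw [val_ofNat han, e])
            fun x hx => h8 x (by simp [hx])
          have := wdeg_update (wf wl) r (Fin.ofNat n a) 8
          rw [wf_ofNat han] at this
          rw [List.map_cons, List.sum_cons]
          omega
      refine hle l _ _ hnd.2 (fun s hs => hl s (by simp [hs])) h1' fun x hx => ?_
      rw [Function.update_of_ne (hrem x hx), h8 x (by simp [hx])]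
    have e : wl.getD s 0 * v = v * wl.getD s 0 := mul_comm _ _
    have hle : v * wl.getD s 0 ≤ b := by omega
    obtain ⟨L', hL', e'⟩ := ih (fun x hx => hl x (by simp [hx])) (fun x hx => hb x (by simp [hx])) hnd.2
      (b := b - v * wl.getD s 0) (r₀ := Function.update r₀ (Fin.ofNat n s) v)
      (fun x hx => by rw [Function.update_of_ne (hrem x hx), h8 x (by simp [hx])]) hr0 h1'
      (fun i hi hz => h2 i (by simp [hi]) hz) (fun x hx => hr x (by simp [hx])) (by omega)
    refine ⟨L', ?_, e'⟩
    rw [enumR, List.mem_flatMap]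
    refine ⟨v, ?_, ?_⟩
    · rw [List.mem_range]
      cases hz : Z.contains s with
      | false => rw [cond_false]; omega
      | true =>
        have : v = 0 := h2 (Fin.ofNat n s) (by rw [val_ofNat hsn]; simp) (by
          rw [val_ofNat hsn]; exact List.contains_iff_mem.1 hz)
        rw [cond_true]; omega
    · rw [ble_of_le hle, cond_true]
      exact hL'

theorem kmono_of_le {base r : Fin n → ℕ} {k : ℕ} (h : ∀ i : Fin n, base i ≤ r i + dig k (i.val + 1)) :
    kmono K base r k = mono (kexp base r k) := if_pos h

theorem kfield_self (b : Fin n → ℕ) : kfield K b b = kfield K (0 : Fin n → ℕ) 0 := by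
  funext k
  have e : kexp b b k = kexp 0 0 k := by
    funext i
    simp [kexp]
  rw [kfield, kfield, kmono_of_le fun i => Nat.le_add_right _ _,
    kmono_of_le (base := 0) (r := 0) fun i => Nat.zero_le _, e]

theorem kf_sbase_self (L : List ℕ) : kz K n L = kf K (sbase S : Fin n → ℕ) (sbase S) L :=
  congrArg (fun φ => lsum φ L) (kfield_self (sbase S)).symm

theorem kspan_enumS_le (hS : SOK n S wl = true) (h : Str.all (strOK n S wl) = true) {Z : List ℕ}
    (hZ : ∀ z ∈ Z, z ∈ S) (q : ℕ) : kspan K n (enumS S wl Str Z q) ≤ sq K n S wl Str Z q := by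
  rw [List.all_eq_true] at h
  refine Submodule.span_le.2 ?_
  rintro _ ⟨L', hL', rfl⟩
  rw [enumS, List.mem_flatMap] at hL'
  obtain ⟨⟨g, L⟩, hL, hL'⟩ := hL'
  cases hg : Nat.ble g q with
  | false => simp only [hg, cond_false] at hL'; exact absurd hL' (by simp)
  | true =>
    simp only [hg, cond_true] at hL'
    rw [Nat.ble_eq] at hg
    obtain ⟨r, h1, h2, h3, h4⟩ := exists_of_mem_enumR (fun s hs => SOK_lt hS hs)
      (fun s hs => strOK_le_eight (h _ hL) (SOK_lt hS hs) hs) (SOK_nodup hS)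
      (fun s hs => sbase_ofNat (SOK_lt hS hs) hs) (kf_sbase_self (K := K) L) hL'
    refine Submodule.subset_span ⟨g, L, r, hL, fun i hi => ?_, fun i hi => h2 i (hZ _ hi) hi, ?_, h4⟩
    · rw [h1 i hi, sbase, if_neg hi]
    · rw [wdeg_sbase hS] at h3
      omega

theorem sq_le_kspan_enumS (hS : SOK n S wl = true) (h : Str.all (strOK n S wl) = true) {Z : List ℕ}
    {q : ℕ} (hq : q ≤ 8) : sq K n S wl Str Z q ≤ kspan K n (enumS S wl Str Z q) := by
  rw [List.all_eq_true] at h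
  refine Submodule.span_le.2 ?_
  rintro _ ⟨g, L, r, hL, h1, h2, rfl, rfl⟩
  obtain ⟨L', hL', e⟩ := exists_mem_enumR (Z := Z) (wl := wl) (r := r) (b := wdeg (wf wl) r)
    (fun s hs => SOK_lt hS hs)
    (fun s hs => strOK_le_eight (h _ hL) (SOK_lt hS hs) hs) (SOK_nodup hS)
    (fun s hs => sbase_ofNat (SOK_lt hS hs) hs) (kf_sbase_self (K := K) L)
    (fun i hi => by rw [h1 i hi, sbase, if_neg hi]) (fun i _ hi => h2 i hi)
    (fun s hs => by
      have h5 : wf wl (Fin.ofNat n s) * r (Fin.ofNat n s) ≤ wdeg (wf wl) r :=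
        Finset.single_le_sum (f := fun i => wf wl i * r i) (fun _ _ => Nat.zero_le _)
          (Finset.mem_univ _)
      rw [wf_ofNat (SOK_lt hS hs)] at h5
      have := SOK_one_le hS hs
      nlinarith)
    (by rw [wdeg_sbase hS]; omega)
  refine Submodule.subset_span ⟨L', ?_, e.symm⟩
  rw [enumS, List.mem_flatMap]
  refine ⟨(g, L), hL, ?_⟩
  rw [ble_of_le (by omega), cond_true, Nat.add_sub_cancel]
  exact hL'

theorem sq_le_of_inSpan (hS : SOK n S wl = true) (h : Str.all (strOK n S wl) = true) {Z : List ℕ}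
    {q : ℕ} (hq : q ≤ 8) {Gs : List (List ℕ)} (hi : inSpan Gs (enumS S wl Str Z q) = true) :
    sq K n S wl Str Z q ≤ kspan K n Gs :=
  (sq_le_kspan_enumS hS h hq).trans (kspan_le_of_inSpan hi)

theorem le_sq_of_inSpan (hS : SOK n S wl = true) (h : Str.all (strOK n S wl) = true) {Z : List ℕ}
    (hZ : ∀ z ∈ Z, z ∈ S) {q : ℕ} {Gs : List (List ℕ)}
    (hi : inSpan (enumS S wl Str Z q) Gs = true) : kspan K n Gs ≤ sq K n S wl Str Z q :=
  (kspan_le_of_inSpan hi).trans (kspan_enumS_le hS h hZ q)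

/-! ### The components of a prolong are spanned by the families -/

variable {G : ℕ → Submodule K (Der K n)} {c : ℕ}

theorem sq_le_component (hS : SOK n S wl = true) (h : Str.all (strOK n S wl) = true)
    (hG : GradedProlong (wf wl) c G) {ys : List (List ℕ)} (hY : G 1 = kspan K n ys)
    (hc : closeOK n S wl Str ys = true) (hlow : ∀ q ≤ c + 2, sq K n S wl Str [] q ≤ G q) (q : ℕ) :
    sq K n S wl Str [] q ≤ G q := by
  induction q with
  | zero => exact hlow 0 (by omega)
  | succ q ih =>
    by_cases hq : q + 1 ≤ c + 2
    · exact hlow _ hq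
    · intro D hD
      refine hG.step q (by omega) D ?_ fun y hy => ?_
      · have := sq_le_homS hS h [] _ hD
        push_cast at this
        rwa [show (q : ℤ) + 1 - 2 = q - 1 by ring] at this
      · rw [hY] at hy
        refine ih ?_
        rw [lie_comm_der]
        induction hy using Submodule.span_induction with
        | mem x hx =>
          obtain ⟨L, hL, rfl⟩ := hx
          exact lie_mem_sq hS h hc hD hL
        | zero => rw [zero_lie]; exact zero_mem _
        | add a b _ _ ha hb => rw [add_lie]; exact add_mem ha hb
        | smul a x _ hx => rw [smul_lie]; exact Submodule.smul_mem _ _ hx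

theorem lie_pn_component (hS : SOK n S wl = true) (hG : GradedProlong (wf wl) c G)
    (hpn : ∀ s ∈ S, pn K n s ∈ G (2 - wl.getD s 0)) {s p q : ℕ} (hs : s ∈ S)
    (hp : p + wl.getD s 0 = q) {D : Der K n} (hD : D ∈ G q) : ⁅pn K n s, D⁆ ∈ G p := by
  have h1 := SOK_one_le hS hs
  have h2 := SOK_le_two hS hs
  exact hG.lie_mem (by omega) (hpn s hs) hD

theorem lie_kspan_eq_zero {ys : List (List ℕ)} {D y : Der K n} (hD : ∀ L ∈ ys, ⁅kz K n L, D⁆ = 0)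
    (hy : y ∈ kspan K n ys) : ⁅y, D⁆ = 0 := by
  induction hy using Submodule.span_induction with
  | mem x hx =>
    obtain ⟨L, hL, rfl⟩ := hx
    exact hD L hL
  | zero => rw [zero_lie]
  | add a b _ _ ha hb => rw [add_lie, ha, hb, add_zero]
  | smul a x _ hx => rw [smul_lie, hx, smul_zero]

/-- If a component contains no fields that commute with all `∂_s`, then the same is true for all
subsequent components. -/
theorem eq_zero_of_lie_pn (hS : SOK n S wl = true) (hG : GradedProlong (wf wl) c G)
    {ys : List (List ℕ)} (hY : G 1 = kspan K n ys) (hc : closeOK n S wl Str ys = true)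
    (htr : ∀ q, ∀ D ∈ G (q + 2), (∀ y ∈ G 1, ⁅D, y⁆ = 0) → D = 0) {q₀ : ℕ} (h2 : 2 ≤ q₀)
    (hz : ∀ D ∈ G q₀, (∀ s ∈ S, ⁅pn K n s, D⁆ = 0) → D = 0) {q : ℕ} (hq : q₀ ≤ q) :
    ∀ D ∈ G q, (∀ s ∈ S, ⁅pn K n s, D⁆ = 0) → D = 0 := by
  induction q, hq using Nat.le_induction with
  | base => exact hz
  | succ q hq ih =>
    intro D hD h0
    obtain ⟨p, rfl⟩ : ∃ p, q = p + 1 := ⟨q - 1, by omega⟩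
    refine htr p D hD fun y hy => ih _ (hG.lie_one _ _ hD _ hy) fun s hs => ?_
    have hsy : ⁅pn K n s, y⁆ = 0 := by
      rw [lie_comm_der]
      rw [hY] at hy
      refine lie_kspan_eq_zero (fun L hL => ?_) hy
      rw [lie_comm_der]
      exact lie_pn_of_closeOK hS hc hs hL
    rw [leibniz_lie, h0 s hs, hsy, zero_lie, lie_zero, add_zero]

theorem component_le_sq (hS : SOK n S wl = true) (h : Str.all (strOK n S wl) = true)
    (hG : GradedProlong (wf wl) c G)
    (hpn : ∀ s ∈ S, pn K n s ∈ G (2 - wl.getD s 0))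
    (hle : ∀ q, sq K n S wl Str [] q ≤ G q) {q₁ q₂ : ℕ}
    (hw : ∀ s ∈ S, q₁ + wl.getD s 0 ≤ q₂)
    (hbase : ∀ q, q₁ ≤ q → q < q₂ → ∀ Z s R, S = Z ++ s :: R → ∀ D ∈ G q,
      (∀ z ∈ Z, ⁅pn K n z, D⁆ = 0) → D ∈ sq K n S wl Str Z q)
    (hz : ∀ q, q₂ ≤ q → ∀ D ∈ G q, (∀ s ∈ S, ⁅pn K n s, D⁆ = 0) → D = 0) (q : ℕ) (hq : q₁ ≤ q) :
    ∀ Z s R, S = Z ++ s :: R → ∀ D ∈ G q,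
      (∀ z ∈ Z, ⁅pn K n z, D⁆ = 0) → D ∈ sq K n S wl Str Z q := by
  induction q using Nat.strong_induction_on with
  | _ q ih =>
    rcases Nat.lt_or_ge q q₂ with hlt | hge
    · exact hbase q hq hlt
    · have key : ∀ R Z, S = Z ++ R → ∀ D ∈ G q, (∀ z ∈ Z, ⁅pn K n z, D⁆ = 0) →
          D ∈ sq K n S wl Str Z q := by
        intro R
        induction R with
        | nil =>
          intro Z hZ D hD h0
          rw [List.append_nil] at hZ
          rw [hz q hge D hD (fun s hs => h0 s (hZ ▸ hs))]
          exact zero_mem _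
        | cons s R ihR =>
          intro Z hZ D hD h0
          have hs : s ∈ S := by rw [hZ]; simp
          have hnd := SOK_nodup hS
          have hsZ : s ∉ Z := by
            rw [hZ, List.nodup_append] at hnd
            intro hm
            exact hnd.2.2 s hm s (by simp) rfl
          have hws := hw s hs
          have h1s := SOK_one_le hS hs
          have hcomm : ∀ z ∈ Z, ⁅pn K n z, ⁅pn K n s, D⁆⁆ = 0 := by
            intro z hz
            rw [leibniz_lie, h0 z hz, lie_zero, add_zero]
            have : ⁅pn K n z, pn K n s⁆ = 0 := by
              have h := lie_pd_smul_pd (K := K) 1 (Fin.ofNat n z) (Fin.ofNat n s)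
              rw [one_smul, one_def, pd_mono, if_pos (by rfl), zero_smul] at h
              exact h
            rw [this, zero_lie]
          have hD1 := lie_pn_component hS hG hpn hs (p := q - wl.getD s 0) (by omega) hD
          obtain ⟨D', hD', e⟩ := exists_lie_pn_eq hS h hs hsZ
            (ih (q - wl.getD s 0) (by omega) (by omega) Z s R hZ _ hD1 hcomm)
          rw [Nat.sub_add_cancel (by omega)] at hD'
          have hZS : ∀ z ∈ Z, z ∈ S := fun z hz => by rw [hZ]; simp [hz]
          have h3 := ihR (Z ++ [s]) (by rw [hZ]; simp) (D - D')
            (sub_mem hD (hle q (sq_mono (by simp) q hD'))) (fun z hz => by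
              rw [List.mem_append, List.mem_singleton] at hz
              rw [lie_sub]
              rcases hz with hz | rfl
              · rw [h0 z hz, lie_pn_eq_zero hS h (hZS z hz) hz hD', sub_zero]
              · rw [e, sub_self])
          have := add_mem (sq_mono (fun z hz => by simp [hz]) q h3) hD'
          rwa [sub_add_cancel] at this
      intro Z s R hZ
      exact key (s :: R) Z hZ

/-- Solutions of the linear equations for a component, given a verified list of items. -/
theorem mem_of_solveOK {ys Gs Ts : List (List ℕ)} {Es : List (List (ℕ × ℕ))}
    {items : List (List ℕ × ℕ × ℕ)} (h : solveOK n ys Gs Ts Es items = true)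
    {P : Submodule K (Der K n)} (hi : kspan K n (items.map Prod.fst) ≤ P)
    (htr : ∀ D ∈ P, (∀ y ∈ ys, ⁅kz K n y, D⁆ = 0) → D = 0) {Q : Submodule K (Der K n)}
    (hiQ : kspan K n (items.map Prod.fst) ≤ Q) {D : Der K n} (hP : D ∈ P)
    (hD : ∀ y ∈ ys, ⁅kz K n y, D⁆ ∈ kspan K n Gs) (hT : ∀ T ∈ Ts, ⁅kz K n T, D⁆ = 0) : D ∈ Q := by
  obtain ⟨D', hD', e⟩ := exists_of_solveOK h hD hT
  have : D - D' = 0 := htr _ (sub_mem hP (hi hD')) fun y hy => by rw [lie_sub, e y hy, sub_self]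
  rw [sub_eq_zero.1 this]
  exact hiQ hD'

end

section

/-! ### Graded prolongs with components given by lists -/

variable [NeZero n] [CharP K 2]

/-- The brackets of the members of two lists. -/
def brLL (A B : List (List ℕ)) : List (List ℕ) := A.flatMap fun a => B.map (brL a)

theorem lie_mem_kspan {A B C : List (List ℕ)} (hA : A.all (validL n) = true)
    (hB : B.all (validL n) = true) (h : inSpan C (brLL A B) = true) {D E : Der K n}
    (hD : D ∈ kspan K n A) (hE : E ∈ kspan K n B) : ⁅D, E⁆ ∈ kspan K n C := by
  rw [List.all_eq_true] at hA hB
  induction hD using Submodule.span_induction with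
  | mem x hx =>
    obtain ⟨a, ha, rfl⟩ := hx
    induction hE using Submodule.span_induction with
    | mem y hy =>
      obtain ⟨b, hb, rfl⟩ := hy
      rw [lie_kf (hA a ha) (hB b hb)]
      exact inSpan_mem h (List.mem_flatMap.2 ⟨a, ha, List.mem_map.2 ⟨b, hb, rfl⟩⟩)
    | zero => rw [lie_zero]; exact zero_mem _
    | add x y _ _ hx hy => rw [lie_add]; exact add_mem hx hy
    | smul c x _ hx => rw [lie_smul]; exact Submodule.smul_mem _ _ hx
  | zero => rw [zero_lie]; exact zero_mem _
  | add x y _ _ hx hy => rw [add_lie]; exact add_mem hx hy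
  | smul c x _ hx => rw [smul_lie]; exact Submodule.smul_mem _ _ hx

/-- The keys in the list are homogeneous of degree `q - 2`. -/
def homOK (wl : List ℕ) (q : ℕ) (L : List ℕ) : Bool :=
  L.all fun k => Nat.beq (wkey wl (k / 16) + 2) (q + wl.getD (k % 16) 0)

theorem kz_mem_homS {wl : List ℕ} (hl : wl.length = n) {q : ℕ} {L : List ℕ}
    (hv : validL n L = true) (h : homOK wl q L = true) :
    kz K n L ∈ homS K (wf wl) ((q : ℤ) - 2) := by
  rw [validL, List.all_eq_true] at hv
  rw [homOK, List.all_eq_true] at h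
  induction L with
  | nil => exact zero_mem _
  | cons k L ih =>
    rw [kz, kf, lsum_cons]
    refine add_mem (kfield_mem_homS (hv k (by simp)) hl ?_)
      (ih (fun x hx => hv x (by simp [hx])) fun x hx => h x (by simp [hx]))
    have h2 := Nat.eq_of_beq_eq_true (h k (by simp))
    have h0 : wdeg (wf wl) (0 : Fin n → ℕ) = 0 := by simp [wdeg]
    have h3 : ((wkey wl (k / 16) : ℕ) : ℤ) + 2 = q + wl.getD (k % 16) 0 := by exact_mod_cast h2
    rw [h0]
    push_cast
    linarith

theorem kspan_le_homS {wl : List ℕ} (hl : wl.length = n) {q : ℕ} {A : List (List ℕ)}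
    (hv : A.all (validL n) = true) (h : A.all (homOK wl q) = true) :
    kspan K n A ≤ homS K (wf wl) ((q : ℤ) - 2) := by
  rw [List.all_eq_true] at hv h
  refine Submodule.span_le.2 ?_
  rintro _ ⟨L, hL, rfl⟩
  exact kz_mem_homS hl (hv L hL) (h L hL)

/-- The verification of the brackets of the first components of a graded Lie algebra. -/
def gradOK (n : ℕ) (wl : List ℕ) (c : ℕ) (Y : ℕ → List (List ℕ)) : Bool :=
  ((List.range (c + 3)).all fun q => (Y q).all (validL n) && (Y q).all (homOK wl q)) &&
  ((List.range (c + 2)).all fun q => inSpan (Y q) (brLL (Y (q + 1)) (Y 1))) &&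
  ((Y 0).all fun T => (Y 1).all fun y => eqv (brL T y) []) &&
  ((Y 0).all fun T => (Y 1).any fun a => (Y 1).any fun b => eqv T (brL a b)) &&
  (List.range (c + 3)).all fun p => (List.range (c + 3)).all fun q =>
    bif Nat.ble 2 p && Nat.ble 2 q && Nat.ble (p + q) (c + 4) then
      inSpan (Y (p + q - 2)) (brLL (Y p) (Y q)) else true

variable {wl : List ℕ} {c : ℕ} {Y : ℕ → List (List ℕ)} {G : ℕ → Submodule K (Der K n)}

theorem gradedProlong_of_gradOK (hl : wl.length = n) (hY : ∀ q, q ≤ c + 2 → G q = kspan K n (Y q))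
    (hstep : ∀ q, c + 2 ≤ q → ∀ D, D ∈ G (q + 1) ↔
      D ∈ homS K (wf wl) ((q : ℤ) - 1) ∧ ∀ y ∈ G 1, ⁅D, y⁆ ∈ G q)
    (h : gradOK n wl c Y = true) : GradedProlong (wf wl) c G := by
  rw [gradOK, Bool.and_eq_true, Bool.and_eq_true, Bool.and_eq_true, Bool.and_eq_true] at h
  obtain ⟨⟨⟨⟨h1, h2⟩, h3⟩, h4⟩, h5⟩ := h
  simp only [List.all_eq_true, List.mem_range] at h1 h2 h3 h4 h5
  have hv : ∀ q, q ≤ c + 2 → (Y q).all (validL n) = true := fun q hq => by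
    have := h1 q (by omega)
    rw [Bool.and_eq_true] at this
    exact this.1
  refine ⟨fun q => ?_, fun q hq D hD hy => (hstep q hq D).2 ⟨hD, hy⟩, fun q D hD y hy => ?_,
    fun D hD y hy => ?_, ?_, fun p q hp hq hpq D hD E hE => ?_⟩
  · by_cases hq : q ≤ c + 2
    · rw [hY q hq]
      have := h1 q (by omega)
      rw [Bool.and_eq_true] at this
      exact kspan_le_homS hl this.1 this.2
    · obtain ⟨q, rfl⟩ : ∃ p, q = p + 1 := ⟨q - 1, by omega⟩
      intro D hD
      have := ((hstep q (by omega) D).1 hD).1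
      push_cast
      rwa [show (q : ℤ) + 1 - 2 = q - 1 by ring]
  · by_cases hq : q < c + 2
    · rw [hY (q + 1) (by omega)] at hD
      rw [hY 1 (by omega)] at hy
      rw [hY q (by omega)]
      exact lie_mem_kspan (hv _ (by omega)) (hv 1 (by omega)) (h2 q hq) hD hy
    · exact ((hstep q (by omega) D).1 hD).2 y hy
  · rw [hY 0 (by omega)] at hD
    rw [hY 1 (by omega)] at hy
    rw [← Submodule.mem_bot K]
    have h0 : (⊥ : Submodule K (Der K n)) = kspan K n [] := by
      rw [kspan]; simp
    rw [h0]
    have hv0 := List.all_eq_true.1 (hv 0 (by omega))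
    have hv1 := List.all_eq_true.1 (hv 1 (by omega))
    rw [← h0, Submodule.mem_bot]
    refine lie_kspan_eq_zero (fun T hT => ?_) hD
    rw [lie_comm_der]
    refine lie_kspan_eq_zero (fun z hz => ?_) hy
    rw [lie_comm_der, lie_kf (hv0 T hT) (hv1 z hz)]
    exact kf_eq_of_eqv (h3 T hT z hz)
  · rw [hY 0 (by omega), hY 1 (by omega)]
    refine Submodule.span_le.2 ?_
    rintro _ ⟨T, hT, rfl⟩
    have := h4 T hT
    simp only [List.any_eq_true] at this
    obtain ⟨a, ha, b, hb, e⟩ := this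
    have hv1 := List.all_eq_true.1 (hv 1 (by omega))
    refine Submodule.subset_span ⟨kz K n a, Submodule.subset_span ⟨a, ha, rfl⟩, kz K n b,
      Submodule.subset_span ⟨b, hb, rfl⟩, ?_⟩
    rw [lie_kf (hv1 a ha) (hv1 b hb)]
    exact (kf_eq_of_eqv e).symm
  · have h6 := h5 p (by omega) q (by omega)
    rw [ble_of_le hp, ble_of_le hq, ble_of_le hpq] at h6
    rw [hY p (by omega)] at hD
    rw [hY q (by omega)] at hE
    rw [hY _ (by omega)]
    exact lie_mem_kspan (hv _ (by omega)) (hv _ (by omega)) h6 hD hE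

/-! ### Transitivity -/

theorem vect_apply {D : Der K n} (h : D ∈ vect K (⊤ : Fin n → ℕ∞)) (f : DP K n) :
    D f = ∑ l, D (X l) * pd l f := by
  conv_lhs => rw [mem_vect_top.1 h]
  exact field_apply _ _

theorem pd_apply_X_of_lie {D : Der K n} {i : Fin n} (h : ⁅(pd i : Der K n), D⁆ = 0) (j : Fin n) :
    pd i (D (X j)) = 0 := by
  have h1 := congrArg (fun E : Der K n => E (X j)) h
  simp only [Derivation.commutator_apply, Derivation.zero_apply, pd_X] at h1
  split_ifs at h1
  · rwa [Derivation.map_one_eq_zero, sub_zero] at h1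
  · rwa [map_zero, sub_zero] at h1

theorem coef_eq_zero_of_pd {f : DP K n} (h : ∀ i, pd i f = 0) {r : Fin n → ℕ} (hr : r ≠ 0) :
    coef f r = 0 := by
  obtain ⟨i, hi⟩ : ∃ i, r i ≠ 0 := by
    by_contra hc
    push Not at hc
    exact hr (funext hc)
  have := coef_pd i f (Function.update r i (r i - 1))
  rw [h i, coef_zero, Function.update_self, Function.update_idem, Nat.sub_add_cancel (by omega),
    Function.update_eq_self] at this
  exact this.symm

theorem apply_X_eq_zero_of_pd {w : Fin n → ℕ} (hw : ∀ i, 1 ≤ w i) {k : ℤ} (hk : 0 ≤ k) {D : Der K n}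
    (hD : D ∈ homS K w k) {j : Fin n} (h : ∀ i, pd i (D (X j)) = 0) : D (X j) = 0 := by
  refine coef_ext fun r => ?_
  rw [coef_zero]
  by_cases hr : r = 0
  · subst hr
    by_contra hne
    have := (mem_homS.1 hD).2 j 0 hne
    have h1 := hw j
    simp at this
    omega
  · exact coef_eq_zero_of_pd h hr

/-- The fields contain, for all `i`, a field `∂_i + ∑ f_s ∂_s`, where the sum is over the indices
`s` in `S₀` (with `f_s` independent of these indeterminates), and it is `∂_i` for `i` in `S₀`. -/
def transOK (n : ℕ) (wl S₀ : List ℕ) (Ys : List (List ℕ)) : Bool :=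
  (Nat.ble n 15) && (wl.all (Nat.ble 1)) && (S₀.all fun s => Nat.blt s n) &&
  (List.range n).all fun i => Ys.any fun y => validL n y && match y with
    | [] => false
    | a :: l => Nat.beq a i && bif S₀.contains i then l.isEmpty else
        l.all fun k => S₀.contains (k % 16) && S₀.all fun s => Nat.beq (dig k (s + 1)) 0

theorem kz_apply_X_eq_zero {S₀ : List ℕ} {L : List ℕ} (hv : validL n L = true)
    (h : ∀ k ∈ L, k % 16 ∈ S₀) {j : Fin n} (hj : j.val ∉ S₀) : kz K n L (X j) = 0 := by
  rw [validL, List.all_eq_true] at hv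
  induction L with
  | nil => simp
  | cons k L ih =>
    rw [kz, kf, lsum_cons, Derivation.add_apply, ih (fun x hx => hv x (by simp [hx]))
      fun x hx => h x (by simp [hx]), add_zero, kfield, smul_pd_X, if_neg]
    rintro rfl
    exact hj ((val_ofNat (validKey_iff.1 (hv k (by simp))).1).symm ▸ h k (by simp))

theorem pd_kz_apply_X {L : List ℕ} {i : Fin n}
    (h : ∀ k ∈ L, dig k (i.val + 1) = 0) (j : Fin n) : pd i (kz K n L (X j)) = 0 := by
  induction L with
  | nil => simp
  | cons k L ih =>
    rw [kz, kf, lsum_cons, Derivation.add_apply, map_add, ih fun x hx => h x (by simp [hx]),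
      add_zero, kfield, smul_pd_X]
    split_ifs
    · rw [kmono_of_le (base := 0) (r := 0) fun i => Nat.zero_le _, pd_mono, if_pos]
      simp [kexp, h k (by simp)]
    · exact map_zero _

theorem eq_zero_of_transOK (hl : wl.length = n) {S₀ : List ℕ} {Ys : List (List ℕ)}
    (h : transOK n wl S₀ Ys = true) {k : ℤ} (hk : 0 ≤ k) {D : Der K n} (hD : D ∈ homS K (wf wl) k)
    (h0 : ∀ y ∈ Ys, ⁅kz K n y, D⁆ = 0) : D = 0 := by
  rw [transOK, Bool.and_eq_true, Bool.and_eq_true, Bool.and_eq_true, Nat.ble_eq] at h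
  obtain ⟨⟨⟨hn, hw⟩, hS⟩, hi⟩ := h
  simp only [List.all_eq_true, List.any_eq_true, List.mem_range, Bool.and_eq_true, Nat.blt_eq] at hw hS hi
  have hw1 : ∀ i : Fin n, 1 ≤ (wf wl : Fin n → ℕ) i := fun i => by
    have hlt : i.val < wl.length := by rw [hl]; exact i.isLt
    rw [wf, List.getD_eq_getElem?_getD, List.getElem?_eq_getElem hlt, Option.getD_some]
    have := hw _ (List.getElem_mem hlt)
    rwa [Nat.ble_eq] at this
  have hDv := homS_le_vect hD
  have hpn : ∀ i : Fin n, pn K n i.val = pd i := fun i => by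
    rw [pn]; congr 1; ext; exact val_ofNat i.isLt
  have hcase : ∀ i : Fin n, ∃ l, validL n (i.val :: l) = true ∧ ⁅kz K n (i.val :: l), D⁆ = 0 ∧
      (i.val ∈ S₀ → l = []) ∧ (i.val ∉ S₀ → ∀ k ∈ l, k % 16 ∈ S₀ ∧
        ∀ s ∈ S₀, dig k (s + 1) = 0) := by
    intro i
    obtain ⟨y, hy, hv, hm⟩ := hi i.val i.isLt
    rcases y with _ | ⟨a, l⟩
    · exact absurd hm (by simp)
    · simp only [Bool.and_eq_true] at hm
      obtain rfl := Nat.eq_of_beq_eq_true hm.1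
      refine ⟨l, hv, h0 _ hy, fun hs => ?_, fun hs k hk => ?_⟩
      · rw [List.contains_iff_mem.2 hs] at hm
        simpa using hm.2
      · rw [show S₀.contains i.val = false by simpa using hs, cond_false, List.all_eq_true] at hm
        have := hm.2 k hk
        rw [Bool.and_eq_true, List.all_eq_true] at this
        exact ⟨List.contains_iff_mem.1 this.1, fun s hs => Nat.eq_of_beq_eq_true (this.2 s hs)⟩
  have hsplit : ∀ (i : Fin n) l, kz K n (i.val :: l) = pd i + kz K n l := fun i l => by
    have := kz_single (K := K) (n := n) (s := i.val) (by omega)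
    rw [hpn] at this
    rw [← this]
    exact kz_append [i.val] l
  have hS0 : ∀ i : Fin n, i.val ∈ S₀ → ∀ j, pd i (D (X j)) = 0 := fun i his j => by
    obtain ⟨l, -, hl0, hl1, -⟩ := hcase i
    rw [hl1 his] at hl0
    refine pd_apply_X_of_lie ?_ j
    rwa [kz_single (by omega), hpn] at hl0
  have hy : ∀ (i j : Fin n) l, ⁅kz K n (i.val :: l), D⁆ = 0 → (∀ k ∈ l, k % 16 ∈ S₀) →
      validL n l = true → pd i (D (X j)) = D (kz K n l (X j)) := by
    intro i j l hl0 hlS hlv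
    have h1 := congrArg (fun E : Der K n => E (X j)) hl0
    simp only [Derivation.commutator_apply, Derivation.zero_apply] at h1
    rw [hsplit, Derivation.add_apply, Derivation.add_apply, map_add, pd_X] at h1
    have h2 : D (if i = j then (1 : DP K n) else 0) = 0 := by
      split_ifs
      · exact Derivation.map_one_eq_zero _
      · exact map_zero _
    have h3 : kz K n l (D (X j)) = 0 := by
      rw [vect_apply (kf_mem_vect l)]
      refine Finset.sum_eq_zero fun m _ => ?_
      by_cases hm : m.val ∈ S₀
      · rw [hS0 m hm, mul_zero]
      · have e : kz K n l (X m) = 0 := kz_apply_X_eq_zero hlv hlS hm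
        rw [e, zero_mul]
    rw [h2, h3, zero_add, add_zero, sub_eq_zero] at h1
    exact h1
  have hlv : ∀ {i : ℕ} {l : List ℕ}, validL n (i :: l) = true → validL n l = true := by
    intro i l h
    rw [validL, List.all_cons, Bool.and_eq_true] at h
    exact h.2
  have hout : ∀ j : Fin n, j.val ∉ S₀ → D (X j) = 0 := by
    intro j hj
    refine apply_X_eq_zero_of_pd hw1 hk hD fun i => ?_
    by_cases his : i.val ∈ S₀
    · exact hS0 i his j
    · obtain ⟨l, hv, hl0, -, hl1⟩ := hcase i
      have e : kz K n l (X j) = 0 := kz_apply_X_eq_zero (hlv hv) (fun k hk => (hl1 his k hk).1) hj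
      rw [hy i j l hl0 (fun k hk => (hl1 his k hk).1) (hlv hv), e, map_zero]
  refine vect_ext hDv (zero_mem _) fun j => ?_
  rw [Derivation.zero_apply]
  by_cases hj : j.val ∈ S₀
  · refine apply_X_eq_zero_of_pd hw1 hk hD fun i => ?_
    by_cases his : i.val ∈ S₀
    · exact hS0 i his j
    · obtain ⟨l, hv, hl0, -, hl1⟩ := hcase i
      rw [hy i j l hl0 (fun k hk => (hl1 his k hk).1) (hlv hv), vect_apply hDv]
      refine Finset.sum_eq_zero fun m _ => ?_
      by_cases hm : m.val ∈ S₀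
      · rw [pd_kz_apply_X (fun k hk => (hl1 his k hk).2 _ hm), mul_zero]
      · rw [hout m hm, zero_mul]
  · exact hout j hj

/-- Transitivity of a graded prolong. -/
theorem GradedProlong.eq_zero (hG : GradedProlong (wf wl) c G) (hl : wl.length = n) {S₀ : List ℕ}
    {Y₀ Y₁ : List (List ℕ)} (h : transOK n wl S₀ (Y₀ ++ Y₁) = true) (hY0 : G 0 = kspan K n Y₀)
    (hY1 : G 1 = kspan K n Y₁) (q : ℕ) {D : Der K n} (hD : D ∈ homS K (wf wl) q)
    (h0 : ∀ y ∈ G 1, ⁅D, y⁆ = 0) : D = 0 := by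
  refine eq_zero_of_transOK hl h (by positivity) hD fun y hy => ?_
  rw [List.mem_append] at hy
  rcases hy with hy | hy
  · have h1 := hG.gen (hY0 ▸ Submodule.subset_span ⟨y, hy, rfl⟩ : kz K n y ∈ G 0)
    rw [lie_comm_der]
    generalize kz K n y = z at h1 ⊢
    induction h1 using Submodule.span_induction with
    | mem x hx =>
      obtain ⟨a, ha, b, hb, rfl⟩ := hx
      rw [leibniz_lie, h0 a ha, h0 b hb, zero_lie, lie_zero, add_zero]
    | zero => exact lie_zero _
    | add a b _ _ ha hb => rw [lie_add, ha, hb, add_zero]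
    | smul a x _ hx => rw [lie_smul, hx, smul_zero]
  · rw [lie_comm_der]
    exact h0 _ (hY1 ▸ Submodule.subset_span ⟨y, hy, rfl⟩)

end

section

/-! ### Simplicity, shearing vectors and derived algebras -/

variable [NeZero n] [CharP K 2]

theorem pd_mem_vect' (N : Fin n → ℕ∞) (i : Fin n) : (pd i : Der K n) ∈ vect K N := by
  have h : (pd i : Der K n) = (1 : DP K n) • pd i := by rw [one_smul]
  rw [mem_vect_iff]
  refine ⟨pd_mem_vect i, fun j r hr k m _ => ?_⟩
  rw [h, smul_pd_X] at hr
  split_ifs at hr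
  · rw [one_def, coef_mono] at hr
    split_ifs at hr with h0
    · rw [← h0]; exact pow_pos (by norm_num) m
    · exact absurd rfl hr
  · exact absurd rfl hr

theorem pd_ne_zero (i : Fin n) : (pd i : Der K n) ≠ 0 := by
  intro h
  have h1 := congrArg (fun D : Der K n => coef (D (X i)) 0) h
  simp only [pd_X, if_pos] at h1
  rw [one_def, coef_mono, if_pos rfl] at h1
  exact one_ne_zero h1

/-- Algebras `g(N)` that are cut out by `vect(n; N)` from `g(∞) = M ⊕ K d`, where `M` is simple. -/
structure Model (g : (Fin n → ℕ∞) → LieSubalgebra K (Der K n)) (S : List ℕ)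
    (M : Submodule K (Der K n)) (d : Der K n) : Prop where
  lt : ∀ s ∈ S, s < n
  nodup : S.Nodup
  ne_nil : S ≠ []
  inf : ∀ N : Fin n → ℕ∞, (∀ i, 1 ≤ N i) → g N = g ⊤ ⊓ vect K N
  sup : (g ⊤).toSubmodule = M ⊔ Submodule.span K {d}
  shear : g ⊤ ≤ vect K (shearS S)
  not_mem : d ∉ M
  mem_vect : ∀ N : Fin n → ℕ∞, (∀ i, 1 ≤ N i) → d ∈ vect K N
  lie_mem : ∀ D ∈ g ⊤, ∀ E ∈ g ⊤, ⁅D, E⁆ ∈ M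
  pn_mem : ∀ s ∈ S, pn K n s ∈ M
  surj : ∀ s ∈ S, ∀ D ∈ M, ∃ E ∈ M, ⁅pn K n s, E⁆ = D
  large : ∀ s ∈ S, ∀ m : ℕ, ∃ D ∈ M, (∀ N : Fin n → ℕ∞, (∀ i, 1 ≤ N i) → m < N (Fin.ofNat n s) →
    D ∈ vect K N) ∧ ∃ j r, coef (D (X j)) r ≠ 0 ∧ 2 ^ m ≤ r (Fin.ofNat n s)
  small : ∀ i : Fin n, i.val ∉ S → ∃ D ∈ g ⊤, (∀ N : Fin n → ℕ∞, (∀ i, 1 ≤ N i) → D ∈ vect K N) ∧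
    ∃ j r, coef (D (X j)) r ≠ 0 ∧ 1 ≤ r i
  simple : ∀ I ≤ M, I ≠ ⊥ → (∀ D ∈ M, ∀ E ∈ I, ⁅D, E⁆ ∈ I) → I = M

section

variable {g : (Fin n → ℕ∞) → LieSubalgebra K (Der K n)} {S : List ℕ}
  {M : Submodule K (Der K n)} {d : Der K n}

theorem one_le_shearS (i : Fin n) : 1 ≤ (shearS S : Fin n → ℕ∞) i := by
  rw [shearS]; split_ifs <;> simp

namespace Model

theorem le_top (h : Model g S M d) : M ≤ (g ⊤).toSubmodule := h.sup ▸ le_sup_left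

theorem d_mem (h : Model g S M d) : d ∈ g ⊤ := by
  rw [← LieSubalgebra.mem_toSubmodule, h.sup]
  exact Submodule.mem_sup_right (Submodule.mem_span_singleton_self d)

theorem shearS_eq (h : Model g S M d) : g (shearS S) = g ⊤ := by
  rw [h.inf _ one_le_shearS]
  exact inf_eq_left.2 h.shear

theorem attained_iff_of_le (h : Model g S M d) {g' : (Fin n → ℕ∞) → LieSubalgebra K (Der K n)}
    (hinf : ∀ N : Fin n → ℕ∞, (∀ i, 1 ≤ N i) → g' N = g' ⊤ ⊓ vect K N)
    (hsh : g' ⊤ ≤ vect K (shearS S)) (hle : g ⊤ ≤ g' ⊤) {N : Fin n → ℕ∞} (hN : ∀ i, 1 ≤ N i) :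
    Attained g' N ↔ ∀ i : Fin n, i.val ∉ S → N i = 1 := by
  constructor
  · intro ha i hi
    by_contra hne
    have h1 : ((1 : ℕ) : ℕ∞) < N i := lt_of_le_of_ne (by exact_mod_cast hN i) fun e => hne (by rw [← e]; rfl)
    obtain ⟨D, hD, j, r, hc, hr⟩ := ha i 1 h1
    rw [hinf N hN] at hD
    have h2 := (mem_vect_iff.1 (hsh hD.1)).2 j
    have h3 := h2 r hc i 1 (by rw [shearS, if_neg hi]; rfl)
    omega
  · intro ha i m hm
    by_cases hi : i.val ∈ S
    · obtain ⟨D, hD, hv, j, r, hc, hr⟩ := h.large _ hi m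
      have e : Fin.ofNat n i.val = i := by ext; exact val_ofNat i.2
      rw [e] at hv hr
      exact ⟨D, by rw [hinf N hN]; exact ⟨hle (h.le_top hD), hv N hN hm⟩, j, r, hc, hr⟩
    · rw [ha i hi] at hm
      have hm0 : m = 0 := by
        have : m < 1 := by exact_mod_cast hm
        omega
      subst hm0
      obtain ⟨D, hD, hv, j, r, hc, hr⟩ := h.small i hi
      exact ⟨D, by rw [hinf N hN]; exact ⟨hle hD, hv N hN⟩, j, r, hc, by simpa using hr⟩

theorem attained_iff (h : Model g S M d) {N : Fin n → ℕ∞} (hN : ∀ i, 1 ≤ N i) :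
    Attained g N ↔ ∀ i : Fin n, i.val ∉ S → N i = 1 := h.attained_iff_of_le h.inf h.shear le_rfl hN

theorem noncritical_of_attained_iff (hg : ∀ N : Fin n → ℕ∞, (∀ i, 1 ≤ N i) →
    (Attained g N ↔ ∀ i : Fin n, i.val ∉ S → N i = 1)) (i : Fin n) :
    Noncritical g i ↔ i.val ∈ S := by
  constructor
  · intro h
    by_contra hi
    obtain ⟨N, hN, ha, hm⟩ := h 2
    rw [(hg N hN).1 ha i hi] at hm
    exact absurd (show (2 : ℕ) ≤ 1 by exact_mod_cast hm) (by norm_num)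
  · intro hi m
    refine ⟨shearS S, one_le_shearS, (hg _ one_le_shearS).2 fun j hj => ?_, ?_⟩
    · rw [shearS, if_neg hj]
    · rw [shearS, if_pos hi]; exact OrderTop.le_top _

theorem numParams_eq' (hlt : ∀ s ∈ S, s < n) (hnd : S.Nodup)
    (hg : ∀ i, Noncritical g i ↔ i.val ∈ S) : numParams g = S.length := by
  have : {i | Noncritical g i} = ((S.map (Fin.ofNat n)).toFinset : Set (Fin n)) := by
    ext i
    simp only [Set.mem_ofPred_eq, List.coe_toFinset, List.mem_map]
    rw [hg i]
    constructor
    · intro h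
      exact ⟨i.val, h, by ext; exact val_ofNat i.2⟩
    · rintro ⟨s, hs, rfl⟩
      rw [val_ofNat (hlt s hs)]
      exact hs
  rw [numParams, this, Set.ncard_coe_finset, List.toFinset_card_of_nodup, List.length_map]
  refine hnd.map_on fun a ha b hb hab => ?_
  have := congrArg Fin.val hab
  rwa [val_ofNat (hlt a ha), val_ofNat (hlt b hb)] at this

theorem unconstrained_eq' (hg : ∀ i, Noncritical g i ↔ i.val ∈ S) :
    unconstrained g = shearS S := by
  funext i
  rw [unconstrained, shearS]
  by_cases h : i.val ∈ S
  · rw [if_pos h, if_pos ((hg i).2 h)]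
  · rw [if_neg h, if_neg fun h' => h ((hg i).1 h')]

theorem noncritical_iff (h : Model g S M d) (i : Fin n) : Noncritical g i ↔ i.val ∈ S :=
  noncritical_of_attained_iff (fun _ hN => h.attained_iff hN) i

theorem numParams_eq (h : Model g S M d) : numParams g = S.length :=
  numParams_eq' h.lt h.nodup h.noncritical_iff

theorem unc_eq (h : Model g S M d) : Unc g = g ⊤ := by
  rw [Unc, unconstrained_eq' h.noncritical_iff, h.shearS_eq]

theorem exists_mem (h : Model g S M d) : ∃ s, s ∈ S := List.exists_mem_of_ne_nil _ h.ne_nil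

theorem not_isSimple (h : Model g S M d) {N : Fin n → ℕ∞} (hN : ∀ i, 1 ≤ N i) :
    ¬ LieAlgebra.IsSimple K (g N) := by
  intro hs
  have hle : g N ≤ g ⊤ := by rw [h.inf N hN]; exact inf_le_left
  let I : LieIdeal K (g N) :=
    { M.comap (g N).toSubmodule.subtype with
      lie_mem := fun {x m} _ => h.lie_mem _ (hle x.2) _ (hle m.2) }
  have hI : ∀ x : g N, x ∈ I ↔ (x : Der K n) ∈ M := fun x => Iff.rfl
  obtain ⟨s, hS⟩ := h.exists_mem
  rcases hs.eq_bot_or_eq_top I with h1 | h1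
  · have h2 : pn K n s ∈ g N := by
      rw [h.inf N hN]
      exact ⟨h.le_top (h.pn_mem s hS), pd_mem_vect' N _⟩
    have h3 : (⟨_, h2⟩ : g N) ∈ I := (hI _).2 (h.pn_mem s hS)
    rw [h1, LieSubmodule.mem_bot] at h3
    exact pd_ne_zero _ (congrArg Subtype.val h3)
  · have h2 : d ∈ g N := by
      rw [h.inf N hN]
      exact ⟨h.d_mem, h.mem_vect N hN⟩
    have h3 : (⟨_, h2⟩ : g N) ∈ I := by rw [h1]; trivial
    exact h.not_mem ((hI _).1 h3)

end Model

/-- A Lie algebra that is mapped isomorphically onto a simple algebra of fields is simple. -/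
theorem isSimple_of_injective {L : Type*} [LieRing L] [LieAlgebra K L] (f : L →ₗ⁅K⁆ Der K n)
    (hf : Function.Injective f) (hr : LinearMap.range (f : L →ₗ[K] Der K n) = M)
    (hna : ∃ D ∈ M, ∃ E ∈ M, ⁅D, E⁆ ≠ 0)
    (hs : ∀ I ≤ M, I ≠ ⊥ → (∀ D ∈ M, ∀ E ∈ I, ⁅D, E⁆ ∈ I) → I = M) : LieAlgebra.IsSimple K L := by
  constructor
  · intro I
    by_cases hb : I.toSubmodule.map (f : L →ₗ[K] Der K n) = ⊥
    · left
      rw [LieSubmodule.eq_bot_iff]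
      intro x hx
      have : f x ∈ I.toSubmodule.map (f : L →ₗ[K] Der K n) := ⟨x, hx, rfl⟩
      rw [hb, Submodule.mem_bot] at this
      exact hf (this.trans (map_zero f).symm)
    · right
      have := hs (I.toSubmodule.map (f : L →ₗ[K] Der K n)) (by rw [← hr]; exact LinearMap.map_le_range) hb ?_
      · rw [eq_top_iff]
        intro x _
        have h1 : f x ∈ M := hr ▸ ⟨x, rfl⟩
        rw [← this] at h1
        obtain ⟨y, hy, hxy⟩ := h1
        rwa [← hf hxy]
      · rintro D hD _ ⟨y, hy, rfl⟩
        rw [← hr] at hD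
        obtain ⟨x, rfl⟩ := hD
        exact ⟨⁅x, y⁆, lie_mem_right K L I x y hy, LieHom.map_lie f x y⟩
  · intro ha
    obtain ⟨D, hD, E, hE, hne⟩ := hna
    rw [← hr] at hD hE
    obtain ⟨x, rfl⟩ := hD
    obtain ⟨y, rfl⟩ := hE
    apply hne
    change ⁅f x, f y⁆ = 0
    rw [← LieHom.map_lie, ha.trivial, map_zero]

theorem finrank_quotient_eq_one {V : Type*} [AddCommGroup V] [Module K V] {P Q : Submodule K V}
    {v : V} (h : P = Q ⊔ Submodule.span K {v}) (hv : v ∉ Q) :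
    Module.finrank K (P ⧸ Q.comap P.subtype) = 1 := by
  have hvP : v ∈ P := h ▸ Submodule.mem_sup_right (Submodule.mem_span_singleton_self v)
  rw [finrank_eq_one_iff']
  refine ⟨Submodule.mkQ _ ⟨v, hvP⟩, fun h0 => hv ((Submodule.Quotient.mk_eq_zero (Q.comap P.subtype)).1 h0), ?_⟩
  intro w
  obtain ⟨⟨w, hw⟩, rfl⟩ := Submodule.mkQ_surjective _ w
  have hw' := hw
  rw [h, Submodule.mem_sup] at hw'
  obtain ⟨a, ha, b, hb, rfl⟩ := hw'
  obtain ⟨c, rfl⟩ := Submodule.mem_span_singleton.1 hb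
  refine ⟨c, ?_⟩
  rw [← map_smul, ← sub_eq_zero, ← map_sub]
  refine (Submodule.Quotient.mk_eq_zero _).2 ?_
  change c • v - (a + c • v) ∈ Q
  simpa using ha

/-- A derived algebra of an algebra of fields. -/
theorem derivedSeries_succ_map (L : LieSubalgebra K (Der K n)) (k : ℕ) {A B : Submodule K (Der K n)}
    (hA : (LieAlgebra.derivedSeries K L k).toSubmodule.map L.toSubmodule.subtype = A)
    (h1 : ∀ D ∈ A, ∀ E ∈ A, ⁅D, E⁆ ∈ B)
    (h2 : B ≤ Submodule.span K {D | ∃ E ∈ A, ∃ F ∈ A, ⁅E, F⁆ = D}) :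
    (LieAlgebra.derivedSeries K L (k + 1)).toSubmodule.map L.toSubmodule.subtype = B := by
  have hm : ∀ x : L, x ∈ LieAlgebra.derivedSeries K L k ↔ (x : Der K n) ∈ A := by
    intro x
    rw [← hA]
    constructor
    · intro hx; exact ⟨x, hx, rfl⟩
    · rintro ⟨y, hy, hxy⟩
      have : y = x := Subtype.ext hxy
      exact this ▸ hy
  rw [show LieAlgebra.derivedSeries K L (k + 1) =
    ⁅LieAlgebra.derivedSeries K L k, LieAlgebra.derivedSeries K L k⁆ from
      LieAlgebra.derivedSeriesOfIdeal_succ K L ⊤ k]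
  apply le_antisymm
  · rw [LieSubmodule.lieIdeal_oper_eq_linear_span', Submodule.map_span, Submodule.span_le]
    rintro _ ⟨_, ⟨x, hx, y, hy, rfl⟩, rfl⟩
    exact h1 _ ((hm x).1 hx) _ ((hm y).1 hy)
  · refine h2.trans (Submodule.span_le.2 ?_)
    rintro _ ⟨E, hE, F, hF, rfl⟩
    have key : ∀ D ∈ A, ∃ x : L, x ∈ LieAlgebra.derivedSeries K L k ∧ (x : Der K n) = D := by
      intro D hD
      rw [← hA] at hD
      obtain ⟨x, hx, rfl⟩ := hD
      exact ⟨x, hx, rfl⟩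
    obtain ⟨x, hx, rfl⟩ := key E hE
    obtain ⟨y, hy, rfl⟩ := key F hF
    exact ⟨⁅x, y⁆, LieSubmodule.lie_mem_lie hx hy, rfl⟩

theorem derivedSeries_zero_map (L : LieSubalgebra K (Der K n)) :
    (LieAlgebra.derivedSeries K L 0).toSubmodule.map L.toSubmodule.subtype = L.toSubmodule := by
  rw [show LieAlgebra.derivedSeries K L 0 = ⊤ from rfl]
  exact Submodule.map_subtype_top _

namespace Model

theorem derived_map (h : Model g S M d) :
    (LieAlgebra.derivedSeries K (g ⊤) 1).toSubmodule.map (g ⊤).toSubmodule.subtype = M := by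
  obtain ⟨s, hS⟩ := h.exists_mem
  refine derivedSeries_succ_map (g ⊤) 0 (derivedSeries_zero_map _) h.lie_mem fun D hD => ?_
  obtain ⟨E, hE, rfl⟩ := h.surj s hS D hD
  exact Submodule.subset_span ⟨_, h.le_top (h.pn_mem s hS), E, h.le_top hE, rfl⟩

theorem derived_comap (h : Model g S M d) :
    (LieAlgebra.derivedSeries K (g ⊤) 1).toSubmodule = M.comap (g ⊤).toSubmodule.subtype := by
  rw [← h.derived_map, Submodule.comap_map_eq_of_injective]
  exact Subtype.val_injective

/-- The embedding of the derived algebra. -/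
def _root_.Kas.derivedHom (L : LieSubalgebra K (Der K n)) (k : ℕ) :
    LieAlgebra.derivedSeries K L k →ₗ⁅K⁆ Der K n :=
  L.incl.comp (LieAlgebra.derivedSeries K L k).incl

theorem _root_.Kas.derivedHom_injective (L : LieSubalgebra K (Der K n)) (k : ℕ) :
    Function.Injective (derivedHom L k) := fun _ _ h => Subtype.ext (Subtype.ext h)

theorem range_derivedHom (h : Model g S M d) :
    LinearMap.range (derivedHom (g ⊤) 1 : LieAlgebra.derivedSeries K (g ⊤) 1 →ₗ[K] Der K n) = M := by
  rw [← h.derived_map]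
  ext D
  constructor
  · rintro ⟨x, rfl⟩; exact ⟨x.1, x.2, rfl⟩
  · rintro ⟨x, hx, rfl⟩; exact ⟨⟨x, hx⟩, rfl⟩

theorem derivedIsSimple (h : Model g S M d) : DerivedIsSimpleOfCodimOne K (Unc g) := by
  rw [h.unc_eq]
  refine ⟨?_, isSimple_of_injective _ (derivedHom_injective _ _) h.range_derivedHom ?_ h.simple⟩
  · have h1 := finrank_quotient_eq_one h.sup h.not_mem
    rw [← h.derived_comap] at h1
    exact h1
  · obtain ⟨s, hS⟩ := h.exists_mem
    obtain ⟨E, hE, h1⟩ := h.surj s hS _ (h.pn_mem s hS)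
    exact ⟨_, h.pn_mem s hS, E, hE, by rw [h1]; exact pd_ne_zero _⟩

end Model

end

end

section

/-! ### Algebras spanned by families of fields -/

variable [NeZero n] [CharP K 2]

/-- Elements of degree at most `-1` in a subspace that is stable under the component of
degree `-1`. -/
theorem exists_low_mem {w : Fin n → ℕ} {A : ℕ → Submodule K (Der K n)}
    (hA : ∀ q, A q ≤ homS K w ((q : ℤ) - 2))
    (htr : ∀ q, ∀ D ∈ A (q + 2), (∀ y ∈ A 1, ⁅D, y⁆ = 0) → D = 0) {I : Submodule K (Der K n)}
    (hI : I ≤ ⨆ q, A q) (hst : ∀ y ∈ A 1, ∀ E ∈ I, ⁅y, E⁆ ∈ I) (hne : I ≠ ⊥) :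
    ∃ E ∈ I, E ≠ 0 ∧ E ∈ A 0 ⊔ A 1 := by
  obtain ⟨D, hD, hD0⟩ := Submodule.exists_mem_ne_zero_of_ne_bot hne
  obtain ⟨B, hB⟩ : ∃ B : ℕ, ∀ q : ℕ, B ≤ q → hproj w ((q : ℤ) - 2) D = 0 := by
    obtain ⟨F, hF⟩ := exists_sum_hproj w (iSup_le_vect hA (hI hD))
    obtain ⟨b, hb⟩ := F.exists_le
    refine ⟨(b + 3).toNat, fun q hq => ?_⟩
    rw [hF, map_sum]
    refine Finset.sum_eq_zero fun k hk => ?_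
    have := hb k hk
    exact hproj_other (by omega) (hproj_mem k D)
  clear hne
  revert D
  induction B with
  | zero =>
    intro D hD hD0 hB
    refine absurd (hproj_ext w (iSup_le_vect hA (hI hD)) fun k => ?_) hD0
    by_cases hk : k < -2
    · exact hproj_eq_zero_of_iSup hA (hI hD) hk
    · have := hB (k + 2).toNat (Nat.zero_le _)
      rwa [show (((k + 2).toNat : ℕ) : ℤ) - 2 = k by omega] at this
  | succ B ih =>
    intro D hD hD0 hB
    by_cases h0 : hproj w ((B : ℤ) - 2) D = 0
    · refine ih D hD hD0 fun q hq => ?_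
      rcases Nat.eq_or_lt_of_le hq with h | h
      · rw [← h]; exact h0
      · exact hB q h
    by_cases hB2 : B < 2
    · refine ⟨D, hD, hD0, ?_⟩
      have e : D - (hproj w (-2) D + hproj w (-1) D) = 0 := by
        refine hproj_ext w (sub_mem (iSup_le_vect hA (hI hD))
          (add_mem (hproj_mem_vect_top _ _) (hproj_mem_vect_top _ _))) fun k => ?_
        rw [map_sub, map_add]
        by_cases hk : k < -2
        · rw [hproj_eq_zero_of_iSup hA (hI hD) hk, hproj_other (by omega) (hproj_mem (-2) D),
            hproj_other (by omega) (hproj_mem (-1) D)]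
          simp
        · by_cases h2 : k = -2
          · rw [h2, hproj_self (hproj_mem (-2) D), hproj_other (by omega) (hproj_mem (-1) D)]
            simp
          · by_cases h1 : k = -1
            · rw [h1, hproj_self (hproj_mem (-1) D), hproj_other (by omega) (hproj_mem (-2) D)]
              simp
            · rw [hproj_other (by omega) (hproj_mem (-2) D), hproj_other (by omega) (hproj_mem (-1) D)]
              have := hB (k + 2).toNat (by omega)
              rw [show (((k + 2).toNat : ℕ) : ℤ) - 2 = k by omega] at this
              rw [this]; simp
      rw [sub_eq_zero] at e
      have e0 := hproj_mem_of_iSup hA (hI hD) 0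
      have e1 := hproj_mem_of_iSup hA (hI hD) 1
      rw [e]
      exact Submodule.add_mem_sup (by simpa using e0) (by simpa using e1)
    · have h1 : ∃ y ∈ A 1, ⁅hproj w ((B : ℤ) - 2) D, y⁆ ≠ 0 := by
        by_contra! hc
        obtain ⟨q, rfl⟩ : ∃ q, B = q + 2 := ⟨B - 2, by omega⟩
        exact h0 (htr q _ (hproj_mem_of_iSup hA (hI hD) (q + 2)) hc)
      obtain ⟨y, hy, hyD⟩ := h1
      have hyh : y ∈ homS K w (-1) := hA 1 hy
      have hV := iSup_le_vect hA (hI hD)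
      refine ih _ (hst y hy D hD) (fun h => ?_) fun q hq => ?_
      · have := hproj_lie (w := w) (k := (B : ℤ) - 2) (m := (B : ℤ) - 3) (by ring) hyh hV
        rw [h, map_zero, lie_comm_der] at this
        exact hyD this.symm
      · rw [hproj_lie (w := w) (k := ((q + 1 : ℕ) : ℤ) - 2) (by push_cast; ring) hyh hV,
          hB (q + 1) (by omega), lie_zero]

/-! #### Certificates of simplicity -/

/-- The successive brackets with the members of the list. -/
def brW (A : List (List ℕ)) (b : List ℕ) : List ℕ := A.foldr (fun a L => cancel (brL a L)) b

/-- All keys that occur in the successive brackets are valid. -/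
def wordOK (n : ℕ) : List (List ℕ) → List ℕ → Bool
  | [], b => validL n b
  | a :: A, b => wordOK n A b && validL n a && validL n (brW A b)

/-- The word attached to each member of the list sends it to `t`, and the subsequent members
to 0. -/
def certOK (n : ℕ) (t : List ℕ) : List (List ℕ × List (List ℕ)) → Bool
  | [] => true
  | (b, A) :: l => wordOK n A b && eqv (brW A b) t &&
      l.all (fun x => wordOK n A x.1 && eqv (brW A x.1) []) && certOK n t l

/-- The successive brackets with the members of the list. -/
def lieW (K : Type*) [Field K] (n : ℕ) [NeZero n] (A : List (List ℕ)) (D : Der K n) : Der K n :=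
  A.foldr (fun a E => ⁅kz K n a, E⁆) D

theorem kz_cancel (L : List ℕ) : kz K n (cancel L) = kz K n L := lsum_cancel add_self_der _ L

theorem lieW_kz {A : List (List ℕ)} {b : List ℕ} (h : wordOK n A b = true) :
    lieW K n A (kz K n b) = kz K n (brW A b) := by
  induction A with
  | nil => rfl
  | cons a A ih =>
    rw [wordOK, Bool.and_eq_true, Bool.and_eq_true] at h
    change ⁅kz K n a, lieW K n A (kz K n b)⁆ = kz K n (cancel (brL a (brW A b)))
    rw [ih h.1.1, lie_kf h.1.2 h.2, kz_cancel]

theorem lieW_comb (A : List (List ℕ)) (c : K) (D E : Der K n) :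
    lieW K n A (c • D + E) = c • lieW K n A D + lieW K n A E := by
  induction A with
  | nil => rfl
  | cons a A ih =>
    change ⁅_, lieW K n A _⁆ = c • ⁅_, lieW K n A D⁆ + ⁅_, lieW K n A E⁆
    rw [ih, lie_add, lie_smul]

theorem lieW_zero (A : List (List ℕ)) : lieW K n A 0 = 0 := by
  have := lieW_comb (K := K) (n := n) A 1 0 0
  rw [smul_zero, one_smul, add_zero] at this
  exact left_eq_add.1 this

theorem lieW_mem {I : Submodule K (Der K n)} {A : List (List ℕ)}
    (hst : ∀ a ∈ A, ∀ E ∈ I, ⁅kz K n a, E⁆ ∈ I) {D : Der K n} (hD : D ∈ I) : lieW K n A D ∈ I := by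
  induction A with
  | nil => exact hD
  | cons a A ih => exact hst a (by simp) _ (ih fun x hx => hst x (by simp [hx]))

theorem kspan_cons {b : List ℕ} {l : List (List ℕ)} {D : Der K n} (hD : D ∈ kspan K n (b :: l)) :
    ∃ (c : K) (E : Der K n), E ∈ kspan K n l ∧ D = c • kz K n b + E := by
  have : {x | ∃ L ∈ b :: l, x = kz K n L} = insert (kz K n b) {x | ∃ L ∈ l, x = kz K n L} := by
    ext x
    simp only [List.mem_cons, Set.mem_insert_iff, Set.mem_ofPred_eq]
    constructor
    · rintro ⟨L, rfl | hL, rfl⟩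
      · exact Or.inl rfl
      · exact Or.inr ⟨L, hL, rfl⟩
    · rintro (rfl | ⟨L, hL, rfl⟩)
      · exact ⟨b, Or.inl rfl, rfl⟩
      · exact ⟨L, Or.inr hL, rfl⟩
  rw [kspan, this, Submodule.mem_span_insert] at hD
  exact hD

theorem mem_of_certOK {t : List ℕ} {cert : List (List ℕ × List (List ℕ))}
    (h : certOK n t cert = true) {I : Submodule K (Der K n)}
    (hst : ∀ x ∈ cert, ∀ a ∈ x.2, ∀ E ∈ I, ⁅kz K n a, E⁆ ∈ I) {D : Der K n} (hD : D ∈ I)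
    (h0 : D ≠ 0) (hs : D ∈ kspan K n (cert.map Prod.fst)) : kz K n t ∈ I := by
  revert D
  induction cert with
  | nil =>
    intro D hD h0 hs
    refine absurd ?_ h0
    have : {x | ∃ L ∈ ([] : List (List ℕ)), x = kz K n L} = ∅ := by ext; simp
    rwa [List.map_nil, kspan, this, Submodule.span_empty, Submodule.mem_bot] at hs
  | cons x l ih =>
    intro D hD h0 hs
    obtain ⟨b, A⟩ := x
    simp only [certOK, Bool.and_eq_true, List.all_eq_true] at h
    obtain ⟨⟨⟨h1, h2⟩, h3⟩, h4⟩ := h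
    obtain ⟨c, E, hE, rfl⟩ := kspan_cons hs
    by_cases hc : c = 0
    · rw [hc, zero_smul, zero_add] at hD h0
      exact ih h4 (fun x hx => hst x (by simp [hx])) hD h0 hE
    · have hl : lieW K n A (c • kz K n b + E) ∈ I := lieW_mem (hst (b, A) (by simp)) hD
      have hz : lieW K n A E = 0 := by
        rw [kspan] at hE
        clear hl hs hD h0 ih
        induction hE using Submodule.span_induction with
        | mem y hy =>
          obtain ⟨L, hL, rfl⟩ := hy
          obtain ⟨x, hx, rfl⟩ := List.mem_map.1 hL
          rw [lieW_kz (h3 x hx).1, kz, kf_eq_of_eqv (h3 x hx).2]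
          rfl
        | zero => exact lieW_zero A
        | add u v _ _ hu hv =>
          have := lieW_comb (K := K) A 1 u v
          rw [one_smul, one_smul, hu, hv, add_zero] at this
          exact this
        | smul a u _ hu =>
          have := lieW_comb (K := K) A a u 0
          rw [add_zero, hu, lieW_zero, smul_zero, add_zero] at this
          exact this
      rw [lieW_comb, hz, add_zero, lieW_kz h1, kz, kf_eq_of_eqv h2] at hl
      exact (Submodule.smul_mem_iff _ hc).1 hl

/-! #### Boolean verifications -/

/-- The digits of the keys are at most 1. -/
def loOK (n : ℕ) (L : List ℕ) : Bool :=
  validL n L && L.all fun k => (List.range n).all fun i => Nat.ble (dig k (i + 1)) 1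

/-- For every index that is not in `S`, some field has a monomial that contains the
indeterminate. -/
def smallOK (n : ℕ) (S : List ℕ) (Y : List (List ℕ)) : Bool :=
  (List.range n).all fun i => S.contains i || Y.any fun L => loOK n L && L.any fun k =>
    Nat.beq (dig k (i + 1)) 1 && Nat.beq (L.count k) 1

/-- The partial derivatives with indices in `S` belong to the families. -/
def pnOK (S wl : List ℕ) (Str : List (ℕ × List ℕ)) : Bool :=
  S.all fun s => inSpan (enumS S wl Str [] (2 - wl.getD s 0)) [[s]]

/-- The constant term of some family contains a partial derivative. -/
def witOK (n : ℕ) (S : List ℕ) (Str : List (ℕ × List ℕ)) (κ : ℕ) : Bool :=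
  ((List.range n).all fun i => Nat.beq (dig κ (i + 1)) (bif S.contains i then 8 else 0)) &&
    Str.any fun x => Nat.beq (x.2.count κ) 1

/-- The number of keys in `Λ` is odd for `d` and even for the members of `E`. -/
def parOK (n : ℕ) (Λ d : List ℕ) (E : List (List ℕ)) : Bool :=
  validL n Λ && validL n d && Nat.beq ((Λ.map fun k => d.count k).sum % 2) 1 &&
    E.all fun L => validL n L && Nat.beq ((Λ.map fun k => L.count k).sum % 2) 0

theorem kz_mem_vect_of_loOK {L : List ℕ} (h : loOK n L = true) {N : Fin n → ℕ∞}
    (hN : ∀ i, 1 ≤ N i) : kz K n L ∈ vect K N := by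
  rw [loOK, Bool.and_eq_true, List.all_eq_true] at h
  refine kf_mem_vect_of fun k hk _ i m hm => ?_
  have := h.2 k hk
  rw [List.all_eq_true] at this
  have := this i (List.mem_range.2 i.2)
  rw [Nat.ble_eq] at this
  have h1 : 1 ≤ m := by
    have := hN i
    rw [hm] at this
    exact_mod_cast this
  have h2 : 2 ^ 1 ≤ 2 ^ m := Nat.pow_le_pow_right (by norm_num) h1
  simp only [kexp, Pi.zero_apply]
  omega

theorem coef_kz {L : List ℕ} (hL : validL n L = true) {k : ℕ} (hk : validKey n k = true) :
    coef (kz K n L (X (Fin.ofNat n (k % 16)))) (kexp 0 0 k) = L.count k :=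
  coef_kf_key hL hk fun _ => Nat.zero_le _

theorem exists_small {S : List ℕ} {Y : List (List ℕ)} (h : smallOK n S Y = true) (i : Fin n)
    (hi : i.val ∉ S) : ∃ L ∈ Y, loOK n L = true ∧
      ∃ j r, coef (kz K n L (X j)) r ≠ 0 ∧ 1 ≤ r i := by
  rw [smallOK, List.all_eq_true] at h
  have := h i (List.mem_range.2 i.2)
  rw [Bool.or_eq_true, List.contains_iff_mem, or_iff_right hi, List.any_eq_true] at this
  obtain ⟨L, hL, h1⟩ := this
  rw [Bool.and_eq_true, List.any_eq_true] at h1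
  obtain ⟨h1, k, hk, h2⟩ := h1
  rw [Bool.and_eq_true, Nat.beq_eq, Nat.beq_eq] at h2
  refine ⟨L, hL, h1, Fin.ofNat n (k % 16), kexp 0 0 k, ?_, ?_⟩
  · rw [loOK, Bool.and_eq_true] at h1
    have hv := h1.1
    rw [validL, List.all_eq_true] at hv
    rw [coef_kz h1.1 (hv k hk), h2.2, Nat.cast_one]
    exact one_ne_zero
  · simp only [kexp, Pi.zero_apply]
    omega

theorem not_mem_of_parOK {Λ d : List ℕ} {E : List (List ℕ)} (h : parOK n Λ d E = true) :
    kz K n d ∉ kspan K n E := by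
  rw [parOK, Bool.and_eq_true, Bool.and_eq_true, Bool.and_eq_true, List.all_eq_true, Nat.beq_eq] at h
  obtain ⟨⟨⟨hΛ, hd⟩, h1⟩, h2⟩ := h
  have hv := hΛ
  rw [validL, List.all_eq_true] at hv
  have key : ∀ L, validL n L = true →
      (Λ.map fun k => coef (kz K n L (X (Fin.ofNat n (k % 16)))) (kexp 0 0 k)).sum =
        (((Λ.map fun k => L.count k).sum : ℕ) : K) := by
    intro L hL
    rw [Nat.cast_list_sum, List.map_map]
    congr 1
    exact List.map_congr_left fun k hk => coef_kz hL (hv k hk)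
  have hz : ∀ D ∈ kspan K n E,
      (Λ.map fun k => coef (D (X (Fin.ofNat n (k % 16)))) (kexp 0 0 k)).sum = 0 := by
    intro D hD
    rw [kspan] at hD
    induction hD using Submodule.span_induction with
    | mem x hx =>
      obtain ⟨L, hL, rfl⟩ := hx
      have h3 := h2 L hL
      rw [Bool.and_eq_true, Nat.beq_eq] at h3
      rw [key L h3.1, CharP.cast_eq_zero_iff K 2]
      exact Nat.dvd_of_mod_eq_zero h3.2
    | zero =>
      refine List.sum_eq_zero fun x hx => ?_
      obtain ⟨k, -, rfl⟩ := List.mem_map.1 hx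
      rfl
    | add x y _ _ hx hy =>
      simp only [Derivation.add_apply, coef_add]
      rw [List.sum_map_add, hx, hy, add_zero]
    | smul c x _ hx =>
      simp only [Derivation.smul_apply, coef_smul]
      rw [List.sum_map_mul_left, hx, mul_zero]
  intro hm
  have := hz _ hm
  rw [key d hd, CharP.cast_eq_zero_iff K 2] at this
  omega

/-! #### Sums of families -/

variable (K n) in
/-- The sum of the components spanned by the families. -/
def strM (S wl : List ℕ) (Str : List (ℕ × List ℕ)) : Submodule K (Der K n) :=
  ⨆ q, sq K n S wl Str [] q

variable {S wl : List ℕ} {Str : List (ℕ × List ℕ)}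

theorem sq_le_strM (q : ℕ) : sq K n S wl Str [] q ≤ strM K n S wl Str :=
  le_iSup (fun q => sq K n S wl Str [] q) q

theorem pn_mem_strM (hS : SOK n S wl = true) (h : Str.all (strOK n S wl) = true)
    (hp : pnOK S wl Str = true) {s : ℕ} (hs : s ∈ S) :
    pn K n s ∈ sq K n S wl Str [] (2 - wl.getD s 0) := by
  rw [pnOK, List.all_eq_true] at hp
  have := inSpan_mem (K := K) (n := n) (hp s hs) (List.mem_singleton_self _)
  rw [kz_single (by have := SOK_lt hS hs; have := SOK_le hS; omega)] at this
  exact kspan_enumS_le hS h (by simp) _ this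

theorem strM_surj (hS : SOK n S wl = true) (h : Str.all (strOK n S wl) = true) {s : ℕ} (hs : s ∈ S)
    {D : Der K n} (hD : D ∈ strM K n S wl Str) : ∃ E ∈ strM K n S wl Str, ⁅pn K n s, E⁆ = D := by
  have : strM K n S wl Str ≤ (strM K n S wl Str).map (LieAlgebra.ad K (Der K n) (pn K n s)) := by
    refine iSup_le fun q D hD => ?_
    obtain ⟨E, hE, rfl⟩ := exists_lie_pn_eq hS h hs (by simp) hD
    exact ⟨E, sq_le_strM _ hE, rfl⟩
  obtain ⟨E, hE, rfl⟩ := this hD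
  exact ⟨E, hE, rfl⟩

theorem strM_le_vect (h : Str.all (strOK n S wl) = true) :
    strM K n S wl Str ≤ (vect K (shearS S : Fin n → ℕ∞)).toSubmodule :=
  iSup_le fun q => sq_le_vect h [] q

theorem exists_witness (h : Str.all (strOK n S wl) = true) {κ : ℕ}
    (hw : witOK n S Str κ = true) : ∃ g L, (g, L) ∈ Str ∧ ∀ r : Fin n → ℕ,
      (∀ i : Fin n, i.val ∉ S → r i = 0) →
      coef (kf K (sbase S) r L (X (Fin.ofNat n (κ % 16)))) r = 1 := by
  rw [witOK, Bool.and_eq_true, List.all_eq_true, List.any_eq_true] at hw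
  obtain ⟨h1, ⟨g, L⟩, hL, h2⟩ := hw
  rw [Nat.beq_eq] at h2
  rw [List.all_eq_true] at h
  have hv := strOK_valid (h _ hL)
  have hk : κ ∈ L := List.count_pos_iff.1 (by rw [h2]; norm_num)
  have hv' := hv
  rw [validL, List.all_eq_true] at hv'
  refine ⟨g, L, hL, fun r hr => ?_⟩
  have hd : ∀ i : Fin n, dig κ (i.val + 1) = (sbase S : Fin n → ℕ) i := by
    intro i
    have := h1 i (List.mem_range.2 i.2)
    rw [Nat.beq_eq] at this
    rw [this, sbase]
    by_cases hi : i.val ∈ S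
    · rw [if_pos hi, List.contains_iff_mem.2 hi, cond_true]
    · rw [if_neg hi, show S.contains i.val = false by simpa using hi, cond_false]
  have e : kexp (sbase S) r κ = r := by
    funext i
    rw [kexp, hd]
    omega
  have := coef_kf_key (K := K) (base := sbase S) (r := r) hv (hv' κ hk) fun i => by rw [hd]; omega
  rw [e, h2, Nat.cast_one] at this
  exact this

theorem strM_large (hS : SOK n S wl = true) (h : Str.all (strOK n S wl) = true) {κ : ℕ}
    (hw : witOK n S Str κ = true) {s : ℕ} (hs : s ∈ S) (m : ℕ) : ∃ D ∈ strM K n S wl Str,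
      (∀ N : Fin n → ℕ∞, (∀ i, 1 ≤ N i) → m < N (Fin.ofNat n s) → D ∈ vect K N) ∧
      ∃ j r, coef (D (X j)) r ≠ 0 ∧ 2 ^ m ≤ r (Fin.ofNat n s) := by
  obtain ⟨g, L, hL, hc⟩ := exists_witness (K := K) h hw
  have hr : ∀ i : Fin n, i.val ∉ S → (Pi.single (Fin.ofNat n s) (2 ^ m) : Fin n → ℕ) i = 0 := by
    intro i hi
    refine Pi.single_eq_of_ne (fun e => hi ?_) _
    rw [e, val_ofNat (SOK_lt hS hs)]
    exact hs
  rw [List.all_eq_true] at h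
  refine ⟨kf K (sbase S) (Pi.single (Fin.ofNat n s) (2 ^ m)) L, ?_, fun N hN hm => ?_, Fin.ofNat n (κ % 16),
    Pi.single (Fin.ofNat n s) (2 ^ m), ?_, ?_⟩
  · refine sq_le_strM _ (Submodule.subset_span ⟨g, L, _, hL, hr, by simp, rfl, rfl⟩)
  · refine kf_mem_vect_of fun k hk _ i p hp => ?_
    have h1 := strOK_dig (h _ hL) hk i.2
    have hp1 : 1 ≤ p := by
      have := hN i
      rw [hp] at this
      exact_mod_cast this
    have h2 : 2 ^ 1 ≤ 2 ^ p := Nat.pow_le_pow_right (by norm_num) hp1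
    rw [kexp, sbase]
    split_ifs at h1 ⊢ with hi
    · by_cases his : i = Fin.ofNat n s
      · rw [← his, Pi.single_eq_same]
        rw [← his, hp] at hm
        have h3 : 2 ^ m < 2 ^ p := Nat.pow_lt_pow_right (by norm_num) (by exact_mod_cast hm)
        omega
      · rw [Pi.single_eq_of_ne his]
        omega
    · rw [hr i hi]
      omega
  · rw [hc _ hr]; exact one_ne_zero
  · rw [Pi.single_eq_same]

variable {c : ℕ} {G : ℕ → Submodule K (Der K n)}

/-- The elements of low degrees and of the words, for the families. -/
def certOf (S wl : List ℕ) (Str : List (ℕ × List ℕ)) (l : List ((ℕ × ℕ) × List (ℕ × ℕ))) :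
    List (List ℕ × List (List ℕ)) :=
  l.map fun x => ((enumS S wl Str [] x.1.1).getD x.1.2 [],
    x.2.map fun p => (enumS S wl Str [] p.1).getD p.2 [])

theorem kz_getD_mem_strM (hS : SOK n S wl = true) (h : Str.all (strOK n S wl) = true) (q i : ℕ) :
    kz K n ((enumS S wl Str [] q).getD i []) ∈ strM K n S wl Str := by
  refine sq_le_strM q (kspan_enumS_le hS h (by simp) q ?_)
  rw [List.getD_eq_getElem?_getD]
  cases e : (enumS S wl Str [] q)[i]? with
  | none => exact zero_mem _
  | some L => exact Submodule.subset_span ⟨L, List.mem_of_getElem? e, rfl⟩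

theorem strM_simple (hS : SOK n S wl = true) (h : Str.all (strOK n S wl) = true)
    (htr : ∀ q, ∀ D ∈ sq K n S wl Str [] (q + 2), (∀ y ∈ sq K n S wl Str [] 1, ⁅D, y⁆ = 0) → D = 0)
    {s : ℕ} (hs : s ∈ S) {l : List ((ℕ × ℕ) × List (ℕ × ℕ))}
    (hc : certOK n [s] (certOf S wl Str l) = true)
    (hl : inSpan ((certOf S wl Str l).map Prod.fst)
      (enumS S wl Str [] 0 ++ enumS S wl Str [] 1) = true) {I : Submodule K (Der K n)}
    (hI : I ≤ strM K n S wl Str) (hne : I ≠ ⊥)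
    (hst : ∀ D ∈ strM K n S wl Str, ∀ E ∈ I, ⁅D, E⁆ ∈ I) : I = strM K n S wl Str := by
  obtain ⟨E, hE, hE0, hlow⟩ := exists_low_mem (fun q => sq_le_homS hS h [] q) htr hI
    (fun y hy => hst y (sq_le_strM 1 hy)) hne
  have h1 : kz K n [s] ∈ I := by
    refine mem_of_certOK hc ?_ hE hE0 ((show _ ≤ kspan K n ((certOf S wl Str l).map Prod.fst) from sup_le ?_ ?_) hlow)
    · intro x hx a ha F hF
      obtain ⟨y, -, rfl⟩ := List.mem_map.1 hx
      obtain ⟨p, -, rfl⟩ := List.mem_map.1 ha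
      exact hst _ (kz_getD_mem_strM hS h _ _) F hF
    · refine (sq_le_kspan_enumS hS h (by norm_num)).trans (Submodule.span_le.2 ?_)
      rintro _ ⟨L, hL, rfl⟩
      exact inSpan_mem hl (List.mem_append_left _ hL)
    · refine (sq_le_kspan_enumS hS h (by norm_num)).trans (Submodule.span_le.2 ?_)
      rintro _ ⟨L, hL, rfl⟩
      exact inSpan_mem hl (List.mem_append_right _ hL)
  rw [kz_single (by have := SOK_lt hS hs; have := SOK_le hS; omega)] at h1
  refine le_antisymm hI fun D hD => ?_
  obtain ⟨F, hF, rfl⟩ := strM_surj hS h hs hD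
  rw [lie_comm_der]
  exact hst F hF _ h1

end

section

/-! ### Graded prolongs spanned by families of fields and one more field -/

variable [NeZero n] [CharP K 2]

variable (K n) in
/-- A graded prolong whose components are spanned by families of fields, except for one more
field `d` of degree 0. -/
structure FamilyProlong (S wl : List ℕ) (Str : List (ℕ × List ℕ)) (c : ℕ)
    (G : ℕ → Submodule K (Der K n)) (Y : ℕ → List (List ℕ)) (d : List ℕ) : Prop where
  hS : SOK n S wl = true
  hStr : Str.all (strOK n S wl) = true
  graded : GradedProlong (wf wl) c G
  eq_kspan : ∀ q ≤ 2, G q = kspan K n (Y q)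
  close : closeOK n S wl Str (Y 1) = true
  trans : ∃ S₀, transOK n wl S₀ (Y 0 ++ Y 1) = true
  eq_sq : ∀ q, q ≠ 2 → G q = sq K n S wl Str [] q
  eq_two : G 2 = sq K n S wl Str [] 2 ⊔ Submodule.span K {kz K n d}
  pn : pnOK S wl Str = true
  valid : (Y 2).all (validL n) = true
  two_two : inSpan (enumS S wl Str [] 2) (brLL (Y 2) (Y 2)) = true
  not_mem : ∃ Λ, parOK n Λ d (enumS S wl Str [] 2) = true
  lo : loOK n d = true

variable {S wl : List ℕ} {Str : List (ℕ × List ℕ)} {c : ℕ} {G : ℕ → Submodule K (Der K n)}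
  {Y : ℕ → List (List ℕ)} {d : List ℕ}

namespace FamilyProlong

theorem sq_le (h : FamilyProlong K n S wl Str c G Y d) (q : ℕ) : sq K n S wl Str [] q ≤ G q := by
  by_cases hq : q = 2
  · rw [hq, h.eq_two]; exact le_sup_left
  · rw [h.eq_sq q hq]

theorem d_mem (h : FamilyProlong K n S wl Str c G Y d) : kz K n d ∈ G 2 := by
  rw [h.eq_two]; exact Submodule.mem_sup_right (Submodule.mem_span_singleton_self _)

theorem eq_zero (h : FamilyProlong K n S wl Str c G Y d) (q : ℕ) {D : Der K n} (hD : D ∈ G (q + 2))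
    (h0 : ∀ y ∈ G 1, ⁅D, y⁆ = 0) : D = 0 := by
  obtain ⟨S₀, ht⟩ := h.trans
  refine h.graded.eq_zero (SOK_length h.hS) ht (h.eq_kspan 0 (by norm_num))
    (h.eq_kspan 1 (by norm_num)) q ?_ h0
  have := h.graded.homog _ hD
  rwa [show (((q + 2 : ℕ) : ℤ) - 2) = q by push_cast; ring] at this

theorem strM_eq (h : FamilyProlong K n S wl Str c G Y d) :
    ⨆ q, G q = strM K n S wl Str ⊔ Submodule.span K {kz K n d} := by
  apply le_antisymm
  · refine iSup_le fun q => ?_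
    by_cases hq : q = 2
    · rw [hq, h.eq_two]
      exact sup_le_sup_right (sq_le_strM 2) _
    · rw [h.eq_sq q hq]
      exact (sq_le_strM q).trans le_sup_left
  · refine sup_le (iSup_mono h.sq_le) ?_
    rw [Submodule.span_singleton_le_iff_mem]
    exact le_iSup G 2 h.d_mem

theorem lie_mem_sq_of_one (h : FamilyProlong K n S wl Str c G Y d) {q : ℕ} {D E : Der K n}
    (hD : D ∈ G 1) (hE : E ∈ sq K n S wl Str [] (q + 1)) : ⁅D, E⁆ ∈ sq K n S wl Str [] q := by
  rw [h.eq_kspan 1 (by norm_num), kspan] at hD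
  induction hD using Submodule.span_induction with
  | mem x hx =>
    obtain ⟨y, hy, rfl⟩ := hx
    exact lie_mem_sq h.hS h.hStr h.close hE hy
  | zero => rw [zero_lie]; exact zero_mem _
  | add x y _ _ hx hy => rw [add_lie]; exact add_mem hx hy
  | smul a x _ hx => rw [smul_lie]; exact Submodule.smul_mem _ _ hx

theorem lie_mem_sq_of_zero (h : FamilyProlong K n S wl Str c G Y d) {q : ℕ} {D E : Der K n}
    (hD : D ∈ G 0) (hE : E ∈ sq K n S wl Str [] (q + 2)) : ⁅D, E⁆ ∈ sq K n S wl Str [] q := by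
  have h1 := h.graded.gen hD
  clear hD
  induction h1 using Submodule.span_induction with
  | mem x hx =>
    obtain ⟨a, ha, b, hb, rfl⟩ := hx
    rw [lie_lie]
    exact sub_mem (h.lie_mem_sq_of_one ha (h.lie_mem_sq_of_one hb hE))
      (h.lie_mem_sq_of_one hb (h.lie_mem_sq_of_one ha hE))
  | zero => rw [zero_lie]; exact zero_mem _
  | add x y _ _ hx hy =>
    rw [add_lie]; exact add_mem hx hy
  | smul a x _ hx => rw [smul_lie]; exact Submodule.smul_mem _ _ hx

theorem lie_mem (h : FamilyProlong K n S wl Str c G Y d) {p q : ℕ} {D E : Der K n}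
    (hD : D ∈ G p) (hE : E ∈ G q) : ⁅D, E⁆ ∈ strM K n S wl Str := by
  by_cases hpq : p + q < 2
  · rw [h.graded.lie_eq_zero hpq hD hE]; exact zero_mem _
  by_cases h4 : p + q = 4
  · refine sq_le_strM 2 ?_
    have hcases : (p = 0 ∧ q = 4) ∨ (p = 1 ∧ q = 3) ∨ (p = 2 ∧ q = 2) ∨ (p = 3 ∧ q = 1) ∨
      (p = 4 ∧ q = 0) := by omega
    rcases hcases with ⟨rfl, rfl⟩ | ⟨rfl, rfl⟩ | ⟨rfl, rfl⟩ | ⟨rfl, rfl⟩ | ⟨rfl, rfl⟩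
    · rw [h.eq_sq 4 (by norm_num)] at hE
      exact h.lie_mem_sq_of_zero hD hE
    · rw [h.eq_sq 3 (by norm_num)] at hE
      exact h.lie_mem_sq_of_one hD hE
    · rw [h.eq_kspan 2 le_rfl] at hD hE
      exact kspan_enumS_le h.hS h.hStr (by simp) 2 (lie_mem_kspan h.valid h.valid h.two_two hD hE)
    · rw [h.eq_sq 3 (by norm_num)] at hD
      rw [lie_comm_der]
      exact h.lie_mem_sq_of_one hE hD
    · rw [h.eq_sq 4 (by norm_num)] at hD
      rw [lie_comm_der]
      exact h.lie_mem_sq_of_zero hE hD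
  · have h1 := h.graded.lie_mem (m := p + q - 2) (by omega) hD hE
    rw [h.eq_sq _ (by omega)] at h1
    exact sq_le_strM _ h1

theorem lie_mem_of_iSup (h : FamilyProlong K n S wl Str c G Y d) {D E : Der K n}
    (hD : D ∈ ⨆ q, G q) (hE : E ∈ ⨆ q, G q) : ⁅D, E⁆ ∈ strM K n S wl Str :=
  Kas.lie_mem_of_iSup (fun _ _ _ hD _ hE => h.lie_mem hD hE) hD hE

theorem d_not_mem (h : FamilyProlong K n S wl Str c G Y d) : kz K n d ∉ strM K n S wl Str := by
  intro hm
  obtain ⟨Λ, hΛ⟩ := h.not_mem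
  have h1 := hproj_mem_of_iSup (fun q => sq_le_homS h.hS h.hStr [] q) hm 2
  rw [hproj_self (h.graded.homog 2 h.d_mem)] at h1
  exact not_mem_of_parOK hΛ (sq_le_kspan_enumS h.hS h.hStr (by norm_num) h1)

theorem simple (h : FamilyProlong K n S wl Str c G Y d) {s : ℕ} (hs : s ∈ S)
    {l : List ((ℕ × ℕ) × List (ℕ × ℕ))} (hc : certOK n [s] (certOf S wl Str l) = true)
    (hl : inSpan ((certOf S wl Str l).map Prod.fst)
      (enumS S wl Str [] 0 ++ enumS S wl Str [] 1) = true) (I : Submodule K (Der K n))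
    (hI : I ≤ strM K n S wl Str) (hne : I ≠ ⊥)
    (hst : ∀ D ∈ strM K n S wl Str, ∀ E ∈ I, ⁅D, E⁆ ∈ I) : I = strM K n S wl Str := by
  refine strM_simple h.hS h.hStr (fun q D hD h0 => ?_) hs hc hl hI hne hst
  refine h.eq_zero q (h.sq_le _ hD) ?_
  rw [h.eq_sq 1 (by norm_num)]
  exact h0

theorem model (h : FamilyProlong K n S wl Str c G Y d) {κ : ℕ} (hw : witOK n S Str κ = true)
    (hsm : smallOK n S (Y 2) = true) {s : ℕ} (hs : s ∈ S)
    {l : List ((ℕ × ℕ) × List (ℕ × ℕ))} (hc : certOK n [s] (certOf S wl Str l) = true)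
    (hl : inSpan ((certOf S wl Str l).map Prod.fst)
      (enumS S wl Str [] 0 ++ enumS S wl Str [] 1) = true)
    {g : (Fin n → ℕ∞) → LieSubalgebra K (Der K n)}
    (hinf : ∀ N : Fin n → ℕ∞, (∀ i, 1 ≤ N i) → g N = g ⊤ ⊓ vect K N)
    (htop : (g ⊤).toSubmodule = ⨆ q, G q) : Model g S (strM K n S wl Str) (kz K n d) where
  lt s hs := SOK_lt h.hS hs
  nodup := SOK_nodup h.hS
  ne_nil := List.ne_nil_of_mem hs
  inf := hinf
  sup := by rw [htop, h.strM_eq]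
  shear := by
    intro D hD
    rw [← LieSubalgebra.mem_toSubmodule, htop, h.strM_eq] at hD
    refine (sup_le (strM_le_vect h.hStr) ?_ : _ ≤ (vect K (shearS S)).toSubmodule) hD
    rw [Submodule.span_singleton_le_iff_mem]
    exact kz_mem_vect_of_loOK h.lo one_le_shearS
  not_mem := h.d_not_mem
  mem_vect N hN := kz_mem_vect_of_loOK h.lo hN
  lie_mem D hD E hE := by
    rw [← LieSubalgebra.mem_toSubmodule, htop] at hD hE
    exact h.lie_mem_of_iSup hD hE
  pn_mem s hs := sq_le_strM _ (pn_mem_strM h.hS h.hStr h.pn hs)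
  surj s hs D hD := strM_surj h.hS h.hStr hs hD
  large s hs m := strM_large h.hS h.hStr hw hs m
  small i hi := by
    obtain ⟨L, hL, hlo, h1⟩ := exists_small (K := K) hsm i hi
    refine ⟨kz K n L, ?_, fun N hN => kz_mem_vect_of_loOK hlo hN, h1⟩
    rw [← LieSubalgebra.mem_toSubmodule, htop]
    refine le_iSup G 2 ?_
    rw [h.eq_kspan 2 le_rfl]
    exact Submodule.subset_span ⟨L, hL, rfl⟩
  simple := h.simple hs hc hl

end FamilyProlong

end

/-! ### Squares of derivations -/

section Squares

variable [CharP K 2]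

/-- The square of a derivation in characteristic 2. -/
def sqd (D : Der K n) : Der K n :=
  Derivation.mk' ((D : DP K n →ₗ[K] DP K n) ∘ₗ (D : DP K n →ₗ[K] DP K n)) fun f g => by
    simp only [LinearMap.comp_apply, Derivation.coeFn_coe, Derivation.leibniz, smul_eq_mul, map_add]
    have := add_self_dp (D f * D g)
    linear_combination this

theorem sqd_apply (D : Der K n) (f : DP K n) : sqd D f = D (D f) := rfl

theorem sqd_lie (D E : Der K n) : ⁅sqd D, E⁆ = ⁅D, ⁅D, E⁆⁆ := by
  ext f
  simp only [Derivation.commutator_apply, sqd_apply, map_sub]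
  linear_combination add_self_dp (D (E (D f))) - add_self_dp (E (D (D f)))

theorem sqd_add (D E : Der K n) : sqd (D + E) = sqd D + sqd E + ⁅D, E⁆ := by
  ext f
  simp only [Derivation.add_apply, sqd_apply, Derivation.commutator_apply, map_add]
  have := add_self_dp (E (D f))
  linear_combination this

theorem sqd_smul (c : K) (D : Der K n) : sqd (c • D) = c ^ 2 • sqd D := by
  ext f
  simp only [Derivation.smul_apply, sqd_apply, Derivation.map_smul, smul_smul, pow_two]

theorem iterate_sqd_lie (D E : Der K n) (m : ℕ) :
    ⁅sqd^[m] D, E⁆ = (fun F => ⁅D, F⁆)^[2 ^ m] E := by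
  induction m generalizing E with
  | zero => rfl
  | succ m ih =>
    rw [Function.iterate_succ_apply', sqd_lie, ih, ih, pow_succ, mul_two, Function.iterate_add_apply]

theorem mono_mul_self {r : Fin n → ℕ} (hr : r ≠ 0) : (mono r : DP K n) * mono r = 0 := by
  rw [mono_mul_mono_char, if_neg]
  intro h
  apply hr
  funext i
  simpa using h i

theorem sqd_smul_pd (f : DP K n) (i : Fin n) :
    sqd (f • pd i : Der K n) = (f * pd i f) • pd i + (f * f) • sqd (pd i) := by
  ext a
  simp only [Derivation.smul_apply, Derivation.add_apply, sqd_apply, Derivation.leibniz, smul_eq_mul]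
  ring

/-- The derivation `∂_i ^ (2 ^ m)`. -/
def pdp (i : Fin n) (m : ℕ) : Der K n := sqd^[m] (pd i)

theorem pdp_succ (i : Fin n) (m : ℕ) : (pdp i (m + 1) : Der K n) = sqd (pdp i m) :=
  Function.iterate_succ_apply' _ _ _

theorem lie_pd_pd (i j : Fin n) : ⁅(pd i : Der K n), (pd j : Der K n)⁆ = 0 := by
  ext f
  rw [Derivation.commutator_apply, pd_comm, sub_self]
  rfl

theorem lie_pdp_pd (i j : Fin n) (m : ℕ) : ⁅(pdp i m : Der K n), (pd j : Der K n)⁆ = 0 := by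
  induction m with
  | zero => exact lie_pd_pd i j
  | succ m ih => rw [pdp_succ, sqd_lie, ih, lie_zero]

theorem lie_pdp_pdp (i j : Fin n) (m k : ℕ) : ⁅(pdp i m : Der K n), (pdp j k : Der K n)⁆ = 0 := by
  induction k with
  | zero => exact lie_pdp_pd i j m
  | succ k ih => rw [lie_comm_der] at ih ⊢; rw [pdp_succ, sqd_lie, ih, lie_zero]

theorem lie_pdp_smul_pd (i j : Fin n) (m : ℕ) (f : DP K n) :
    ⁅(pdp i m : Der K n), (f • pd j : Der K n)⁆ = (pdp i m f) • pd j := by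
  have h := lie_pdp_pd (K := K) i j m
  ext a
  have h1 := congrArg (fun D : Der K n => D a) h
  simp only [Derivation.commutator_apply, Derivation.zero_apply] at h1
  simp only [Derivation.commutator_apply, Derivation.smul_apply, Derivation.leibniz, smul_eq_mul]
  linear_combination f * h1

theorem lie_pdp_vect (i : Fin n) (m : ℕ) {D : Der K n} (hD : D ∈ vect K (⊤ : Fin n → ℕ∞)) :
    ⁅(pdp i m : Der K n), D⁆ = ∑ j, (pdp i m (D (X j))) • pd j := by
  conv_lhs => rw [mem_vect_top.1 hD]
  rw [lie_sum]
  exact Finset.sum_congr rfl fun j _ => lie_pdp_smul_pd i j m _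

theorem pdp_mono (i : Fin n) (m : ℕ) (r : Fin n → ℕ) : pdp i m (mono r : DP K n) =
    if r i < 2 ^ m then 0 else mono (Function.update r i (r i - 2 ^ m)) := by
  induction m generalizing r with
  | zero =>
    rw [pdp, Function.iterate_zero, id, pd_mono, pow_zero]
    by_cases h : r i = 0
    · rw [if_pos h, if_pos (by omega)]
    · rw [if_neg h, if_neg (by omega)]
  | succ m ih =>
    rw [pdp_succ, sqd_apply, ih]
    have h2 : 2 ^ (m + 1) = 2 ^ m + 2 ^ m := by ring
    by_cases h : r i < 2 ^ m
    · rw [if_pos h, map_zero, if_pos (by omega)]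
    · rw [if_neg h, ih, Function.update_self, Function.update_idem, h2]
      by_cases h3 : r i - 2 ^ m < 2 ^ m
      · rw [if_pos h3, if_pos (by omega)]
      · rw [if_neg h3, if_neg (by omega), Nat.sub_sub]

theorem pdp_eq_zero_of_lt {i : Fin n} {m : ℕ} {f : DP K n}
    (h : ∀ r, coef f r ≠ 0 → r i < 2 ^ m) : pdp i m f = 0 := by
  rw [dp_eq_sum f, map_sum]
  refine Finset.sum_eq_zero fun r hr => ?_
  have hc : coef f r ≠ 0 := (Finsupp.mem_support_iff (M := K)).1 hr
  rw [Derivation.map_smul, pdp_mono, if_pos (h r hc), smul_zero]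

/-- The span of the `∂_i ^ (2 ^ m)` with `1 ≤ m ≤ j` and of all fields. -/
def sqSpan (K : Type*) [Field K] [CharP K 2] (n j : ℕ) : Submodule K (Der K n) :=
  Submodule.span K ({D | ∃ i m, 1 ≤ m ∧ m ≤ j ∧ D = pdp i m} ∪
    {D | ∃ r i, D = (mono r : DP K n) • pd i})

theorem vect_le_sqSpan (j : ℕ) : (vect K (⊤ : Fin n → ℕ∞)).toSubmodule ≤ sqSpan K n j := by
  intro D hD
  rw [vect_eq_sum hD]
  exact Submodule.sum_mem _ fun i _ => Submodule.sum_mem _ fun r _ => Submodule.smul_mem _ _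
    (Submodule.subset_span (Or.inr ⟨r, i, rfl⟩))

theorem lie_sqSpan {j : ℕ} {D E : Der K n} (hD : D ∈ sqSpan K n j) (hE : E ∈ sqSpan K n j) :
    ⁅D, E⁆ ∈ vect K (⊤ : Fin n → ℕ∞) := by
  induction hD using Submodule.span_induction with
  | mem x hx =>
    induction hE using Submodule.span_induction with
    | mem y hy =>
      rcases hx with ⟨i, m, -, -, rfl⟩ | ⟨r, i, rfl⟩ <;> rcases hy with ⟨i', m', -, -, rfl⟩ | ⟨s, k, rfl⟩
      · rw [lie_pdp_pdp]; exact zero_mem _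
      · rw [lie_pdp_smul_pd]; exact smul_pd_mem_vect _ _
      · rw [lie_comm_der, lie_pdp_smul_pd]; exact smul_pd_mem_vect _ _
      · exact LieSubalgebra.lie_mem _ (smul_pd_mem_vect _ _) (smul_pd_mem_vect _ _)
    | zero => rw [lie_zero]; exact zero_mem _
    | add x y _ _ hx hy => rw [lie_add]; exact add_mem hx hy
    | smul c x _ hx => rw [lie_smul]; exact Submodule.smul_mem _ _ hx
  | zero => rw [zero_lie]; exact zero_mem _
  | add x y _ _ hx hy => rw [add_lie]; exact add_mem hx hy
  | smul c x _ hx => rw [smul_lie]; exact Submodule.smul_mem _ _ hx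

theorem sqd_mem_sqSpan {j : ℕ} {D : Der K n} (hD : D ∈ sqSpan K n j) :
    sqd D ∈ sqSpan K n (j + 1) := by
  induction hD using Submodule.span_induction with
  | mem x hx =>
    rcases hx with ⟨i, m, h1, h2, rfl⟩ | ⟨r, i, rfl⟩
    · exact Submodule.subset_span (Or.inl ⟨i, m + 1, by omega, by omega, (pdp_succ i m).symm⟩)
    · rw [sqd_smul_pd]
      by_cases hr : r = 0
      · rw [hr, ← one_def, one_mul, one_mul, one_smul]
        exact add_mem (vect_le_sqSpan _ (smul_pd_mem_vect _ _))
          (Submodule.subset_span (Or.inl ⟨i, 1, le_rfl, by omega, rfl⟩))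
      · rw [mono_mul_self hr, zero_smul, add_zero]
        exact vect_le_sqSpan _ (smul_pd_mem_vect _ _)
  | zero =>
    have : sqd (0 : Der K n) = 0 := by ext; simp [sqd_apply]
    rw [this]; exact zero_mem _
  | add x y hx' hy' hx hy =>
    rw [sqd_add]
    exact add_mem (add_mem hx hy) (vect_le_sqSpan _ (lie_sqSpan hx' hy'))
  | smul c x _ hx => rw [sqd_smul]; exact Submodule.smul_mem _ _ hx

theorem iterate_sqd_mem_sqSpan {D : Der K n} (hD : D ∈ vect K (⊤ : Fin n → ℕ∞)) (j : ℕ) :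
    sqd^[j] D ∈ sqSpan K n j := by
  induction j with
  | zero => exact vect_le_sqSpan 0 hD
  | succ j ih => rw [Function.iterate_succ_apply']; exact sqd_mem_sqSpan ih

end Squares

/-! ### Powers of adjoint operators -/

/-- The powers `(ad x) ^ (2 ^ j)`, `j ≤ k`, span a space of dimension at most `a * k + C` modulo the
inner derivations. -/
def PowerUpper (K L : Type*) [Field K] [LieRing L] [LieAlgebra K L] (a : ℕ) : Prop :=
  ∃ C : ℕ, ∀ k : ℕ, ∃ T : Submodule K (Module.End K L), Module.Finite K T ∧
    Module.finrank K T ≤ a * k + C ∧ ∀ (x : L) (j : ℕ), j ≤ k →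
      (LieAlgebra.ad K L x) ^ (2 ^ j) ∈
        T ⊔ LinearMap.range (LieAlgebra.ad K L : L →ₗ[K] Module.End K L)

/-- For all `k`, there are `b * k` powers `(ad x) ^ (2 ^ j)`, `j ≤ k + 3`, that are linearly
independent modulo the inner derivations. -/
def PowerLower (K L : Type*) [Field K] [LieRing L] [LieAlgebra K L] (b : ℕ) : Prop :=
  ∀ k : ℕ, ∃ φ : Fin b × Fin k → Module.End K L,
    (∀ p, ∃ (x : L) (j : ℕ), j ≤ k + 3 ∧ φ p = (LieAlgebra.ad K L x) ^ (2 ^ j)) ∧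
    ∀ c : Fin b × Fin k → K,
      ∑ p, c p • φ p ∈ LinearMap.range (LieAlgebra.ad K L : L →ₗ[K] Module.End K L) → c = 0

theorem PowerLower.le {L : Type*} [LieRing L] [LieAlgebra K L] {a b : ℕ} (hb : PowerLower K L b)
    (ha : PowerUpper K L a) : b ≤ a := by
  obtain ⟨C, hC⟩ := ha
  have key : ∀ k, b * k ≤ a * (k + 3) + C := by
    intro k
    obtain ⟨T, hT, hdim, hmem⟩ := hC (k + 3)
    obtain ⟨φ, hφ, hind⟩ := hb k
    set R := LinearMap.range (LieAlgebra.ad K L : L →ₗ[K] Module.End K L) with hR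
    have hli : LinearIndependent K fun p => R.mkQ (φ p) := by
      rw [Fintype.linearIndependent_iff]
      intro c hc
      have h0 : R.mkQ (∑ p, c p • φ p) = 0 := by
        rw [map_sum, ← hc]
        exact Finset.sum_congr rfl fun p _ => map_smul _ _ _
      exact congrFun (hind c ((Submodule.Quotient.mk_eq_zero R).1 h0))
    have hT' : ∀ p, R.mkQ (φ p) ∈ T.map R.mkQ := by
      intro p
      obtain ⟨x, j, hj, e⟩ := hφ p
      obtain ⟨u, hu, v, hv, e2⟩ := Submodule.mem_sup.1 (hmem x j hj)
      refine ⟨u, hu, ?_⟩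
      rw [e, ← e2, map_add, (Submodule.Quotient.mk_eq_zero R).2 hv |> fun h => (h : R.mkQ v = 0),
        add_zero]
    have hf : Module.Finite K (T.map R.mkQ) := Module.Finite.map T R.mkQ
    have h1 : LinearIndependent K fun p => (⟨R.mkQ (φ p), hT' p⟩ : T.map R.mkQ) :=
      LinearIndependent.of_comp (T.map R.mkQ).subtype hli
    have h2 := h1.fintype_card_le_finrank
    rw [Fintype.card_prod, Fintype.card_fin, Fintype.card_fin] at h2
    exact h2.trans ((Submodule.finrank_map_le R.mkQ T).trans hdim)
  by_contra hlt
  have h1 := key (3 * a + C + 1)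
  have h2 : (a + 1) * (3 * a + C + 1) ≤ b * (3 * a + C + 1) := Nat.mul_le_mul_right _ (by omega)
  nlinarith

section Families

variable [NeZero n] [CharP K 2]

theorem lie_pdp_kf {base r : Fin n → ℕ} {s : ℕ} {L : List ℕ} (hs : s < n)
    (hb : ∀ k ∈ L, dig k (s + 1) ≤ base (Fin.ofNat n s)) (m : ℕ) :
    ⁅(pdp (Fin.ofNat n s) m : Der K n), kf K base r L⁆ = if r (Fin.ofNat n s) < 2 ^ m then 0 else
      kf K base (Function.update r (Fin.ofNat n s) (r (Fin.ofNat n s) - 2 ^ m)) L := by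
  induction m generalizing r with
  | zero =>
    have := lie_pn_kf (K := K) (base := base) (r := r) hs hb
    rw [pdp, Function.iterate_zero, id, pow_zero]
    refine this.trans ?_
    by_cases h : r (Fin.ofNat n s) = 0
    · rw [if_pos h, if_pos (by omega)]
    · rw [if_neg h, if_neg (by omega)]
  | succ m ih =>
    rw [pdp_succ, sqd_lie, ih]
    have h2 : 2 ^ (m + 1) = 2 ^ m + 2 ^ m := by ring
    by_cases h : r (Fin.ofNat n s) < 2 ^ m
    · rw [if_pos h, lie_zero, if_pos (by omega)]
    · rw [if_neg h, ih, Function.update_self, Function.update_idem, h2]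
      by_cases h3 : r (Fin.ofNat n s) - 2 ^ m < 2 ^ m
      · rw [if_pos h3, if_pos (by omega)]
      · rw [if_neg h3, if_neg (by omega), Nat.sub_sub]

theorem exists_of_coef_kf_ne_zero {base r : Fin n → ℕ} {L : List ℕ} {j : Fin n} {e : Fin n → ℕ}
    (h : coef (kf K base r L (X j)) e ≠ 0) :
    ∃ k ∈ L, (∀ i : Fin n, base i ≤ r i + dig k (i.val + 1)) ∧ e = kexp base r k := by
  induction L with
  | nil => exact absurd rfl h
  | cons a L ih =>
    rw [kf, lsum_cons, Derivation.add_apply, coef_add] at h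
    by_cases h1 : coef (kfield K base r a (X j)) e = 0
    · rw [h1, zero_add] at h
      obtain ⟨k, hk, h2⟩ := ih h
      exact ⟨k, List.mem_cons_of_mem _ hk, h2⟩
    · rw [coef_kfield] at h1
      split_ifs at h1 with hj
      · rw [kmono] at h1
        split_ifs at h1 with hc
        · rw [coef_mono] at h1
          split_ifs at h1 with he
          · exact ⟨a, by simp, hc, he.symm⟩
          · exact absurd rfl h1
        · exact absurd rfl h1
      · exact absurd rfl h1

theorem coef_zero_mul (f g : DP K n) : coef (f * g) 0 = coef f 0 * coef g 0 := by
  induction f using dp_induction with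
  | h0 => rw [zero_mul, coef_zero, zero_mul]
  | ha f₁ f₂ h₁ h₂ => rw [add_mul, coef_add, h₁, h₂, coef_add, add_mul]
  | hm a r =>
    induction g using dp_induction with
    | h0 => rw [mul_zero, coef_zero, mul_zero]
    | ha f₁ f₂ h₁ h₂ => rw [mul_add, coef_add, h₁, h₂, coef_add, mul_add]
    | hm b s =>
      rw [smul_mul', mul_smul', mono_mul_mono]
      simp only [coef_smul, coef_mono]
      by_cases hr : r = 0
      · subst hr
        have : binom (0 : Fin n → ℕ) s = 1 := by simp [binom]
        rw [this, zero_add]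
        simp
      · have : r + s ≠ 0 := fun h => hr (by
          funext i
          have := congrFun h i
          simp only [Pi.add_apply, Pi.zero_apply] at this ⊢
          omega)
        rw [if_neg hr, if_neg this]
        simp

variable {S wl : List ℕ} {Str : List (ℕ × List ℕ)}

/-- The constant terms of the brackets with a field whose coefficients have no terms of degree
less than 2. -/
theorem coef_lie_eq_zero {D E : Der K n} (hD : D ∈ vect K (⊤ : Fin n → ℕ∞))
    (hE : E ∈ vect K (⊤ : Fin n → ℕ∞)) {i : Fin n} (h : ∀ j r, coef (E (X j)) r ≠ 0 → 2 ≤ r i)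
    (j : Fin n) : coef (⁅D, E⁆ (X j)) 0 = 0 := by
  have h0 : ∀ j, coef (E (X j)) 0 = 0 := by
    intro j
    by_contra hne
    have := h j 0 hne
    simp at this
  rw [Derivation.commutator_apply, vect_apply hD (E (X j)),
    vect_apply hE (D (X j)), coef_sub, coef_sum, coef_sum,
    Finset.sum_eq_zero, Finset.sum_eq_zero, sub_zero]
  · intro l _
    rw [coef_zero_mul, h0, zero_mul]
  · intro l _
    rw [coef_zero_mul, coef_pd]
    by_contra hne
    have := h j _ (right_ne_zero_of_mul hne)
    by_cases hl : i = l
    · subst hl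
      simp at this
    · rw [Function.update_of_ne hl] at this
      simp at this

theorem ad_pow_apply {L : Type*} [LieRing L] [LieAlgebra K L] (f : L →ₗ⁅K⁆ Der K n) (x y : L)
    (j : ℕ) : f (((LieAlgebra.ad K L x) ^ (2 ^ j)) y) = ⁅sqd^[j] (f x), f y⁆ := by
  rw [iterate_sqd_lie]
  generalize 2 ^ j = m
  induction m with
  | zero => rfl
  | succ m ih =>
    rw [pow_succ', Function.iterate_succ_apply', ← ih, Module.End.mul_apply, LieAlgebra.ad_apply,
      LieHom.map_lie]

theorem powerLower_of_families (hS : SOK n S wl = true) (h : Str.all (strOK n S wl) = true)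
    (hp : pnOK S wl Str = true) {κ : ℕ} (hw : witOK n S Str κ = true)
    {L : Type*} [LieRing L] [LieAlgebra K L] (f : L →ₗ⁅K⁆ Der K n)
    (hr : LinearMap.range (f : L →ₗ[K] Der K n) = strM K n S wl Str) :
    PowerLower K L S.length := by
  intro k
  have hx : ∀ a : Fin S.length, ∃ x : L, f x = pn K n S[a] := by
    intro a
    have := sq_le_strM _ (pn_mem_strM (K := K) (n := n) hS h hp (List.getElem_mem a.2))
    rw [← hr] at this
    exact this
  choose x hx using hx
  refine ⟨fun p => (LieAlgebra.ad K L (x p.1)) ^ (2 ^ (p.2.val + 4)),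
    fun p => ⟨x p.1, p.2.val + 4, by omega, rfl⟩, ?_⟩
  rintro c ⟨y, hy⟩
  funext ⟨a, l⟩
  obtain ⟨g, L', hL, hc⟩ := exists_witness (K := K) h hw
  have hsa : ∀ a : Fin S.length, S[a] < n := fun a => SOK_lt hS (List.getElem_mem a.2)
  set r : Fin n → ℕ := Pi.single (Fin.ofNat n S[a]) (2 ^ (l.val + 4)) with hrdef
  have hr0 : ∀ i : Fin n, i.val ∉ S → r i = 0 := by
    intro i hi
    refine Pi.single_eq_of_ne (fun e => hi ?_) _
    rw [e, val_ofNat (hsa a)]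
    exact List.getElem_mem a.2
  have hY : kf K (sbase S) r L' ∈ strM K n S wl Str :=
    sq_le_strM _ (Submodule.subset_span ⟨g, L', _, hL, hr0, by simp, rfl, rfl⟩)
  have hstr := h
  rw [List.all_eq_true] at h
  have hY' := hY
  rw [← hr] at hY'
  obtain ⟨z, hz⟩ := hY'
  change f z = _ at hz
  have hdig : ∀ b : Fin S.length, ∀ k ∈ L', dig k (S[b] + 1) ≤ (sbase S : Fin n → ℕ) (Fin.ofNat n S[b]) :=
    fun b => strOK_le_eight (h _ hL) (hsa b) (List.getElem_mem b.2)
  have h8 : (sbase S : Fin n → ℕ) (Fin.ofNat n S[a]) = 8 := sbase_ofNat (hsa a) (List.getElem_mem a.2)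
  have hbig : (16 : ℕ) ≤ 2 ^ (l.val + 4) := by
    calc (16 : ℕ) = 2 ^ 4 := by norm_num
      _ ≤ _ := Nat.pow_le_pow_right (by norm_num) (by omega)
  have e1 := congrArg (fun φ : Module.End K L => coef (f (φ z) (X (Fin.ofNat n (κ % 16)))) 0) hy
  have hvec : ∀ D ∈ strM K n S wl Str, D ∈ vect K (⊤ : Fin n → ℕ∞) := fun D hD =>
    vect_le_top (strM_le_vect hstr hD)
  have eL : coef (⁅f y, f z⁆ (X (Fin.ofNat n (κ % 16)))) 0 = 0 := by
    refine coef_lie_eq_zero (i := Fin.ofNat n S[a]) (hvec _ (hr ▸ ⟨y, rfl⟩)) (hvec _ (hz ▸ hY)) ?_ _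
    intro j e he
    rw [hz] at he
    obtain ⟨q, hq, -, rfl⟩ := exists_of_coef_kf_ne_zero he
    rw [kexp, h8, hrdef, Pi.single_eq_same]
    omega
  change coef (f ⁅y, z⁆ _) 0 = _ at e1
  rw [LieHom.map_lie, eL] at e1
  have e2 : ∀ p : Fin S.length × Fin k,
      coef (f (((LieAlgebra.ad K L (x p.1)) ^ (2 ^ (p.2.val + 4))) z) (X (Fin.ofNat n (κ % 16)))) 0 =
        if p = (a, l) then 1 else 0 := by
    rintro ⟨b, m⟩
    rw [ad_pow_apply, hx, hz]
    have h1 := lie_pdp_kf (K := K) (r := r) (hsa b) (hdig b) (m.val + 4)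
    rw [pdp] at h1
    change coef ((⁅sqd^[m.val + 4] (pd (Fin.ofNat n S[b]) : Der K n), kf K (sbase S) r L'⁆ : Der K n) _) 0 = _
    rw [h1]
    by_cases hb : b = a
    · subst hb
      rw [hrdef, Pi.single_eq_same]
      by_cases hm : m = l
      · subst hm
        rw [if_neg (lt_irrefl _), if_pos rfl, Nat.sub_self]
        have : Function.update (Pi.single (Fin.ofNat n S[b]) (2 ^ (m.val + 4)) : Fin n → ℕ)
            (Fin.ofNat n S[b]) 0 = 0 := by
          funext i
          by_cases hi : i = Fin.ofNat n S[b]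
          · rw [hi, Function.update_self]; rfl
          · rw [Function.update_of_ne hi, Pi.single_eq_of_ne hi]; rfl
        rw [this]
        exact hc 0 fun _ _ => rfl
      · rw [if_neg (fun e => hm (Prod.ext_iff.1 e).2)]
        split_ifs with hlt
        · rfl
        · have hml : m.val < l.val := by
            by_contra hge
            have : l.val < m.val := lt_of_le_of_ne (by omega) fun e => hm (Fin.ext e.symm)
            exact hlt (Nat.pow_lt_pow_right (by norm_num) (by omega))
          have h3 : 2 ^ (m.val + 4) * 2 ≤ 2 ^ (l.val + 4) := by
            rw [← pow_succ]; exact Nat.pow_le_pow_right (by norm_num) (by omega)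
          by_contra hne
          obtain ⟨q, hq, -, he⟩ := exists_of_coef_kf_ne_zero hne
          have h4 := congrFun he (Fin.ofNat n S[b])
          rw [kexp, h8, Function.update_self, Pi.zero_apply] at h4
          have h5 := strOK_dig (h _ hL) hq (hsa b)
          rw [if_pos (show S[b] ∈ S from List.getElem_mem b.2)] at h5
          rw [val_ofNat (hsa b)] at h4
          omega
    · rw [if_neg (fun e => hb (Prod.ext_iff.1 e).1), if_pos]
      · rfl
      · rw [hrdef, Pi.single_eq_of_ne]
        · positivity
        · intro e
          apply hb
          have := congrArg Fin.val e
          rw [val_ofNat (hsa a), val_ofNat (hsa b)] at this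
          exact Fin.ext ((List.Nodup.getElem_inj_iff (SOK_nodup hS)).1 this)
  have e3 : ∀ s : Finset (Fin S.length × Fin k), coef (f ((∑ p ∈ s, c p •
      (LieAlgebra.ad K L (x p.1)) ^ (2 ^ (p.2.val + 4))) z) (X (Fin.ofNat n (κ % 16)))) 0 =
      ∑ p ∈ s, c p * if p = (a, l) then 1 else 0 := by
    intro s
    induction s using Finset.induction_on with
    | empty => rw [Finset.sum_empty, Finset.sum_empty, LinearMap.zero_apply, map_zero]; rfl
    | insert p s hp ih =>
      rw [Finset.sum_insert hp, Finset.sum_insert hp, LinearMap.add_apply, map_add,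
        Derivation.add_apply, coef_add, ih, LinearMap.smul_apply, map_smul, Derivation.smul_apply,
        coef_smul, e2]
  have e4 := e1.trans (e3 Finset.univ)
  simpa using e4.symm

end Families

section

variable [NeZero n] [CharP K 2]

variable {S wl : List ℕ} {Str : List (ℕ × List ℕ)} {c : ℕ} {G : ℕ → Submodule K (Der K n)}
  {Y : ℕ → List (List ℕ)} {d : List ℕ}

variable (K n) in
/-- The span of the fields with exponents less than `B`. -/
def boxSpan (B : ℕ) : Submodule K (Der K n) :=
  Submodule.span K (Set.range fun p : (Fin n → Fin B) × Fin n =>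
    ((mono fun i => (p.1 i).val : DP K n) • pd p.2 : Der K n))

theorem mem_boxSpan {B : ℕ} {D : Der K n} (hD : D ∈ vect K (⊤ : Fin n → ℕ∞))
    (h : ∀ j r, coef (D (X j)) r ≠ 0 → ∀ i, r i < B) : D ∈ boxSpan K n B := by
  rw [vect_eq_sum hD]
  refine Submodule.sum_mem _ fun j _ => Submodule.sum_mem _ fun r hr => Submodule.smul_mem _ _ ?_
  have hc := (Finsupp.mem_support_iff (M := K)).1 hr
  exact Submodule.subset_span ⟨(fun i => ⟨r i, h j r hc i⟩, j), rfl⟩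

theorem hproj_mem_boxSpan {w : Fin n → ℕ} (hw : ∀ i, 1 ≤ w i ∧ w i ≤ 2) {k : ℤ} {B : ℕ}
    (hk : k + 2 < B) (D : Der K n) : hproj w k D ∈ boxSpan K n B := by
  refine mem_boxSpan (hproj_mem_vect_top k D) fun j r hr i => ?_
  rw [coef_hproj] at hr
  split_ifs at hr with h1
  · have h2 : r i ≤ wdeg w r := by
      have h3 : w i * r i ≤ wdeg w r :=
        Finset.single_le_sum (f := fun i => w i * r i) (fun _ _ => Nat.zero_le _) (Finset.mem_univ i)
      have h4 : 1 * r i ≤ w i * r i := Nat.mul_le_mul_right _ (hw i).1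
      omega
    have h5 := (hw j).2
    have h6 : (wdeg w r : ℤ) < B := by rw [h1]; have : (w j : ℤ) ≤ 2 := by exact_mod_cast h5
                                       omega
    omega
  · exact absurd rfl hr

namespace FamilyProlong

/-- A field that normalizes the sum of the families differs from its elements by components of
bounded degree. -/
theorem mem_of_normalizes (h : FamilyProlong K n S wl Str c G Y d)
    (hw : ∀ i : Fin n, 1 ≤ (wf wl i : ℕ) ∧ wf wl i ≤ 2) {D : Der K n}
    (hD : D ∈ vect K (⊤ : Fin n → ℕ∞)) (hn : ∀ E ∈ strM K n S wl Str, ⁅D, E⁆ ∈ strM K n S wl Str) :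
    D ∈ strM K n S wl Str ⊔ boxSpan K n (c + 3) := by
  obtain ⟨F, hF⟩ := exists_sum_hproj (wf wl : Fin n → ℕ) hD
  rw [hF]
  refine Submodule.sum_mem _ fun k _ => ?_
  by_cases hk : k + 2 < (c + 3 : ℕ)
  · exact Submodule.mem_sup_right (hproj_mem_boxSpan hw hk D)
  · refine Submodule.mem_sup_left ?_
    obtain ⟨q, hq, rfl⟩ : ∃ q : ℕ, c + 2 ≤ q ∧ k = (q : ℤ) - 1 := ⟨(k + 1).toNat, by omega, by omega⟩
    have h1 := h.graded.step q hq (hproj (wf wl) ((q : ℤ) - 1) D) (hproj_mem _ D) fun y hy => ?_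
    · rw [h.eq_sq (q + 1) (by omega)] at h1
      exact sq_le_strM _ h1
    · have hy1 := hy
      rw [h.eq_sq 1 (by norm_num)] at hy1
      have h2 := hn y (sq_le_strM _ hy1)
      have h3 := hproj_mem_of_iSup (fun q => sq_le_homS h.hS h.hStr [] q) h2 q
      have hyh : y ∈ homS K (wf wl) (-1) := h.graded.homog 1 hy
      rw [lie_comm_der, hproj_lie (k := (q : ℤ) - 1) (by ring) hyh hD, lie_comm_der] at h3
      exact h.sq_le q h3

theorem powerUpper (h : FamilyProlong K n S wl Str c G Y d)
    (hw : ∀ i : Fin n, 1 ≤ (wf wl i : ℕ) ∧ wf wl i ≤ 2)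
    {L : Type*} [LieRing L] [LieAlgebra K L] (f : L →ₗ⁅K⁆ Der K n) (hf : Function.Injective f)
    (hr : LinearMap.range (f : L →ₗ[K] Der K n) = strM K n S wl Str) :
    PowerUpper K L S.length := by
  obtain ⟨π, hπ⟩ := LinearMap.exists_leftInverse_of_injective (f : L →ₗ[K] Der K n)
    (LinearMap.ker_eq_bot.2 hf)
  have hπ' : ∀ D ∈ strM K n S wl Str, f (π D) = D := by
    intro D hD
    rw [← hr] at hD
    obtain ⟨x, rfl⟩ := hD
    exact congrArg f (LinearMap.congr_fun hπ x)
  have hfm : ∀ x, f x ∈ strM K n S wl Str := fun x => hr ▸ ⟨x, rfl⟩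
  let ρ : Der K n →ₗ[K] Module.End K L :=
    { toFun := fun D => π ∘ₗ (LieAlgebra.ad K (Der K n) D : Der K n →ₗ[K] Der K n) ∘ₗ (f : L →ₗ[K] Der K n)
      map_add' := fun D E => by
        ext x
        simp
      map_smul' := fun a D => by
        ext x
        simp }
  have hρ : ∀ D x, ρ D x = π ⁅D, f x⁆ := fun _ _ => rfl
  have hbox : Module.Finite K (boxSpan K n (c + 3)) := Module.Finite.span_of_finite K (Set.finite_range _)
  refine ⟨Module.finrank K (boxSpan K n (c + 3)), fun k => ?_⟩
  let P : Submodule K (Der K n) := Submodule.span K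
    (Set.range fun p : Fin S.length × Fin k => (pdp (Fin.ofNat n S[p.1]) (p.2.val + 1) : Der K n))
  have hP : Module.Finite K P := Module.Finite.span_of_finite K (Set.finite_range _)
  have hPd : Module.finrank K P ≤ S.length * k := by
    have := finrank_range_le_card (R := K)
      (fun p : Fin S.length × Fin k => (pdp (Fin.ofNat n S[p.1]) (p.2.val + 1) : Der K n))
    rw [Fintype.card_prod, Fintype.card_fin, Fintype.card_fin] at this
    exact this
  refine ⟨(P ⊔ boxSpan K n (c + 3)).map ρ, Module.Finite.map _ ρ, ?_, fun x j hj => ?_⟩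
  · exact (Submodule.finrank_map_le ρ _).trans
      ((Submodule.finrank_add_le_finrank_add_finrank P (boxSpan K n (c + 3))).trans
        (Nat.add_le_add_right hPd _))
  · have hv : f x ∈ vect K (⊤ : Fin n → ℕ∞) := vect_le_top (strM_le_vect h.hStr (hfm x))
    have hpow : (LieAlgebra.ad K L x) ^ (2 ^ j) = ρ (sqd^[j] (f x)) := by
      ext y
      apply hf
      rw [hρ, ad_pow_apply, hπ']
      rw [← ad_pow_apply]
      exact hfm _
    let Z : Submodule K (Der K n) :=
      { carrier := {D | ∀ E ∈ strM K n S wl Str, ⁅D, E⁆ = 0}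
        zero_mem' := fun E _ => zero_lie E
        add_mem' := fun {D D'} hD hD' E hE => by rw [add_lie, hD E hE, hD' E hE, add_zero]
        smul_mem' := fun a D hD E hE => by rw [smul_lie, hD E hE, smul_zero] }
    have hdec : sqSpan K n j ≤ (P ⊔ Z) ⊔ (vect K (⊤ : Fin n → ℕ∞)).toSubmodule := by
      refine Submodule.span_le.2 ?_
      rintro D (⟨i, m, h1, h2, rfl⟩ | ⟨r, i, rfl⟩)
      · refine Submodule.mem_sup_left ?_
        by_cases hi : i.val ∈ S
        · refine Submodule.mem_sup_left ?_
          obtain ⟨a, ha, e⟩ := List.getElem_of_mem hi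
          refine Submodule.subset_span ⟨(⟨a, ha⟩, ⟨m - 1, by omega⟩), ?_⟩
          have e1 : Fin.ofNat n S[a] = i := by ext; rw [e]; exact val_ofNat i.2
          change pdp (Fin.ofNat n S[a]) (m - 1 + 1) = _
          rw [e1, Nat.sub_add_cancel h1]
        · refine Submodule.mem_sup_right fun E hE => ?_
          have hE' := strM_le_vect h.hStr hE
          rw [lie_pdp_vect i m (vect_le_top hE')]
          refine Finset.sum_eq_zero fun l _ => ?_
          rw [pdp_eq_zero_of_lt, zero_smul]
          intro r hr
          have h3 := (mem_vect_iff.1 hE').2 l r hr i 1 (by rw [shearS, if_neg hi]; rfl)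
          exact h3.trans_le (Nat.pow_le_pow_right (by norm_num) h1)
      · exact Submodule.mem_sup_right (smul_pd_mem_vect _ _)
    obtain ⟨A, hA, V, hV, e⟩ := Submodule.mem_sup.1 (hdec (iterate_sqd_mem_sqSpan hv j))
    obtain ⟨A1, hA1, A2, hA2, rfl⟩ := Submodule.mem_sup.1 hA
    have hPn : ∀ E ∈ strM K n S wl Str, ⁅A1, E⁆ ∈ strM K n S wl Str := by
      intro E hE
      clear e hA
      induction hA1 using Submodule.span_induction with
      | mem y hy =>
        obtain ⟨p, rfl⟩ := hy
        change ⁅sqd^[p.2.val + 1] (pd (Fin.ofNat n S[p.1]) : Der K n), E⁆ ∈ _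
        rw [iterate_sqd_lie]
        generalize 2 ^ (p.2.val + 1) = m
        induction m with
        | zero => exact hE
        | succ m ih =>
          rw [Function.iterate_succ_apply']
          exact h.lie_mem_of_iSup (le_iSup G _ (h.sq_le _
            (pn_mem_strM h.hS h.hStr h.pn (List.getElem_mem p.1.2)))) (iSup_mono h.sq_le ih)
      | zero => rw [zero_lie]; exact zero_mem _
      | add x y _ _ hx hy => rw [add_lie]; exact add_mem hx hy
      | smul a x _ hx => rw [smul_lie]; exact Submodule.smul_mem _ _ hx
    have hVn : ∀ E ∈ strM K n S wl Str, ⁅V, E⁆ ∈ strM K n S wl Str := by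
      intro E hE
      have h1 : ⁅V, E⁆ = ⁅sqd^[j] (f x), E⁆ - ⁅A1, E⁆ := by
        rw [← e, add_lie, add_lie, hA2 E hE]
        abel
      rw [h1]
      refine sub_mem ?_ (hPn E hE)
      have h2 := hE
      rw [← hr] at h2
      obtain ⟨y, rfl⟩ := h2
      change ⁅_, f y⁆ ∈ _
      rw [← ad_pow_apply]
      exact hfm _
    obtain ⟨V1, hV1, V2, hV2, rfl⟩ := Submodule.mem_sup.1 (h.mem_of_normalizes hw hV hVn)
    have hρZ : ρ A2 = 0 := by
      ext y
      rw [hρ, hA2 _ (hfm y), map_zero]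
      rfl
    have hρM : ρ V1 = LieAlgebra.ad K L (π V1) := by
      ext y
      apply hf
      rw [LieAlgebra.ad_apply, LieHom.map_lie, hπ' _ hV1, hρ, hπ']
      exact h.lie_mem_of_iSup (iSup_mono h.sq_le hV1) (iSup_mono h.sq_le (hfm y))
    rw [hpow, ← e, map_add, map_add, map_add, hρZ, hρM, add_zero, ← add_assoc, add_right_comm,
      ← map_add]
    exact Submodule.add_mem_sup ⟨_, Submodule.add_mem_sup hA1 hV2, rfl⟩ ⟨_, rfl⟩

end FamilyProlong

end

section

/-! ### Verification of the components of a prolong -/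

variable [NeZero n] [CharP K 2]

variable (K n) in
/-- A graded prolong that contains the families of fields. -/
structure FamilyIn (S wl : List ℕ) (Str : List (ℕ × List ℕ)) (c : ℕ)
    (G : ℕ → Submodule K (Der K n)) (Y : ℕ → List (List ℕ)) : Prop where
  hS : SOK n S wl = true
  hStr : Str.all (strOK n S wl) = true
  graded : GradedProlong (wf wl) c G
  eq_kspan : ∀ q ≤ 2, G q = kspan K n (Y q)
  close : closeOK n S wl Str (Y 1) = true
  trans : ∃ S₀, transOK n wl S₀ (Y 0 ++ Y 1) = true
  pn_ok : pnOK S wl Str = true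
  low : ∀ q ≤ c + 2, sq K n S wl Str [] q ≤ G q

variable {S wl : List ℕ} {Str : List (ℕ × List ℕ)} {c : ℕ} {G : ℕ → Submodule K (Der K n)}
  {Y : ℕ → List (List ℕ)} {d : List ℕ}

namespace FamilyIn

theorem sq_le (h : FamilyIn K n S wl Str c G Y) (q : ℕ) : sq K n S wl Str [] q ≤ G q :=
  sq_le_component h.hS h.hStr h.graded (h.eq_kspan 1 (by norm_num)) h.close h.low q

theorem eq_zero (h : FamilyIn K n S wl Str c G Y) (q : ℕ) (D : Der K n) (hD : D ∈ G (q + 2))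
    (h0 : ∀ y ∈ G 1, ⁅D, y⁆ = 0) : D = 0 := by
  obtain ⟨S₀, ht⟩ := h.trans
  refine h.graded.eq_zero (SOK_length h.hS) ht (h.eq_kspan 0 (by norm_num))
    (h.eq_kspan 1 (by norm_num)) q ?_ h0
  have := h.graded.homog _ hD
  rwa [show (((q + 2 : ℕ) : ℤ) - 2) = q by push_cast; ring] at this

theorem lie_of_kz (h : FamilyIn K n S wl Str c G Y) {q : ℕ} {D : Der K n}
    (hD : D ∈ G (q + 1)) {y : List ℕ} (hy : y ∈ Y 1) : ⁅kz K n y, D⁆ ∈ G q := by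
  rw [lie_comm_der]
  refine h.graded.lie_one q D hD _ ?_
  rw [h.eq_kspan 1 (by norm_num)]
  exact Submodule.subset_span ⟨y, hy, rfl⟩

/-- The solution of the equations for a component, in terms of a list of its elements. -/
theorem mem_of_solve (h : FamilyIn K n S wl Str c G Y) {q : ℕ} {Gs : List (List ℕ)}
    (hGs : G (q + 1) ≤ kspan K n Gs) {Z : List ℕ} (hZ : ∀ z ∈ Z, z ∈ S)
    {Es : List (List (ℕ × ℕ))} {items : List (List ℕ × ℕ × ℕ)}
    (hs : solveOK n (Y 1) Gs (Z.map fun z => [z]) Es items = true)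
    {Q : Submodule K (Der K n)} (hQ : Q ≤ G (q + 2)) (hi : kspan K n (items.map Prod.fst) ≤ Q)
    {D : Der K n} (hD : D ∈ G (q + 2)) (hDZ : ∀ z ∈ Z, ⁅pn K n z, D⁆ = 0) : D ∈ Q := by
  refine mem_of_solveOK hs (P := G (q + 2)) (hi.trans hQ) (fun E hE h0 => ?_) hi hD
    (fun y hy => hGs (h.lie_of_kz hD hy)) fun T hT => ?_
  · refine h.eq_zero q E hE fun y hy => ?_
    rw [h.eq_kspan 1 (by norm_num)] at hy
    rw [lie_comm_der]
    exact lie_kspan_eq_zero h0 hy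
  · obtain ⟨z, hz, rfl⟩ := List.mem_map.1 hT
    have h1 := SOK_lt h.hS (hZ z hz)
    have h2 := SOK_le h.hS
    rw [kz_single (by omega)]
    exact hDZ z hz

theorem eq_zero_of_solve (h : FamilyIn K n S wl Str c G Y) {q : ℕ} {Gs : List (List ℕ)}
    (hGs : G (q + 1) ≤ kspan K n Gs) {Es : List (List (ℕ × ℕ))}
    (hs : solveOK n (Y 1) Gs (S.map fun z => [z]) Es [] = true) :
    ∀ p, q + 2 ≤ p → ∀ D ∈ G p, (∀ s ∈ S, ⁅pn K n s, D⁆ = 0) → D = 0 := by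
  intro p hp D hD h0
  refine eq_zero_of_lie_pn h.hS h.graded (h.eq_kspan 1 (by norm_num)) h.close h.eq_zero
    (by omega : 2 ≤ q + 2) (fun E hE hE0 => ?_) hp D hD h0
  have := h.mem_of_solve hGs (fun z hz => hz) hs (Q := ⊥) bot_le ?_ hE hE0
  · exact (Submodule.mem_bot K).1 this
  · refine Submodule.span_le.2 ?_
    rintro _ ⟨L, hL, rfl⟩
    simp at hL

theorem pn_mem (h : FamilyIn K n S wl Str c G Y) {s : ℕ} (hs : s ∈ S) :
    pn K n s ∈ G (2 - wl.getD s 0) := h.sq_le _ (pn_mem_strM h.hS h.hStr h.pn_ok hs)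

theorem le_sq (h : FamilyIn K n S wl Str c G Y) {q₁ q₂ : ℕ} (hne : S ≠ [])
    (hw : ∀ s ∈ S, q₁ + wl.getD s 0 ≤ q₂)
    (hbase : ∀ q, q₁ ≤ q → q < q₂ → ∀ Z s R, S = Z ++ s :: R → ∀ D ∈ G q,
      (∀ z ∈ Z, ⁅pn K n z, D⁆ = 0) → D ∈ sq K n S wl Str Z q)
    (hz : ∀ q, q₂ ≤ q → ∀ D ∈ G q, (∀ s ∈ S, ⁅pn K n s, D⁆ = 0) → D = 0) (q : ℕ) (hq : q₁ ≤ q) :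
    G q ≤ sq K n S wl Str [] q := by
  intro D hD
  obtain ⟨s, R, rfl⟩ := List.exists_cons_of_ne_nil hne
  exact component_le_sq h.hS h.hStr h.graded (fun s hs => h.pn_mem hs) h.sq_le hw hbase hz q hq
    [] s R rfl D hD (by simp)

theorem familyProlong (h : FamilyIn K n S wl Str c G Y)
    (h3 : ∀ q, 3 ≤ q → G q ≤ sq K n S wl Str [] q)
    (h0 : inSpan (enumS S wl Str [] 0) (Y 0) = true)
    (h1 : inSpan (enumS S wl Str [] 1) (Y 1) = true)
    (h2 : inSpan (d :: enumS S wl Str [] 2) (Y 2) = true) (hd : inSpan (Y 2) [d] = true)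
    (hv : (Y 2).all (validL n) = true)
    (h22 : inSpan (enumS S wl Str [] 2) (brLL (Y 2) (Y 2)) = true) {Λ : List ℕ}
    (hΛ : parOK n Λ d (enumS S wl Str [] 2) = true) (hlo : loOK n d = true) :
    FamilyProlong K n S wl Str c G Y d where
  hS := h.hS
  hStr := h.hStr
  graded := h.graded
  eq_kspan := h.eq_kspan
  close := h.close
  trans := h.trans
  pn := h.pn_ok
  valid := hv
  two_two := h22
  not_mem := ⟨Λ, hΛ⟩
  lo := hlo
  eq_sq q hq := by
    refine le_antisymm ?_ (h.sq_le q)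
    by_cases hq3 : 3 ≤ q
    · exact h3 q hq3
    · rw [h.eq_kspan q (by omega)]
      have : q = 0 ∨ q = 1 := by omega
      rcases this with rfl | rfl
      · exact le_sq_of_inSpan h.hS h.hStr (by simp) h0
      · exact le_sq_of_inSpan h.hS h.hStr (by simp) h1
  eq_two := by
    apply le_antisymm
    · rw [h.eq_kspan 2 le_rfl]
      refine (kspan_le_of_inSpan h2).trans fun D hD => ?_
      obtain ⟨a, E, hE, rfl⟩ := kspan_cons hD
      refine add_mem (Submodule.mem_sup_right ?_)
        (Submodule.mem_sup_left (kspan_enumS_le h.hS h.hStr (by simp) 2 hE))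
      exact Submodule.smul_mem _ _ (Submodule.mem_span_singleton_self _)
    · refine sup_le (h.sq_le 2) ?_
      rw [Submodule.span_singleton_le_iff_mem, h.eq_kspan 2 le_rfl]
      exact inSpan_mem hd (List.mem_singleton_self _)

end FamilyIn

/-! #### Fields given by lists of indeterminates -/

/-- The key of `x_{a_1} ⋯ x_{a_k} ∂_b`. -/
def vfKey (p : List ℕ × ℕ) : ℕ := (p.2 - 1) + (p.1.map fun a => 16 ^ a).sum

/-- The lists span the same space of fields. -/
def vfOK (n : ℕ) (l : List (List (List ℕ × ℕ))) (Y : List (List ℕ)) : Bool :=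
  inSpan Y (l.map fun v => v.map vfKey) && inSpan (l.map fun v => v.map vfKey) Y &&
  l.all fun v => v.all fun p =>
    Nat.beq (vfKey p % 16) (p.2 - 1) &&
      (List.range n).all fun i => Nat.beq (dig (vfKey p) (i + 1)) (p.1.count (i + 1))

theorem vfSpan_eq {l : List (List (List ℕ × ℕ))} {Y : List (List ℕ)} (h : vfOK n l Y = true) :
    vfSpan K n l = kspan K n Y := by
  rw [vfOK, Bool.and_eq_true, Bool.and_eq_true, List.all_eq_true] at h
  obtain ⟨⟨h', h''⟩, h⟩ := h
  have key : ∀ v ∈ l, vf K n v = kz K n (v.map vfKey) := by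
    intro v hv
    have h1 := h v hv
    rw [List.all_eq_true] at h1
    rw [vf, kz, kf, lsum, List.map_map]
    congr 1
    refine List.map_congr_left fun p hp => ?_
    have h2 := h1 p hp
    rw [Bool.and_eq_true, Nat.beq_eq, List.all_eq_true] at h2
    rw [Function.comp_apply, kfield, h2.1,
      kmono_of_le (base := 0) (r := 0) fun i => Nat.zero_le _]
    congr 2
    funext i
    have h3 := h2.2 i (List.mem_range.2 i.2)
    rw [Nat.beq_eq] at h3
    simp [kexp, expo, h3]
  refine Eq.trans ?_ (le_antisymm (kspan_le_of_inSpan h') (kspan_le_of_inSpan h''))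
  rw [vfSpan, kspan]
  congr 1
  ext D
  constructor
  · rintro ⟨v, hv, rfl⟩
    exact ⟨_, List.mem_map_of_mem hv, key v hv⟩
  · rintro ⟨L, hL, rfl⟩
    obtain ⟨v, hv, rfl⟩ := List.mem_map.1 hL
    exact ⟨v, hv, (key v hv).symm⟩

theorem span_pd_eq (hn : n ≤ 15) :
    Submodule.span K (Set.range (pd : Fin n → Der K n)) =
      kspan K n ((List.range n).map fun i => [i]) := by
  rw [kspan]
  congr 1
  ext D
  constructor
  · rintro ⟨i, rfl⟩
    refine ⟨[i.val], List.mem_map.2 ⟨i.val, List.mem_range.2 i.2, rfl⟩, ?_⟩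
    rw [kz_single (by omega)]
    congr 1
    ext
    exact (val_ofNat i.2).symm
  · rintro ⟨L, hL, rfl⟩
    obtain ⟨i, hi, rfl⟩ := List.mem_map.1 hL
    rw [List.mem_range] at hi
    rw [kz_single (by omega)]
    exact ⟨_, rfl⟩

theorem kspan_le_vect {Y : List (List ℕ)} (h : Y.all (loOK n) = true) {N : Fin n → ℕ∞}
    (hN : ∀ i, 1 ≤ N i) : kspan K n Y ≤ (vect K N).toSubmodule := by
  rw [List.all_eq_true] at h
  refine Submodule.span_le.2 ?_
  rintro _ ⟨L, hL, rfl⟩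
  exact kz_mem_vect_of_loOK (h L hL) hN

theorem kspan_nil : kspan K n [] = ⊥ := by
  rw [kspan, Submodule.span_eq_bot]
  rintro _ ⟨L, hL, rfl⟩
  simp at hL

/-! #### The items for a list of fields -/

theorem redItem_mem {P : Submodule K (Der K n)} {D : List ℕ} (hD : kz K n D ∈ P)
    {items : List (List ℕ × ℕ × ℕ)} (hi : ∀ i ∈ items, kz K n i.1 ∈ P) (v : ℕ) :
    kz K n (redItem items D v).1 ∈ P := by
  induction items generalizing D v with
  | nil => exact hD
  | cons i l ih =>
    have hl := fun j hj => hi j (List.mem_cons_of_mem _ hj)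
    rw [redItem]
    cases v.testBit (64 + i.2.2) with
    | false => exact ih hD hl _
    | true =>
      refine ih ?_ hl _
      rw [kz_cancel, kz_append]
      exact add_mem hD (hi i List.mem_cons_self)

theorem addItem_mem {P : Submodule K (Der K n)} {items : List (List ℕ × ℕ × ℕ)}
    (hi : ∀ i ∈ items, kz K n i.1 ∈ P) {D : List ℕ × ℕ} (hD : kz K n D.1 ∈ P) :
    ∀ i ∈ addItem items D, kz K n i.1 ∈ P := by
  obtain ⟨D, v⟩ := D
  cases v with
  | zero => exact hi
  | succ v =>
    intro i h
    rw [addItem, List.mem_cons] at h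
    rcases h with rfl | h
    · exact hD
    · obtain ⟨j, hj, rfl⟩ := List.mem_map.1 h
      cases j.2.1.testBit v.succ.log2 with
      | false => exact hi j hj
      | true =>
        change kz K n (cancel (D ++ j.1)) ∈ P
        rw [kz_cancel, kz_append]
        exact add_mem hD (hi j hj)

theorem kspan_mkItems_le (ys Gs Ds : List (List ℕ)) :
    kspan K n ((mkItems ys Gs Ds).map Prod.fst) ≤ kspan K n Ds := by
  refine Submodule.span_le.2 ?_
  rintro _ ⟨L, hL, rfl⟩
  obtain ⟨i, hi, rfl⟩ := List.mem_map.1 hL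
  rw [mkItems] at hi
  have key : ∀ (Es : List (List ℕ)) (f : List ℕ → ℕ) (items : List (List ℕ × ℕ × ℕ)),
      (∀ D ∈ Es, D ∈ Ds) → (∀ i ∈ items, kz K n i.1 ∈ kspan K n Ds) →
      ∀ i ∈ Es.foldl (fun items D => addItem items (redItem items D (f D))) items,
        kz K n i.1 ∈ kspan K n Ds := by
    intro Es f
    induction Es with
    | nil => exact fun items _ h => h
    | cons D l ih =>
      intro items h1 h2
      refine ih _ (fun E hE => h1 E (List.mem_cons_of_mem _ hE)) ?_
      exact addItem_mem h2 (redItem_mem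
        (show kz K n D ∈ kspan K n Ds from
          Submodule.subset_span ⟨D, h1 D List.mem_cons_self, rfl⟩) h2 _)
  exact key Ds _ [] (fun _ h => h) (by simp) i hi

namespace FamilyIn

theorem mem_sq_of_solve (h : FamilyIn K n S wl Str c G Y) {q : ℕ} {Gs : List (List ℕ)}
    (hGs : G (q + 1) ≤ kspan K n Gs) {Z : List ℕ} (hZ : ∀ z ∈ Z, z ∈ S)
    {Es : List (List (ℕ × ℕ))} (hs : solveOK n (Y 1) Gs (Z.map fun z => [z]) Es
      (mkItems (Y 1) Gs (enumS S wl Str Z (q + 2))) = true)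
    {D : Der K n} (hD : D ∈ G (q + 2)) (hDZ : ∀ z ∈ Z, ⁅pn K n z, D⁆ = 0) :
    D ∈ sq K n S wl Str Z (q + 2) :=
  h.mem_of_solve hGs hZ hs ((sq_mono (by simp) _).trans (h.sq_le _))
    ((kspan_mkItems_le _ _ _).trans (kspan_enumS_le h.hS h.hStr hZ _)) hD hDZ

end FamilyIn

/-! #### Prolongs of components given by lists -/

section

variable {low neg mid top : Submodule K (Der K n)}

theorem gradedProlong_gcomp (hl : wl.length = n)
    (hY : ∀ q, q ≤ c + 2 → gcomp (wf wl) ⊤ c low neg mid top q = kspan K n (Y q))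
    (h : gradOK n wl c Y = true) : GradedProlong (wf wl) c (gcomp (wf wl) ⊤ c low neg mid top) :=
  gradedProlong_of_gradOK hl hY (fun _ hq _ => gcomp_succ hq) h

theorem familyIn_gcomp (hS : SOK n S wl = true) (hStr : Str.all (strOK n S wl) = true)
    (hY : ∀ q, q ≤ c + 2 → gcomp (wf wl) ⊤ c low neg mid top q = kspan K n (Y q))
    (h : gradOK n wl c Y = true) (hclose : closeOK n S wl Str (Y 1) = true) {S₀ : List ℕ}
    (htrans : transOK n wl S₀ (Y 0 ++ Y 1) = true) (hpn : pnOK S wl Str = true)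
    (hlow : ∀ q, q ≤ c + 2 → sq K n S wl Str [] q ≤ kspan K n (Y q)) :
    FamilyIn K n S wl Str c (gcomp (wf wl) ⊤ c low neg mid top) Y where
  hS := hS
  hStr := hStr
  graded := gradedProlong_gcomp (SOK_length hS) hY h
  eq_kspan q hq := hY q (by omega)
  close := hclose
  trans := ⟨S₀, htrans⟩
  pn_ok := hpn
  low q hq := by rw [hY q hq]; exact hlow q hq

theorem prolong_eq_inf_of_loOK (hmid : c = 0 → mid = ⊥)
    (h : GradedProlong (wf wl) c (gcomp (wf wl) ⊤ c low neg mid top))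
    (hY : ∀ q, q ≤ c + 2 → gcomp (wf wl) ⊤ c low neg mid top q = kspan K n (Y q))
    (hlo : ∀ q, q ≤ c + 2 → (Y q).all (loOK n) = true) {N : Fin n → ℕ∞} (hN : ∀ i, 1 ≤ N i) :
    prolong (wf wl) N c low neg mid top =
      prolong (wf wl) ⊤ c low neg mid top ⊓ vect K N := by
  have key : ∀ q, q ≤ c + 2 →
      gcomp (wf wl) ⊤ c low neg mid top q ≤ (vect K N).toSubmodule := fun q hq => by
    rw [hY q hq]; exact kspan_le_vect (hlo q hq) hN
  refine h.prolong_eq_inf hmid (key 0 (by omega)) (key 1 (by omega)) ?_ ?_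
  · rcases Nat.eq_zero_or_pos c with h0 | h0
    · rw [hmid h0]; exact bot_le
    · have := key 2 (by omega)
      rwa [gcomp, if_pos h0] at this
  · have := key (c + 2) le_rfl
    rwa [gcomp, if_neg (lt_irrefl c), Nat.sub_self] at this

end

/-- The relations among the brackets of the fields, modulo the fields `Ts`. -/
def relPairs (ys Ts : List (List ℕ)) : List (List (ℕ × ℕ)) :=
  let ps := (List.range ys.length).flatMap fun q => (List.range q).map fun p =>
    ((p, q), brL (ys.getD p []) (ys.getD q []))
  ps.flatMap fun x => bif relOK Ts x.2 then [[x.1]] else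
    match ps.find? fun y => eqv y.2 x.2 with
    | some y => bif Nat.beq y.1.1 x.1.1 && Nat.beq y.1.2 x.1.2 then [] else [[y.1, x.1]]
    | none => []

end

/-! ### The algebra `kas~(7; N)` -/

/-- The families of elements of `kas~(7; N)`. -/
def kas7tStr : List (ℕ × List ℕ) :=
  [(1, [0x68811081, 0x77810181, 0x77811082, 0x78701181, 0x78711083, 0x78801084, 0x78810085,
   0x86810182, 0x87701182, 0x87710183, 0x87800184, 0x87810086, 0x88601183, 0x88700185, 0x88701086,
   0x88800080, 0x88800171, 0x88801072, 0x88810073]), (0, [0x78800081, 0x87800082, 0x88700083]),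
   (0, [0x68801081, 0x77800181, 0x77801082, 0x78701083, 0x78800085, 0x86800182, 0x87700183,
   0x87800086, 0x88800073]), (0, [0x68810081, 0x77810082, 0x78700181, 0x78710083, 0x78800084,
   0x87700182, 0x88600183, 0x88700086, 0x88800072]), (0, [0x77810081, 0x78701081, 0x86810082,
   0x87701082, 0x87710083, 0x87800084, 0x88601083, 0x88700085, 0x88800071])]

/-- The component of degree 0 of `kas~(7; N)`. -/
def kas7tGen : List (List ℕ) :=
  [[0x100000, 0x105, 0x1006], [0x1000000, 0x104, 0x10006], [0x10000000, 0x1004, 0x10005], [0x10,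
   0x101, 0x1002, 0x10003, 0x100004, 0x1000005, 0x10000006], [0x100004, 0x101, 0x1002],
   [0x1000005, 0x101, 0x10003], [0x10000006, 0x1002, 0x10003], [0x100005, 0x1003], [0x100006,
   0x103], [0x1000004, 0x10002], [0x1000006, 0x102], [0x10000004, 0x10001], [0x10000005, 0x1001],
   [0x100003], [0x1000002], [0x10000001], [0x1000001, 0x10000002], [0x100001, 0x10000003],
   [0x100002, 0x1000003], [0x14, 0x10000002], [0x15, 0x100001], [0x16, 0x1000003], [0x11], [0x12],
   [0x13]]

/-- The element of degree 0 that is not in the derived algebra. -/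
def kas7tD : List ℕ := [0x10, 0x101, 0x1002, 0x10003, 0x100004, 0x1000005, 0x10000006]

/-- The components of nonpositive degrees of `kas~(7; N)`. -/
def kas7tY : ℕ → List (List ℕ)
  | 0 => []
  | 1 => (List.range 7).map fun i => [i]
  | _ => kas7tGen

def kas7tCert : List ((ℕ × ℕ) × List (ℕ × ℕ)) :=
  [((1, 3), [(2, 1), (2, 0)]), ((1, 2), [(2, 2), (2, 0)]), ((1, 6), [(2, 0)]), ((1, 1), [(2, 2), (2, 1)]), ((1, 5), [(2, 1)]), ((1, 9), [(2, 2)]), ((1, 0), [])]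

set_option maxRecDepth 100000

theorem kas7t_SOK :
    SOK 7 [0, 4, 5, 6] wt7t = true := by
  decide +kernel

theorem kas7t_strOK :
    kas7tStr.all (strOK 7 [0, 4, 5, 6] wt7t) = true := by
  decide +kernel

theorem kas7t_closeOK :
    closeOK 7 [0, 4, 5, 6] wt7t kas7tStr (kas7tY 1) = true := by
  decide +kernel

theorem kas7t_transOK :
    transOK 7 wt7t [] (kas7tY 0 ++ kas7tY 1) = true := by
  decide +kernel

theorem kas7t_pnOK :
    pnOK [0, 4, 5, 6] wt7t kas7tStr = true := by
  decide +kernel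

theorem kas7t_gradOK :
    gradOK 7 wt7t 0 kas7tY = true := by
  decide +kernel

theorem kas7t_low0 :
    inSpan (kas7tY 0) (enumS [0, 4, 5, 6] wt7t kas7tStr [] 0) = true := by
  decide +kernel

theorem kas7t_low1 :
    inSpan (kas7tY 1) (enumS [0, 4, 5, 6] wt7t kas7tStr [] 1) = true := by
  decide +kernel

theorem kas7t_low2 :
    inSpan (kas7tY 2) (enumS [0, 4, 5, 6] wt7t kas7tStr [] 2) = true := by
  decide +kernel

theorem kas7t_up0 :
    inSpan (enumS [0, 4, 5, 6] wt7t kas7tStr [] 0) (kas7tY 0) = true := by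
  decide +kernel

theorem kas7t_up1 :
    inSpan (enumS [0, 4, 5, 6] wt7t kas7tStr [] 1) (kas7tY 1) = true := by
  decide +kernel

theorem kas7t_up2 :
    inSpan (kas7tD :: enumS [0, 4, 5, 6] wt7t kas7tStr [] 2) (kas7tY 2) = true := by
  decide +kernel

theorem kas7t_d :
    inSpan (kas7tY 2) [kas7tD] = true := by
  decide +kernel

theorem kas7t_lo :
    loOK 7 kas7tD = true := by
  decide +kernel

theorem kas7t_valid :
    (kas7tY 2).all (validL 7) = true := by
  decide +kernel

theorem kas7t_two_two :
    inSpan (enumS [0, 4, 5, 6] wt7t kas7tStr [] 2) (brLL (kas7tY 2) (kas7tY 2)) = true := by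
  decide +kernel

theorem kas7t_parOK :
    parOK 7 [0x101, 0x10003, 0x1000005] kas7tD (enumS [0, 4, 5, 6] wt7t kas7tStr [] 2) = true := by
  decide +kernel

theorem kas7t_witOK :
    witOK 7 [0, 4, 5, 6] kas7tStr 0x88800080 = true := by
  decide +kernel

theorem kas7t_smallOK :
    smallOK 7 [0, 4, 5, 6] (kas7tY 2) = true := by
  decide +kernel

theorem kas7t_certOK :
    certOK 7 [0] (certOf [0, 4, 5, 6] wt7t kas7tStr kas7tCert) = true := by
  decide +kernel

theorem kas7t_cert_span :
    inSpan ((certOf [0, 4, 5, 6] wt7t kas7tStr kas7tCert).map Prod.fst)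
      (enumS [0, 4, 5, 6] wt7t kas7tStr [] 0 ++ enumS [0, 4, 5, 6] wt7t kas7tStr [] 1) = true := by
  decide +kernel

theorem kas7t_solve0 :
    solveOK 7 (kas7tY 1) (kas7tY 2) (([] : List ℕ).map fun z => [z]) (relPairs (kas7tY 1) [])
      (mkItems (kas7tY 1) (kas7tY 2) (enumS [0, 4, 5, 6] wt7t kas7tStr [] 3)) = true := by
  decide +kernel

theorem kas7t_solve1 :
    solveOK 7 (kas7tY 1) (kas7tY 2) ([0].map fun z => [z]) (relPairs (kas7tY 1) [])
      (mkItems (kas7tY 1) (kas7tY 2) (enumS [0, 4, 5, 6] wt7t kas7tStr [0] 3)) = true := by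
  decide +kernel

theorem kas7t_solve2 :
    solveOK 7 (kas7tY 1) (kas7tY 2) ([0, 4].map fun z => [z]) (relPairs (kas7tY 1) [])
      (mkItems (kas7tY 1) (kas7tY 2) (enumS [0, 4, 5, 6] wt7t kas7tStr [0, 4] 3)) = true := by
  decide +kernel

theorem kas7t_solve3 :
    solveOK 7 (kas7tY 1) (kas7tY 2) ([0, 4, 5].map fun z => [z]) (relPairs (kas7tY 1) [])
      (mkItems (kas7tY 1) (kas7tY 2) (enumS [0, 4, 5, 6] wt7t kas7tStr [0, 4, 5] 3)) = true := by
  decide +kernel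

theorem kas7t_zero :
    solveOK 7 (kas7tY 1) (kas7tY 2) ([0, 4, 5, 6].map fun z => [z]) (relPairs (kas7tY 1) []) [] = true := by
  decide +kernel

section
variable [CharP K 2]

set_option maxRecDepth 100000 in
theorem kas7tZero_eq : kas7tZero K = kspan K 7 (kas7tY 2) :=
  vfSpan_eq (by decide +kernel)

variable (K) in
/-- The components of `kas~(7; N)` for `N = ∞`. -/
def kas7tComp : ℕ → Submodule K (Der K 7) :=
  gcomp (wf wt7t) ⊤ 0 ⊥ (Submodule.span K (Set.range pd)) ⊥ (kas7tZero K)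

theorem kas7tComp_eq (q : ℕ) (hq : q ≤ 0 + 2) : kas7tComp K q = kspan K 7 (kas7tY q) := by
  interval_cases q
  · exact kspan_nil.symm
  · exact span_pd_eq (by norm_num)
  · exact kas7tZero_eq

theorem kas7t_familyIn : FamilyIn K 7 [0, 4, 5, 6] wt7t kas7tStr 0
    (kas7tComp K) kas7tY :=
  familyIn_gcomp kas7t_SOK kas7t_strOK kas7tComp_eq kas7t_gradOK kas7t_closeOK kas7t_transOK
    kas7t_pnOK fun q hq => by
      interval_cases q
      · exact sq_le_of_inSpan kas7t_SOK kas7t_strOK (by norm_num) kas7t_low0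
      · exact sq_le_of_inSpan kas7t_SOK kas7t_strOK (by norm_num) kas7t_low1
      · exact sq_le_of_inSpan kas7t_SOK kas7t_strOK (by norm_num) kas7t_low2

theorem kas7t_le_sq (q : ℕ) (hq : 3 ≤ q) :
    kas7tComp K q ≤ sq K 7 [0, 4, 5, 6] wt7t kas7tStr [] q := by
  have h := kas7t_familyIn (K := K)
  have h2 : kas7tComp K (1 + 1) ≤ kspan K 7 (kas7tY 2) := (kas7tComp_eq 2 le_rfl).le
  refine h.le_sq (q₁ := 3) (q₂ := 4) (by simp) (by decide) ?_ ?_ q hq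
  · intro q h3 h4 Z s R hZ D hD hDZ
    obtain rfl : q = 3 := by omega
    rcases Z with _ | ⟨a, _ | ⟨b, _ | ⟨c, _ | ⟨d, Z⟩⟩⟩⟩ <;>
      simp only [List.nil_append, List.cons_append, List.cons.injEq] at hZ
    · exact h.mem_sq_of_solve h2 (by simp) kas7t_solve0 hD hDZ
    · obtain ⟨rfl, -⟩ := hZ
      exact h.mem_sq_of_solve h2 (by simp) kas7t_solve1 hD hDZ
    · obtain ⟨rfl, rfl, -⟩ := hZ
      exact h.mem_sq_of_solve h2 (by simp) kas7t_solve2 hD hDZ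
    · obtain ⟨rfl, rfl, rfl, -⟩ := hZ
      exact h.mem_sq_of_solve h2 (by simp) kas7t_solve3 hD hDZ
    · obtain ⟨-, -, -, -, hZ⟩ := hZ
      simp at hZ
  · intro q hq D hD h0
    exact h.eq_zero_of_solve h2 kas7t_zero q (by omega) D hD h0

theorem kas7t_familyProlong : FamilyProlong K 7 [0, 4, 5, 6] wt7t kas7tStr 0
    (kas7tComp K) kas7tY kas7tD :=
  kas7t_familyIn.familyProlong kas7t_le_sq kas7t_up0 kas7t_up1 kas7t_up2 kas7t_d
    kas7t_valid kas7t_two_two kas7t_parOK kas7t_lo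

theorem kas7t_eq (N : Fin 7 → ℕ∞) : kas7t K N =
    prolong (wf wt7t) N 0 ⊥ (Submodule.span K (Set.range pd)) ⊥
      (kas7tZero K) := by
  rw [kas7t]
  congr 1
  funext i
  fin_cases i <;> rfl

theorem kas7t_model : Model (kas7t K) [0, 4, 5, 6]
    (strM K 7 [0, 4, 5, 6] wt7t kas7tStr)
    (kz K 7 kas7tD) := by
  refine kas7t_familyProlong.model kas7t_witOK kas7t_smallOK (by simp) kas7t_certOK
    kas7t_cert_span (fun N hN => ?_) ?_
  · rw [kas7t_eq, kas7t_eq]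
    refine prolong_eq_inf_of_loOK (fun _ => rfl) kas7t_familyIn.graded kas7tComp_eq
      (fun q hq => ?_) hN
    interval_cases q <;> decide +kernel
  · rw [kas7t_eq]
    exact kas7t_familyIn.graded.prolong_top fun _ => rfl

end

/-! ### The algebra `kas(10; N)` -/

/-- The component of degree -1 of `kas(10; N)`. -/
def kas10Neg : List (List ℕ) :=
  [[0x2], [0x3], [0x4], [0x5], [0x6, 0x100000], [0x7, 0x1000000], [0x8, 0x1000, 0x10000001], [0x9,
   0x10000, 0x100000001]]

/-- The families of elements of `kas(10; N)` that generate the others. -/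
def kas10Seed : List (List ℕ) :=
  [[0x10000882, 0x100000883, 0x1000000884, 0x1010000880, 0x1110000783, 0x1110000877,
   0x10000000885, 0x10100000880, 0x10110000782, 0x10110000876, 0x11010000879, 0x11100000878,
   0x11110000780, 0x11110000871], [0x1883, 0x1000884, 0x10000887, 0x11001872, 0x101001873,
   0x111000877, 0x1001001874, 0x1010001783, 0x1010001877, 0x1011000784, 0x1011001870,
   0x1111001773, 0x1111001867, 0x10000000888, 0x10001001875, 0x10010001782, 0x10010001876,
   0x10011000785, 0x10011000879, 0x10101000878, 0x10101001870, 0x10111000780, 0x10111001772,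
   0x10111001866, 0x11000001878, 0x11010000788, 0x11010001780, 0x11010001871, 0x11011001869,
   0x11101001868, 0x11111000778, 0x11111001770, 0x11111001861], [0x10882, 0x100885, 0x10110872,
   0x100000886, 0x100110873, 0x110100876, 0x1000000889, 0x1000110874, 0x1010100879, 0x1010110870,
   0x1100010783, 0x1100010877, 0x1100100784, 0x1100100878, 0x1110100780, 0x1110110773,
   0x1110110867, 0x10000110875, 0x10100010782, 0x10100010876, 0x10100100785, 0x10100110870,
   0x10110110772, 0x10110110866, 0x11000010879, 0x11010110869, 0x11100000789, 0x11100010780,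
   0x11100010871, 0x11100110868, 0x11110100779, 0x11110110770, 0x11110110861]]

/-- The bracket of the `i`-th element of degree -1 with a list of keys. -/
def brNeg (i : ℕ) (L : List ℕ) : List ℕ := cancel (brL (kas10Neg.getD i []) L)

/-- The families of elements of `kas(10; N)`. -/
def kas10Str : List (ℕ × List ℕ) :=
  let M := cancel (brL [0x10002, 0x100005, 0x100000006, 0x1000000009] (kas10Seed.getD 1 []))
  let A := brNeg 4 M
  (List.range 8).map (fun i => (1, brNeg i M)) ++
    ([brNeg 2 A, brNeg 6 A].map (fun L => (0, L)) ++
      ((kas10Seed ++ [M]).map (fun L => (2, L)) ++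
        [brNeg 3 (brNeg 6 M), brNeg 1 A].map fun L => (0, L)))

/-- The element of degree 0 that is not in the derived algebra. -/
def kas10D : List ℕ := [0x1002, 0x100004, 0x10000006, 0x1000000008]

/-- The components of nonpositive degrees of `kas(10; N)`. -/
def kas10Y : ℕ → List (List ℕ)
  | 0 => [[0], [1]]
  | 1 => kas10Neg
  | _ => kas10D :: enumS [0, 1] wt10 kas10Str [] 2

def kas10Cert : List ((ℕ × ℕ) × List (ℕ × ℕ)) :=
  [((1, 6), [(1, 0)]), ((1, 7), [(1, 1)]), ((1, 4), [(1, 2)]), ((1, 5), [(1, 3)]), ((1, 2), [(1, 4)]), ((1, 3), [(1, 5)]), ((1, 0), [(1, 6)]), ((1, 1), [(1, 7)]), ((0, 1), [(2, 0)]), ((0, 0), [])]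

set_option maxRecDepth 100000

theorem kas10_SOK :
    SOK 10 [0, 1] wt10 = true := by
  decide +kernel

theorem kas10_strOK :
    kas10Str.all (strOK 10 [0, 1] wt10) = true := by
  decide +kernel

theorem kas10_closeOK :
    closeOK 10 [0, 1] wt10 kas10Str (kas10Y 1) = true := by
  decide +kernel

theorem kas10_transOK :
    transOK 10 wt10 [0, 1] (kas10Y 0 ++ kas10Y 1) = true := by
  decide +kernel

theorem kas10_pnOK :
    pnOK [0, 1] wt10 kas10Str = true := by
  decide +kernel

theorem kas10_gradOK :
    gradOK 10 wt10 0 kas10Y = true := by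
  decide +kernel

theorem kas10_low0 :
    inSpan (kas10Y 0) (enumS [0, 1] wt10 kas10Str [] 0) = true := by
  decide +kernel

theorem kas10_low1 :
    inSpan (kas10Y 1) (enumS [0, 1] wt10 kas10Str [] 1) = true := by
  decide +kernel

theorem kas10_low2 :
    inSpan (kas10Y 2) (enumS [0, 1] wt10 kas10Str [] 2) = true := by
  decide +kernel

theorem kas10_up0 :
    inSpan (enumS [0, 1] wt10 kas10Str [] 0) (kas10Y 0) = true := by
  decide +kernel

theorem kas10_up1 :
    inSpan (enumS [0, 1] wt10 kas10Str [] 1) (kas10Y 1) = true := by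
  decide +kernel

theorem kas10_up2 :
    inSpan (kas10D :: enumS [0, 1] wt10 kas10Str [] 2) (kas10Y 2) = true := by
  decide +kernel

theorem kas10_d :
    inSpan (kas10Y 2) [kas10D] = true := by
  decide +kernel

theorem kas10_lo :
    loOK 10 kas10D = true := by
  decide +kernel

theorem kas10_valid :
    (kas10Y 2).all (validL 10) = true := by
  decide +kernel

theorem kas10_two_two :
    inSpan (enumS [0, 1] wt10 kas10Str [] 2) (brLL (kas10Y 2) (kas10Y 2)) = true := by
  decide +kernel

theorem kas10_parOK :
    parOK 10 [0x10, 0x1000000008, 0x100000007] kas10D (enumS [0, 1] wt10 kas10Str [] 2) = true := by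
  decide +kernel

theorem kas10_witOK :
    witOK 10 [0, 1] kas10Str 0x880 = true := by
  decide +kernel

theorem kas10_smallOK :
    smallOK 10 [0, 1] (kas10Y 2) = true := by
  decide +kernel

theorem kas10_certOK :
    certOK 10 [0] (certOf [0, 1] wt10 kas10Str kas10Cert) = true := by
  decide +kernel

theorem kas10_cert_span :
    inSpan ((certOf [0, 1] wt10 kas10Str kas10Cert).map Prod.fst)
      (enumS [0, 1] wt10 kas10Str [] 0 ++ enumS [0, 1] wt10 kas10Str [] 1) = true := by
  decide +kernel

theorem kas10_solve03 :
    solveOK 10 (kas10Y 1) (kas10Y 2) (([] : List ℕ).map fun z => [z])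
      (relPairs (kas10Y 1) [])
      (mkItems (kas10Y 1) (kas10Y 2) (enumS [0, 1] wt10 kas10Str [] 3)) = true := by
  decide +kernel

theorem kas10_solve04 :
    solveOK 10 (kas10Y 1) (enumS [0, 1] wt10 kas10Str [] 3) (([] : List ℕ).map fun z => [z])
      (relPairs (kas10Y 1) [])
      (mkItems (kas10Y 1) (enumS [0, 1] wt10 kas10Str [] 3) (enumS [0, 1] wt10 kas10Str [] 4)) = true := by
  decide +kernel

theorem kas10_solve13 :
    solveOK 10 (kas10Y 1) (kas10Y 2) ([0].map fun z => [z])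
      (relPairs (kas10Y 1) [[0]])
      (mkItems (kas10Y 1) (kas10Y 2) (enumS [0, 1] wt10 kas10Str [0] 3)) = true := by
  decide +kernel

theorem kas10_solve14 :
    solveOK 10 (kas10Y 1) (enumS [0, 1] wt10 kas10Str [] 3) ([0].map fun z => [z])
      (relPairs (kas10Y 1) [[0]])
      (mkItems (kas10Y 1) (enumS [0, 1] wt10 kas10Str [] 3) (enumS [0, 1] wt10 kas10Str [0] 4)) = true := by
  decide +kernel

theorem kas10_zero :
    solveOK 10 (kas10Y 1) (kas10Y 2) ([0, 1].map fun z => [z])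
      (relPairs (kas10Y 1) [[0], [1]]) [] = true := by
  decide +kernel

section
variable [CharP K 2]

theorem kas10NegTwo_eq : kas10NegTwo K = kspan K 10 (kas10Y 0) :=
  vfSpan_eq (by decide +kernel)

theorem kas10NegOne_eq : kas10NegOne K = kspan K 10 (kas10Y 1) :=
  vfSpan_eq (by decide +kernel)

theorem kas10Zero_eq : kas10Zero K = kspan K 10 (kas10Y 2) :=
  vfSpan_eq (by decide +kernel)

variable (K) in
/-- The components of `kas(10; N)` for `N = ∞`. -/
def kas10Comp : ℕ → Submodule K (Der K 10) :=
  gcomp (wf wt10) ⊤ 0 (kas10NegTwo K) (kas10NegOne K) ⊥ (kas10Zero K)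

theorem kas10Comp_eq (q : ℕ) (hq : q ≤ 0 + 2) : kas10Comp K q = kspan K 10 (kas10Y q) := by
  interval_cases q
  · exact kas10NegTwo_eq
  · exact kas10NegOne_eq
  · exact kas10Zero_eq

theorem kas10_familyIn : FamilyIn K 10 [0, 1] wt10 kas10Str 0
    (kas10Comp K) kas10Y :=
  familyIn_gcomp kas10_SOK kas10_strOK kas10Comp_eq kas10_gradOK kas10_closeOK kas10_transOK
    kas10_pnOK fun q hq => by
      interval_cases q
      · exact sq_le_of_inSpan kas10_SOK kas10_strOK (by norm_num) kas10_low0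
      · exact sq_le_of_inSpan kas10_SOK kas10_strOK (by norm_num) kas10_low1
      · exact sq_le_of_inSpan kas10_SOK kas10_strOK (by norm_num) kas10_low2

theorem kas10_le_sq (q : ℕ) (hq : 3 ≤ q) :
    kas10Comp K q ≤ sq K 10 [0, 1] wt10 kas10Str [] q := by
  have h := kas10_familyIn (K := K)
  have h2 : kas10Comp K (1 + 1) ≤ kspan K 10 (kas10Y 2) := (kas10Comp_eq 2 le_rfl).le
  have h3 : kas10Comp K (2 + 1) ≤ kspan K 10 (enumS [0, 1] wt10 kas10Str [] 3) := fun D hD =>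
    sq_le_kspan_enumS h.hS h.hStr (by norm_num)
      (h.mem_sq_of_solve (Z := []) h2 (by simp) kas10_solve03 hD (by simp))
  refine h.le_sq (q₁ := 3) (q₂ := 5) (by simp) (by decide) ?_ ?_ q hq
  · intro q hq3 hq5 Z s R hZ D hD hDZ
    have hq : q = 3 ∨ q = 4 := by omega
    rcases Z with _ | ⟨a, _ | ⟨b, Z⟩⟩ <;>
      simp only [List.nil_append, List.cons_append, List.cons.injEq] at hZ
    · rcases hq with rfl | rfl
      · exact h.mem_sq_of_solve h2 (by simp) kas10_solve03 hD hDZ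
      · exact h.mem_sq_of_solve h3 (by simp) kas10_solve04 hD hDZ
    · obtain ⟨rfl, -⟩ := hZ
      rcases hq with rfl | rfl
      · exact h.mem_sq_of_solve h2 (by simp) kas10_solve13 hD hDZ
      · exact h.mem_sq_of_solve h3 (by simp) kas10_solve14 hD hDZ
    · obtain ⟨-, -, hZ⟩ := hZ
      simp at hZ
  · intro q hq D hD h0
    exact h.eq_zero_of_solve h2 kas10_zero q (by omega) D hD h0

theorem kas10_familyProlong : FamilyProlong K 10 [0, 1] wt10 kas10Str 0
    (kas10Comp K) kas10Y kas10D :=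
  kas10_familyIn.familyProlong kas10_le_sq kas10_up0 kas10_up1 kas10_up2 kas10_d
    kas10_valid kas10_two_two kas10_parOK kas10_lo

theorem kas10_eq (N : Fin 10 → ℕ∞) : kas10 K N =
    prolong (wf wt10) N 0 (kas10NegTwo K) (kas10NegOne K) ⊥
      (kas10Zero K) := by
  rw [kas10]
  congr 1
  funext i
  fin_cases i <;> rfl

theorem kas10_model : Model (kas10 K) [0, 1]
    (strM K 10 [0, 1] wt10 kas10Str)
    (kz K 10 kas10D) := by
  refine kas10_familyProlong.model kas10_witOK kas10_smallOK (by simp) kas10_certOK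
    kas10_cert_span (fun N hN => ?_) ?_
  · rw [kas10_eq, kas10_eq]
    refine prolong_eq_inf_of_loOK (fun _ => rfl) kas10_familyIn.graded kas10Comp_eq
      (fun q hq => ?_) hN
    interval_cases q <;> decide +kernel
  · rw [kas10_eq]
    exact kas10_familyIn.graded.prolong_top fun _ => rfl

end

section

/-! ### Contact fields given by keys -/

/-- The keys of the contact field of the function given by a key. -/
def ctK (k : ℕ) : List ℕ :=
  k :: (List.range 3).flatMap fun i =>
    brHalf (16 ^ (i + 2) + (i + 1)) k ++ (brHalf (16 ^ (i + 2)) (k + (i + 1)) ++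
      (brHalf (i + 1) (k + (i + 4)) ++ brHalf (i + 4) (k + (i + 1))))

/-- The keys of the contact field of the function given by a list of keys. -/
def ctL (L : List ℕ) : List ℕ := L.flatMap ctK

variable (K) in
/-- The function given by a list of keys. -/
abbrev fz (n : ℕ) (L : List ℕ) : DP K n := lsum (kmono K (0 : Fin n → ℕ) 0) L

/-- The keys of the product of functions given by keys. -/
def mulK (A B : List ℕ) : List ℕ :=
  A.flatMap fun a => B.flatMap fun b =>
    bif Nat.beq ((a / 16) &&& (b / 16)) 0 then [(a / 16) * 16 + b] else []

theorem kmono_add_mod {base r : Fin n → ℕ} {k j : ℕ} (hk : k % 16 = 0) (hj : j < 16) :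
    kmono K base r (k + j) = kmono K base r k := by
  have e : ∀ i, dig (k + j) (i + 1) = dig k (i + 1) := fun i => by
    rw [dig_succ, dig_succ, show (k + j) / 16 = k / 16 by omega]
  have e' : kexp base r (k + j) = kexp base r k := funext fun i => by rw [kexp, kexp, e]
  simp only [kmono, e, e']

theorem kmono_zero_left (k : ℕ) :
    (kmono K (0 : Fin n → ℕ) 0 k) = mono (fun j : Fin n => dig k (j.val + 1)) := by
  rw [kmono, if_pos (show ∀ i : Fin n, (0 : Fin n → ℕ) i ≤ _ from fun _ => Nat.zero_le _)]
  congr 1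
  funext j
  simp [kexp]

theorem dig_pow (s i : ℕ) : dig (16 ^ s) i = if i = s then 1 else 0 := by
  rw [dig]
  rcases lt_trichotomy i s with h | rfl | h
  · obtain ⟨c, rfl⟩ := Nat.exists_eq_add_of_lt h
    rw [if_neg (by omega), show 16 ^ (i + c + 1) = 16 ^ i * (16 * 16 ^ c) by ring,
      Nat.mul_div_cancel_left _ (by positivity)]
    omega
  · rw [if_pos rfl, Nat.div_self (by positivity)]
  · rw [if_neg (by omega), Nat.div_eq_of_lt (Nat.pow_lt_pow_right (by norm_num) h)]

theorem kmono_pow (s : Fin n) : (kmono K (0 : Fin n → ℕ) 0 (16 ^ (s.val + 1))) = X s := by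
  rw [kmono_zero_left, X]
  congr 1
  funext j
  rw [dig_pow]
  by_cases h : j = s
  · subst h; simp
  · rw [Pi.single_eq_of_ne h, if_neg]
    intro h'
    exact h (Fin.ext (by omega))

variable [CharP K 2]

theorem kmono_mul {a b : ℕ} (ha : validKey n a = true) :
    (kmono K (0 : Fin n → ℕ) 0 a) * kmono K 0 0 b =
      fz K n (bif Nat.beq ((a / 16) &&& (b / 16)) 0 then [(a / 16) * 16 + b] else []) := by
  rw [kmono_zero_left, kmono_zero_left, mono_mul_mono_char]
  by_cases h : (a / 16) &&& (b / 16) = 0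
  · rw [show Nat.beq ((a / 16) &&& (b / 16)) 0 = true by rw [Nat.beq_eq]; exact h, cond_true, fz,
      lsum_cons, lsum_nil, add_zero, kmono_zero_left, if_pos]
    · congr 1
      funext j
      exact (dig_key_add h j).symm
    · intro i
      rw [dig_succ, dig_succ]
      exact land_digits h i
  · rw [show Nat.beq ((a / 16) &&& (b / 16)) 0 = false from by
      rw [← Bool.not_eq_true, Nat.beq_eq]; exact h, cond_false, fz, lsum_nil, if_neg]
    intro hi
    refine h (land_eq_zero_of_digits _ _ fun k => ?_)
    rw [← dig_succ, ← dig_succ]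
    by_cases hk : k < n
    · exact hi ⟨k, hk⟩
    · rw [dig_eq_zero_of_valid ha (by omega), Nat.zero_and]

theorem fz_mul {A B : List ℕ} (hA : validL n A = true) :
    fz K n A * fz K n B = fz K n (mulK A B) := by
  rw [validL, List.all_eq_true] at hA
  rw [mulK]
  induction A with
  | nil => simp
  | cons a A ih =>
    rw [List.flatMap_cons, fz, fz, fz, lsum_append, lsum_cons, add_mul,
      ih fun x hx => hA x (by simp [hx])]
    congr 1
    clear ih
    induction B with
    | nil => simp
    | cons b B ih =>
      rw [List.flatMap_cons, lsum_append, lsum_cons, mul_add,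
        ih, kmono_mul (hA a (by simp))]

/-- The shift of a function key is concentrated at `t`. -/
def TShift (base r : Fin 7 → ℕ) (k : ℕ) : Prop :=
  ∀ j, (base j = 0 ∧ r j = 0) ∨ (j = 0 ∧ dig k 1 ≠ 0)

theorem TShift.compat {base r : Fin 7 → ℕ} {k a j : ℕ} (h : TShift base r k) (ha : dig a 1 = 0)
    (hk : k % 16 = 0) (hj : j < 16) : Compat base r a (k + j) := by
  intro i
  refine (h i).imp_right ?_
  rintro ⟨rfl, h1⟩
  refine ⟨ha, ?_⟩
  change dig (k + j) 1 ≠ 0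
  rwa [show (1 : ℕ) = 0 + 1 from rfl, dig_succ, show (k + j) / 16 = k / 16 by omega, ← dig_succ]

theorem mul_pd_kmono {base r : Fin 7 → ℕ} {k a j : ℕ} (h : TShift base r k)
    (hk : k % 16 = 0) (hv : validKey 7 a = true) (ha : dig a 1 = 0) (hj : j < 7) :
    (kmono K 0 0 a * pd (Fin.ofNat 7 (a % 16)) (kmono K base r k)) • (pd (Fin.ofNat 7 j) : Der K 7) =
      kf K base r (brHalf a (k + j)) := by
  have := brHalf_left (K := K) hv (h.compat ha hk (show j < 16 by omega))
  rwa [kmono_add_mod hk (by omega), show (k + j) % 16 = j by omega] at this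

theorem X_mul_pd_kmono {base r : Fin 7 → ℕ} {k : ℕ} (h : TShift base r k) (hk : k % 16 = 0)
    (s c j : Fin 7) (hs : s ≠ 0) : (X s * pd c (kmono K base r k)) • (pd j : Der K 7) =
      kf K base r (brHalf (16 ^ (s.val + 1) + c) (k + j)) := by
  have e : (kmono K (0 : Fin 7 → ℕ) 0 (16 ^ (s.val + 1) + c)) = X s := by
    rw [kmono_add_mod (by rw [pow_succ]; omega) (by omega), kmono_pow]
  have hv : ∀ s c : Fin 7, s ≠ 0 → Fin.ofNat 7 ((16 ^ (s.val + 1) + c) % 16) = c ∧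
      validKey 7 (16 ^ (s.val + 1) + c) = true ∧ dig (16 ^ (s.val + 1) + c) 1 = 0 := by decide +kernel
  obtain ⟨e1, hv, hd⟩ := hv s c hs
  have := mul_pd_kmono (K := K) h hk (a := 16 ^ (s.val + 1) + c) (j := j)
    hv hd j.isLt
  rw [e, e1] at this
  rw [← this]
  congr 2
  ext
  exact (Nat.mod_eq_of_lt j.isLt).symm

theorem pd_kmono_smul_pd {base r : Fin 7 → ℕ} {k : ℕ} (h : TShift base r k) (hk : k % 16 = 0)
    (c j : Fin 7) : pd c (kmono K base r k) • (pd j : Der K 7) =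
      kf K base r (brHalf c (k + j)) := by
  have e : (kmono K (0 : Fin 7 → ℕ) 0 c.val) = 1 := by
    rw [kmono_zero_left, one_def]
    congr 1
    funext i
    revert c i; decide
  have hv : ∀ c : Fin 7, Fin.ofNat 7 (c.val % 16) = c ∧ validKey 7 c = true ∧ dig c 1 = 0 := by
    decide +kernel
  obtain ⟨e1, hv, hd⟩ := hv c
  have := mul_pd_kmono (K := K) h hk (a := c) (j := j)
    hv hd j.isLt
  rw [e, e1, one_mul] at this
  rw [← this]
  congr 2
  ext
  exact (Nat.mod_eq_of_lt j.isLt).symm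

theorem contact_kmono {base r : Fin 7 → ℕ} {k : ℕ} (h : TShift base r k) (hk : k % 16 = 0) :
    contact (kmono K base r k) = kf K base r (ctK k) := by
  have key : ∀ i : Fin 3, (xi K i * pd (ixi i) (kmono K base r k)) • (pd 0 : Der K 7) +
      ((xi K i * pd 0 (kmono K base r k)) • pd (ixi i) +
        (pd (ixi i) (kmono K base r k) • pd (ieta i) +
          pd (ieta i) (kmono K base r k) • pd (ixi i))) =
      kf K base r (brHalf (16 ^ (i.val + 2) + (i.val + 1)) k ++
        (brHalf (16 ^ (i.val + 2)) (k + (i.val + 1)) ++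
        (brHalf (i.val + 1) (k + (i.val + 4)) ++ brHalf (i.val + 4) (k + (i.val + 1))))) := by
    intro i
    have h1 : (ixi i).val = i.val + 1 := by revert i; decide
    have h2 : (ieta i).val = i.val + 4 := by revert i; decide
    have h3 : ixi i ≠ 0 := by revert i; decide
    rw [xi, X_mul_pd_kmono h hk _ _ _ h3, X_mul_pd_kmono h hk _ _ _ h3, pd_kmono_smul_pd h hk,
      pd_kmono_smul_pd h hk, h1, h2]
    simp only [kf, lsum_append]
    rfl
  have h0 : kmono K base r k • (pd 0 : Der K 7) = kfield K base r k := by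
    rw [kfield, hk]; rfl
  have hE : ∀ g, eulerXi K g = ∑ i, xi K i * pd (ixi i) g := fun g => by
    simp only [eulerXi, Fin.sum_univ_three, Derivation.add_apply, Derivation.smul_apply,
      smul_eq_mul]
  rw [ctK, kf, lsum_cons, lsum_flatMap, ← h0]
  simp only [List.range_succ, List.range_zero, List.nil_append, List.map_append, List.map_cons,
    List.map_nil, List.sum_append, List.sum_cons, List.sum_nil, add_zero]
  refine Eq.trans ?_ (congrArg (kmono K base r k • (pd 0 : Der K 7) + ·)
    (congrArg₂ (· + ·) (congrArg₂ (· + ·) (key 0) (key 1)) (key 2)))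
  rw [contact, hE, eulerXi]
  simp only [Fin.sum_univ_three, add_smul, smul_add, smul_smul, mul_comm (pd 0 _)]
  abel

theorem contact_add (f g : DP K 7) : contact (f + g) = contact f + contact g := by
  simp only [contact, map_add, add_smul, Finset.sum_add_distrib]
  abel

theorem contact_smul (c : K) (f : DP K 7) : contact (c • f) = c • contact f := by
  simp only [contact, Derivation.map_smul, ← smul_add, smul_assoc, ← Finset.smul_sum]

variable (K) in
/-- The contact field as a linear function of the generating function. -/
def contactL : DP K 7 →ₗ[K] Der K 7 where
  toFun := contact
  map_add' := contact_add
  map_smul' := contact_smul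

theorem contact_injective : Function.Injective (contact : DP K 7 → Der K 7) := by
  refine (injective_iff_map_eq_zero (contactL K)).2 fun f hf => ?_
  change contact f = 0 at hf
  have h1 : ∀ i, pd (ixi i) f = 0 := fun i => by
    have := congrArg (fun D : Der K 7 => D (X (ieta i))) hf
    simp only [contact, eulerXi, Fin.sum_univ_three, Derivation.add_apply, Derivation.smul_apply,
      smul_eq_mul, pd_X, Derivation.zero_apply] at this
    fin_cases i <;> simpa [ixi, ieta] using this
  have h2 := congrArg (fun D : Der K 7 => D (X 0)) hf
  simp only [contact, eulerXi, Fin.sum_univ_three, Derivation.add_apply, Derivation.smul_apply,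
    smul_eq_mul, pd_X, Derivation.zero_apply, h1] at h2
  simpa [ixi, ieta] using h2

/-- The contact field of a function given by a list of keys. -/
theorem contact_lsum {base r : Fin 7 → ℕ} {L : List ℕ}
    (h : ∀ k ∈ L, TShift base r k ∧ k % 16 = 0) :
    contact (lsum (kmono K base r) L) = kf K base r (ctL L) := by
  induction L with
  | nil => exact map_zero (contactL K)
  | cons k L ih =>
    rw [ctL, List.flatMap_cons, kf, lsum_append, lsum_cons, contact_add,
      ih fun x hx => h x (by simp [hx]), contact_kmono (h k (by simp)).1 (h k (by simp)).2, ctL]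

theorem contact_fz {L : List ℕ} (h : ∀ k ∈ L, k % 16 = 0) : contact (fz K 7 L) = kz K 7 (ctL L) :=
  contact_lsum fun k hk => ⟨fun _ => Or.inl ⟨rfl, rfl⟩, h k hk⟩

theorem contactSpan_eq {s : Set (DP K 7)} {Ls Y : List (List ℕ)}
    (hs : s = {f | ∃ L ∈ Ls, f = fz K 7 L}) (h0 : Ls.all (fun L => L.all fun k => k % 16 == 0) = true)
    (h1 : inSpan Y (Ls.map ctL) = true) (h2 : inSpan (Ls.map ctL) Y = true) :
    contactSpan s = kspan K 7 Y := by
  rw [List.all_eq_true] at h0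
  have h3 : ∀ L ∈ Ls, contact (fz K 7 L) = kz K 7 (ctL L) := fun L hL => contact_fz fun k hk => by
    have := List.all_eq_true.1 (h0 L hL) k hk
    simpa using this
  have e : contactSpan s = kspan K 7 (Ls.map ctL) := by
    rw [contactSpan, kspan, hs]
    congr 1
    ext D
    constructor
    · rintro ⟨_, ⟨L, hL, rfl⟩, rfl⟩
      exact ⟨ctL L, List.mem_map_of_mem hL, h3 L hL⟩
    · rintro ⟨_, hL', rfl⟩
      obtain ⟨L, hL, rfl⟩ := List.mem_map.1 hL'
      exact ⟨_, ⟨L, hL, rfl⟩, h3 L hL⟩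
  rw [e]
  exact le_antisymm (kspan_le_of_inSpan h1) (kspan_le_of_inSpan h2)

end

/-! ### The algebra `kas(7; N)` -/

/-- The families of generating functions of `kas`, and of the fields that represent them. -/
def kasPairs : List (ℕ × List ℕ × List ℕ) :=
  [(1, [0x180], [0x84, 0x10077]), (1, [0x1080], [0x85, 0x1077]), (1, [0x10080], [0x86, 0x177]),
   (2, [0x1000180], [0x10082, 0x1000084, 0x1010077]), (2, [0x10000180], [0x10081, 0x10000084,
   0x10010077]), (2, [0x101080], [0x1083, 0x100085, 0x101077]), (2, [0x10001080], [0x1081,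
   0x10000085, 0x10001077]), (2, [0x110080], [0x183, 0x100086, 0x100177]), (2, [0x1010080],
   [0x182, 0x1000086, 0x1000177]), (1, [0x11180], [0x87]), (3, [0x11000180], [0x1010081,
   0x10010082, 0x11000084, 0x11010077]), (3, [0x10101080], [0x101081, 0x10001083, 0x10100085,
   0x10101077]), (3, [0x1110080], [0x100182, 0x1000183, 0x1100086, 0x1100177]), (1, [0x11080,
   0x111170], [0x83, 0x100077]), (1, [0x10180, 0x1011170], [0x82, 0x1000077]), (1, [0x1180,
   0x10011170], [0x81, 0x10000077]), (3, [0x11000080, 0x11100170], [0x10181, 0x11082, 0x1001084,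
   0x1010085, 0x1011077, 0x1110071, 0x10000184, 0x10010086, 0x10010177, 0x10110072, 0x11000080,
   0x11010073, 0x11100074, 0x11110067, 0x101000081, 0x110000082, 0x111000077]), (3, [0x10100080,
   0x11101070], [0x1181, 0x11083, 0x101084, 0x110085, 0x111077, 0x1101071, 0x10000185, 0x10001086,
   0x10001177, 0x10100080, 0x10101072, 0x11001073, 0x11100075, 0x11101067, 0x100100081,
   0x110000083, 0x110100077]), (3, [0x1100080, 0x11110070], [0x1182, 0x10183, 0x100184, 0x110086,
   0x110177, 0x1000185, 0x1001086, 0x1001177, 0x1100080, 0x1100171, 0x10100172, 0x11000173,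
   0x11100076, 0x11100167, 0x100100082, 0x101000083, 0x101100077]), (2, [0x100080, 0x1101070],
   [0x185, 0x1086, 0x1177, 0x100080, 0x101072, 0x1001073, 0x1100075, 0x1101067, 0x100000083,
   0x100100077]), (3, [0x1101080, 0x10110080], [0x100181, 0x101082, 0x1001083, 0x1100085,
   0x1101077, 0x10000183, 0x10100086, 0x10100177]), (2, [0x1000080, 0x1100170], [0x184, 0x10086,
   0x10177, 0x110072, 0x1000080, 0x1010073, 0x1100074, 0x1110067, 0x100000082, 0x101000077]), (3,
   [0x1100180, 0x11010080], [0x110082, 0x1000181, 0x1010083, 0x1100084, 0x1110077, 0x10000182,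
   0x11000086, 0x11000177]), (2, [0x10000080, 0x10100170], [0x1084, 0x10085, 0x11077, 0x110071,
   0x10000080, 0x10010073, 0x10100074, 0x10110067, 0x100000081, 0x110000077]), (3, [0x10100180,
   0x11001080], [0x110081, 0x1001081, 0x10001082, 0x10010083, 0x10100084, 0x10110077, 0x11000085,
   0x11001077]), (2, [0x1001180, 0x10010180, 0x11011170], [0x1000081, 0x10000082, 0x11000077]),
   (2, [0x101180, 0x10011080, 0x10111170], [0x100081, 0x10000083, 0x10100077]), (2, [0x110180,
   0x1011080, 0x1111170], [0x100082, 0x1000083, 0x1100077]), (1, [0x80, 0x100170], [0x80, 0x10073,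
   0x100074, 0x110067, 0x100000077]), (2, [0x100180, 0x1001080], [0x1082, 0x10083, 0x100084,
   0x110077, 0x1000085, 0x1001077]), (2, [0x1001080, 0x10010080], [0x181, 0x1082, 0x1000085,
   0x1001077, 0x10000086, 0x10000177]), (3, [0x1101180, 0x10110180, 0x11011080, 0x11111170],
   [0x1100081, 0x10100082, 0x11000083, 0x11100077])]

/-- The families of elements of `kas(7; N)`. -/
def kas7Str : List (ℕ × List ℕ) :=
  kasPairs.map fun x =>
    (wkey wt7 (x.2.1.headI / 16) - 16, cancel (ctL x.2.1))

/-- The component of degree -1 of `kas(7; N)`. -/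
def kas7Neg : List (List ℕ) :=
  [[0x4], [0x5], [0x6], [0x1, 0x100000], [0x2, 0x1000000], [0x3, 0x10000000]]

/-- The element of degree 0 that is not in the derived algebra. -/
def kas7D : List ℕ := [0x10, 0x101, 0x1002, 0x10003]

/-- The components of degrees at most 1 of `kas(7; N)`. -/
def kas7Y : ℕ → List (List ℕ)
  | 0 => [[0]]
  | 1 => kas7Neg
  | 2 => kas7D :: enumS [0] wt7 kas7Str [] 2
  | _ => enumS [0] wt7 kas7Str [] 3

def kas7Cert : List ((ℕ × ℕ) × List (ℕ × ℕ)) :=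
  [((1, 3), [(1, 0)]), ((1, 4), [(1, 1)]), ((1, 5), [(1, 2)]), ((1, 0), [(1, 3)]), ((1, 1), [(1, 4)]), ((1, 2), [(1, 5)]), ((0, 0), [])]

/-- The key of `ξ_{i+1}`. -/
def xk (i : Fin 3) : List ℕ := [16 ^ (i.val + 2)]

/-- The key of `η_{i+1}`. -/
def ek (i : Fin 3) : List ℕ := [16 ^ (i.val + 5)]

/-- The keys of `Φ`. -/
def phiK : List ℕ := (List.finRange 3).flatMap fun i => mulK (xk i) (ek i)

/-- The generating functions of the component of degree -1. -/
def kas7NegF : List (List ℕ) :=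
  (List.finRange 7).flatMap fun i => if i ≠ 0 then [[16 ^ (i.val + 1)]] else []

/-- The generating functions of the component of degree 0. -/
def kas7ZeroF : List (List ℕ) :=
  [16] :: (List.finRange 7).flatMap fun i => (List.finRange 7).flatMap fun j =>
    if i ≠ 0 ∧ j ≠ 0 ∧ i ≠ j then [mulK [16 ^ (i.val + 1)] [16 ^ (j.val + 1)]] else []

/-- The generating functions of the component of degree 1. -/
def kas7OneF : List (List ℕ) :=
  let I := List.finRange 3
  [mulK (mulK (xk 0) (xk 1)) (xk 2)] ++ (I.map (fun i => mulK (ek i) phiK) ++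
    (I.map (fun i => mulK (xk i) phiK) ++
    ((I.flatMap fun i => I.flatMap fun j => I.flatMap fun k =>
      if i ≠ j ∧ i ≠ k ∧ j ≠ k then [mulK (mulK (xk i) (ek j)) (ek k)] else []) ++
    ((I.flatMap fun i => I.flatMap fun j =>
      if i ≠ j then [mulK (ek i) ([16] ++ mulK (xk j) (ek j))] else []) ++
    I.map fun i => mulK [16] (xk i)))))

set_option maxRecDepth 100000

theorem kas7_SOK :
    SOK 7 [0] wt7 = true := by
  decide +kernel

theorem kas7_strOK :
    kas7Str.all (strOK 7 [0] wt7) = true := by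
  decide +kernel

theorem kas7_closeOK :
    closeOK 7 [0] wt7 kas7Str (kas7Y 1) = true := by
  decide +kernel

theorem kas7_transOK :
    transOK 7 wt7 [0] (kas7Y 0 ++ kas7Y 1) = true := by
  decide +kernel

theorem kas7_pnOK :
    pnOK [0] wt7 kas7Str = true := by
  decide +kernel

theorem kas7_gradOK :
    gradOK 7 wt7 1 kas7Y = true := by
  decide +kernel

theorem kas7_low0 :
    inSpan (kas7Y 0) (enumS [0] wt7 kas7Str [] 0) = true := by
  decide +kernel

theorem kas7_low1 :
    inSpan (kas7Y 1) (enumS [0] wt7 kas7Str [] 1) = true := by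
  decide +kernel

theorem kas7_low2 :
    inSpan (kas7Y 2) (enumS [0] wt7 kas7Str [] 2) = true := by
  decide +kernel

theorem kas7_low3 :
    inSpan (kas7Y 3) (enumS [0] wt7 kas7Str [] 3) = true := by
  decide +kernel

theorem kas7_up0 :
    inSpan (enumS [0] wt7 kas7Str [] 0) (kas7Y 0) = true := by
  decide +kernel

theorem kas7_up1 :
    inSpan (enumS [0] wt7 kas7Str [] 1) (kas7Y 1) = true := by
  decide +kernel

theorem kas7_up3 :
    inSpan (enumS [0] wt7 kas7Str [] 3) (kas7Y 3) = true := by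
  decide +kernel

theorem kas7_up2 :
    inSpan (kas7D :: enumS [0] wt7 kas7Str [] 2) (kas7Y 2) = true := by
  decide +kernel

theorem kas7_d :
    inSpan (kas7Y 2) [kas7D] = true := by
  decide +kernel

theorem kas7_lo :
    loOK 7 kas7D = true := by
  decide +kernel

theorem kas7_valid :
    (kas7Y 2).all (validL 7) = true := by
  decide +kernel

theorem kas7_two_two :
    inSpan (enumS [0] wt7 kas7Str [] 2) (brLL (kas7Y 2) (kas7Y 2)) = true := by
  decide +kernel

theorem kas7_parOK :
    parOK 7 [0x10, 0x100004, 0x1000005, 0x10000006] kas7D (enumS [0] wt7 kas7Str [] 2) = true := by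
  decide +kernel

theorem kas7_witOK :
    witOK 7 [0] kas7Str 0x80 = true := by
  decide +kernel

theorem kas7_smallOK :
    smallOK 7 [0] (kas7Y 2) = true := by
  decide +kernel

theorem kas7_certOK :
    certOK 7 [0] (certOf [0] wt7 kas7Str kas7Cert) = true := by
  decide +kernel

theorem kas7_cert_span :
    inSpan ((certOf [0] wt7 kas7Str kas7Cert).map Prod.fst)
      (enumS [0] wt7 kas7Str [] 0 ++ enumS [0] wt7 kas7Str [] 1) = true := by
  decide +kernel

theorem kas7_solve :
    solveOK 7 (kas7Y 1) (kas7Y 3) (([] : List ℕ).map fun z => [z])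
      (relPairs (kas7Y 1) [])
      (mkItems (kas7Y 1) (kas7Y 3) (enumS [0] wt7 kas7Str [] 4)) = true := by
  decide +kernel

theorem kas7_zero :
    solveOK 7 (kas7Y 1) (enumS [0] wt7 kas7Str [] 4) ([0].map fun z => [z])
      (relPairs (kas7Y 1) [[0]]) [] = true := by
  decide +kernel

section
variable [CharP K 2]

theorem fz_var (i : Fin 7) : fz K 7 [16 ^ (i.val + 1)] = X i := by
  rw [fz, lsum_cons, lsum_nil, add_zero, kmono_pow]

theorem fz_xk (i : Fin 3) : fz K 7 (xk i) = xi K i := by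
  rw [xi, ← fz_var, xk]
  fin_cases i <;> rfl

theorem fz_ek (i : Fin 3) : fz K 7 (ek i) = eta K i := by
  rw [eta, ← fz_var, ek]
  fin_cases i <;> rfl

theorem fz_tk : fz K 7 [16] = tt K := fz_var 0

theorem validL_xk : ∀ i, validL 7 (xk i) = true := by
  decide +kernel

theorem validL_ek : ∀ i, validL 7 (ek i) = true := by
  decide +kernel

theorem fz_phiK : fz K 7 phiK = phi K := by
  rw [phi, Fin.sum_univ_three, phiK, fz, lsum_flatMap]
  simp only [← fz_mul (K := K) (validL_xk _), fz_xk, fz_ek, List.finRange_succ, List.finRange_zero,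
    List.map_cons, List.map_nil, List.sum_cons, List.sum_nil, add_zero, add_assoc]
  rfl

theorem kas7NegTwo_eq : contactSpan {(1 : DP K 7)} = kspan K 7 (kas7Y 0) := by
  refine contactSpan_eq (Ls := [[0]]) ?_ (by decide +kernel) (by decide +kernel) (by decide +kernel)
  ext f
  have : fz K 7 [0] = 1 := by
    rw [fz, lsum_cons, lsum_nil, add_zero, kmono_zero_left, one_def]
    congr 1
    funext j
    simp [dig]
  simp [this]

theorem kas7NegOne_eq : contactSpan {f : DP K 7 | ∃ i : Fin 7, i ≠ 0 ∧ f = X i} =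
    kspan K 7 (kas7Y 1) := by
  refine contactSpan_eq (Ls := kas7NegF) ?_ (by decide +kernel) (by decide +kernel)
    (by decide +kernel)
  ext f
  simp only [← fz_var, kas7NegF, List.mem_flatMap, List.mem_finRange, true_and,
    List.mem_ite_nil_right, List.mem_singleton]
  constructor
  · rintro ⟨i, hi, rfl⟩
    exact ⟨_, ⟨i, hi, rfl⟩, rfl⟩
  · rintro ⟨_, ⟨i, hi, rfl⟩, rfl⟩
    exact ⟨i, hi, rfl⟩

theorem kas7Zero_eq : contactSpan {f : DP K 7 | f = tt K ∨
      ∃ i j : Fin 7, i ≠ 0 ∧ j ≠ 0 ∧ i ≠ j ∧ f = X i * X j} = kspan K 7 (kas7Y 2) := by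
  refine contactSpan_eq (Ls := kas7ZeroF) ?_ (by decide +kernel) (by decide +kernel)
    (by decide +kernel)
  have hv : ∀ i : Fin 7, validL 7 [16 ^ (i.val + 1)] = true := by decide +kernel
  ext f
  simp only [← fz_var, fz_mul (hv _), ← fz_tk, kas7ZeroF, List.mem_cons, List.mem_flatMap,
    List.mem_finRange, true_and, List.mem_ite_nil_right, List.not_mem_nil, or_false]
  constructor
  · rintro (rfl | ⟨i, j, h1, h2, h3, rfl⟩)
    · exact ⟨_, Or.inl rfl, rfl⟩
    · exact ⟨_, Or.inr ⟨i, j, ⟨h1, h2, h3⟩, rfl⟩, rfl⟩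
  · rintro ⟨_, rfl | ⟨i, j, ⟨h1, h2, h3⟩, rfl⟩, rfl⟩
    · exact Or.inl rfl
    · exact Or.inr ⟨i, j, h1, h2, h3, rfl⟩

theorem kasOne_eq : contactSpan (kasOne K) = kspan K 7 (kas7Y 3) := by
  refine contactSpan_eq (Ls := kas7OneF) ?_ (by decide +kernel) (by decide +kernel)
    (by decide +kernel)
  have hx : ∀ i j, validL 7 (mulK (xk i) (xk j)) = true := by decide +kernel
  have he : ∀ i j, validL 7 (mulK (xk i) (ek j)) = true := by decide +kernel
  have ht : validL 7 [16] = true := by decide +kernel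
  ext f
  simp only [kasOne, ← fz_xk, ← fz_ek, ← fz_phiK, ← fz_tk, fz_mul (validL_xk _), fz_mul (hx _ _),
    fz_mul (validL_ek _), fz_mul (he _ _), fz_mul ht, kas7OneF, List.mem_append, List.mem_map,
    List.mem_flatMap, List.mem_finRange, true_and, List.mem_ite_nil_right, List.mem_singleton,
    ← lsum_append (M := DP K 7)]
  constructor
  · rintro (rfl | ⟨i, rfl⟩ | ⟨i, rfl⟩ | ⟨i, j, k, h1, h2, h3, rfl⟩ | ⟨i, j, h, rfl⟩ | ⟨i, rfl⟩)
    · exact ⟨_, Or.inl rfl, rfl⟩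
    · exact ⟨_, Or.inr (Or.inl ⟨i, rfl⟩), rfl⟩
    · exact ⟨_, Or.inr (Or.inr (Or.inl ⟨i, rfl⟩)), rfl⟩
    · exact ⟨_, Or.inr (Or.inr (Or.inr (Or.inl ⟨i, j, k, ⟨h1, h2, h3⟩, rfl⟩))), rfl⟩
    · exact ⟨_, Or.inr (Or.inr (Or.inr (Or.inr (Or.inl ⟨i, j, h, rfl⟩)))), rfl⟩
    · exact ⟨_, Or.inr (Or.inr (Or.inr (Or.inr (Or.inr ⟨i, rfl⟩)))), rfl⟩
  · rintro ⟨_, rfl | ⟨i, rfl⟩ | ⟨i, rfl⟩ | ⟨i, j, k, ⟨h1, h2, h3⟩, rfl⟩ | ⟨i, j, h, rfl⟩ | ⟨i, rfl⟩, rfl⟩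
    · exact Or.inl rfl
    · exact Or.inr (Or.inl ⟨i, rfl⟩)
    · exact Or.inr (Or.inr (Or.inl ⟨i, rfl⟩))
    · exact Or.inr (Or.inr (Or.inr (Or.inl ⟨i, j, k, h1, h2, h3, rfl⟩)))
    · exact Or.inr (Or.inr (Or.inr (Or.inr (Or.inl ⟨i, j, h, rfl⟩))))
    · exact Or.inr (Or.inr (Or.inr (Or.inr (Or.inr ⟨i, rfl⟩))))

variable (K) in
/-- The components of `kas(7; N)` for `N = ∞`. -/
def kas7Comp : ℕ → Submodule K (Der K 7) :=
  gcomp (wf wt7) ⊤ 1 (contactSpan {1}) (contactSpan {f | ∃ i : Fin 7, i ≠ 0 ∧ f = X i})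
    (contactSpan {f | f = tt K ∨ ∃ i j : Fin 7, i ≠ 0 ∧ j ≠ 0 ∧ i ≠ j ∧ f = X i * X j})
    (contactSpan (kasOne K))

theorem kas7Comp_eq (q : ℕ) (hq : q ≤ 1 + 2) : kas7Comp K q = kspan K 7 (kas7Y q) := by
  interval_cases q
  · exact kas7NegTwo_eq
  · exact kas7NegOne_eq
  · exact kas7Zero_eq
  · exact kasOne_eq

theorem kas7_familyIn : FamilyIn K 7 [0] wt7 kas7Str 1 (kas7Comp K) kas7Y :=
  familyIn_gcomp kas7_SOK kas7_strOK kas7Comp_eq kas7_gradOK kas7_closeOK kas7_transOK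
    kas7_pnOK fun q hq => by
      interval_cases q
      · exact sq_le_of_inSpan kas7_SOK kas7_strOK (by norm_num) kas7_low0
      · exact sq_le_of_inSpan kas7_SOK kas7_strOK (by norm_num) kas7_low1
      · exact sq_le_of_inSpan kas7_SOK kas7_strOK (by norm_num) kas7_low2
      · exact sq_le_of_inSpan kas7_SOK kas7_strOK (by norm_num) kas7_low3

theorem kas7_le_sq (q : ℕ) (hq : 3 ≤ q) : kas7Comp K q ≤ sq K 7 [0] wt7 kas7Str [] q := by
  have h := kas7_familyIn (K := K)
  have h3 : kas7Comp K (2 + 1) ≤ kspan K 7 (kas7Y 3) := (kas7Comp_eq 3 le_rfl).le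
  have h4 : kas7Comp K (3 + 1) ≤ sq K 7 [0] wt7 kas7Str [] 4 := fun D hD =>
    h.mem_sq_of_solve (Z := []) h3 (by simp) kas7_solve hD (by simp)
  refine h.le_sq (q₁ := 3) (q₂ := 5) (by simp) (by decide) ?_ ?_ q hq
  · intro q hq3 hq5 Z s R hZ D hD hDZ
    have hq : q = 3 ∨ q = 4 := by omega
    rcases Z with _ | ⟨a, Z⟩
    · rcases hq with rfl | rfl
      · exact le_sq_of_inSpan h.hS h.hStr (by simp) kas7_up3 (h3 hD)
      · exact h4 hD
    · simp at hZ
  · intro q hq D hD h0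
    exact h.eq_zero_of_solve (h4.trans (sq_le_kspan_enumS h.hS h.hStr (by norm_num))) kas7_zero q
      hq D hD h0

theorem kas7_familyProlong : FamilyProlong K 7 [0] wt7 kas7Str 1 (kas7Comp K) kas7Y
    kas7D :=
  kas7_familyIn.familyProlong kas7_le_sq kas7_up0 kas7_up1 kas7_up2 kas7_d
    kas7_valid kas7_two_two kas7_parOK kas7_lo

theorem kas7_eq (N : Fin 7 → ℕ∞) : kas7 K N =
    prolong (wf wt7) N 1 (contactSpan {1}) (contactSpan {f | ∃ i : Fin 7, i ≠ 0 ∧ f = X i})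
      (contactSpan {f | f = tt K ∨ ∃ i j : Fin 7, i ≠ 0 ∧ j ≠ 0 ∧ i ≠ j ∧ f = X i * X j})
      (contactSpan (kasOne K)) := by
  rw [kas7]
  congr 1
  funext i
  fin_cases i <;> rfl

theorem kas7_model : Model (kas7 K) [0] (strM K 7 [0] wt7 kas7Str)
    (kz K 7 kas7D) := by
  refine kas7_familyProlong.model kas7_witOK kas7_smallOK (by simp) kas7_certOK
    kas7_cert_span (fun N hN => ?_) ?_
  · rw [kas7_eq, kas7_eq]
    refine prolong_eq_inf_of_loOK (by norm_num) kas7_familyIn.graded kas7Comp_eq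
      (fun q hq => ?_) hN
    interval_cases q <;> decide +kernel
  · rw [kas7_eq]
    exact kas7_familyIn.graded.prolong_top (by norm_num)

end

/-! ### Pairs of a generating function and of the field that represents it -/

section
variable [CharP K 2]

theorem foldr_iterate_last {α ι : Type*} [DecidableEq ι] (F : ι → α → α) (r : ι → ℕ) (f : α)
    {l : List ι} (hl : l.Nodup) (h : ∃ i ∈ l, r i ≠ 0) : ∃ i ∈ l, r i ≠ 0 ∧
      l.foldr (fun i g => (F i)^[r i] g) f =
        l.foldr (fun j g => (F j)^[Function.update r i (r i - 1) j] g) (F i f) := by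
  induction l with
  | nil => obtain ⟨i, hi, -⟩ := h; simp at hi
  | cons a t ih =>
    rw [List.nodup_cons] at hl
    by_cases ht : ∃ i ∈ t, r i ≠ 0
    · obtain ⟨i, hi, h0, e⟩ := ih hl.2 ht
      refine ⟨i, List.mem_cons_of_mem _ hi, h0, ?_⟩
      rw [List.foldr_cons, List.foldr_cons, e, Function.update_of_ne]
      rintro rfl
      exact hl.1 hi
    · push Not at ht
      have key : ∀ (r' : ι → ℕ) (f : α), (∀ i ∈ t, r' i = 0) →
          t.foldr (fun i g => (F i)^[r' i] g) f = f := by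
        intro r' f
        clear ih ht hl h
        induction t with
        | nil => exact fun _ => rfl
        | cons b t ih =>
          intro hr
          rw [List.foldr_cons, ih fun i hi => hr i (List.mem_cons_of_mem _ hi), hr b (by simp)]
          rfl
      have ha : r a ≠ 0 := by
        obtain ⟨i, hi, h0⟩ := h
        rcases List.mem_cons.1 hi with rfl | hi
        · exact h0
        · exact absurd (ht i hi) h0
      refine ⟨a, by simp, ha, ?_⟩
      rw [List.foldr_cons, List.foldr_cons, key r f ht, key _ _ fun i hi => ?_,
        Function.update_self, ← Function.iterate_succ_apply, Nat.succ_eq_add_one,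
        Nat.sub_add_cancel (by omega)]
      rw [Function.update_of_ne, ht i hi]
      rintro rfl
      exact hl.1 hi

variable (K) in
/-- The basis of the component of degree -1 of the regraded algebra. -/
def en (i : Fin 8) : DP K 7 := mono (negExp i)

theorem pd_zero_en (i : Fin 8) : pd 0 (en K i) = 0 := by
  have : negExp i 0 = 0 := by revert i; decide
  rw [en, pd_mono, if_pos this]

theorem contactBracket_en (i : Fin 8) (f : DP K 7) :
    contactBracket (en K i) f = contact (en K i) f := by
  simp only [contactBracket, contact, pd_zero_en, zero_mul, zero_smul, add_zero, zero_add,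
    Fin.sum_univ_three, Derivation.add_apply, Derivation.smul_apply, smul_eq_mul]

/-- The generating function of a pair. -/
def pairF : Der K 7 × Der K 8 →ₗ[K] DP K 7 where
  toFun x := x.1 (X 0)
  map_add' _ _ := rfl
  map_smul' _ _ := rfl

/-- The contact field of a pair. -/
def pairC : Der K 7 × Der K 8 →ₗ[K] Der K 7 := contactL K ∘ₗ pairF

/-- The action of the component of degree -1 on pairs. -/
def adP (i : Fin 8) : Der K 7 × Der K 8 →ₗ[K] Der K 7 × Der K 8 where
  toFun x := (contact (en K i) (pairF x) • pd 0, ⁅(pd i : Der K 8), x.2⁆)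
  map_add' x y := by
    rw [map_add, map_add, add_smul, Prod.snd_add, lie_add]; rfl
  map_smul' c x := by
    rw [map_smul, Derivation.map_smul, smul_assoc, Prod.smul_snd, lie_smul]; rfl

theorem pairF_adP (i : Fin 8) (x : Der K 7 × Der K 8) :
    pairF (adP i x) = contactBracket (en K i) (pairF x) := by
  rw [contactBracket_en]
  change (contact (en K i) (pairF x) • (pd 0 : Der K 7)) (X 0) = _
  rw [smul_pd_X, if_pos rfl]

/-- The weights of the regraded contact algebra. -/
def wReg : Fin 7 → ℕ := wf [1, 0, 0, 0, 1, 1, 1]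

/-- The weights of the indeterminates of the realization. -/
def wOne : Fin 8 → ℕ := wf wt8

theorem wOne_eq (i : Fin 8) : wOne i = 1 := by revert i; decide

variable (K) in
/-- Graded spaces of pairs that are closed under the action of the component of degree -1. -/
structure Pairs (T : ℕ → Submodule K (Der K 7 × Der K 8)) : Prop where
  zero : T 0 = ⊥
  one : T 1 ≤ Submodule.span K (Set.range fun i => (en K i • pd 0, pd i))
  ad : ∀ q i, ∀ x ∈ T (q + 1), adP i x ∈ T q ∧ pairC (adP i x) = ⁅contact (en K i), pairC x⁆
  homF : ∀ q, ∀ x ∈ T q, x.1 ∈ homS K wReg ((q : ℤ) - 2)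
  homC : ∀ q, ∀ x ∈ T q, pairC x ∈ homS K wReg ((q : ℤ) - 2)
  hom : ∀ q, ∀ x ∈ T q, x.2 ∈ homS K wOne ((q : ℤ) - 2)
  sup : (kas7 K ⊤).toSubmodule = ⨆ q, (T q).map pairC

namespace Pairs

variable {T : ℕ → Submodule K (Der K 7 × Der K 8)}

theorem adP_mem (h : Pairs K T) {x : Der K 7 × Der K 8} (hx : x ∈ ⨆ q, T q) (i : Fin 8) :
    adP i x ∈ ⨆ q, T q := by
  have : (⨆ q, T q) ≤ (⨆ q, T q).comap (adP i) := by
    refine iSup_le fun q x hx => ?_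
    rcases q with _ | q
    · rw [h.zero, Submodule.mem_bot] at hx
      rw [hx]; exact zero_mem _
    · exact Submodule.mem_iSup_of_mem q (h.ad q i x hx).1
  exact this hx

theorem wdeg_negExp : ∀ j, wdeg wReg (negExp j) = 0 := by decide

theorem coef_zero (h : Pairs K T) {x : Der K 7 × Der K 8} (hx : x ∈ ⨆ q, T q) (j : Fin 8) :
    coef (x.2 (X j)) 0 = coef (pairF x) (negExp j) := by
  have : (⨆ q, T q) ≤ LinearMap.eqLocus
      ((coefL 0 : DP K 8 →ₗ[K] K) ∘ₗ
        ({ toFun := fun x => x.2 (X j), map_add' := fun _ _ => rfl, map_smul' := fun _ _ => rfl } :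
          Der K 7 × Der K 8 →ₗ[K] DP K 8)) (coefL (negExp j) ∘ₗ pairF) := by
    refine iSup_le fun q x hx => ?_
    change coef (x.2 (X j)) 0 = coef (pairF x) (negExp j)
    by_cases hq : q = 1
    · subst hq
      replace hx := h.one hx
      induction hx using Submodule.span_induction with
      | zero => rfl
      | add a b _ _ ha hb => exact congrArg₂ (· + ·) ha hb
      | smul c a _ ha => exact congrArg (c * ·) ha
      | mem a ha =>
        obtain ⟨i, rfl⟩ := ha
        change coef ((pd i : Der K 8) (X j)) 0 = coef ((en K i • (pd 0 : Der K 7)) (X 0)) (negExp j)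
        rw [smul_pd_X, if_pos rfl, pd_X, en, coef_mono]
        have he : ∀ i j : Fin 8, negExp i = negExp j ↔ i = j := by decide
        simp only [he]
        split_ifs
        · rw [one_def, coef_mono, if_pos rfl]
        · rfl
    · have h1 : coef (x.2 (X j)) 0 = 0 := by
        by_contra hne
        have := (mem_homS.1 (h.hom q x hx)).2 j 0 hne
        rw [wOne_eq] at this
        simp at this
        omega
      have h2 : coef (pairF x) (negExp j) = 0 := by
        by_contra hne
        have := (mem_homS.1 (h.homF q x hx)).2 0 (negExp j) hne
        rw [← wdeg_cast, wdeg_negExp j,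
          show wReg 0 = 1 from rfl] at this
        push_cast at this
        omega
      rw [h1, h2]
  exact this hx

theorem represents (h : Pairs K T) {x : Der K 7 × Der K 8} (hx : x ∈ ⨆ q, T q) :
    Represents x.2 (pairF x) := by
  intro r j
  obtain ⟨m, hm⟩ : ∃ m, m = ∑ i, r i := ⟨_, rfl⟩
  induction m generalizing x r with
  | zero =>
    have : r = 0 := funext fun i => (Finset.sum_eq_zero_iff.1 hm.symm) i (Finset.mem_univ i)
    subst this
    exact h.coef_zero hx j
  | succ m ih =>
    have hr : ∃ i ∈ List.finRange 8, r i ≠ 0 := by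
      by_contra hc
      push Not at hc
      have : ∑ i, r i = 0 := Finset.sum_eq_zero fun i _ => hc i (List.mem_finRange i)
      omega
    obtain ⟨i, -, hi, e⟩ := foldr_iterate_last (fun i => contactBracket (mono (negExp i) : DP K 7))
      r (pairF x) (List.nodup_finRange 8) hr
    have e' : adNeg r (pairF x) = adNeg (Function.update r i (r i - 1)) (pairF (adP i x)) := by
      rw [pairF_adP]; exact e
    have hsum : m = ∑ k, Function.update r i (r i - 1) k := by
      have h1 := Finset.sum_update_of_mem (Finset.mem_univ i) r (r i - 1)
      have h2 := Finset.sum_update_of_mem (Finset.mem_univ i) r (r i)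
      rw [Function.update_eq_self] at h2
      omega
    rw [e', ← ih (h.adP_mem hx i) _ hsum]
    change _ = coef (⁅(pd i : Der K 8), x.2⁆ (X j)) _
    rw [Derivation.commutator_apply, coef_sub, coef_pd, Function.update_self, Function.update_idem,
      Nat.sub_add_cancel (by omega), Function.update_eq_self, pd_X]
    have : x.2 (if i = j then (1 : DP K 8) else 0) = 0 := by
      split_ifs
      · exact Derivation.map_one_eq_zero _
      · exact map_zero _
    rw [this, Kas.coef_zero, sub_zero]

theorem mem_vect (h : Pairs K T) {x : Der K 7 × Der K 8} (hx : x ∈ ⨆ q, T q) :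
    x.2 ∈ vect K (⊤ : Fin 8 → ℕ∞) := by
  have : (⨆ q, T q) ≤ (vect K (⊤ : Fin 8 → ℕ∞)).toSubmodule.comap (LinearMap.snd K _ _) :=
    iSup_le fun q x hx => homS_le_vect (h.hom q x hx)
  exact this hx

theorem snd_eq_of_represents (h : Pairs K T) {x : Der K 7 × Der K 8} (hx : x ∈ ⨆ q, T q)
    {D : Der K 8} (hD : D ∈ vect K (⊤ : Fin 8 → ℕ∞)) (hr : Represents D (pairF x)) : D = x.2 :=
  vect_ext hD (h.mem_vect hx) fun j => coef_ext fun r => (hr r j).trans (h.represents hx r j).symm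

theorem snd_eq_zero (h : Pairs K T) {x : Der K 7 × Der K 8} (hx : x ∈ ⨆ q, T q)
    (h0 : pairC x = 0) : x.2 = 0 := by
  have h1 : pairF x = 0 := contact_injective (h0.trans (map_zero (contactL K)).symm)
  refine (h.snd_eq_of_represents hx (zero_mem _) ?_).symm
  have := h.represents (x := 0) (zero_mem _)
  rwa [map_zero, ← h1] at this

theorem snd_eq_snd (h : Pairs K T) {x y : Der K 7 × Der K 8} (hx : x ∈ ⨆ q, T q)
    (hy : y ∈ ⨆ q, T q) (h0 : pairC x = pairC y) : x.2 = y.2 :=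
  sub_eq_zero.1 (h.snd_eq_zero (sub_mem hx hy) (by rw [map_sub, h0, sub_self]))

theorem map_iSup (h : Pairs K T) : (⨆ q, T q).map pairC = (kas7 K ⊤).toSubmodule := by
  rw [h.sup, Submodule.map_iSup]

theorem exists_pair (h : Pairs K T) {D : Der K 7} (hD : D ∈ kas7 K ⊤) :
    ∃ x ∈ ⨆ q, T q, pairC x = D := by
  rwa [← LieSubalgebra.mem_toSubmodule, ← h.map_iSup] at hD

theorem pairC_mem (h : Pairs K T) {x : Der K 7 × Der K 8} (hx : x ∈ ⨆ q, T q) :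
    pairC x ∈ kas7 K ⊤ := by
  rw [← LieSubalgebra.mem_toSubmodule, ← h.map_iSup]
  exact ⟨x, hx, rfl⟩

theorem exists_pair_of_homS (h : Pairs K T) {q : ℕ} {D : Der K 7} (hD : D ∈ kas7 K ⊤)
    (hq : D ∈ homS K wReg ((q : ℤ) - 2)) : ∃ x ∈ T q, pairC x = D := by
  rw [← LieSubalgebra.mem_toSubmodule, h.sup] at hD
  have := hproj_mem_of_iSup (w := wReg) (G := fun q => (T q).map pairC) (fun q => ?_) hD q
  · rw [hproj_self hq] at this
    exact this
  · rintro _ ⟨x, hx, rfl⟩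
    exact h.homC q x hx

theorem bracket_one (h : Pairs K T) {q : ℕ} {x y : Der K 7 × Der K 8} (hx : x ∈ T 1)
    (hy : y ∈ T (q + 1)) : ∃ z ∈ T q, pairC z = ⁅pairC x, pairC y⁆ ∧ z.2 = ⁅x.2, y.2⁆ := by
  replace hx := h.one hx
  induction hx using Submodule.span_induction with
  | zero => exact ⟨0, zero_mem _, by simp, by simp⟩
  | add a b _ _ ha hb =>
    obtain ⟨z, h1, h2, h3⟩ := ha
    obtain ⟨z', h1', h2', h3'⟩ := hb
    exact ⟨z + z', add_mem h1 h1', by rw [map_add, map_add, add_lie, h2, h2'],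
      by rw [Prod.snd_add, Prod.snd_add, add_lie, h3, h3']⟩
  | smul c a _ ha =>
    obtain ⟨z, h1, h2, h3⟩ := ha
    exact ⟨c • z, Submodule.smul_mem _ c h1, by rw [map_smul, map_smul, smul_lie, h2],
      by rw [Prod.smul_snd, Prod.smul_snd, smul_lie, h3]⟩
  | mem a ha =>
    obtain ⟨i, rfl⟩ := ha
    have h1 := h.ad q i y hy
    refine ⟨_, h1.1, ?_, rfl⟩
    rw [h1.2]
    congr 2
    change en K i = (en K i • (pd 0 : Der K 7)) (X 0)
    rw [smul_pd_X, if_pos rfl]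

theorem bracket (h : Pairs K T) (m : ℕ) : ∀ p q, p + q = m → ∀ x ∈ T p, ∀ y ∈ T q,
    ∃ z ∈ T (m - 2), pairC z = ⁅pairC x, pairC y⁆ ∧ z.2 = ⁅x.2, y.2⁆ := by
  induction m with
  | zero =>
    intro p q hpq x hx y hy
    obtain rfl : p = 0 := by omega
    rw [h.zero, Submodule.mem_bot] at hx
    exact ⟨0, zero_mem _, by simp [hx], by simp [hx]⟩
  | succ m ih =>
    intro p q hpq x hx y hy
    rcases p with _ | _ | p
    · rw [h.zero, Submodule.mem_bot] at hx
      exact ⟨0, zero_mem _, by simp [hx], by simp [hx]⟩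
    · rcases q with _ | q
      · rw [h.zero, Submodule.mem_bot] at hy
        exact ⟨0, zero_mem _, by simp [hy], by simp [hy]⟩
      · obtain rfl : m = q + 1 := by omega
        exact h.bracket_one hx hy
    rcases q with _ | _ | q
    · rw [h.zero, Submodule.mem_bot] at hy
      exact ⟨0, zero_mem _, by simp [hy], by simp [hy]⟩
    · obtain rfl : m = p + 2 := by omega
      rw [lie_comm_der (pairC x), lie_comm_der x.2]
      exact h.bracket_one hy hx
    obtain rfl : m = p + q + 3 := by omega
    have hxT : x ∈ ⨆ q, T q := Submodule.mem_iSup_of_mem _ hx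
    have hyT : y ∈ ⨆ q, T q := Submodule.mem_iSup_of_mem _ hy
    obtain ⟨z, hz, hzX⟩ := h.exists_pair_of_homS (q := p + q + 2)
      ((kas7 K ⊤).lie_mem (h.pairC_mem hxT) (h.pairC_mem hyT))
      (lie_mem_homS (by push_cast; ring) (h.homC _ x hx) (h.homC _ y hy))
    have hzT : z ∈ ⨆ q, T q := Submodule.mem_iSup_of_mem _ hz
    refine ⟨z, hz, hzX, ?_⟩
    have key : ∀ i, ⁅(pd i : Der K 8), z.2 - ⁅x.2, y.2⁆⁆ = 0 := by
      intro i
      obtain ⟨z1, h1, h2, h3⟩ := ih (p + 1) (q + 2) (by omega) _ (h.ad _ i x hx).1 y hy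
      obtain ⟨z2, h1', h2', h3'⟩ := ih (p + 2) (q + 1) (by omega) x hx _ (h.ad _ i y hy).1
      have := h.snd_eq_snd (h.adP_mem hzT i)
        (add_mem (Submodule.mem_iSup_of_mem _ h1) (Submodule.mem_iSup_of_mem _ h1')) ?_
      · change ⁅(pd i : Der K 8), z.2⁆ = z1.2 + z2.2 at this
        rw [lie_sub, this, h3, h3', leibniz_lie (pd i : Der K 8)]
        exact sub_self _
      · rw [(h.ad _ i z hz).2, hzX, map_add, h2, h2', (h.ad _ i x hx).2, (h.ad _ i y hy).2,
          leibniz_lie (contact (en K i))]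
    have hhom : z.2 - ⁅x.2, y.2⁆ ∈ homS K wOne ((p + q : ℕ) : ℤ) := by
      refine sub_mem ?_ (lie_mem_homS ?_ (h.hom _ x hx) (h.hom _ y hy))
      · have := h.hom _ z hz
        rwa [show ((p + q + 2 : ℕ) : ℤ) - 2 = (p + q : ℕ) by push_cast; ring] at this
      · push_cast; ring
    have : z.2 - ⁅x.2, y.2⁆ = 0 := by
      refine vect_ext (homS_le_vect hhom) (zero_mem _) fun j => ?_
      rw [Derivation.zero_apply]
      exact apply_X_eq_zero_of_pd (fun i => (wOne_eq i).ge) (by positivity) hhom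
        fun i => pd_apply_X_of_lie (key i) j
    exact sub_eq_zero.1 this

theorem bracket_mem (h : Pairs K T) {x y : Der K 7 × Der K 8} (hx : x ∈ ⨆ q, T q)
    (hy : y ∈ ⨆ q, T q) : ∃ z ∈ ⨆ q, T q, pairC z = ⁅pairC x, pairC y⁆ ∧ z.2 = ⁅x.2, y.2⁆ := by
  induction hx using Submodule.iSup_induction' with
  | zero => exact ⟨0, zero_mem _, by simp, by simp⟩
  | add a b _ _ ha hb =>
    obtain ⟨z, h1, h2, h3⟩ := ha
    obtain ⟨z', h1', h2', h3'⟩ := hb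
    exact ⟨z + z', add_mem h1 h1', by rw [map_add, map_add, add_lie, h2, h2'],
      by rw [Prod.snd_add, Prod.snd_add, add_lie, h3, h3']⟩
  | mem p x hx =>
    induction hy using Submodule.iSup_induction' with
    | zero => exact ⟨0, zero_mem _, by simp, by simp⟩
    | add a b _ _ ha hb =>
      obtain ⟨z, h1, h2, h3⟩ := ha
      obtain ⟨z', h1', h2', h3'⟩ := hb
      exact ⟨z + z', add_mem h1 h1', by rw [map_add, map_add, lie_add, h2, h2'],
        by rw [Prod.snd_add, Prod.snd_add, lie_add, h3, h3']⟩
    | mem q y hy =>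
      obtain ⟨z, hz, h1, h2⟩ := h.bracket (p + q) p q rfl x hx y hy
      exact ⟨z, Submodule.mem_iSup_of_mem _ hz, h1, h2⟩

/-- The realization of `kas`, before the restriction of the shearing vector. -/
theorem kas8_top (h : Pairs K T) :
    (kas8 K ⊤).toSubmodule = (⨆ q, T q).map (LinearMap.snd K (Der K 7) (Der K 8)) := by
  have hA : ∀ D : Der K 8, (D ∈ vect K (⊤ : Fin 8 → ℕ∞) ∧
      ∃ f, contact f ∈ kas7 K ⊤ ∧ Represents D f) ↔ ∃ x ∈ ⨆ q, T q, x.2 = D := by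
    intro D
    constructor
    · rintro ⟨hD, f, hf, hr⟩
      obtain ⟨x, hx, e⟩ := h.exists_pair hf
      have : pairF x = f := contact_injective e
      exact ⟨x, hx, (h.snd_eq_of_represents hx hD (this ▸ hr)).symm⟩
    · rintro ⟨x, hx, rfl⟩
      exact ⟨h.mem_vect hx, pairF x, h.pairC_mem hx, h.represents hx⟩
  let L : LieSubalgebra K (Der K 8) :=
    { (⨆ q, T q).map (LinearMap.snd K (Der K 7) (Der K 8)) with
      lie_mem' := by
        rintro _ _ ⟨x, hx, rfl⟩ ⟨y, hy, rfl⟩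
        obtain ⟨z, hz, -, e⟩ := h.bracket_mem hx hy
        exact ⟨z, hz, e⟩ }
  have hL : LieSubalgebra.lieSpan K (Der K 8) {D | D ∈ vect K (⊤ : Fin 8 → ℕ∞) ∧
      ∃ f, contact f ∈ kas7 K ⊤ ∧ Represents D f} = L := by
    apply le_antisymm
    · rw [LieSubalgebra.lieSpan_le]
      exact fun D hD => (hA D).1 hD
    · exact fun D hD => LieSubalgebra.subset_lieSpan ((hA D).2 hD)
  have : kas8 K ⊤ = L := by
    rw [kas8, hL]
    refine inf_eq_left.2 ?_
    rintro _ ⟨x, hx, rfl⟩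
    exact h.mem_vect hx
  rw [this]

end Pairs

end

/-! ### The families of pairs -/

/-- The families of elements of `kas(8; M)`. -/
def kas8Str : List (ℕ × List ℕ) := kasPairs.map fun x => (x.1, x.2.2)

/-- The key of the generating function `e_i` of degree -1. -/
def nk (i : ℕ) : ℕ := [0, 0x1100, 0x10100, 0x11000, 0x100, 0x1000, 0x10000, 0x11100].getD i 0

/-- The function `D f` for the field `D` given by the list `A` and the function `f` given by `B`. -/
def brF (A B : List ℕ) : List ℕ := A.flatMap fun a => B.flatMap fun b => brHalf a b

/-- The pair of lists is mapped by the elements of degree -1 to combinations of the pairs `C`. -/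
def adOK (C : List (List ℕ × List ℕ)) (F L : List ℕ) : Bool :=
  let rows := elimK (C.map Prod.snd) 0 []
  (List.range 8).all fun i =>
    let y := ctL [nk i]
    let v := coordK rows (brL [i] L)
    eqv (brL [i] L) (pick v 0 (C.map Prod.snd)) && eqv (brF y F) (pick v 0 (C.map Prod.fst)) &&
      eqv (ctL (brF y F)) (brL y (ctL F))

/-- The pairs that occur in the components of degree one less. -/
def closePairs (g : ℕ) : List (List ℕ × List ℕ) :=
  (kasPairs.filter fun x => Nat.beq (x.1 + 1) g).map Prod.snd ++
    (kasPairs.filter fun x => Nat.beq x.1 g).map fun x => (shiftK 0 1 x.2.1, shiftK 0 1 x.2.2)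

/-- The pairs of degree -1. -/
def lowPairs : List (List ℕ × List ℕ) :=
  (kasPairs.filter fun x => Nat.beq x.1 1).map fun x => (shiftK 0 8 x.2.1, shiftK 0 8 x.2.2)

/-- The list consists of keys of functions with a positive digit at the first indeterminate. -/
def funOK (F : List ℕ) : Bool := F.all fun k => Nat.beq (k % 16) 0 && Nat.ble 1 (dig k 1)

/-- The elements of degree 0 that are not products of others. -/
def kas8D : List ℕ := [0x10, 0x101, 0x1002, 0x10003]

set_option maxRecDepth 100000

theorem kasPairs_adOK : (kasPairs.all fun x => adOK (closePairs x.1) x.2.1 x.2.2) = true := by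
  decide +kernel

theorem kas8D_adOK : adOK lowPairs [16] kas8D = true := by
  decide +kernel

theorem kasPairs_funOK : (kasPairs.all fun x => funOK x.2.1 && Nat.ble 1 x.1 &&
    (List.range 8).all fun i => funOK (brF (ctL [nk i]) x.2.1)) = true := by
  decide +kernel

theorem kas8D_funOK : ((List.range 8).all fun i =>
    (brF (ctL [nk i]) [16]).all fun k => Nat.beq (k % 16) 0) = true := by
  decide +kernel

theorem kasPairs_strOK : (kasPairs.all fun x => strOK 7 [0] [1, 0, 0, 0, 1, 1, 1] (x.1, x.2.1) &&
    strOK 7 [0] [1, 0, 0, 0, 1, 1, 1] (x.1, ctL x.2.1)) = true := by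
  decide +kernel

theorem kas8_strOK : kas8Str.all (strOK 8 [0] wt8) = true := by
  decide +kernel

theorem kas8_SOK : SOK 8 [0] wt8 = true := by
  decide +kernel

theorem lowPairs_eq : (lowPairs.all fun x => (eqv x.1 [] && eqv x.2 []) ||
    (List.range 8).any fun i => eqv x.1 [nk i] && eqv x.2 [i]) = true := by
  decide +kernel

theorem kasPairs_kas7Str : (kasPairs.all fun x => kas7Str.any fun y => eqv (ctL x.2.1) y.2) = true := by
  decide +kernel

theorem kas7Str_kasPairs : (kas7Str.all fun y => kasPairs.any fun x => eqv (ctL x.2.1) y.2) = true := by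
  decide +kernel

theorem ctL_nk : ∀ i < 8, (ctL [nk i]).all (fun a => validKey 7 a && Nat.beq (dig a 1) 0) = true := by
  decide +kernel

theorem nk_negExp : ∀ i : Fin 8, nk i % 16 = 0 ∧ ∀ j : Fin 7, dig (nk i) (j.val + 1) = negExp i j := by
  decide +kernel

/-! ### The space of pairs -/

section
variable [CharP K 2]

theorem kz_nk (i : Fin 8) : kz K 7 [nk i] = en K i • pd 0 := by
  rw [kz, kf, lsum_cons, lsum_nil, add_zero, kfield, (nk_negExp i).1, kmono_zero_left, en]
  congr 2
  exact funext (nk_negExp i).2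

theorem contact_en (i : Fin 8) : contact (en K i) = kz K 7 (ctL [nk i]) := by
  rw [← contact_fz (K := K) (L := [nk i]) (by simpa using (nk_negExp i).1), fz, lsum_cons, lsum_nil,
    add_zero, kmono_zero_left, en]
  congr 2
  exact (funext (nk_negExp i).2).symm

theorem pairF_kf {base r : Fin 7 → ℕ} {F : List ℕ} (hF : ∀ k ∈ F, k % 16 = 0) (D : Der K 8) :
    pairF (kf K base r F, D) = lsum (kmono K base r) F := by
  change (kf K base r F) (X 0) = _
  induction F with
  | nil => rfl
  | cons k F ih =>
    rw [kf, lsum_cons, lsum_cons, Derivation.add_apply, ← ih fun k hk => hF k (List.mem_cons_of_mem _ hk),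
      kfield, hF k List.mem_cons_self, smul_pd_X]
    rfl

theorem kz_apply_smul_pd {base r : Fin 7 → ℕ} {A F : List ℕ}
    (hA : ∀ a ∈ A, validKey 7 a = true ∧ dig a 1 = 0)
    (hF : ∀ k ∈ F, TShift base r k ∧ k % 16 = 0) :
    kz K 7 A (lsum (kmono K base r) F) • (pd 0 : Der K 7) = kf K base r (brF A F) := by
  induction A with
  | nil => exact zero_smul _ _
  | cons a A ih =>
    rw [kz, kf, lsum_cons, Derivation.add_apply, add_smul, ih fun a ha => hA a (List.mem_cons_of_mem _ ha),
      show brF (a :: A) F = F.flatMap (brHalf a) ++ brF A F from rfl, kf_append]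
    congr 1
    obtain ⟨hv, h0⟩ := hA a List.mem_cons_self
    clear ih hA
    induction F with
    | nil => rw [lsum_nil, map_zero, zero_smul]; rfl
    | cons k F ih =>
      rw [lsum_cons, map_add, add_smul, ih fun k hk => hF k (List.mem_cons_of_mem _ hk),
        List.flatMap_cons, kf_append]
      congr 1
      obtain ⟨h1, h2⟩ := hF k List.mem_cons_self
      exact mul_pd_kmono h1 h2 hv h0 (j := 0) (by norm_num)

theorem pick_pair_mem {base r : Fin 7 → ℕ} {base' r' : Fin 8 → ℕ} (C : List (List ℕ × List ℕ))
    {P : Submodule K (Der K 7 × Der K 8)}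
    (h : ∀ x ∈ C, (kf K base r x.1, kf K base' r' x.2) ∈ P) (v i : ℕ) :
    (kf K base r (pick v i (C.map Prod.fst)), kf K base' r' (pick v i (C.map Prod.snd))) ∈ P := by
  induction C generalizing i with
  | nil => exact zero_mem P
  | cons x C ih =>
    have hC := ih (fun x hx => h x (List.mem_cons_of_mem _ hx)) (i + 1)
    rw [List.map_cons, List.map_cons, pick, pick]
    cases v.testBit i
    · exact hC
    · rw [cond_true, cond_true, kf_append, kf_append, ← Prod.mk_add_mk]
      exact add_mem (h x List.mem_cons_self) hC

theorem exists_of_adOK {C : List (List ℕ × List ℕ)} {F L : List ℕ} (h : adOK C F L = true)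
    (i : Fin 8) : ∃ v, eqv (brL [i.val] L) (pick v 0 (C.map Prod.snd)) = true ∧
      eqv (brF (ctL [nk i]) F) (pick v 0 (C.map Prod.fst)) = true ∧
      eqv (ctL (brF (ctL [nk i]) F)) (brL (ctL [nk i]) (ctL F)) = true := by
  have h1 := List.all_eq_true.1 h i.val (List.mem_range.2 i.2)
  simp only [Bool.and_eq_true] at h1
  exact ⟨_, h1.1.1, h1.1.2, h1.2⟩

theorem adP_kf {base r : Fin 7 → ℕ} {base' r' : Fin 8 → ℕ} {C : List (List ℕ × List ℕ)}
    {F L : List ℕ} (h : adOK C F L = true) (hF : ∀ k ∈ F, TShift base r k ∧ k % 16 = 0) (i : Fin 8)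
    (hF' : ∀ k ∈ brF (ctL [nk i]) F, TShift base r k ∧ k % 16 = 0) (hv : validL 7 (ctL F) = true)
    (hc : ∀ a ∈ ctL [nk i], ∀ b ∈ ctL F, Compat base r a b) (hL : validL 8 L = true)
    (hc' : ∀ b ∈ L, Compat base' r' i b) {P : Submodule K (Der K 7 × Der K 8)}
    (hP : ∀ x ∈ C, (kf K base r x.1, kf K base' r' x.2) ∈ P) :
    adP i (kf K base r F, kf K base' r' L) ∈ P ∧
      pairC (adP i (kf K base r F, kf K base' r' L)) =
        ⁅contact (en K i), pairC (kf K base r F, kf K base' r' L)⁆ := by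
  obtain ⟨v, h1, h2, h3⟩ := exists_of_adOK h i
  have hA : ∀ a ∈ ctL [nk i], validKey 7 a = true ∧ dig a 1 = 0 := by
    intro a ha
    have := List.all_eq_true.1 (ctL_nk i i.2) a ha
    rwa [Bool.and_eq_true, Nat.beq_eq] at this
  have hpd : (pd i : Der K 8) = kz K 8 [i.val] := by
    rw [kz_single (by omega)]
    congr 1
    ext
    exact (val_ofNat i.2).symm
  have e : adP i (kf K base r F, kf K base' r' L) =
      (kf K base r (brF (ctL [nk i]) F), kf K base' r' (brL [i.val] L)) := by
    change ((contact (en K i)) (pairF (kf K base r F, kf K base' r' L)) • (pd 0 : Der K 7),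
      ⁅(pd i : Der K 8), kf K base' r' L⁆) = _
    rw [pairF_kf fun k hk => (hF k hk).2, contact_en, kz_apply_smul_pd hA hF, hpd,
      lie_kf_of_compat ?_ hL ?_]
    · simp only [validL, List.all_cons, List.all_nil, Bool.and_true, validKey_iff]
      omega
    · simpa using hc'
  rw [e]
  constructor
  · rw [kf_eq_of_eqv h1, kf_eq_of_eqv h2]
    exact pick_pair_mem C hP _ _
  · change contact (pairF _) = ⁅contact (en K i), contact (pairF _)⁆
    rw [pairF_kf fun k hk => (hF' k hk).2, pairF_kf fun k hk => (hF k hk).2, contact_lsum hF',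
      contact_lsum hF, contact_en, lie_kf_of_compat ?_ hv hc, kf_eq_of_eqv h3]
    rw [validL, List.all_eq_true]
    exact fun a ha => (hA a ha).1

theorem sbase_zero_of_ne {i : Fin n} [NeZero n] (hi : i ≠ 0) (m : ℕ) :
    (sbase [0] : Fin n → ℕ) i = 0 ∧ (Pi.single 0 m : Fin n → ℕ) i = 0 := by
  refine ⟨?_, Pi.single_eq_of_ne hi _⟩
  rw [sbase, if_neg]
  rw [List.mem_singleton]
  exact fun h => hi (Fin.ext (by rw [h, Fin.val_zero]))

theorem TShift.single {k : ℕ} (h : dig k 1 ≠ 0) (m : ℕ) : TShift (sbase [0]) (Pi.single 0 m) k := by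
  intro j
  by_cases hj : j = 0
  · exact Or.inr ⟨hj, h⟩
  · exact Or.inl (sbase_zero_of_ne hj m)

theorem Compat.single [NeZero n] {a b : ℕ} (ha : dig a 1 = 0) (hb : dig b 1 ≠ 0) (m : ℕ) :
    Compat (sbase [0] : Fin n → ℕ) (Pi.single 0 m) a b := by
  intro j
  by_cases hj : j = 0
  · subst hj
    rw [Fin.val_zero]
    exact Or.inr ⟨ha, hb⟩
  · exact Or.inl (sbase_zero_of_ne hj m)

variable (K) in
/-- The pair of the family of `F` and `L` with the parameter `m`. -/
def pairStr (m : ℕ) (x : List ℕ × List ℕ) : Der K 7 × Der K 8 :=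
  (kf K (sbase [0]) (Pi.single 0 m) x.1, kf K (sbase [0]) (Pi.single 0 m) x.2)

variable (K) in
/-- The pair of the generating function `t`. -/
def pairT : Der K 7 × Der K 8 := (kz K 7 [16], kz K 8 kas8D)

variable (K) in
/-- The graded components of the space of pairs. -/
def kasT (q : ℕ) : Submodule K (Der K 7 × Der K 8) :=
  Submodule.span K {x | (∃ m, ∃ y ∈ kasPairs, y.1 + m = q ∧ x = pairStr K m y.2) ∨
    (q = 2 ∧ x = pairT K)}

theorem pairStr_mem {q m : ℕ} {y : ℕ × List ℕ × List ℕ} (hy : y ∈ kasPairs) (hq : y.1 + m = q) :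
    pairStr K m y.2 ∈ kasT K q := Submodule.subset_span (Or.inl ⟨m, y, hy, hq, rfl⟩)

theorem kasT_induction {q : ℕ} {P : Submodule K (Der K 7 × Der K 8)}
    (h : ∀ m, ∀ y ∈ kasPairs, y.1 + m = q → pairStr K m y.2 ∈ P) (h' : q = 2 → pairT K ∈ P) :
    kasT K q ≤ P := by
  refine Submodule.span_le.2 ?_
  rintro _ (⟨m, y, hy, hq, rfl⟩ | ⟨hq, rfl⟩)
  · exact h m y hy hq
  · exact h' hq

theorem kasPairs_spec {y : ℕ × List ℕ × List ℕ} (hy : y ∈ kasPairs) : 1 ≤ y.1 ∧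
    (∀ k ∈ y.2.1, dig k 1 ≠ 0 ∧ k % 16 = 0) ∧
    (∀ i < 8, ∀ k ∈ brF (ctL [nk i]) y.2.1, dig k 1 ≠ 0 ∧ k % 16 = 0) ∧
    strOK 7 [0] [1, 0, 0, 0, 1, 1, 1] (y.1, y.2.1) = true ∧
    strOK 7 [0] [1, 0, 0, 0, 1, 1, 1] (y.1, ctL y.2.1) = true ∧
    strOK 8 [0] wt8 (y.1, y.2.2) = true ∧
    adOK (closePairs y.1) y.2.1 y.2.2 = true := by
  have key : ∀ F, funOK F = true → ∀ k ∈ F, dig k 1 ≠ 0 ∧ k % 16 = 0 := by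
    intro F hF k hk
    have := List.all_eq_true.1 hF k hk
    rw [Bool.and_eq_true, Nat.beq_eq, Nat.ble_eq] at this
    omega
  have h1 := List.all_eq_true.1 kasPairs_funOK y hy
  rw [Bool.and_eq_true, Bool.and_eq_true, Nat.ble_eq, List.all_eq_true] at h1
  have h2 := List.all_eq_true.1 kasPairs_strOK y hy
  rw [Bool.and_eq_true] at h2
  exact ⟨h1.1.2, key _ h1.1.1, fun i hi => key _ (h1.2 i (List.mem_range.2 hi)), h2.1, h2.2,
    List.all_eq_true.1 kas8_strOK _ (List.mem_map.2 ⟨y, hy, rfl⟩),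
    List.all_eq_true.1 kasPairs_adOK y hy⟩

theorem pairStr_eq_kz (y : List ℕ × List ℕ) (hF : ∀ k ∈ y.1, dig k 1 ≤ 8)
    (hL : ∀ k ∈ y.2, dig k 1 ≤ 8) :
    (kz K 7 (shiftK 0 8 y.1), kz K 8 (shiftK 0 8 y.2)) = pairStr K 0 y := by
  have key : ∀ {n : ℕ} [NeZero n] (L : List ℕ), (∀ k ∈ L, dig k 1 ≤ 8) →
      kz K n (shiftK 0 8 L) = kf K (sbase [0]) (Pi.single 0 0) L := by
    intro n _ L hL
    have h8 : (sbase [0] : Fin n → ℕ) (Fin.ofNat n 0) = 8 :=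
      sbase_ofNat (Nat.pos_of_ne_zero (NeZero.ne n)) (List.mem_singleton_self 0)
    rw [kz_shiftK (Nat.pos_of_ne_zero (NeZero.ne n)) (kf_sbase_self (S := [0]) L) h8.ge (by rwa [h8])]
    congr 1
    funext j
    by_cases hj : j = 0
    · subst hj
      rw [Pi.single_eq_same]
      exact (Function.update_self _ _ _).trans (by rw [h8])
    · exact (Function.update_of_ne hj _ _).trans
        ((sbase_zero_of_ne hj 0).1.trans (sbase_zero_of_ne hj 0).2.symm)
  exact Prod.ext (key _ hF) (key _ hL)

theorem kf_shift_one [NeZero n] {L : List ℕ} (hL : ∀ k ∈ L, 1 ≤ dig k 1 ∧ dig k 1 ≤ 8) (m : ℕ) :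
    kf K (sbase [0] : Fin n → ℕ) (Pi.single 0 m) (shiftK 0 1 L) =
      if m = 0 then 0 else kf K (sbase [0]) (Pi.single 0 (m - 1)) L := by
  have hn : 0 < n := Nat.pos_of_ne_zero (NeZero.ne n)
  have h0 : (Pi.single 0 m : Fin n → ℕ) (Fin.ofNat n 0) = m := Pi.single_eq_same _ _
  have h8 : (sbase [0] : Fin n → ℕ) (Fin.ofNat n 0) = 8 := sbase_ofNat hn (List.mem_singleton_self 0)
  rw [← lie_pn_kf_shift hn (Or.inr fun k hk => (hL k hk).1),
    lie_pn_kf hn fun k hk => (hL k hk).2.trans h8.ge, h0]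
  congr 2
  funext j
  by_cases hj : j = 0
  · subst hj
    rw [Pi.single_eq_same]
    exact Function.update_self _ _ _
  · refine (Function.update_of_ne hj _ _).trans ?_
    rw [Pi.single_eq_of_ne hj, Pi.single_eq_of_ne hj]

theorem kasPairs_dig {y : ℕ × List ℕ × List ℕ} (hy : y ∈ kasPairs) :
    (∀ k ∈ y.2.1, 1 ≤ dig k 1 ∧ dig k 1 ≤ 8) ∧ (∀ k ∈ y.2.2, 1 ≤ dig k 1 ∧ dig k 1 ≤ 8) ∧
      ∀ k ∈ ctL y.2.1, 1 ≤ dig k 1 ∧ dig k 1 ≤ 8 := by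
  obtain ⟨-, -, -, h1, h2, h3, -⟩ := kasPairs_spec hy
  have key : ∀ {n : ℕ} [NeZero n] {wl : List ℕ} {g : ℕ} {L : List ℕ} (_ : 0 < n),
      strOK n [0] wl (g, L) = true → ∀ k ∈ L, 1 ≤ dig k 1 ∧ dig k 1 ≤ 8 := by
    intro n _ wl g L hn h k hk
    have := strOK_dig h hk hn
    rwa [if_pos (List.mem_singleton_self 0)] at this
  exact ⟨key (by norm_num) h1, key (by norm_num) h3, key (by norm_num) h2⟩

theorem closePairs_mem {y : ℕ × List ℕ × List ℕ} {q m : ℕ} (hq : y.1 + m = q + 1)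
    {x : List ℕ × List ℕ} (hx : x ∈ closePairs y.1) : pairStr K m x ∈ kasT K q := by
  rw [closePairs, List.mem_append, List.mem_map, List.mem_map] at hx
  rcases hx with ⟨z, hz, rfl⟩ | ⟨z, hz, rfl⟩
  · rw [List.mem_filter, Nat.beq_eq] at hz
    exact pairStr_mem hz.1 (by omega)
  · rw [List.mem_filter, Nat.beq_eq] at hz
    obtain ⟨h1, h2, -⟩ := kasPairs_dig hz.1
    have e : pairStr K m (shiftK 0 1 z.2.1, shiftK 0 1 z.2.2) =
        if m = 0 then 0 else pairStr K (m - 1) z.2 := by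
      rw [pairStr, kf_shift_one h1, kf_shift_one h2]
      split_ifs <;> rfl
    rw [e]
    split_ifs
    · exact zero_mem _
    · exact pairStr_mem hz.1 (by omega)

theorem lowPairs_mem {x : List ℕ × List ℕ} (hx : x ∈ lowPairs) :
    (kz K 7 x.1, kz K 8 x.2) ∈ kasT K 1 := by
  obtain ⟨z, hz, rfl⟩ := List.mem_map.1 hx
  rw [List.mem_filter, Nat.beq_eq] at hz
  obtain ⟨h1, h2, -⟩ := kasPairs_dig hz.1
  rw [pairStr_eq_kz z.2 (fun k hk => (h1 k hk).2) fun k hk => (h2 k hk).2]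
  exact pairStr_mem hz.1 (by omega)

theorem wdeg_single_one [NeZero n] {wl : List ℕ} (h : wl.getD 0 0 = 1) (m : ℕ) :
    wdeg (wf wl : Fin n → ℕ) (Pi.single 0 m) = m := by
  rw [wdeg_single, wf, Fin.val_zero, h, one_mul]

theorem pairStr_ad {q m : ℕ} {y : ℕ × List ℕ × List ℕ} (hy : y ∈ kasPairs) (hq : y.1 + m = q + 1)
    (i : Fin 8) : adP i (pairStr K m y.2) ∈ kasT K q ∧
      pairC (adP i (pairStr K m y.2)) = ⁅contact (en K i), pairC (pairStr K m y.2)⁆ := by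
  obtain ⟨-, h1, h2, -, h3, h4, h5⟩ := kasPairs_spec hy
  obtain ⟨-, h6, h7⟩ := kasPairs_dig hy
  refine adP_kf h5 (fun k hk => ⟨TShift.single (h1 k hk).1 m, (h1 k hk).2⟩) i
    (fun k hk => ⟨TShift.single (h2 i i.2 k hk).1 m, (h2 i i.2 k hk).2⟩) (strOK_valid h3)
    (fun a ha b hb => ?_) (strOK_valid h4) (fun b hb => ?_) fun x hx => closePairs_mem hq hx
  · have := List.all_eq_true.1 (ctL_nk i i.2) a ha
    rw [Bool.and_eq_true, Nat.beq_eq] at this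
    exact Compat.single this.2 (Nat.one_le_iff_ne_zero.1 (h7 b hb).1) m
  · refine Compat.single ?_ (Nat.one_le_iff_ne_zero.1 (h6 b hb).1) m
    rw [dig, Nat.div_eq_of_lt (by omega)]

theorem pairT_ad (i : Fin 8) : adP i (pairT K) ∈ kasT K 1 ∧
    pairC (adP i (pairT K)) = ⁅contact (en K i), pairC (pairT K)⁆ := by
  have h0 : ∀ k, TShift 0 0 k := fun k j => Or.inl ⟨rfl, rfl⟩
  refine adP_kf kas8D_adOK (fun k hk => ⟨h0 k, ?_⟩) i (fun k hk => ⟨h0 k, ?_⟩) (by decide +kernel)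
    (fun _ _ _ _ _ => Or.inl ⟨rfl, rfl⟩) (by decide +kernel) (fun _ _ _ => Or.inl ⟨rfl, rfl⟩)
    fun x hx => lowPairs_mem hx
  · rw [List.mem_singleton.1 hk]
  · have := List.all_eq_true.1 kas8D_funOK i (List.mem_range.2 i.2)
    have := List.all_eq_true.1 this k hk
    rwa [Nat.beq_eq] at this

theorem pairC_pairStr {y : ℕ × List ℕ × List ℕ} (hy : y ∈ kasPairs) (m : ℕ) :
    pairC (pairStr K m y.2) = kf K (sbase [0]) (Pi.single 0 m) (ctL y.2.1) := by
  have h1 := (kasPairs_spec hy).2.1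
  change contact (pairF (pairStr K m y.2)) = _
  rw [pairStr, pairF_kf fun k hk => (h1 k hk).2]
  exact contact_lsum fun k hk => ⟨TShift.single (h1 k hk).1 m, (h1 k hk).2⟩

theorem pairC_pairT : pairC (pairT K) = kz K 7 [0x10, 0x101, 0x1002, 0x10003] := by
  have h0 : ∀ k ∈ [16], k % 16 = 0 := by decide
  change contact (pairF (pairT K)) = _
  rw [pairT, pairF_kf h0]
  exact (contact_fz h0).trans (kf_eq_of_eqv (by decide +kernel))

theorem strM_single [NeZero n] {wl : List ℕ} {Str : List (ℕ × List ℕ)} :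
    strM K n [0] wl Str = Submodule.span K {D | ∃ m, ∃ x ∈ Str,
      D = kf K (sbase [0]) (Pi.single 0 m) x.2} := by
  apply le_antisymm
  · refine iSup_le fun q => Submodule.span_le.2 ?_
    rintro _ ⟨g, L, r, h, h1, -, -, rfl⟩
    refine Submodule.subset_span ⟨r 0, _, h, ?_⟩
    congr 1
    funext j
    by_cases hj : j = 0
    · rw [hj, Pi.single_eq_same]
    · rw [Pi.single_eq_of_ne hj]
      refine h1 j fun hm => hj (Fin.ext ?_)
      rw [List.mem_singleton.1 hm, Fin.val_zero]
  · refine Submodule.span_le.2 ?_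
    rintro _ ⟨m, x, hx, rfl⟩
    refine sq_le_strM _ (Submodule.subset_span ⟨x.1, x.2, _, hx, fun i hi => ?_, by simp, rfl, rfl⟩)
    refine Pi.single_eq_of_ne (fun h => hi ?_) _
    rw [h, Fin.val_zero]
    exact List.mem_singleton_self 0

variable (K) in
/-- The pairs of elements of the families. -/
def kasW : Submodule K (Der K 7 × Der K 8) :=
  Submodule.span K {x | ∃ m, ∃ y ∈ kasPairs, x = pairStr K m y.2}

theorem iSup_kasT : ⨆ q, kasT K q = kasW K ⊔ Submodule.span K {pairT K} := by
  apply le_antisymm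
  · refine iSup_le fun q => kasT_induction (fun m y hy _ => ?_) fun _ => ?_
    · exact Submodule.mem_sup_left (Submodule.subset_span ⟨m, y, hy, rfl⟩)
    · exact Submodule.mem_sup_right (Submodule.mem_span_singleton_self _)
  · refine sup_le (Submodule.span_le.2 ?_) ?_
    · rintro _ ⟨m, y, hy, rfl⟩
      exact Submodule.mem_iSup_of_mem _ (pairStr_mem hy rfl)
    · rw [Submodule.span_singleton_le_iff_mem]
      exact Submodule.mem_iSup_of_mem 2 (Submodule.subset_span (Or.inr ⟨rfl, rfl⟩))

theorem map_pairC_kasW : (kasW K).map pairC = strM K 7 [0] wt7 kas7Str := by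
  rw [strM_single, kasW, Submodule.map_span]
  congr 1
  ext D
  constructor
  · rintro ⟨_, ⟨m, y, hy, rfl⟩, rfl⟩
    obtain ⟨x, hx, e⟩ := List.any_eq_true.1 (List.all_eq_true.1 kasPairs_kas7Str y hy)
    exact ⟨m, x, hx, (pairC_pairStr hy m).trans (kf_eq_of_eqv e)⟩
  · rintro ⟨m, x, hx, rfl⟩
    obtain ⟨y, hy, e⟩ := List.any_eq_true.1 (List.all_eq_true.1 kas7Str_kasPairs x hx)
    exact ⟨_, ⟨m, y, hy, rfl⟩, (pairC_pairStr hy m).trans (kf_eq_of_eqv e)⟩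

theorem map_snd_kasW : (kasW K).map (LinearMap.snd K (Der K 7) (Der K 8)) =
    strM K 8 [0] wt8 kas8Str := by
  rw [strM_single, kasW, Submodule.map_span]
  congr 1
  ext D
  constructor
  · rintro ⟨_, ⟨m, y, hy, rfl⟩, rfl⟩
    exact ⟨m, _, List.mem_map.2 ⟨y, hy, rfl⟩, rfl⟩
  · rintro ⟨m, x, hx, rfl⟩
    obtain ⟨y, hy, rfl⟩ := List.mem_map.1 hx
    exact ⟨_, ⟨m, y, hy, rfl⟩, rfl⟩

theorem wReg_SOK : SOK 7 [0] [1, 0, 0, 0, 1, 1, 1] = true := by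
  decide +kernel

theorem kasT_ad {q : ℕ} (i : Fin 8) {x : Der K 7 × Der K 8} (hx : x ∈ kasT K (q + 1)) :
    adP i x ∈ kasT K q ∧ pairC (adP i x) = ⁅contact (en K i), pairC x⁆ := by
  induction hx using Submodule.span_induction with
  | zero => exact ⟨by rw [map_zero]; exact zero_mem _, by rw [map_zero, map_zero, lie_zero]⟩
  | add a b _ _ ha hb =>
    exact ⟨by rw [map_add]; exact add_mem ha.1 hb.1,
      by rw [map_add, map_add, map_add, lie_add, ha.2, hb.2]⟩
  | smul c a _ ha =>
    exact ⟨by rw [map_smul]; exact Submodule.smul_mem _ c ha.1,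
      by rw [map_smul, map_smul, map_smul, lie_smul, ha.2]⟩
  | mem a ha =>
    rcases ha with ⟨m, y, hy, hq, rfl⟩ | ⟨hq, rfl⟩
    · exact pairStr_ad hy hq i
    · obtain rfl : q = 1 := by omega
      exact pairT_ad i

theorem kasPairs_pairs : Pairs K (kasT K) where
  zero := by
    refine (Submodule.eq_bot_iff _).2 fun x hx => ?_
    refine (kasT_induction (P := ⊥) (fun m y hy hq => ?_) (fun h => absurd h (by norm_num)) hx)
    have := (kasPairs_spec hy).1
    omega
  one := by
    refine kasT_induction (fun m y hy hq => ?_) fun h => absurd h (by norm_num)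
    have h1 := (kasPairs_spec hy).1
    obtain rfl : m = 0 := by omega
    obtain ⟨h2, h3, -⟩ := kasPairs_dig hy
    rw [← pairStr_eq_kz y.2 (fun k hk => (h2 k hk).2) fun k hk => (h3 k hk).2]
    have hl : (shiftK 0 8 y.2.1, shiftK 0 8 y.2.2) ∈ lowPairs :=
      List.mem_map.2 ⟨y, List.mem_filter.2 ⟨hy, Nat.beq_eq.symm ▸ hq⟩, rfl⟩
    have h := List.all_eq_true.1 lowPairs_eq _ hl
    rw [Bool.or_eq_true, Bool.and_eq_true] at h
    dsimp only at h
    rcases h with h | h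
    · have e1 : kz K 7 _ = _ := kf_eq_of_eqv h.1
      have e2 : kz K 8 _ = _ := kf_eq_of_eqv h.2
      rw [e1, e2]
      exact zero_mem _
    · obtain ⟨i, hi, h⟩ := List.any_eq_true.1 h
      rw [List.mem_range] at hi
      rw [Bool.and_eq_true] at h
      refine Submodule.subset_span ⟨⟨i, hi⟩, ?_⟩
      have e1 : kz K 7 _ = _ := kf_eq_of_eqv h.1
      have e2 : kz K 8 _ = _ := kf_eq_of_eqv h.2
      rw [e1, e2]
      refine Prod.ext (kz_nk ⟨i, hi⟩).symm ?_
      change pd _ = kz K 8 [i]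
      rw [kz_single (by omega)]
      congr 1
      ext
      exact (val_ofNat hi).symm
  ad q i x hx := kasT_ad i hx
  homF q x hx := by
    refine (kasT_induction (P := (homS K wReg ((q : ℤ) - 2)).comap (LinearMap.fst K _ _))
      (fun m y hy hq => ?_) (fun hq => ?_)) hx
    · have := kf_mem_homS (K := K) wReg_SOK (kasPairs_spec hy).2.2.2.1 (Pi.single 0 m)
      rwa [wdeg_single_one rfl, ← Nat.cast_add, add_comm m, hq] at this
    · subst hq
      exact kz_mem_homS (wl := [1, 0, 0, 0, 1, 1, 1]) rfl (by decide +kernel) (by decide +kernel)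
  homC q x hx := by
    refine (kasT_induction (P := (homS K wReg ((q : ℤ) - 2)).comap pairC)
      (fun m y hy hq => ?_) (fun hq => ?_)) hx
    · have := kf_mem_homS (K := K) wReg_SOK (kasPairs_spec hy).2.2.2.2.1 (Pi.single 0 m)
      rw [wdeg_single_one rfl, ← Nat.cast_add, add_comm m, hq] at this
      rwa [Submodule.mem_comap, pairC_pairStr hy]
    · subst hq
      rw [Submodule.mem_comap, pairC_pairT]
      exact kz_mem_homS (wl := [1, 0, 0, 0, 1, 1, 1]) rfl (by decide +kernel) (by decide +kernel)
  hom q x hx := by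
    refine (kasT_induction (P := (homS K wOne ((q : ℤ) - 2)).comap (LinearMap.snd K _ _))
      (fun m y hy hq => ?_) (fun hq => ?_)) hx
    · have := kf_mem_homS (K := K) kas8_SOK (kasPairs_spec hy).2.2.2.2.2.1 (Pi.single 0 m)
      rwa [wdeg_single_one rfl, ← Nat.cast_add, add_comm m, hq] at this
    · subst hq
      exact kz_mem_homS (wl := wt8) rfl (by decide +kernel) (by decide +kernel)
  sup := by
    rw [← Submodule.map_iSup, iSup_kasT, Submodule.map_sup, map_pairC_kasW, Submodule.map_span,
      Set.image_singleton, pairC_pairT, kas7_model.sup]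
    rfl

end

/-! ### The algebra `kas(8; M)` -/

set_option maxRecDepth 100000

theorem kas8_pnOK : pnOK [0] wt8 kas8Str = true := by
  decide +kernel

theorem kas8_witOK : witOK 8 [0] kas8Str 128 = true := by
  decide +kernel

theorem kas8_lo : loOK 8 kas8D = true := by
  decide +kernel

theorem kas8_parOK : parOK 8 [0x10, 0x100000007] kas8D
    (enumS [0] wt8 kas8Str [] 2) = true := by
  decide +kernel

theorem kas8_smallOK :
    smallOK 8 [0] (enumS [0] wt8 kas8Str [] 2) = true := by
  decide +kernel

section
variable [CharP K 2]

variable (K) in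
/-- The derived algebra of `kas(7; ∞)`. -/
abbrev kas7M : Submodule K (Der K 7) := strM K 7 [0] wt7 kas7Str

variable (K) in
/-- The derived algebra of `kas(8; ∞)`. -/
abbrev kas8M : Submodule K (Der K 8) := strM K 8 [0] wt8 kas8Str

theorem kas8_sup : (kas8 K ⊤).toSubmodule = kas8M K ⊔ Submodule.span K {kz K 8 kas8D} := by
  rw [kasPairs_pairs.kas8_top, iSup_kasT, Submodule.map_sup, map_snd_kasW, Submodule.map_span,
    Set.image_singleton]
  rfl

theorem kas8D_mem_homS : kz K 8 kas8D ∈ homS K (wf wt8) (((2 : ℕ) : ℤ) - 2) :=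
  kz_mem_homS rfl (by decide +kernel) (by decide +kernel)

theorem kas8D_not_mem : kz K 8 kas8D ∉ kas8M K := by
  intro hm
  have h1 := hproj_mem_of_iSup (fun q => sq_le_homS kas8_SOK kas8_strOK [] q) hm 2
  rw [hproj_self kas8D_mem_homS] at h1
  exact not_mem_of_parOK kas8_parOK (sq_le_kspan_enumS kas8_SOK kas8_strOK (by norm_num) h1)

theorem kasW_le : kasW K ≤ ⨆ q, kasT K q := by
  rw [iSup_kasT]; exact le_sup_left

theorem exists_of_mem_kas7M {D : Der K 7} (h : D ∈ kas7M K) : ∃ x ∈ kasW K, pairC x = D := by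
  rwa [kas7M, ← map_pairC_kasW] at h

theorem exists_of_mem_kas8M {D : Der K 8} (h : D ∈ kas8M K) : ∃ x ∈ kasW K, x.2 = D := by
  rwa [kas8M, ← map_snd_kasW] at h

theorem pairC_mem_kas7M {x : Der K 7 × Der K 8} (h : x ∈ kasW K) : pairC x ∈ kas7M K := by
  rw [kas7M, ← map_pairC_kasW]; exact ⟨x, h, rfl⟩

theorem snd_mem_kas8M {x : Der K 7 × Der K 8} (h : x ∈ kasW K) : x.2 ∈ kas8M K := by
  rw [kas8M, ← map_snd_kasW]; exact ⟨x, h, rfl⟩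

theorem exists_of_mem_kas8 {D : Der K 8} (h : D ∈ kas8 K ⊤) : ∃ x ∈ ⨆ q, kasT K q, x.2 = D := by
  rwa [← LieSubalgebra.mem_toSubmodule, kasPairs_pairs.kas8_top] at h

theorem snd_mem_kas8 {x : Der K 7 × Der K 8} (h : x ∈ ⨆ q, kasT K q) : x.2 ∈ kas8 K ⊤ := by
  rw [← LieSubalgebra.mem_toSubmodule, kasPairs_pairs.kas8_top]; exact ⟨x, h, rfl⟩

/-- The bracket with an element of the derived algebra. -/
theorem exists_bracket {x y : Der K 7 × Der K 8} (hx : x ∈ ⨆ q, kasT K q)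
    (hy : y ∈ ⨆ q, kasT K q) : ∃ z ∈ kasW K, pairC z = ⁅pairC x, pairC y⁆ ∧ z.2 = ⁅x.2, y.2⁆ := by
  have h := kasPairs_pairs (K := K)
  obtain ⟨z, hz, h1, h2⟩ := h.bracket_mem hx hy
  obtain ⟨z', hz', e⟩ := exists_of_mem_kas7M
    (kas7_model.lie_mem _ (h.pairC_mem hx) _ (h.pairC_mem hy))
  exact ⟨z', hz', e, (h.snd_eq_snd (kasW_le hz') hz (e.trans h1.symm)).trans h2⟩

theorem kas8_pn_mem : pn K 8 0 ∈ kas8M K :=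
  sq_le_strM _ (pn_mem_strM kas8_SOK kas8_strOK kas8_pnOK (List.mem_singleton_self 0))

theorem pairC_eq_zero {x : Der K 7 × Der K 8} (hx : x ∈ ⨆ q, kasT K q) (h0 : x.2 = 0) :
    pairC x = 0 := by
  have h := kasPairs_pairs (K := K)
  have hW : x ∈ kasW K := by
    rw [iSup_kasT, Submodule.mem_sup] at hx
    obtain ⟨a, ha, b, hb, rfl⟩ := hx
    obtain ⟨c, rfl⟩ := Submodule.mem_span_singleton.1 hb
    by_cases hc : c = 0
    · rwa [hc, zero_smul, add_zero]
    · refine absurd ?_ (kas8D_not_mem (K := K))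
      have : kz K 8 kas8D = -(c⁻¹ • a.2) := by
        rw [eq_neg_iff_add_eq_zero, ← smul_eq_zero_iff_right hc, smul_add, smul_inv_smul₀ hc,
          add_comm]
        exact h0
      rw [this]
      exact neg_mem (Submodule.smul_mem _ _ (snd_mem_kas8M ha))
  by_contra hne
  let J : Submodule K (Der K 7) :=
    (kasW K ⊓ LinearMap.ker (LinearMap.snd K (Der K 7) (Der K 8))).map pairC
  have hJ : J = kas7M K := by
    refine kas7_model.simple J ?_ ?_ ?_
    · rintro _ ⟨y, hy, rfl⟩
      exact pairC_mem_kas7M hy.1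
    · intro hb
      have : pairC x ∈ J := ⟨x, ⟨hW, h0⟩, rfl⟩
      rw [hb, Submodule.mem_bot] at this
      exact hne this
    · rintro D hD _ ⟨y, hy, rfl⟩
      obtain ⟨d, hd, rfl⟩ := exists_of_mem_kas7M hD
      obtain ⟨z, hz, h1, h2⟩ := exists_bracket (kasW_le hd) (kasW_le hy.1)
      refine ⟨z, ⟨hz, ?_⟩, h1⟩
      have : y.2 = 0 := hy.2
      rw [this, lie_zero] at h2
      exact h2
  obtain ⟨y, hy, e⟩ := exists_of_mem_kas8M (kas8_pn_mem (K := K))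
  have hyJ := pairC_mem_kas7M hy
  rw [← hJ] at hyJ
  obtain ⟨z, hz, e'⟩ := hyJ
  have h1 : z.2 = y.2 := h.snd_eq_snd (kasW_le hz.1) (kasW_le hy) e'
  have h2 : z.2 = 0 := hz.2
  exact pd_ne_zero _ (e.symm.trans (h1.symm.trans h2))

theorem kas8_simple (I : Submodule K (Der K 8)) (hI : I ≤ kas8M K) (hne : I ≠ ⊥)
    (hst : ∀ D ∈ kas8M K, ∀ E ∈ I, ⁅D, E⁆ ∈ I) : I = kas8M K := by
  have h := kasPairs_pairs (K := K)
  let J : Submodule K (Der K 7) :=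
    (kasW K ⊓ I.comap (LinearMap.snd K (Der K 7) (Der K 8))).map pairC
  have hJ : J = kas7M K := by
    refine kas7_model.simple J ?_ ?_ ?_
    · rintro _ ⟨y, hy, rfl⟩
      exact pairC_mem_kas7M hy.1
    · intro hb
      refine hne ((Submodule.eq_bot_iff _).2 fun D hD => ?_)
      obtain ⟨x, hx, rfl⟩ := exists_of_mem_kas8M (hI hD)
      have : pairC x ∈ J := ⟨x, ⟨hx, hD⟩, rfl⟩
      rw [hb, Submodule.mem_bot] at this
      exact h.snd_eq_zero (kasW_le hx) this
    · rintro D hD _ ⟨y, hy, rfl⟩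
      obtain ⟨d, hd, rfl⟩ := exists_of_mem_kas7M hD
      obtain ⟨z, hz, h1, h2⟩ := exists_bracket (kasW_le hd) (kasW_le hy.1)
      refine ⟨z, ⟨hz, ?_⟩, h1⟩
      change z.2 ∈ I
      rw [h2]
      exact hst _ (snd_mem_kas8M hd) _ hy.2
  refine le_antisymm hI fun D hD => ?_
  obtain ⟨x, hx, rfl⟩ := exists_of_mem_kas8M hD
  have hxJ := pairC_mem_kas7M hx
  rw [← hJ] at hxJ
  obtain ⟨y, hy, e⟩ := hxJ
  rw [← h.snd_eq_snd (kasW_le hy.1) (kasW_le hx) e]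
  exact hy.2

theorem kas8_model : Model (kas8 K) [0] (kas8M K) (kz K 8 kas8D) where
  lt s hs := SOK_lt kas8_SOK hs
  nodup := SOK_nodup kas8_SOK
  ne_nil := by simp
  inf N _ := by
    have e : (kas8 K ⊤ : LieSubalgebra K (Der K 8)) ⊓ vect K N =
        _ ⊓ vect K (⊤ : Fin 8 → ℕ∞) ⊓ vect K N := rfl
    have hle : vect K N ≤ vect K (⊤ : Fin 8 → ℕ∞) := fun D hD => vect_le_top hD
    rw [e, inf_assoc, inf_eq_right.2 hle]
    rfl
  sup := kas8_sup
  shear := by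
    intro D hD
    rw [← LieSubalgebra.mem_toSubmodule, kas8_sup] at hD
    refine (sup_le (strM_le_vect kas8_strOK) ?_ : _ ≤ (vect K (shearS [0])).toSubmodule) hD
    rw [Submodule.span_singleton_le_iff_mem]
    exact kz_mem_vect_of_loOK kas8_lo one_le_shearS
  not_mem := kas8D_not_mem
  mem_vect N hN := kz_mem_vect_of_loOK kas8_lo hN
  lie_mem D hD E hE := by
    obtain ⟨x, hx, rfl⟩ := exists_of_mem_kas8 hD
    obtain ⟨y, hy, rfl⟩ := exists_of_mem_kas8 hE
    obtain ⟨z, hz, -, e⟩ := exists_bracket hx hy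
    rw [← e]
    exact snd_mem_kas8M hz
  pn_mem s hs := by
    rw [List.mem_singleton.1 hs]
    exact kas8_pn_mem
  surj s hs D hD := strM_surj kas8_SOK kas8_strOK hs hD
  large s hs m := strM_large kas8_SOK kas8_strOK kas8_witOK hs m
  small i hi := by
    obtain ⟨L, hL, hlo, h1⟩ := exists_small (K := K) kas8_smallOK i hi
    refine ⟨kz K 8 L, ?_, fun N hN => kz_mem_vect_of_loOK hlo hN, h1⟩
    rw [← LieSubalgebra.mem_toSubmodule, kas8_sup]
    exact Submodule.mem_sup_left (sq_le_strM 2 (kspan_enumS_le kas8_SOK kas8_strOK (by simp) 2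
      (Submodule.subset_span ⟨L, hL, rfl⟩)))
  simple := kas8_simple

end

/-! ### The isomorphism of `kas(7; L)` and `kas(8; M)` -/

theorem nonempty_lieEquiv {L L' : Type*} [LieRing L] [LieAlgebra K L] [LieRing L'] [LieAlgebra K L']
    (R : Submodule K (L × L'))
    (hlie : ∀ x ∈ R, ∀ y ∈ R, ((⁅x.1, y.1⁆, ⁅x.2, y.2⁆) : L × L') ∈ R)
    (h1 : ∀ a, ∃ b, (a, b) ∈ R) (h2 : ∀ b, ∃ a, (a, b) ∈ R) (h3 : ∀ b, ((0, b) : L × L') ∈ R → b = 0)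
    (h4 : ∀ a, ((a, 0) : L × L') ∈ R → a = 0) : Nonempty (L ≃ₗ⁅K⁆ L') := by
  have u1 : ∀ {a b b'}, (a, b) ∈ R → (a, b') ∈ R → b = b' := by
    intro a b b' hb hb'
    have := R.sub_mem hb hb'
    rw [Prod.mk_sub_mk, sub_self] at this
    exact sub_eq_zero.1 (h3 _ this)
  have u2 : ∀ {a a' b}, (a, b) ∈ R → (a', b) ∈ R → a = a' := by
    intro a a' b hb hb'
    have := R.sub_mem hb hb'
    rw [Prod.mk_sub_mk, sub_self] at this
    exact sub_eq_zero.1 (h4 _ this)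
  choose f hf using h1
  choose g hg using h2
  exact ⟨{ toFun := f
           map_add' := fun a b => u1 (hf _) (R.add_mem (hf a) (hf b))
           map_smul' := fun c a => u1 (hf _) (R.smul_mem c (hf a))
           map_lie' := fun {a b} => u1 (hf _) (hlie _ (hf a) _ (hf b))
           invFun := g
           left_inv := fun a => u2 (hg _) (hf a)
           right_inv := fun b => u1 (hf _) (hg b) }⟩

section
variable [CharP K 2]

theorem coef_lie_pd (i : Fin n) (D : Der K n) (j : Fin n) (r : Fin n → ℕ) :
    coef (⁅(pd i : Der K n), D⁆ (X j)) r = coef (D (X j)) (Function.update r i (r i + 1)) := by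
  rw [Derivation.commutator_apply, coef_sub, coef_pd, pd_X]
  have : D (if i = j then (1 : DP K n) else 0) = 0 := by
    split_ifs
    · exact Derivation.map_one_eq_zero _
    · exact map_zero _
  rw [this, coef_zero, sub_zero]

theorem coef_iterate_lie_pd (i : Fin n) (D : Der K n) (j : Fin n) (k : ℕ) (r : Fin n → ℕ) :
    coef ((fun E => ⁅(pd i : Der K n), E⁆)^[k] D (X j)) r =
      coef (D (X j)) (Function.update r i (r i + k)) := by
  induction k generalizing r with
  | zero => rw [add_zero, Function.update_eq_self]; rfl
  | succ k ih =>
    rw [Function.iterate_succ_apply', coef_lie_pd, ih, Function.update_self, Function.update_idem,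
      add_right_comm, add_assoc]

/-- The restriction of the first coordinate of the shearing vector in terms of `ad ∂_1`. -/
theorem mem_vect_shearFirst {m : ℕ} {D : Der K (n + 1)}
    (hD : D ∈ vect K (shearS [0] : Fin (n + 1) → ℕ∞)) : D ∈ vect K (shearFirst n m) ↔
      (fun E => ⁅(pd 0 : Der K (n + 1)), E⁆)^[2 ^ m] D = 0 := by
  have hT := vect_le_top hD
  constructor
  · intro h
    have hv : ∀ k, (fun E => ⁅(pd 0 : Der K (n + 1)), E⁆)^[k] D ∈
        vect K (⊤ : Fin (n + 1) → ℕ∞) := by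
      intro k
      induction k with
      | zero => exact hT
      | succ k ih =>
        rw [Function.iterate_succ_apply']
        exact (vect K _).lie_mem (pd_mem_vect 0) ih
    refine vect_ext (hv _) (zero_mem _) fun j => coef_ext fun r => ?_
    rw [coef_iterate_lie_pd, Derivation.zero_apply, coef_zero]
    by_contra hne
    have := (mem_vect_iff.1 h).2 j _ hne 0 m rfl
    rw [Function.update_self] at this
    omega
  · intro h
    refine mem_vect_iff.2 ⟨hT, fun j r hr i k hk => ?_⟩
    by_cases hi : i = 0
    · subst hi
      change (m : ℕ∞) = k at hk
      obtain rfl : m = k := by exact_mod_cast hk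
      by_contra hlt
      refine hr ?_
      have := coef_iterate_lie_pd 0 D j (2 ^ m) (Function.update r 0 (r 0 - 2 ^ m))
      rw [h, Derivation.zero_apply, coef_zero, Function.update_self, Function.update_idem,
        Nat.sub_add_cancel (by omega), Function.update_eq_self] at this
      exact this.symm
    · obtain ⟨i, rfl⟩ := Fin.exists_succ_eq.2 hi
      refine (mem_vect_iff.1 hD).2 j r hr _ k ?_
      rw [← hk, shearS, if_neg (by simp)]
      rfl

theorem shearFirst_top : shearFirst n ⊤ = shearS [0] := by
  funext i
  refine Fin.cases ?_ (fun i => ?_) i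
  · simp [shearFirst, shearS]
  · simp [shearFirst, shearS]

theorem one_le_shearFirst {m : ℕ∞} (h : 1 ≤ m) (i : Fin (n + 1)) : 1 ≤ shearFirst n m i := by
  refine Fin.cases ?_ (fun i => ?_) i
  · exact h
  · exact le_rfl

theorem contact_en_zero : contact (en K 0) = pd 0 := by
  rw [contact_en, show kz K 7 (ctL [nk (0 : Fin 8)]) = kz K 7 [0] from
    kf_eq_of_eqv (by decide +kernel), kz_single (by norm_num)]
  rfl

theorem pairC_adP {x : Der K 7 × Der K 8} (hx : x ∈ ⨆ q, kasT K q) (i : Fin 8) :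
    pairC (adP i x) = ⁅contact (en K i), pairC x⁆ := by
  induction hx using Submodule.iSup_induction' with
  | zero => rw [map_zero, map_zero, lie_zero]
  | add a b _ _ ha hb => rw [map_add, map_add, map_add, lie_add, ha, hb]
  | mem q x hx =>
    rcases q with _ | q
    · rw [kasPairs_pairs.zero, Submodule.mem_bot] at hx
      rw [hx, map_zero, map_zero, lie_zero]
    · exact (kasT_ad i hx).2

theorem iterate_adP {x : Der K 7 × Der K 8} (hx : x ∈ ⨆ q, kasT K q) (k : ℕ) :
    ∃ y ∈ ⨆ q, kasT K q, pairC y = (fun E => ⁅(pd 0 : Der K 7), E⁆)^[k] (pairC x) ∧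
      y.2 = (fun E => ⁅(pd 0 : Der K 8), E⁆)^[k] x.2 := by
  induction k with
  | zero => exact ⟨x, hx, rfl, rfl⟩
  | succ k ih =>
    obtain ⟨y, hy, h1, h2⟩ := ih
    refine ⟨adP 0 y, kasPairs_pairs.adP_mem hy 0, ?_, ?_⟩
    · rw [pairC_adP hy, Function.iterate_succ_apply', h1, contact_en_zero]
    · rw [Function.iterate_succ_apply', ← h2]
      rfl

theorem pairC_mem_vect_iff {x : Der K 7 × Der K 8} (hx : x ∈ ⨆ q, kasT K q) (m : ℕ∞) :
    pairC x ∈ vect K (shearFirst 6 m) ↔ x.2 ∈ vect K (shearFirst 7 m) := by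
  have h1 := kas7_model.shear (kasPairs_pairs.pairC_mem hx)
  have h2 := kas8_model.shear (snd_mem_kas8 hx)
  induction m using ENat.recTopCoe with
  | top =>
    rw [shearFirst_top, shearFirst_top]
    exact ⟨fun _ => h2, fun _ => h1⟩
  | coe m =>
    rw [mem_vect_shearFirst h1, mem_vect_shearFirst h2]
    obtain ⟨y, hy, e1, e2⟩ := iterate_adP hx (2 ^ m)
    rw [← e1, ← e2]
    exact ⟨kasPairs_pairs.snd_eq_zero hy, pairC_eq_zero hy⟩

theorem kas7_equiv_kas8 {m : ℕ∞} (hm : 1 ≤ m) :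
    Nonempty (kas7 K (shearFirst 6 m) ≃ₗ⁅K⁆ kas8 K (shearFirst 7 m)) := by
  have h := kasPairs_pairs (K := K)
  have e7 := kas7_model.inf (K := K) _ (one_le_shearFirst (n := 6) hm)
  have e8 := kas8_model.inf (K := K) _ (one_le_shearFirst (n := 7) hm)
  let φ : kas7 K (shearFirst 6 m) × kas8 K (shearFirst 7 m) →ₗ[K] Der K 7 × Der K 8 :=
    (kas7 K (shearFirst 6 m)).toSubmodule.subtype.prodMap
      (kas8 K (shearFirst 7 m)).toSubmodule.subtype
  have hR : ∀ a b, (a, b) ∈ ((⨆ q, kasT K q).map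
      (pairC.prod (LinearMap.snd K (Der K 7) (Der K 8)))).comap φ ↔
      ∃ x ∈ ⨆ q, kasT K q, pairC x = (a : Der K 7) ∧ x.2 = (b : Der K 8) := by
    intro a b
    constructor
    · rintro ⟨x, hx, e⟩
      exact ⟨x, hx, congrArg Prod.fst e, congrArg Prod.snd e⟩
    · rintro ⟨x, hx, e1, e2⟩
      exact ⟨x, hx, Prod.ext e1 e2⟩
  refine nonempty_lieEquiv (((⨆ q, kasT K q).map
      (pairC.prod (LinearMap.snd K (Der K 7) (Der K 8)))).comap φ) ?_ ?_ ?_ ?_ ?_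
  · rintro ⟨a, b⟩ hx ⟨a', b'⟩ hy
    obtain ⟨x, hx, e1, e2⟩ := (hR a b).1 hx
    obtain ⟨y, hy, e1', e2'⟩ := (hR a' b').1 hy
    obtain ⟨z, hz, h1, h2⟩ := h.bracket_mem hx hy
    refine (hR _ _).2 ⟨z, hz, ?_, ?_⟩
    · rw [h1, e1, e1']; rfl
    · rw [h2, e2, e2']; rfl
  · rintro ⟨a, ha⟩
    have ha' := ha
    rw [e7] at ha'
    obtain ⟨x, hx, e⟩ := h.exists_pair ha'.1
    have hb : x.2 ∈ kas8 K (shearFirst 7 m) := by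
      rw [e8]
      exact ⟨snd_mem_kas8 hx, (pairC_mem_vect_iff hx m).1 (e ▸ ha'.2)⟩
    exact ⟨⟨x.2, hb⟩, (hR _ _).2 ⟨x, hx, e, rfl⟩⟩
  · rintro ⟨b, hb⟩
    have hb' := hb
    rw [e8] at hb'
    obtain ⟨x, hx, e⟩ := exists_of_mem_kas8 hb'.1
    have ha : pairC x ∈ kas7 K (shearFirst 6 m) := by
      rw [e7]
      exact ⟨h.pairC_mem hx, (pairC_mem_vect_iff hx m).2 (e ▸ hb'.2)⟩
    exact ⟨⟨pairC x, ha⟩, (hR _ _).2 ⟨x, hx, rfl, e⟩⟩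
  · intro b hb
    obtain ⟨x, hx, e1, e2⟩ := (hR _ _).1 hb
    exact Subtype.ext (e2.symm.trans (h.snd_eq_zero hx e1))
  · intro a ha
    obtain ⟨x, hx, e1, e2⟩ := (hR _ _).1 ha
    exact Subtype.ext (e1.symm.trans (pairC_eq_zero hx e2))

end

/-! ### The prolong of the nonpositive part of `kas(8; M)` -/

/-- The components of nonpositive degrees of `kas(8; M)`. -/
def kas8Y : ℕ → List (List ℕ)
  | 0 => []
  | 1 => (List.range 8).map fun i => [i]
  | _ => kas8D :: enumS [0] wt8 kas8Str [] 2

/-- The element of degree 2 of the prolong that does not belong to `kas(8; M)`. -/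
def kas8U : List ℕ :=
  [0x11100000, 0x101100001, 0x110101, 0x1001101, 0x110100002, 0x111002, 0x10001102, 0x111000003,
   0x1011003, 0x10010103, 0x1101004, 0x10100104, 0x1110005, 0x11000105, 0x10110006, 0x11001006]

set_option maxRecDepth 100000

theorem kas8_closeOK :
    closeOK 8 [0] wt8 kas8Str (kas8Y 1) = true := by
  decide +kernel

theorem kas8_transOK :
    transOK 8 wt8 [] (kas8Y 0 ++ kas8Y 1) = true := by
  decide +kernel

theorem kas8_gradOK :
    gradOK 8 wt8 0 kas8Y = true := by
  decide +kernel

theorem kas8_low0 :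
    inSpan (kas8Y 0) (enumS [0] wt8 kas8Str [] 0) = true := by
  decide +kernel

theorem kas8_low1 :
    inSpan (kas8Y 1) (enumS [0] wt8 kas8Str [] 1) = true := by
  decide +kernel

theorem kas8_low2 :
    inSpan (kas8Y 2) (enumS [0] wt8 kas8Str [] 2) = true := by
  decide +kernel

theorem kas8_up1 :
    inSpan (enumS [0] wt8 kas8Str [] 1) (kas8Y 1) = true := by
  decide +kernel

theorem kas8_up2 :
    inSpan (kas8D :: enumS [0] wt8 kas8Str [] 2) (kas8Y 2) = true := by
  decide +kernel

theorem kas8_d :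
    inSpan (kas8Y 2) [kas8D] = true := by
  decide +kernel

theorem kas8U_homOK :
    (validL 8 kas8U && homOK wt8 4 kas8U) = true := by
  decide +kernel

theorem kas8U_lo :
    loOK 8 kas8U = true := by
  decide +kernel

theorem kas8U_low :
    inSpan (enumS [0] wt8 kas8Str [] 3) (brLL [kas8U] (kas8Y 1)) = true := by
  decide +kernel

theorem kas8U_two :
    inSpan (enumS [0] wt8 kas8Str [] 4) (brLL [kas8U] (enumS [0] wt8 kas8Str [] 2)) = true := by
  decide +kernel

theorem kas8U_valid :
    ((enumS [0] wt8 kas8Str [] 2).all (validL 8) && (kas8Y 1).all (validL 8)) = true := by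
  decide +kernel

theorem kas8D_U :
    eqv (brL kas8D kas8U) kas8U = true := by
  decide +kernel

theorem kas8U_parOK :
    parOK 8 [0x110101] kas8U
      (enumS [0] wt8 kas8Str [] 4) = true := by
  decide +kernel

theorem kas8_solve3 :
    solveOK 8 (kas8Y 1) (kas8Y 2) (([] : List ℕ).map fun z => [z]) (relPairs (kas8Y 1) [])
      (mkItems (kas8Y 1) (kas8Y 2) (enumS [0] wt8 kas8Str [] 3)) = true := by
  decide +kernel

theorem kas8_solve4 :
    solveOK 8 (kas8Y 1) (enumS [0] wt8 kas8Str [] 3) (([] : List ℕ).map fun z => [z])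
      (relPairs (kas8Y 1) [])
      (mkItems (kas8Y 1) (enumS [0] wt8 kas8Str [] 3)
        (kas8U :: enumS [0] wt8 kas8Str [] 4)) = true := by
  decide +kernel

theorem kas8_solve5 :
    solveOK 8 (kas8Y 1) (kas8U :: enumS [0] wt8 kas8Str [] 4) (([] : List ℕ).map fun z => [z])
      (relPairs (kas8Y 1) [])
      (mkItems (kas8Y 1) (kas8U :: enumS [0] wt8 kas8Str [] 4)
        (enumS [0] wt8 kas8Str [] 5)) = true := by
  decide +kernel

theorem kas8_zero :
    solveOK 8 (kas8Y 1) (enumS [0] wt8 kas8Str [] 5) ([0].map fun z => [z])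
      (relPairs (kas8Y 1) [[0]]) [] = true := by
  decide +kernel

section
variable [CharP K 2]

set_option maxRecDepth 100000 in
theorem kas8Zero_eq : kas8Zero K = kspan K 8 (kas8Y 2) :=
  vfSpan_eq (by decide +kernel)

variable (K) in
/-- The components of the prolong for the shearing vector `∞`. -/
def prolong8Comp : ℕ → Submodule K (Der K 8) :=
  gcomp (wf wt8) ⊤ 0 ⊥ (Submodule.span K (Set.range pd)) ⊥ (kas8Zero K)

theorem prolong8Comp_eq (q : ℕ) (hq : q ≤ 0 + 2) :
    prolong8Comp K q = kspan K 8 (kas8Y q) := by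
  interval_cases q
  · exact kspan_nil.symm
  · exact span_pd_eq (by norm_num)
  · exact kas8Zero_eq

variable (K) in
/-- The homogeneous components of the derived algebra of `kas(8; ∞)`. -/
abbrev sq8 (q : ℕ) : Submodule K (Der K 8) := sq K 8 [0] wt8 kas8Str [] q

theorem prolong8_familyIn :
    FamilyIn K 8 [0] wt8 kas8Str 0 (prolong8Comp K) kas8Y :=
  familyIn_gcomp kas8_SOK kas8_strOK prolong8Comp_eq kas8_gradOK kas8_closeOK kas8_transOK
    kas8_pnOK fun q hq => by
      interval_cases q
      · exact sq_le_of_inSpan kas8_SOK kas8_strOK (by norm_num) kas8_low0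
      · exact sq_le_of_inSpan kas8_SOK kas8_strOK (by norm_num) kas8_low1
      · exact sq_le_of_inSpan kas8_SOK kas8_strOK (by norm_num) kas8_low2

variable (K) in
/-- The span of the element of degree 2 outside of `kas(8; M)`. -/
def spanU : Submodule K (Der K 8) := Submodule.span K {kz K 8 kas8U}

theorem kas8U_mem_homS : kz K 8 kas8U ∈ homS K (wf wt8) (((4 : ℕ) : ℤ) - 2) := by
  have := kas8U_homOK
  rw [Bool.and_eq_true] at this
  exact kz_mem_homS rfl this.1 this.2

theorem kas8U_valid' : [kas8U].all (validL 8) = true := by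
  have := kas8U_homOK
  rw [Bool.and_eq_true] at this
  rw [List.all_cons, this.1]
  rfl

theorem kspan_cons_le (b : List ℕ) (l : List (List ℕ)) :
    kspan K 8 (b :: l) ≤ kspan K 8 l ⊔ Submodule.span K {kz K 8 b} := by
  intro D hD
  obtain ⟨a, E, hE, rfl⟩ := kspan_cons hD
  exact add_mem (Submodule.mem_sup_right (Submodule.smul_mem _ _ (Submodule.mem_span_singleton_self _)))
    (Submodule.mem_sup_left hE)

theorem le_kspan_cons (b : List ℕ) (l : List (List ℕ)) :
    kspan K 8 l ⊔ Submodule.span K {kz K 8 b} ≤ kspan K 8 (b :: l) := by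
  refine sup_le (Submodule.span_mono ?_) ?_
  · rintro _ ⟨L, hL, rfl⟩
    exact ⟨L, List.mem_cons_of_mem _ hL, rfl⟩
  · rw [Submodule.span_singleton_le_iff_mem]
    exact Submodule.subset_span ⟨b, List.mem_cons_self, rfl⟩

theorem kspan_le_sq8 (q : ℕ) :
    kspan K 8 (enumS [0] wt8 kas8Str [] q) ≤ sq8 K q :=
  kspan_enumS_le kas8_SOK kas8_strOK (by simp) q

theorem sq8_le_kspan {q : ℕ} (hq : q ≤ 8) :
    sq8 K q ≤ kspan K 8 (enumS [0] wt8 kas8Str [] q) :=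
  sq_le_kspan_enumS kas8_SOK kas8_strOK hq

theorem prolong8Comp_zero : prolong8Comp K 0 = ⊥ := rfl

theorem prolong8Comp_one : prolong8Comp K 1 ≤ sq8 K 1 := by
  rw [prolong8Comp_eq 1 (by norm_num)]
  exact le_sq_of_inSpan kas8_SOK kas8_strOK (by simp) kas8_up1

theorem prolong8Comp_two : prolong8Comp K 2 = sq8 K 2 ⊔ Submodule.span K {kz K 8 kas8D} := by
  apply le_antisymm
  · rw [prolong8Comp_eq 2 le_rfl]
    exact (kspan_le_of_inSpan kas8_up2).trans ((kspan_cons_le _ _).trans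
      (sup_le_sup_right (kspan_le_sq8 2) _))
  · refine sup_le (prolong8_familyIn.sq_le 2) ?_
    rw [Submodule.span_singleton_le_iff_mem, prolong8Comp_eq 2 le_rfl]
    exact inSpan_mem kas8_d (List.mem_singleton_self _)

theorem prolong8Comp_three : prolong8Comp K 3 ≤ sq8 K 3 := fun D hD =>
  prolong8_familyIn.mem_sq_of_solve (q := 1) (Z := []) (prolong8Comp_eq 2 le_rfl).le (by simp)
    kas8_solve3 hD (by simp)

theorem kas8U_mem : kz K 8 kas8U ∈ prolong8Comp K 4 := by
  have hv := kas8U_valid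
  rw [Bool.and_eq_true] at hv
  refine prolong8_familyIn.graded.step 3 (by norm_num) _ (by simpa using kas8U_mem_homS)
    fun y hy => ?_
  rw [prolong8Comp_eq 1 (by norm_num)] at hy
  refine prolong8_familyIn.sq_le 3 (kspan_le_sq8 3 ?_)
  exact lie_mem_kspan kas8U_valid' hv.2 kas8U_low
    (Submodule.subset_span ⟨_, List.mem_singleton_self _, rfl⟩) hy

theorem prolong8Comp_four : prolong8Comp K 4 = sq8 K 4 ⊔ spanU K := by
  have hle : sq8 K 4 ⊔ spanU K ≤ prolong8Comp K 4 := by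
    refine sup_le (prolong8_familyIn.sq_le 4) ?_
    rw [spanU, Submodule.span_singleton_le_iff_mem]
    exact kas8U_mem
  refine le_antisymm (fun D hD => ?_) hle
  exact prolong8_familyIn.mem_of_solve (q := 2) (Z := [])
    (prolong8Comp_three.trans (sq8_le_kspan (by norm_num))) (by simp) kas8_solve4 hle
    ((kspan_mkItems_le _ _ _).trans ((kspan_cons_le _ _).trans
      (sup_le_sup_right (kspan_le_sq8 4) _))) hD (by simp)

theorem prolong8Comp_five : prolong8Comp K 5 ≤ sq8 K 5 := fun D hD =>
  prolong8_familyIn.mem_sq_of_solve (q := 3) (Z := [])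
    (prolong8Comp_four.le.trans ((sup_le_sup_right (sq8_le_kspan (by norm_num)) _).trans
      (le_kspan_cons _ _))) (by simp) kas8_solve5 hD (by simp)

theorem prolong8Comp_of_five_le (q : ℕ) (hq : 5 ≤ q) : prolong8Comp K q ≤ sq8 K q := by
  refine prolong8_familyIn.le_sq (q₁ := 5) (q₂ := 6) (by simp) (by decide) ?_ ?_ q hq
  · intro q h5 h6 Z s R hZ D hD hDZ
    obtain rfl : q = 5 := by omega
    rcases Z with _ | ⟨a, Z⟩
    · exact prolong8Comp_five hD
    · simp at hZ
  · intro q hq D hD h0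
    exact prolong8_familyIn.eq_zero_of_solve (q := 4)
      (prolong8Comp_five.trans (sq8_le_kspan (by norm_num))) kas8_zero q hq D hD h0

theorem prolong8Comp_le (q : ℕ) (h2 : q ≠ 2) (h4 : q ≠ 4) : prolong8Comp K q ≤ sq8 K q := by
  by_cases h5 : 5 ≤ q
  · exact prolong8Comp_of_five_le q h5
  · have : q = 0 ∨ q = 1 ∨ q = 3 := by omega
    rcases this with rfl | rfl | rfl
    · rw [prolong8Comp_zero]; exact bot_le
    · exact prolong8Comp_one
    · exact prolong8Comp_three

theorem iSup_prolong8Comp :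
    ⨆ q, prolong8Comp K q = kas8M K ⊔ Submodule.span K {kz K 8 kas8D} ⊔ spanU K := by
  apply le_antisymm
  · refine iSup_le fun q => ?_
    by_cases h2 : q = 2
    · rw [h2, prolong8Comp_two]
      exact le_sup_of_le_left (sup_le_sup_right (sq_le_strM 2) _)
    by_cases h4 : q = 4
    · rw [h4, prolong8Comp_four]
      exact sup_le_sup_right (le_sup_of_le_left (sq_le_strM 4)) _
    · exact (prolong8Comp_le q h2 h4).trans (le_sup_of_le_left (le_sup_of_le_left (sq_le_strM q)))
  · refine sup_le (sup_le (iSup_mono prolong8_familyIn.sq_le) ?_) ?_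
    · exact le_iSup_of_le 2 (prolong8Comp_two.ge.trans' le_sup_right)
    · exact le_iSup_of_le 4 (prolong8Comp_four.ge.trans' le_sup_right)

theorem prolong8_eq (N : Fin 8 → ℕ∞) : prolong8 K N =
    prolong (wf wt8) N 0 ⊥ (Submodule.span K (Set.range pd)) ⊥
      (kas8Zero K) := by
  rw [prolong8]
  congr 1
  funext i
  fin_cases i <;> rfl

theorem prolong8_inf {N : Fin 8 → ℕ∞} (hN : ∀ i, 1 ≤ N i) :
    prolong8 K N = prolong8 K ⊤ ⊓ vect K N := by
  rw [prolong8_eq, prolong8_eq]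
  refine prolong_eq_inf_of_loOK (fun _ => rfl) prolong8_familyIn.graded prolong8Comp_eq
    (fun q hq => ?_) hN
  interval_cases q <;> decide +kernel

theorem prolong8_top :
    (prolong8 K ⊤).toSubmodule = kas8M K ⊔ Submodule.span K {kz K 8 kas8D} ⊔ spanU K := by
  rw [prolong8_eq, ← iSup_prolong8Comp]
  exact prolong8_familyIn.graded.prolong_top fun _ => rfl

theorem prolong8_top_eq : (prolong8 K ⊤).toSubmodule = (kas8 K ⊤).toSubmodule ⊔ spanU K := by
  rw [prolong8_top, kas8_sup]

theorem kas8_le_prolong8 : kas8 K ⊤ ≤ prolong8 K ⊤ := by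
  rw [← LieSubalgebra.toSubmodule_le_toSubmodule, prolong8_top_eq]
  exact le_sup_left

theorem prolong8_shear : prolong8 K ⊤ ≤ vect K (shearS [0]) := by
  rw [← LieSubalgebra.toSubmodule_le_toSubmodule, prolong8_top_eq]
  refine sup_le (LieSubalgebra.toSubmodule_le_toSubmodule _ _ |>.2 kas8_model.shear) ?_
  rw [spanU, Submodule.span_singleton_le_iff_mem]
  exact kz_mem_vect_of_loOK kas8U_lo one_le_shearS

theorem prolong8_noncritical (i : Fin 8) : Noncritical (prolong8 K) i ↔ i.val ∈ [0] :=
  Model.noncritical_of_attained_iff (fun _ hN =>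
    kas8_model.attained_iff_of_le (fun _ => prolong8_inf) prolong8_shear kas8_le_prolong8 hN) i

theorem prolong8_numParams : numParams (prolong8 K) = 1 :=
  Model.numParams_eq' (S := [0]) (by simp) (by simp) prolong8_noncritical

theorem prolong8_unc : Unc (prolong8 K) = prolong8 K ⊤ := by
  rw [Unc, Model.unconstrained_eq' prolong8_noncritical, prolong8_inf one_le_shearS]
  exact inf_eq_left.2 prolong8_shear

theorem kas8U_not_mem : kz K 8 kas8U ∉ kas8 K ⊤ := by
  intro hm
  rw [← LieSubalgebra.mem_toSubmodule, kas8_sup, Submodule.mem_sup] at hm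
  obtain ⟨D, hD, E, hE, e⟩ := hm
  have h1 := hproj_mem_of_iSup (fun q => sq_le_homS kas8_SOK kas8_strOK [] q) hD 4
  obtain ⟨c, rfl⟩ := Submodule.mem_span_singleton.1 hE
  have h2 := congrArg (hproj (wf wt8) (((4 : ℕ) : ℤ) - 2)) e
  rw [map_add, map_smul, hproj_self kas8U_mem_homS, hproj_other (by norm_num) kas8D_mem_homS,
    smul_zero, add_zero] at h2
  rw [h2] at h1
  exact not_mem_of_parOK kas8U_parOK (sq8_le_kspan (by norm_num) h1)

theorem kas8D_not_mem_sup : kz K 8 kas8D ∉ kas8M K ⊔ spanU K := by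
  intro hm
  rw [Submodule.mem_sup] at hm
  obtain ⟨D, hD, E, hE, e⟩ := hm
  have h1 := hproj_mem_of_iSup (fun q => sq_le_homS kas8_SOK kas8_strOK [] q) hD 2
  obtain ⟨c, rfl⟩ := Submodule.mem_span_singleton.1 hE
  have h2 := congrArg (hproj (wf wt8) (((2 : ℕ) : ℤ) - 2)) e
  rw [map_add, map_smul, hproj_self kas8D_mem_homS, hproj_other (by norm_num) kas8U_mem_homS,
    smul_zero, add_zero] at h2
  rw [h2] at h1
  exact not_mem_of_parOK kas8_parOK (sq8_le_kspan (by norm_num) h1)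

theorem lie_kas8U_mem {D : Der K 8} (hD : D ∈ kas8M K) : ⁅kz K 8 kas8U, D⁆ ∈ kas8M K := by
  have hv := kas8U_valid
  rw [Bool.and_eq_true] at hv
  have : kas8M K ≤ (kas8M K).comap (LieAlgebra.ad K (Der K 8) (kz K 8 kas8U)) := by
    refine iSup_le fun q D hD => ?_
    change ⁅kz K 8 kas8U, D⁆ ∈ kas8M K
    by_cases h0 : q = 0
    · subst h0
      have := prolong8_familyIn.sq_le 0 hD
      rw [prolong8Comp_zero, Submodule.mem_bot] at this
      rw [this, lie_zero]
      exact zero_mem _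
    by_cases h2 : q = 2
    · subst h2
      exact sq_le_strM 4 (kspan_le_sq8 4 (lie_mem_kspan kas8U_valid' hv.1 kas8U_two
        (Submodule.subset_span ⟨_, List.mem_singleton_self _, rfl⟩) (sq8_le_kspan (by norm_num) hD)))
    · have := prolong8_familyIn.graded.lie_mem (m := q + 2) (by omega) kas8U_mem
        (prolong8_familyIn.sq_le q hD)
      exact sq_le_strM _ (prolong8Comp_le (q + 2) (by omega) (by omega) this)
  exact this hD

theorem lie_D_U : ⁅kz K 8 kas8D, kz K 8 kas8U⁆ = kz K 8 kas8U := by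
  have := kas8U_homOK
  rw [Bool.and_eq_true] at this
  rw [lie_kf (by decide +kernel) this.1]
  exact kf_eq_of_eqv kas8D_U

theorem prolong8_derived_one :
    (LieAlgebra.derivedSeries K (prolong8 K ⊤) 1).toSubmodule.map
      (prolong8 K ⊤).toSubmodule.subtype = kas8M K ⊔ spanU K := by
  have hU : kz K 8 kas8U ∈ kas8M K ⊔ spanU K :=
    Submodule.mem_sup_right (Submodule.mem_span_singleton_self _)
  have h8 : ∀ D ∈ kas8 K ⊤, ⁅D, kz K 8 kas8U⁆ ∈ kas8M K ⊔ spanU K := by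
    intro D hD
    rw [← LieSubalgebra.mem_toSubmodule, kas8_sup, Submodule.mem_sup] at hD
    obtain ⟨E, hE, F, hF, rfl⟩ := hD
    obtain ⟨c, rfl⟩ := Submodule.mem_span_singleton.1 hF
    rw [add_lie, smul_lie, lie_D_U, lie_comm_der]
    exact add_mem (Submodule.mem_sup_left (lie_kas8U_mem hE)) (Submodule.smul_mem _ c hU)
  refine derivedSeries_succ_map _ 0 (derivedSeries_zero_map _) ?_ (sup_le (fun D hD => ?_) ?_)
  · intro D hD E hE
    rw [prolong8_top_eq, Submodule.mem_sup] at hD hE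
    obtain ⟨D, hD, F, hF, rfl⟩ := hD
    obtain ⟨E, hE, F', hF', rfl⟩ := hE
    obtain ⟨c, rfl⟩ := Submodule.mem_span_singleton.1 hF
    obtain ⟨c', rfl⟩ := Submodule.mem_span_singleton.1 hF'
    rw [add_lie, lie_add, lie_add, smul_lie, smul_lie, lie_smul, lie_smul, lie_self, smul_zero,
      smul_zero, add_zero, lie_comm_der (kz K 8 kas8U) E]
    exact add_mem (add_mem (Submodule.mem_sup_left (kas8_model.lie_mem _ hD _ hE))
      (Submodule.smul_mem _ _ (h8 D hD))) (Submodule.smul_mem _ _ (h8 E hE))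
  · obtain ⟨E, hE, rfl⟩ := kas8_model.surj 0 (by simp) D hD
    have hle := kas8_model.le_top.trans
      (LieSubalgebra.toSubmodule_le_toSubmodule _ _ |>.2 (kas8_le_prolong8 (K := K)))
    exact Submodule.subset_span ⟨_, hle (kas8_model.pn_mem 0 (by simp)), E, hle hE, rfl⟩
  · rw [spanU, Submodule.span_singleton_le_iff_mem]
    refine Submodule.subset_span ⟨_, kas8_le_prolong8 kas8_model.d_mem, kz K 8 kas8U, ?_, lie_D_U⟩
    rw [prolong8_top_eq]
    exact Submodule.mem_sup_right (Submodule.mem_span_singleton_self _)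

theorem prolong8_derived_two :
    (LieAlgebra.derivedSeries K (prolong8 K ⊤) 2).toSubmodule.map
      (prolong8 K ⊤).toSubmodule.subtype = kas8M K := by
  have hM : ∀ D ∈ kas8M K, ∀ E ∈ kas8M K, ⁅D, E⁆ ∈ kas8M K := fun D hD E hE =>
    kas8_model.lie_mem _ (kas8_model.le_top hD) _ (kas8_model.le_top hE)
  refine derivedSeries_succ_map _ 1 prolong8_derived_one ?_ fun D hD => ?_
  · intro D hD E hE
    rw [Submodule.mem_sup] at hD hE
    obtain ⟨D, hD, F, hF, rfl⟩ := hD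
    obtain ⟨E, hE, F', hF', rfl⟩ := hE
    obtain ⟨c, rfl⟩ := Submodule.mem_span_singleton.1 hF
    obtain ⟨c', rfl⟩ := Submodule.mem_span_singleton.1 hF'
    rw [add_lie, lie_add, lie_add, smul_lie, smul_lie, lie_smul, lie_smul, lie_self, smul_zero,
      smul_zero, add_zero, lie_comm_der D (kz K 8 kas8U)]
    exact add_mem (add_mem (hM D hD E hE) (Submodule.smul_mem _ _ (lie_kas8U_mem hD)))
      (Submodule.smul_mem _ _ (lie_kas8U_mem hE))
  · obtain ⟨E, hE, rfl⟩ := kas8_model.surj 0 (by simp) D hD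
    exact Submodule.subset_span ⟨_, Submodule.mem_sup_left (kas8_model.pn_mem 0 (by simp)), E,
      Submodule.mem_sup_left hE, rfl⟩

theorem prolong8_finrank :
    Module.finrank K (prolong8 K ⊤ ⧸ Submodule.comap
      (prolong8 K ⊤).toSubmodule.subtype (kas8 K ⊤).toSubmodule) = 1 :=
  finrank_quotient_eq_one prolong8_top_eq kas8U_not_mem

theorem prolong8_finrank_derived :
    Module.finrank K (prolong8 K ⊤ ⧸ LieAlgebra.derivedSeries K (prolong8 K ⊤) 1) = 1 := by
  have h1 := finrank_quotient_eq_one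
    ((prolong8_top (K := K)).trans (sup_right_comm _ _ _)) kas8D_not_mem_sup
  rw [← prolong8_derived_one, Submodule.comap_map_eq_of_injective Subtype.val_injective] at h1
  exact h1

end

section
variable [CharP K 2]

/-- Derived algebras with different numbers of parameters are not isomorphic. -/
theorem isEmpty_equiv [NeZero n] [NeZero n'] {g : (Fin n → ℕ∞) → LieSubalgebra K (Der K n)}
    {g' : (Fin n' → ℕ∞) → LieSubalgebra K (Der K n')} {S S' wl wl' : List ℕ}
    {Str Str' : List (ℕ × List ℕ)} {d : List ℕ} {d' : Der K n'} {c κ : ℕ}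
    {G : ℕ → Submodule K (Der K n)} {Y : ℕ → List (List ℕ)}
    (h : Model g S (strM K n S wl Str) (kz K n d)) (h' : Model g' S' (strM K n' S' wl' Str') d')
    (hf : FamilyProlong K n S wl Str c G Y d) (hw : ∀ i : Fin n, 1 ≤ (wf wl i : ℕ) ∧ wf wl i ≤ 2)
    (hS : SOK n' S' wl' = true) (hStr : Str'.all (strOK n' S' wl') = true)
    (hp : pnOK S' wl' Str' = true) (hκ : witOK n' S' Str' κ = true)
    (hlt : S.length < S'.length) :
    IsEmpty (LieAlgebra.derivedSeries K (Unc g) 1 ≃ₗ⁅K⁆ LieAlgebra.derivedSeries K (Unc g') 1) := by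
  rw [h.unc_eq, h'.unc_eq]
  refine ⟨fun e => hlt.not_ge ?_⟩
  refine (powerLower_of_families hS hStr hp hκ ((derivedHom (g' ⊤) 1).comp e.toLieHom) ?_).le
    (hf.powerUpper hw (derivedHom (g ⊤) 1) (derivedHom_injective _ _) h.range_derivedHom)
  rw [← h'.range_derivedHom]
  exact LinearMap.range_comp_of_range_eq_top _ (LinearEquiv.range e.toLinearEquiv)

end

end Kas
end

theorem mainTheorem3 (K : Type*) [Field K] [CharP K 2] [IsAlgClosed K] :
    -- The shearing vectors: the noncritical coordinates and the numbers of parameters.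
    ((∀ N : Fin 7 → ℕ∞, (∀ i, 1 ≤ N i) →
        (Kas.Attained (Kas.kas7 K) N ↔ ∀ i, i ≠ 0 → N i = 1)) ∧
      (∀ N : Fin 8 → ℕ∞, (∀ i, 1 ≤ N i) →
        (Kas.Attained (Kas.kas8 K) N ↔ ∀ i, i ≠ 0 → N i = 1)) ∧
      (∀ N : Fin 10 → ℕ∞, (∀ i, 1 ≤ N i) →
        (Kas.Attained (Kas.kas10 K) N ↔ ∀ i, i ≠ 0 → i ≠ 1 → N i = 1)) ∧
      (∀ N : Fin 7 → ℕ∞, (∀ i, 1 ≤ N i) →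
        (Kas.Attained (Kas.kas7t K) N ↔ N 1 = 1 ∧ N 2 = 1 ∧ N 3 = 1)) ∧
      Kas.numParams (Kas.kas7 K) = 1 ∧ Kas.numParams (Kas.kas8 K) = 1 ∧
      Kas.numParams (Kas.kas10 K) = 2 ∧ Kas.numParams (Kas.kas7t K) = 4) ∧
    -- The algebras are not simple, whatever the shearing vector.
    ((∀ N : Fin 7 → ℕ∞, (∀ i, 1 ≤ N i) → ¬ LieAlgebra.IsSimple K (Kas.kas7 K N)) ∧
      (∀ N : Fin 8 → ℕ∞, (∀ i, 1 ≤ N i) → ¬ LieAlgebra.IsSimple K (Kas.kas8 K N)) ∧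
      (∀ N : Fin 10 → ℕ∞, (∀ i, 1 ≤ N i) → ¬ LieAlgebra.IsSimple K (Kas.kas10 K N)) ∧
      (∀ N : Fin 7 → ℕ∞, (∀ i, 1 ≤ N i) → ¬ LieAlgebra.IsSimple K (Kas.kas7t K N))) ∧
    -- The derived algebras are simple ideals of codimension 1.
    (Kas.DerivedIsSimpleOfCodimOne K (Kas.Unc (Kas.kas7 K)) ∧
      Kas.DerivedIsSimpleOfCodimOne K (Kas.Unc (Kas.kas8 K)) ∧
      Kas.DerivedIsSimpleOfCodimOne K (Kas.Unc (Kas.kas10 K)) ∧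
      Kas.DerivedIsSimpleOfCodimOne K (Kas.Unc (Kas.kas7t K))) ∧
    -- The algebras `kas(7; L)` and `kas(8; M)` are isomorphic.
    (Nonempty (Kas.Unc (Kas.kas7 K) ≃ₗ⁅K⁆ Kas.Unc (Kas.kas8 K)) ∧
      ∀ m : ℕ∞, 1 ≤ m → Nonempty
        (Kas.kas7 K (Kas.shearFirst 6 m) ≃ₗ⁅K⁆ Kas.kas8 K (Kas.shearFirst 7 m))) ∧
    -- The three simple algebras are pairwise non-isomorphic.
    (IsEmpty (LieAlgebra.derivedSeries K (Kas.Unc (Kas.kas7 K)) 1 ≃ₗ⁅K⁆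
        LieAlgebra.derivedSeries K (Kas.Unc (Kas.kas10 K)) 1) ∧
      IsEmpty (LieAlgebra.derivedSeries K (Kas.Unc (Kas.kas7 K)) 1 ≃ₗ⁅K⁆
        LieAlgebra.derivedSeries K (Kas.Unc (Kas.kas7t K)) 1) ∧
      IsEmpty (LieAlgebra.derivedSeries K (Kas.Unc (Kas.kas10 K)) 1 ≃ₗ⁅K⁆
        LieAlgebra.derivedSeries K (Kas.Unc (Kas.kas7t K)) 1)) ∧
    -- The complete prolong of the nonpositive part of `kas(8; M)`.
    (Kas.numParams (Kas.prolong8 K) = 1 ∧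
      Kas.Unc (Kas.kas8 K) ≤ Kas.Unc (Kas.prolong8 K) ∧
      Module.finrank K (Kas.Unc (Kas.prolong8 K) ⧸ Submodule.comap
        (Kas.Unc (Kas.prolong8 K)).toSubmodule.subtype (Kas.Unc (Kas.kas8 K)).toSubmodule) = 1 ∧
      Module.finrank K (Kas.Unc (Kas.prolong8 K) ⧸
        LieAlgebra.derivedSeries K (Kas.Unc (Kas.prolong8 K)) 1) = 1 ∧
      (LieAlgebra.derivedSeries K (Kas.Unc (Kas.prolong8 K)) 2).toSubmodule.map
          (Kas.Unc (Kas.prolong8 K)).toSubmodule.subtype =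
        (LieAlgebra.derivedSeries K (Kas.Unc (Kas.kas8 K)) 1).toSubmodule.map
          (Kas.Unc (Kas.kas8 K)).toSubmodule.subtype) := by
  refine ⟨⟨fun N hN => ?_, fun N hN => ?_, fun N hN => ?_, fun N hN => ?_,
    Kas.kas7_model.numParams_eq, Kas.kas8_model.numParams_eq, Kas.kas10_model.numParams_eq,
    Kas.kas7t_model.numParams_eq⟩,
    ⟨fun N hN => Kas.kas7_model.not_isSimple hN, fun N hN => Kas.kas8_model.not_isSimple hN,
      fun N hN => Kas.kas10_model.not_isSimple hN, fun N hN => Kas.kas7t_model.not_isSimple hN⟩,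
    ⟨Kas.kas7_model.derivedIsSimple, Kas.kas8_model.derivedIsSimple,
      Kas.kas10_model.derivedIsSimple, Kas.kas7t_model.derivedIsSimple⟩,
    ⟨?_, fun m hm => Kas.kas7_equiv_kas8 hm⟩, ⟨?_, ?_, ?_⟩, Kas.prolong8_numParams, ?_⟩
  · rw [Kas.kas7_model.attained_iff hN]
    simp only [List.mem_cons, List.not_mem_nil, or_false, ne_eq, Fin.ext_iff]
    rfl
  · rw [Kas.kas8_model.attained_iff hN]
    simp only [List.mem_cons, List.not_mem_nil, or_false, ne_eq, Fin.ext_iff]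
    rfl
  · rw [Kas.kas10_model.attained_iff hN]
    simp only [List.mem_cons, List.not_mem_nil, or_false, not_or, and_imp, ne_eq, Fin.ext_iff]
    rfl
  · rw [Kas.kas7t_model.attained_iff hN]
    simp [Fin.forall_fin_succ]
  · have h := Kas.kas7_equiv_kas8 (K := K) (m := ⊤) le_top
    rwa [Kas.shearFirst_top, Kas.shearFirst_top, Kas.kas7_model.shearS_eq,
      Kas.kas8_model.shearS_eq, ← Kas.kas7_model.unc_eq, ← Kas.kas8_model.unc_eq] at h
  · exact Kas.isEmpty_equiv Kas.kas7_model Kas.kas10_model Kas.kas7_familyProlong (by decide)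
      Kas.kas10_SOK Kas.kas10_strOK Kas.kas10_pnOK Kas.kas10_witOK (by decide)
  · exact Kas.isEmpty_equiv Kas.kas7_model Kas.kas7t_model Kas.kas7_familyProlong (by decide)
      Kas.kas7t_SOK Kas.kas7t_strOK Kas.kas7t_pnOK Kas.kas7t_witOK (by decide)
  · exact Kas.isEmpty_equiv Kas.kas10_model Kas.kas7t_model Kas.kas10_familyProlong (by decide)
      Kas.kas7t_SOK Kas.kas7t_strOK Kas.kas7t_pnOK Kas.kas7t_witOK (by decide)
  · rw [Kas.prolong8_unc, Kas.kas8_model.unc_eq, Kas.prolong8_derived_two,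
      Kas.kas8_model.derived_map]
    exact ⟨Kas.kas8_le_prolong8, Kas.prolong8_finrank, Kas.prolong8_finrank_derived, rfl⟩
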